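/- **Model.** A unit-cost log-RAM has registers $R_0,R_1,\dots$ holding nonnegative integers, an input register and an output register holding bit strings, and a finite list of instructions. With arguments $A,A'$ of the form constant, $R_j$ or $R_{R_j}$, and a destination $D$ of the form $R_i$ or $R_{R_i}$, these are: $D=A\ \mathrm{op}\ A'$ with $\mathrm{op}\in\{\lor,\land,\oplus,\lnot,+,-,*,\div\}$ (bitwise Boolean operations, difference cut off at $0$, integer division); cyclic shift by $A$ positions of the $A'$ rightmost bits of $R_j$, with the result in $D$; reading bits $A,\dots,A'$ of the input into $D$; appending the $A$ rightmost bits of $R_j$ to the output; jump to a given instruction if $A=A'$. At the start $R_0$ holds the input length $n$ and all other registers hold $0$. Only values of $O(\log n)$ bits may be assigned, and only $O(\log n)$ bits may be shifted, read or written by one instruction. The running time is the number of instructions executed. **Algorithm F-R** for the product of two $m$-bit integers $a,b$. Let $P\ge 2$ and $N$ be powers of $2$ with $2P\mid N$, $P=\Theta(\log m)$, $N=\Theta(m/P^2)$ and $NP^2/4\ge m$ (here and below $\log m$ is read as $\lfloor\log_2 m\rfloor+1$). Let $\mathcal R=\mathbb C[x]/(x^P+1)$, and let $\rho\in\mathcal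 R$ be the $N$-th root of unity given by the polynomial of degree less than $P$ with $\rho(e^{(2k+1)\pi i/P})=e^{(2k+1)2\pi i/N}$ for $0\le k<P$, so that $\rho^{N/(2P)}=x$. 1. Cut each factor into pieces of $P$ bits, and let each group of $P/2$ consecutive pieces be the lower $P/2$ coefficients of an element of $\mathcal R$ whose other coefficients are $0$. This gives two arrays of length $N$ over $\mathcal R$, whose upper halves are $0$. 2. Compute the FFT of length $N$ with root $\rho$ of both arrays, in $\log_2 N$ binary levels. The levels are grouped into rounds of $\log_2(2P)$ levels (the last round may be shorter) that perform FFTs of length $2P$ (in the last round, of the remaining length), in which all factors are powers of $x$. Between two rounds each entry is multiplied in $\mathcal R$ by the appropriate power of $\rho$. 3. Multiply the two transforms componentwise in $\mathcal R$. 4. Compute the inverse FFT in the same way, with $\rho^{-1},x^{-1}$ in place of $\rho,x$ and a final division by $N$. 5. Round the coefficients to integers and compose the product $ab$ from them. The real and imaginary parts of the coefficients of elements of $\mathcal R$ are stored as integers of $H=\Theta(\log m)$ bits and a sign, with $S=\Theta(\log m)$ bits after the binary point, and with an error of at most $2^{-P}$ at every level. Each multiplication in $\mathcal R$ (in step 3,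 and by powers of $\rho$ in steps 2 and 4) is done as follows, with $K=\Theta(\log m)$, $P\mid K$ and $4P\cdot 2^{2H}<2^K$. The sequences $(u_j)_{j<P}$ of the stored real parts and of the stored imaginary parts of both factors are replaced by $(u_j\theta^j)_{j<P}$ with $\theta=2^{K/P}$, and transformed by FFTs of length $P$ modulo $2^K+1$ with root $\theta^2$, in $\log_2 P$ levels whose factors are powers of $2$. The values are multiplied pairwise, each by a single multiplication instruction of the machine. The results are combined to the transforms of the real and of the imaginary part of the product, transformed back, and rounded to $S$ bits after the binary point. **Theorem.** Algorithm F-R runs in linear time on the unit-cost log-RAM. That is, there are a log-RAM program and constants (in particular for the word length, for the orders of magnitude of the parameters, and $C$) such that for every $m\ge 1$ there are parameters $P,N,S,H,K$ as above such that, for all integers $0\le a,b<2^m$, the program, started with the concatenation of the $m$-bit binary representations of $a$ and $b$ as its input, performs algorithm F-R with these parameters on $a$ and $b$, going through the arrays after all levels of the FFTs and of the FFTs inside the multiplications in $\mathcal R$, halts after at most $C\,m$ instructions, all of them allowed, and outputs the $2m$-bit binary representation of $ab$. -/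

import Mathlib

/-! ## The unit-cost log-RAM -/

namespace LogRAM

/-- The operations of an assignment. -/
inductive Op
  | lor | land | lxor | lnot | add | sub | mul | div

/-- Arguments: a constant, `R_j`, or `R_{R_j}`. -/
inductive Arg
  | const (k : ℕ) | reg (j : ℕ) | ind (j : ℕ)

/-- Destinations: `R_i`, or `R_{R_i}`. -/
inductive Dest
  | reg (i : ℕ) | ind (i : ℕ)

/-- The instruction set. -/
inductive Instr
  /-- `d = A op A'` -/
  | assign (d : Dest) (op : Op) (A A' : Arg)
  /-- `d = R_j` with its `A'` rightmost bits cyclically shifted by `A` positions, to the left if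
  `left` is true and to the right otherwise -/
  | shift (d : Dest) (j : ℕ) (left : Bool) (A A' : Arg)
  /-- read the bits at positions `A, …, A'` of the input register into `d` -/
  | input (d : Dest) (A A' : Arg)
  /-- append the `A` rightmost bits of `R_j` to the right end of the output register -/
  | output (j : ℕ) (A : Arg)
  /-- go to the instruction with number `target` if `A = A'` -/
  | jump (A A' : Arg) (target : ℕ)

/-- A program is a finite list of instructions, numbered from `0`. -/
abbrev Program := List Instr

/-- A configuration: number of the next instruction, registers, and output register. -/
structure Config where
  pc : ℕ
  mem : ℕ → ℕ
  out : List Bool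

def Arg.eval (mem : ℕ → ℕ) : Arg → ℕ
  | .const k => k
  | .reg j => mem j
  | .ind j => mem (mem j)

def Dest.addr (mem : ℕ → ℕ) : Dest → ℕ
  | .reg i => i
  | .ind i => mem i

/-- The value of an operation. Boolean operations act bitwise, negation complements each bit of the
binary representation of its first argument, the difference is cut off at `0`, and division by `0`
is not allowed. -/
def Op.eval : Op → ℕ → ℕ → Option ℕ
  | .lor, x, y => some (x ||| y)
  | .land, x, y => some (x &&& y)
  | .lxor, x, y => some (x ^^^ y)
  | .lnot, x, _ => some (2 ^ Nat.size x - 1 - x)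
  | .add, x, y => some (x + y)
  | .sub, x, y => some (x - y)
  | .mul, x, y => some (x * y)
  | .div, x, y => if y = 0 then none else some (x / y)

/-- Cyclic shift to the left by `s` positions of the `len` rightmost bits of `x`; the other bits
stay in place. -/
def rotateLeft (x s len : ℕ) : ℕ :=
  2 ^ len * (x / 2 ^ len) +
    ((x % 2 ^ len) * 2 ^ (s % len)) % 2 ^ len + (x % 2 ^ len) / 2 ^ (len - s % len)

/-- The corresponding cyclic shift to the right. -/
def rotateRight (x s len : ℕ) : ℕ := rotateLeft x (len - s % len) len

/-- The `len` rightmost bits of `x`, the most significant one first. -/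
def bits (len x : ℕ) : List Bool := (List.range len).map fun i => x.testBit (len - 1 - i)

/-- The number with the given bits, the most significant one first. -/
def ofBits (l : List Bool) : ℕ := l.foldl (fun x b => 2 * x + b.toNat) 0

/-- Assign `x` to the destination `d` and go on to the next instruction; only values of at most `w`
bits may be assigned. -/
def Config.write (w : ℕ) (s : Config) (d : Dest) (x : ℕ) : Option Config :=
  if x < 2 ^ w then
    some { s with pc := s.pc + 1, mem := Function.update s.mem (d.addr s.mem) x }
  else none

/-- One instruction on a machine with words of `w` bits and the given input register, whose bits are
numbered from left to right, starting at `0`. The result is `none` if the instruction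
is not allowed. -/
def Instr.exec (w : ℕ) (inp : List Bool) (s : Config) : Instr → Option Config
  | .assign d op A A' => (op.eval (A.eval s.mem) (A'.eval s.mem)).bind (s.write w d)
  | .shift d j left A A' =>
      if A.eval s.mem ≤ w ∧ A'.eval s.mem ≤ w then
        s.write w d
          (if left then rotateLeft (s.mem j) (A.eval s.mem) (A'.eval s.mem)
            else rotateRight (s.mem j) (A.eval s.mem) (A'.eval s.mem))
      else none
  | .input d A A' =>
      if A.eval s.mem ≤ A'.eval s.mem ∧ A'.eval s.mem < inp.length ∧
          A'.eval s.mem - A.eval s.mem + 1 ≤ w then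
        s.write w d
          (ofBits ((inp.drop (A.eval s.mem)).take (A'.eval s.mem - A.eval s.mem + 1)))
      else none
  | .output j A =>
      if A.eval s.mem ≤ w then
        some { s with pc := s.pc + 1, out := s.out ++ bits (A.eval s.mem) (s.mem j) }
      else none
  | .jump A A' target =>
      some { s with pc := if A.eval s.mem = A'.eval s.mem then target else s.pc + 1 }

/-- The start configuration: `R_0` holds the length of the input. -/
def start (inp : List Bool) : Config where
  pc := 0
  mem := fun i => if i = 0 then inp.length else 0
  out := []

/-- `σ` lists the configurations of a computation that makes exactly `T` steps, each of them
allowed, and then halts because no instruction has the number reached. Words have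
`κ (⌊log₂ n⌋ + 1)` bits, where `n` is the length of the input. -/
structure IsHaltingRun (prog : Program) (κ : ℕ) (inp : List Bool) (σ : ℕ → Config) (T : ℕ) :
    Prop where
  start_eq : σ 0 = start inp
  step : ∀ t < T, ∃ I, prog[(σ t).pc]? = some I ∧
    I.exec (κ * (Nat.log 2 inp.length + 1)) inp (σ t) = some (σ (t + 1))
  halted : prog[(σ T).pc]? = none

/-- The instruction executed in configuration `s` is a multiplication of `x` by `y`. -/
def ExecutesMul (prog : Program) (s : Config) (x y : ℕ) : Prop :=
  ∃ d A A', prog[s.pc]? = some (.assign d .mul A A') ∧ A.eval s.mem = x ∧ A'.eval s.mem = y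

end LogRAM

/-! ## The fast Fourier transform with few expensive multiplications -/

namespace FR

/-- Reversal of the `k` lowest bits. -/
def bitRev : ℕ → ℕ → ℕ
  | 0, _ => 0
  | k + 1, p => 2 ^ k * (p % 2) + bitRev k (p / 2)

section FFT

variable {A : Type*} [CommRing A]

/-- Binary level `l` of an FFT of length `N`, done in place. The FFT decomposes `N` into factors
`J`, the last one possibly smaller. The level belongs to the round `l / log₂ J`, in which FFTs of
length `D = min J M` are applied within subarrays of length `M = N / J ^ (l / log₂ J)`. The only
factors are powers of `ξ`, a root of unity of order `J`. -/
def butterfly (N J : ℕ) (ξ : A) (l : ℕ) (f : ℕ → A) : ℕ → A := fun p =>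
  let M := N / J ^ (l / Nat.log 2 J)
  let D := min J M
  let B := N / 2 ^ l
  if p % B < B / 2 then f p + f (p + B / 2)
  else (f (p - B / 2) - f p) *
    ξ ^ (J / D * 2 ^ (l % Nat.log 2 J) * ((p % B - B / 2) / (M / D)))

/-- After level `l` a round is complete, and it is not the last one. -/
def RoundEnds (N J l : ℕ) : Prop :=
  (l + 1) % Nat.log 2 J = 0 ∧ J ^ ((l + 1) / Nat.log 2 J) < N

instance (N J l : ℕ) : Decidable (RoundEnds N J l) := inferInstanceAs (Decidable (_ ∧ _))

/-- The exponent of the root of unity `ω` of order `N` with which position `p` is multiplied at the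
end of the round that level `l` completes. -/
def twiddleExp (N J l p : ℕ) : ℕ :=
  let K := N / J ^ ((l + 1) / Nat.log 2 J)
  J ^ (l / Nat.log 2 J) * (p % K) * bitRev (Nat.log 2 J) (p / K % J)

/-- The array after `l` binary levels of the FFT of `f` of length `N`, where `ω ^ (N / J) = ξ`. -/
def fftState (N J : ℕ) (ω ξ : A) (f : ℕ → A) : ℕ → ℕ → A
  | 0 => f
  | l + 1 => fun p =>
      if RoundEnds N J l then
        butterfly N J ξ l (fftState N J ω ξ f l) p * ω ^ twiddleExp N J l p
      else butterfly N J ξ l (fftState N J ω ξ f l) p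

/-- The result of the FFT in natural order. -/
def fft (N J : ℕ) (ω ξ : A) (f : ℕ → A) (p : ℕ) : A :=
  fftState N J ω ξ f (Nat.log 2 N) (bitRev (Nat.log 2 N) p)

end FFT

/-! ## The ring `ℂ[x] / (x ^ P + 1)` -/

noncomputable section

open Polynomial

/-- The ring `ℂ[x] / (x ^ P + 1)`. -/
abbrev PolyRing (P : ℕ) : Type := AdjoinRoot (X ^ P + 1 : ℂ[X])

/-- The class of `x`. -/
def ringX (P : ℕ) : PolyRing P := AdjoinRoot.root _

/-- The class of `c 0 + c 1 x + ⋯ + c (P - 1) x ^ (P - 1)`. -/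
def ofCoeffs (P : ℕ) (c : ℕ → ℂ) : PolyRing P :=
  ∑ j ∈ Finset.range P, AdjoinRoot.of _ (c j) * ringX P ^ j

/-- The root of unity of order `N` in `ℂ[x] / (x ^ P + 1)` that is given by the polynomial of degree
less than `P` with the value `exp ((2 k + 1) 2 π i / N)` at `exp ((2 k + 1) π i / P)`, for
`k = 0, …, P - 1`. If `2 P` divides `N`, then its power with exponent `N / (2 P)` is `x`. -/
def rho (P N : ℕ) : PolyRing P :=
  AdjoinRoot.mk _ (Lagrange.interpolate Finset.univ
    (fun k : Fin P => Complex.exp ((2 * (k : ℕ) + 1) * Real.pi * Complex.I / P))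
    (fun k : Fin P => Complex.exp ((2 * (k : ℕ) + 1) * 2 * Real.pi * Complex.I / N)))

/-- The factor `a` is cut into pieces of `P` bits; the next `P / 2` of them are the lower half of the
coefficients of the next ring element, and the upper half is zero. -/
def decompose (P a i : ℕ) : PolyRing P :=
  ofCoeffs P fun j =>
    if j < P / 2 then ((a / 2 ^ (P * (i * (P / 2) + j)) % 2 ^ P : ℕ) : ℂ) else 0

/-! ## The algorithm on a log-RAM -/

/-- Parameters: degree `P`, length `N` of the FFT, number `S` of bits after the binary
point, number `H` of bits of a coefficient, exponent `K` of the modulus `2 ^ K + 1` used for the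
multiplications in `ℂ[x] / (x ^ P + 1)`. -/
structure Params where
  P : ℕ
  N : ℕ
  S : ℕ
  H : ℕ
  K : ℕ

/-- The parameters are suitable for factors of `m` bits, and have the right order of magnitude with
constant `c`. -/
structure Params.Valid (p : Params) (m c : ℕ) : Prop where
  P_pow : ∃ k, p.P = 2 ^ (k + 1)
  N_pow : ∃ k, p.N = 2 ^ k
  dvd_N : 2 * p.P ∣ p.N
  /-- each factor fits into half of the array -/
  capacity : m ≤ p.N / 2 * (p.P / 2 * p.P)
  dvd_K : p.P ∣ p.K
  /-- products in the ring are determined by their coefficients modulo `2 ^ K + 1` -/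
  large_K : 4 * p.P * 2 ^ (2 * p.H) < 2 ^ p.K
  N_le : p.N * p.P ^ 2 ≤ c * m
  order : ∀ x ∈ [p.P, p.S, p.H, p.K],
    Nat.log 2 m + 1 ≤ c * x ∧ x ≤ c * (Nat.log 2 m + 1)

namespace Params

variable (p : Params)

/-- The integers stored for the ring element number `i` of the array that starts in register `b`.
Component `0` is for the real parts and component `1` for the imaginary parts of the
coefficients; the integer `u` is stored as `u + 2 ^ H`. -/
def stored (s : LogRAM.Config) (b i : ℕ) : Fin 2 → ℕ → ℤ := fun e j =>
  (s.mem (b + 2 * p.P * i + 2 * j + e) : ℤ) - 2 ^ p.H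

/-- The integers `u`, of `H` bits and a sign, are the coefficients of `z` with `S` bits after the
binary point, up to an error of at most `2 ^ (-P)`. -/
def Approximates (u : Fin 2 → ℕ → ℤ) (z : PolyRing p.P) : Prop :=
  ∃ c : ℕ → ℂ, z = ofCoeffs p.P c ∧ ∀ j < p.P,
    (∀ e, |u e j| ≤ 2 ^ p.H) ∧
    |(u 0 j : ℝ) / 2 ^ p.S - (c j).re| ≤ 1 / 2 ^ p.P ∧
    |(u 1 j : ℝ) / 2 ^ p.S - (c j).im| ≤ 1 / 2 ^ p.P

/-- An approximation of the array `F` of length `N` is stored in the `2 P N` consecutive registers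
that start with register `b`. -/
def HoldsArray (s : LogRAM.Config) (b : ℕ) (F : ℕ → PolyRing p.P) : Prop :=
  ∀ i < p.N, p.Approximates (p.stored s b i) (F i)

/-! ### Multiplication in the ring -/

/-- The integers modulo `2 ^ K + 1`. -/
abbrev Res : Type := ZMod (2 ^ p.K + 1)

/-- The power of `2` whose `P`-th power is `-1` modulo `2 ^ K + 1`. -/
def theta : p.Res := 2 ^ (p.K / p.P)

/-- The computation goes, between the times `s` and `t`, through all binary levels of the FFT of `g`
of length `P` modulo `2 ^ K + 1` with the root of unity `ξ ^ 2`. After each level the array is stored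
in `P` consecutive registers. -/
def PassesInnerFFT (σ : ℕ → LogRAM.Config) (s t : ℕ) (ξ : p.Res) (g : ℕ → p.Res) : Prop :=
  ∃ τ : ℕ → ℕ, Monotone τ ∧ s ≤ τ 0 ∧ τ (Nat.log 2 p.P) ≤ t ∧
    ∀ l ≤ Nat.log 2 p.P, ∃ b, ∀ k < p.P,
      (σ (τ l)).mem (b + k) = (fftState p.P (2 * p.P) 1 ξ g l k).val

/-- The FFT of length `P` of the sequence `u j * θ ^ j` modulo `2 ^ K + 1`. -/
def innerFFT (u : ℕ → ℤ) : ℕ → p.Res :=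
  fft p.P (2 * p.P) 1 p.theta fun j => u j * p.theta ^ j

/-- The FFTs of the real and imaginary parts of a product, from those of the factors. -/
def pointwise (u v : Fin 2 → ℕ → ℤ) : Fin 2 → ℕ → p.Res
  | 0 => fun k =>
      p.innerFFT (u 0) k * p.innerFFT (v 0) k - p.innerFFT (u 1) k * p.innerFFT (v 1) k
  | 1 => fun k =>
      p.innerFFT (u 0) k * p.innerFFT (v 1) k + p.innerFFT (u 1) k * p.innerFFT (v 0) k

/-- The real and imaginary parts of the coefficients of a product modulo `2 ^ K + 1`, by
inverse FFTs. -/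
def innerProduct (u v : Fin 2 → ℕ → ℤ) (e : Fin 2) (j : ℕ) : p.Res :=
  fft p.P (2 * p.P) 1 (p.theta ^ (2 * p.P - 1)) (p.pointwise u v e) j *
    p.theta ^ (2 * p.P - j) * (p.P : p.Res)⁻¹

/-- Between the times `s` and `t` the computation multiplies the elements of
`ℂ[x] / (x ^ P + 1)` with the stored integers `u` and `v`, with the result `y`: it goes through all
levels of the FFTs of the real and imaginary parts of the factors, multiplies the values pairwise by
single multiplication instructions, goes through all levels of the inverse FFTs, and rounds the
coefficients of the product to `S` bits after the binary point. -/
def RingMul (prog : LogRAM.Program) (σ : ℕ → LogRAM.Config) (s t : ℕ)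
    (u v y : Fin 2 → ℕ → ℤ) : Prop :=
  ∃ t₁ t₂, s ≤ t₁ ∧ t₁ ≤ t₂ ∧ t₂ ≤ t ∧
    (∀ e, p.PassesInnerFFT σ s t₁ p.theta fun j => u e j * p.theta ^ j) ∧
    (∀ e, p.PassesInnerFFT σ s t₁ p.theta fun j => v e j * p.theta ^ j) ∧
    (∀ e e', ∀ k < p.P, ∃ τ, t₁ ≤ τ ∧ τ ≤ t₂ ∧
      LogRAM.ExecutesMul prog (σ τ) (p.innerFFT (u e) k).val (p.innerFFT (v e') k).val) ∧
    (∀ e, p.PassesInnerFFT σ t₂ t (p.theta ^ (2 * p.P - 1)) (p.pointwise u v e)) ∧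
    ∀ e, ∀ j < p.P, |y e j * 2 ^ p.S - (p.innerProduct u v e j).valMinAbs| ≤ 2 ^ p.S

/-! ### The whole algorithm -/

/-- The computation goes, between the times `s` and `t`, through all binary levels of the FFT of `F`
of length `N` over `ℂ[x] / (x ^ P + 1)`: the array after `l` levels is stored at time `τ l`. If a
round ends with level `l`, then the array is stored at time `τ' l` too, before the multiplications by
powers of `ω`; these are multiplications in the ring, done between the times `τ' l` and
`τ (l + 1)`. -/
def PassesFFT (prog : LogRAM.Program) (σ : ℕ → LogRAM.Config) (s t : ℕ)
    (ω ξ : PolyRing p.P) (F : ℕ → PolyRing p.P) : Prop :=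
  ∃ τ τ' : ℕ → ℕ, s ≤ τ 0 ∧ τ (Nat.log 2 p.N) ≤ t ∧
    (∀ l < Nat.log 2 p.N, τ l ≤ τ' l ∧ τ' l ≤ τ (l + 1)) ∧
    ∃ b b' : ℕ → ℕ,
      (∀ l ≤ Nat.log 2 p.N,
        p.HoldsArray (σ (τ l)) (b l) (fftState p.N (2 * p.P) ω ξ F l)) ∧
      ∀ l < Nat.log 2 p.N, RoundEnds p.N (2 * p.P) l →
        p.HoldsArray (σ (τ' l)) (b' l)
          (butterfly p.N (2 * p.P) ξ l (fftState p.N (2 * p.P) ω ξ F l)) ∧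
        ∀ i < p.N, ∃ t₀ d, τ' l ≤ t₀ ∧ t₀ ≤ τ (l + 1) ∧
          p.Approximates (p.stored (σ t₀) d 0) (ω ^ twiddleExp p.N (2 * p.P) l i) ∧
          p.RingMul prog σ t₀ (τ (l + 1)) (p.stored (σ (τ' l)) (b' l) i)
            (p.stored (σ t₀) d 0) (p.stored (σ (τ (l + 1))) (b (l + 1)) i)

/-- The computation `σ` of the program performs the algorithm on the factors `a` and `b` within `T`
steps: the factors are decomposed, the FFTs of both arrays are computed, the results are multiplied
componentwise, the inverse FFT is computed and divided by `N`, so that the coefficients of the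
product are stored at time `t₄`; only then is the output composed. -/
def Performs (prog : LogRAM.Program) (σ : ℕ → LogRAM.Config) (T a b : ℕ) : Prop :=
  ∃ t₁ t₂ t₃ t₄, t₁ ≤ t₂ ∧ t₂ ≤ t₃ ∧ t₃ ≤ t₄ ∧ t₄ ≤ T ∧
    let ω := rho p.P p.N
    let x := ringX p.P
    let Fa := fft p.N (2 * p.P) ω x (decompose p.P a)
    let Fb := fft p.N (2 * p.P) ω x (decompose p.P b)
    p.PassesFFT prog σ 0 t₁ ω x (decompose p.P a) ∧
    p.PassesFFT prog σ 0 t₁ ω x (decompose p.P b) ∧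
    (∃ d₁ d₂ d,
      p.HoldsArray (σ t₁) d₁ Fa ∧ p.HoldsArray (σ t₁) d₂ Fb ∧
      p.HoldsArray (σ t₂) d (fun i => Fa i * Fb i) ∧
      ∀ i < p.N, p.RingMul prog σ t₁ t₂ (p.stored (σ t₁) d₁ i) (p.stored (σ t₁) d₂ i)
        (p.stored (σ t₂) d i)) ∧
    p.PassesFFT prog σ t₂ t₃ (ω ^ (p.N - 1)) (x ^ (p.N - 1)) (fun i => Fa i * Fb i) ∧
    (∃ d, p.HoldsArray (σ t₄) d fun i =>
      AdjoinRoot.of _ (p.N : ℂ)⁻¹ *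
        fft p.N (2 * p.P) (ω ^ (p.N - 1)) (x ^ (p.N - 1)) (fun i => Fa i * Fb i) i) ∧
    (σ t₄).out = []

end Params

end

end FR

/-! ## A structured language that is compiled to log-RAM programs -/

namespace LogRAM

/-- Expressions over variables and arrays. -/
inductive Exp
  | const (k : ℕ) | var (x : ℕ)
  | add (a b : Exp) | sub (a b : Exp) | mul (a b : Exp) | div (a b : Exp) | mod (a b : Exp)
  | load (arr : ℕ) (i : Exp)

namespace Exp

instance : Add Exp := ⟨add⟩
instance : Sub Exp := ⟨sub⟩
instance : Mul Exp := ⟨mul⟩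
instance : Div Exp := ⟨div⟩
instance : Mod Exp := ⟨mod⟩
instance (n : ℕ) : OfNat Exp n := ⟨const n⟩

end Exp

/-- Statements. `ifz e c d` executes `c` if `e = 0` and `d` otherwise, and `loop x e c` executes `c`
for `x = 0, 1, …` until `x = e`. -/
inductive Stmt
  | skip
  | set (x : ℕ) (e : Exp)
  | store (arr : ℕ) (i e : Exp)
  | seq (c d : Stmt)
  | ifz (e : Exp) (c d : Stmt)
  | loop (x : ℕ) (e : Exp) (c : Stmt)
  | input (x : ℕ) (a b : Exp)
  | output (x : ℕ) (e : Exp)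

infixr:30 ";;" => Stmt.seq

/-- The values of the variables and arrays, and the output. -/
structure St where
  v : ℕ → ℕ
  a : ℕ → ℕ → ℕ
  out : List Bool

namespace Exp

/-- The value of an expression. -/
def val (st : St) : Exp → ℕ
  | const k => k
  | var x => st.v x
  | add a b => a.val st + b.val st
  | sub a b => a.val st - b.val st
  | mul a b => a.val st * b.val st
  | div a b => a.val st / b.val st
  | mod a b => a.val st % b.val st
  | load arr i => st.a arr (i.val st)

/-- If the variables and array entries are less than `B`, then the value is less than
`B ^ e.deg`. -/
def deg : Exp → ℕ
  | const _ => 1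
  | var _ => 1
  | add a b => max a.deg b.deg + 1
  | sub a _ => a.deg
  | mul a b => a.deg + b.deg
  | div a _ => a.deg
  | mod a _ => a.deg
  | load _ _ => 1

/-- Where the value is found after the code with temporary registers from number `d` on. -/
def arg : Exp → ℕ → Arg
  | const k, _ => .const k
  | var x, _ => .reg x
  | _, d => .reg (64 + d)

/-- The code that evaluates an expression with temporary registers from number `d` on. -/
def code : Exp → ℕ → List Instr
  | const _, _ => []
  | var _, _ => []
  | add a b, d => a.code d ++ (b.code (d + 1) ++
      [.assign (.reg (64 + d)) .add (a.arg d) (b.arg (d + 1))])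
  | sub a b, d => a.code d ++ (b.code (d + 1) ++
      [.assign (.reg (64 + d)) .sub (a.arg d) (b.arg (d + 1))])
  | mul a b, d => a.code d ++ (b.code (d + 1) ++
      [.assign (.reg (64 + d)) .mul (a.arg d) (b.arg (d + 1))])
  | div a b, d => a.code d ++ (b.code (d + 1) ++
      [.assign (.reg (64 + d)) .div (a.arg d) (b.arg (d + 1))])
  | mod a b, d => a.code d ++ (b.code (d + 1) ++
      [.assign (.reg (66 + d)) .div (a.arg d) (b.arg (d + 1)),
        .assign (.reg (66 + d)) .mul (.reg (66 + d)) (b.arg (d + 1)),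
        .assign (.reg (64 + d)) .sub (a.arg d) (.reg (66 + d))])
  | load arr i, d => i.code d ++
      [.assign (.reg (64 + d)) .add (.reg (80 + arr)) (i.arg d),
        .assign (.reg (64 + d)) .add (.ind (64 + d)) (.const 0)]

/-- The static conditions: constants are small, variables, arrays and temporary registers have
admissible numbers, and all degrees are at most `8`. -/
def wf : Exp → ℕ → Bool
  | const k, _ => k < 256
  | var x, _ => x < 64
  | add a b, d => a.wf d && b.wf (d + 1) && d < 14 && max a.deg b.deg + 1 ≤ 8
  | sub a b, d => a.wf d && b.wf (d + 1) && d < 14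
  | mul a b, d => a.wf d && b.wf (d + 1) && d < 14 && a.deg + b.deg ≤ 8
  | div a b, d => a.wf d && b.wf (d + 1) && d < 14
  | mod a b, d => a.wf d && b.wf (d + 1) && d < 14
  | load arr i, d => i.wf d && d < 14 && arr < 24

end Exp

namespace Stmt

/-- The length of the code. -/
def len : Stmt → ℕ
  | skip => 0
  | set _ e => (e.code 0).length + 1
  | store _ i e => (i.code 0).length + (e.code 1).length + 2
  | seq c d => c.len + d.len
  | ifz e c d => (e.code 0).length + 1 + (d.len + 1 + c.len)
  | loop _ e c => 1 + ((e.code 0).length + 1 + (c.len + 2))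
  | input _ a b => (a.code 0).length + (b.code 1).length + 1
  | output _ e => (e.code 0).length + 1

/-- The code of a statement that starts with instruction number `o`. -/
def code : Stmt → ℕ → List Instr
  | skip, _ => []
  | set x e, _ => e.code 0 ++ [.assign (.reg x) .add (e.arg 0) (.const 0)]
  | store arr i e, _ => i.code 0 ++ (e.code 1 ++
      [.assign (.reg 66) .add (.reg (80 + arr)) (i.arg 0),
        .assign (.ind 66) .add (e.arg 1) (.const 0)])
  | seq c d, o => c.code o ++ d.code (o + c.len)
  | ifz e c d, o => e.code 0 ++
      ([.jump (e.arg 0) (.const 0) (o + (e.code 0).length + 1 + d.len + 1)] ++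
      (d.code (o + (e.code 0).length + 1) ++
      ([.jump (.const 0) (.const 0) (o + (e.code 0).length + 1 + d.len + 1 + c.len)] ++
      c.code (o + (e.code 0).length + 1 + d.len + 1))))
  | loop x e c, o => [.assign (.reg x) .add (.const 0) (.const 0)] ++ (e.code 0 ++
      ([.jump (.reg x) (e.arg 0) (o + 1 + (e.code 0).length + 1 + c.len + 2)] ++
      (c.code (o + 1 + (e.code 0).length + 1) ++
      [.assign (.reg x) .add (.reg x) (.const 1), .jump (.const 0) (.const 0) (o + 1)])))
  | input x a b, _ => a.code 0 ++ (b.code 1 ++ [.input (.reg x) (a.arg 0) (b.arg 1)])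
  | output x e, _ => e.code 0 ++ [.output x (e.arg 0)]

/-- The static conditions. -/
def wf : Stmt → Bool
  | skip => true
  | set x e => x < 64 && e.wf 0
  | store arr i e => arr < 24 && i.wf 0 && e.wf 1
  | seq c d => c.wf && d.wf
  | ifz e c d => e.wf 0 && c.wf && d.wf
  | loop x e c => x < 64 && e.wf 0 && c.wf
  | input x a b => x < 64 && a.wf 0 && b.wf 1
  | output x e => x < 64 && e.wf 0

end Stmt

end LogRAM

namespace LogRAM

/-- A program with its input and word length, the length `L` of the arrays, a bound `acc` for the
accessible array indices, and a bound `B` for the values of variables and array entries. -/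
structure Env where
  prog : Program
  w : ℕ
  inp : List Bool
  L : ℕ
  acc : ℕ
  B : ℕ

/-- The result of the next step, if it is allowed. -/
def stepOf (prog : Program) (w : ℕ) (inp : List Bool) (s : Config) : Option Config :=
  (prog[s.pc]?).bind fun I => I.exec w inp s

/-- The computation of a program. -/
def run (prog : Program) (w : ℕ) (inp : List Bool) : ℕ → Config
  | 0 => start inp
  | t + 1 => (stepOf prog w inp (run prog w inp t)).getD (run prog w inp t)

namespace Env

variable (E : Env)

/-- The computation. -/
def σ (t : ℕ) : Config := run E.prog E.w E.inp t

/-- The first `s` steps are allowed. -/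
def Okay (s : ℕ) : Prop := ∀ t < s, stepOf E.prog E.w E.inp (E.σ t) = some (E.σ (t + 1))

/-- The bounds fit together. -/
structure Good : Prop where
  B_ge : 256 ≤ E.B
  B_le : E.B ^ 8 ≤ 2 ^ E.w
  L_le : 104 + 24 * E.L ≤ E.B
  acc_le : E.acc ≤ E.L

/-- The registers hold the values of the variables and arrays. -/
structure Rep (mem : ℕ → ℕ) (st : St) : Prop where
  var : ∀ x < 64, mem x = st.v x
  base : 0 < E.acc → ∀ a < 24, mem (80 + a) = 104 + a * E.L
  arr : ∀ a < 24, ∀ i < E.L, mem (104 + a * E.L + i) = st.a a i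
  var_lt : ∀ x < 64, st.v x < E.B
  arr_lt : ∀ a < 24, ∀ i < E.L, st.a a i < E.B

/-- At time `s` instruction `o` is reached with the values `st`. -/
structure At (s o : ℕ) (st : St) : Prop where
  okay : E.Okay s
  pc : (E.σ s).pc = o
  out : (E.σ s).out = st.out
  rep : E.Rep (E.σ s).mem st

/-- The program contains the given instructions, from number `o` on. -/
def CodeAt (o : ℕ) (l : List Instr) : Prop := ∀ i < l.length, E.prog[o + i]? = l[i]?

variable {E}

theorem codeAt_append {o : ℕ} {l l' : List Instr} :
    E.CodeAt o (l ++ l') ↔ E.CodeAt o l ∧ E.CodeAt (o + l.length) l' := by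
  constructor
  · intro h
    refine ⟨fun i hi => ?_, fun i hi => ?_⟩
    · rw [h i (by simp; omega), List.getElem?_append_left hi]
    · rw [add_assoc, h (l.length + i) (by simp; omega), List.getElem?_append_right (by omega)]
      simp
  · rintro ⟨h, h'⟩ i hi
    by_cases hl : i < l.length
    · rw [h i hl, List.getElem?_append_left hl]
    · have := h' (i - l.length) (by simp at hi; omega)
      rw [List.getElem?_append_right (by omega), ← this]
      congr 1; omega

theorem codeAt_cons {o : ℕ} {I : Instr} {l : List Instr} :
    E.CodeAt o (I :: l) ↔ E.prog[o]? = some I ∧ E.CodeAt (o + 1) l := by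
  rw [← List.singleton_append, codeAt_append]
  simp [CodeAt]

theorem Okay.succ {s : ℕ} {I : Instr} {c : Config} (h : E.Okay s)
    (hI : E.prog[(E.σ s).pc]? = some I) (hc : I.exec E.w E.inp (E.σ s) = some c) :
    E.Okay (s + 1) ∧ E.σ (s + 1) = c := by
  have h1 : stepOf E.prog E.w E.inp (E.σ s) = some c := by simp [stepOf, hI, hc]
  have h2 : E.σ (s + 1) = c := by
    change (stepOf E.prog E.w E.inp (E.σ s)).getD _ = c
    rw [h1]; rfl
  refine ⟨fun t ht => ?_, h2⟩
  rcases Nat.lt_succ_iff_lt_or_eq.1 ht with ht | rfl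
  · exact h t ht
  · rw [h1, h2]

theorem At.exec {s o o' : ℕ} {st st' : St} {I : Instr} {mem : ℕ → ℕ} {out : List Bool}
    (h : E.At s o st) (hI : E.prog[o]? = some I)
    (hc : I.exec E.w E.inp (E.σ s) = some ⟨o', mem, out⟩) (hout : out = st'.out)
    (hrep : E.Rep mem st') : E.At (s + 1) o' st' ∧ (E.σ (s + 1)).mem = mem := by
  obtain ⟨h1, h2⟩ := h.okay.succ (h.pc ▸ hI) hc
  refine ⟨⟨h1, ?_, ?_, ?_⟩, ?_⟩ <;> rw [h2]
  · exact hout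
  · exact hrep

theorem Rep.update_temp {mem : ℕ → ℕ} {st : St} (h : E.Rep mem st) {r : ℕ} (hr : 64 ≤ r)
    (hr' : r < 80) (x : ℕ) : E.Rep (Function.update mem r x) st where
  var y hy := by rw [Function.update_of_ne (by omega), h.var y hy]
  base hp a ha := by rw [Function.update_of_ne (by omega), h.base hp a ha]
  arr a ha i hi := by rw [Function.update_of_ne (by omega), h.arr a ha i hi]
  var_lt := h.var_lt
  arr_lt := h.arr_lt

theorem At.assign {s o : ℕ} {st st' : St} {d : Dest} {op : Op} {A A' : Arg} {y : ℕ}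
    (h : E.At s o st) (hI : E.prog[o]? = some (.assign d op A A'))
    (hv : op.eval (A.eval (E.σ s).mem) (A'.eval (E.σ s).mem) = some y) (hy : y < 2 ^ E.w)
    (hout : st'.out = st.out)
    (hrep : E.Rep (Function.update (E.σ s).mem (d.addr (E.σ s).mem) y) st') :
    E.At (s + 1) (o + 1) st' ∧
      (E.σ (s + 1)).mem = Function.update (E.σ s).mem (d.addr (E.σ s).mem) y := by
  refine h.exec hI (out := st.out) ?_ hout.symm hrep
  simp [Instr.exec, hv, Config.write, hy, h.pc, h.out]

theorem At.assign_temp {s o : ℕ} {st : St} {r : ℕ} {op : Op} {A A' : Arg} {y : ℕ}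
    (h : E.At s o st) (hI : E.prog[o]? = some (.assign (.reg r) op A A'))
    (hv : op.eval (A.eval (E.σ s).mem) (A'.eval (E.σ s).mem) = some y) (hy : y < 2 ^ E.w)
    (hr : 64 ≤ r) (hr' : r < 80) :
    E.At (s + 1) (o + 1) st ∧ (E.σ (s + 1)).mem = Function.update (E.σ s).mem r y :=
  h.assign hI hv hy rfl (h.rep.update_temp hr hr' y)

theorem At.jump {s o : ℕ} {st : St} {A A' : Arg} {t : ℕ} (h : E.At s o st)
    (hI : E.prog[o]? = some (.jump A A' t)) :
    E.At (s + 1) (if A.eval (E.σ s).mem = A'.eval (E.σ s).mem then t else o + 1) st := by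
  refine (h.exec hI (mem := (E.σ s).mem) (out := (E.σ s).out) ?_ h.out h.rep).1
  simp [Instr.exec, h.pc]

end Env

/-! ### Expressions -/

namespace Exp

/-- No division by zero, and all array indices are in range. -/
def Ok (E : Env) (st : St) : Exp → Prop
  | const _ => True
  | var _ => True
  | add a b => a.Ok E st ∧ b.Ok E st
  | sub a b => a.Ok E st ∧ b.Ok E st
  | mul a b => a.Ok E st ∧ b.Ok E st
  | div a b => a.Ok E st ∧ b.Ok E st ∧ b.val st ≠ 0
  | mod a b => a.Ok E st ∧ b.Ok E st ∧ b.val st ≠ 0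
  | load _ i => i.Ok E st ∧ i.val st < E.acc

variable {E : Env} {st : St}

theorem wf_deg : ∀ (e : Exp) {d : ℕ}, e.wf d = true → 1 ≤ e.deg ∧ e.deg ≤ 8
  | const _, _, _ => by simp [deg]
  | var _, _, _ => by simp [deg]
  | add a b, d, h => by
      simp only [wf, Bool.and_eq_true, decide_eq_true_eq] at h
      simp only [deg]; omega
  | sub a b, d, h => by
      simp only [wf, Bool.and_eq_true, decide_eq_true_eq] at h
      exact wf_deg a h.1.1
  | mul a b, d, h => by
      simp only [wf, Bool.and_eq_true, decide_eq_true_eq] at h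
      have := wf_deg a h.1.1.1
      simp only [deg]; omega
  | div a b, d, h => by
      simp only [wf, Bool.and_eq_true, decide_eq_true_eq] at h
      exact wf_deg a h.1.1
  | mod a b, d, h => by
      simp only [wf, Bool.and_eq_true, decide_eq_true_eq] at h
      exact wf_deg a h.1.1
  | load _ _, _, _ => by simp [deg]

theorem val_lt_pow (hE : E.Good) {mem : ℕ → ℕ} (hr : E.Rep mem st) :
    ∀ (e : Exp) {d : ℕ}, e.wf d = true → e.Ok E st → e.val st < E.B ^ e.deg
  | const k, d, h, _ => by
      simp only [wf, decide_eq_true_eq] at h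
      have := hE.B_ge
      simp only [val, deg, pow_one]; omega
  | var x, d, h, _ => by
      simp only [wf, decide_eq_true_eq] at h
      simpa only [val, deg, pow_one] using hr.var_lt x h
  | add a b, d, h, ho => by
      simp only [wf, Bool.and_eq_true, decide_eq_true_eq] at h
      have h1 := val_lt_pow hE hr a h.1.1.1 ho.1
      have h2 := val_lt_pow hE hr b h.1.1.2 ho.2
      have hB := hE.B_ge
      have h3 : E.B ^ a.deg ≤ E.B ^ max a.deg b.deg := Nat.pow_le_pow_right (by omega) (by simp)
      have h4 : E.B ^ b.deg ≤ E.B ^ max a.deg b.deg := Nat.pow_le_pow_right (by omega) (by simp)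
      simp only [val, deg, pow_succ]
      nlinarith [Nat.zero_le (E.B ^ max a.deg b.deg)]
  | sub a b, d, h, ho => by
      simp only [wf, Bool.and_eq_true, decide_eq_true_eq] at h
      exact lt_of_le_of_lt (Nat.sub_le _ _) (val_lt_pow hE hr a h.1.1 ho.1)
  | mul a b, d, h, ho => by
      simp only [wf, Bool.and_eq_true, decide_eq_true_eq] at h
      simp only [val, deg, pow_add]
      exact Nat.mul_lt_mul'' (val_lt_pow hE hr a h.1.1.1 ho.1) (val_lt_pow hE hr b h.1.1.2 ho.2)
  | div a b, d, h, ho => by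
      simp only [wf, Bool.and_eq_true, decide_eq_true_eq] at h
      exact lt_of_le_of_lt (Nat.div_le_self _ _) (val_lt_pow hE hr a h.1.1 ho.1)
  | mod a b, d, h, ho => by
      simp only [wf, Bool.and_eq_true, decide_eq_true_eq] at h
      exact lt_of_le_of_lt (Nat.mod_le _ _) (val_lt_pow hE hr a h.1.1 ho.1)
  | load arr i, d, h, ho => by
      simp only [wf, Bool.and_eq_true, decide_eq_true_eq] at h
      simpa only [val, deg, pow_one] using
        hr.arr_lt arr h.2 (i.val st) (lt_of_lt_of_le ho.2 hE.acc_le)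

theorem val_lt (hE : E.Good) {mem : ℕ → ℕ} (hr : E.Rep mem st) (e : Exp) {d : ℕ}
    (h : e.wf d = true) (ho : e.Ok E st) : e.val st < 2 ^ E.w :=
  lt_of_lt_of_le (val_lt_pow hE hr e h ho)
    (le_trans (Nat.pow_le_pow_right (by have := hE.B_ge; omega) (wf_deg e h).2) hE.B_le)

theorem Env.Good.lt_of_le (hE : E.Good) {x : ℕ} (hx : x ≤ E.B) : x < 2 ^ E.w := by
  refine lt_of_le_of_lt hx (lt_of_lt_of_le ?_ hE.B_le)
  have := hE.B_ge
  calc E.B = E.B ^ 1 := (pow_one _).symm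
    _ < E.B ^ 8 := Nat.pow_lt_pow_right (by omega) (by norm_num)

/-- The argument has the same value after changes of later temporary registers. -/
theorem arg_eval_congr (e : Exp) {d : ℕ} (h : e.wf d = true) {mem mem' : ℕ → ℕ}
    (hr : E.Rep mem st) (hr' : E.Rep mem' st) (ht : mem' (64 + d) = mem (64 + d)) :
    (e.arg d).eval mem' = (e.arg d).eval mem := by
  cases e <;> simp_all [arg, Arg.eval, wf, hr.var, hr'.var]

/-- Evaluation of an expression. -/
theorem run_code (hE : E.Good) : ∀ (e : Exp) {d o s : ℕ}, e.wf d = true → e.Ok E st →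
    E.CodeAt o (e.code d) → E.At s o st →
    E.At (s + (e.code d).length) (o + (e.code d).length) st ∧
      (e.arg d).eval (E.σ (s + (e.code d).length)).mem = e.val st ∧
      ∀ k < d, (E.σ (s + (e.code d).length)).mem (64 + k) = (E.σ s).mem (64 + k) := by
  have bin : ∀ (op : Op) (e a b : Exp) (d o s : ℕ)
      (_ : ∀ {d o s : ℕ}, a.wf d = true → a.Ok E st → E.CodeAt o (a.code d) → E.At s o st →
        E.At (s + (a.code d).length) (o + (a.code d).length) st ∧
        (a.arg d).eval (E.σ (s + (a.code d).length)).mem = a.val st ∧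
        ∀ k < d, (E.σ (s + (a.code d).length)).mem (64 + k) = (E.σ s).mem (64 + k))
      (_ : ∀ {d o s : ℕ}, b.wf d = true → b.Ok E st → E.CodeAt o (b.code d) → E.At s o st →
        E.At (s + (b.code d).length) (o + (b.code d).length) st ∧
        (b.arg d).eval (E.σ (s + (b.code d).length)).mem = b.val st ∧
        ∀ k < d, (E.σ (s + (b.code d).length)).mem (64 + k) = (E.σ s).mem (64 + k)),
      a.wf d = true → b.wf (d + 1) = true → d < 14 → a.Ok E st → b.Ok E st →
      op.eval (a.val st) (b.val st) = some (e.val st) → e.val st < 2 ^ E.w →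
      e.code d = a.code d ++ (b.code (d + 1) ++
        [.assign (.reg (64 + d)) op (a.arg d) (b.arg (d + 1))]) →
      e.arg d = .reg (64 + d) →
      E.CodeAt o (e.code d) → E.At s o st →
      E.At (s + (e.code d).length) (o + (e.code d).length) st ∧
        (e.arg d).eval (E.σ (s + (e.code d).length)).mem = e.val st ∧
        ∀ k < d, (E.σ (s + (e.code d).length)).mem (64 + k) = (E.σ s).mem (64 + k) := by
    intro op e a b d o s iha ihb wa wb hd oa ob hop hlt hcode harg hc h
    rw [hcode, Env.codeAt_append, Env.codeAt_append, Env.codeAt_cons] at hc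
    obtain ⟨a1, a2, a3⟩ := iha wa oa hc.1 h
    obtain ⟨b1, b2, b3⟩ := ihb wb ob hc.2.1 a1
    have e1 := arg_eval_congr a wa a1.rep b1.rep (b3 d (by omega))
    obtain ⟨c1, c2⟩ := b1.assign_temp hc.2.2.1 (y := e.val st) (by rw [e1, a2, b2, hop]) hlt
      (by omega) (by omega)
    have hl : (e.code d).length = (a.code d).length + (b.code (d + 1)).length + 1 := by
      rw [hcode]; simp; omega
    rw [hl, ← add_assoc, ← add_assoc, ← add_assoc, ← add_assoc, harg]
    refine ⟨c1, ?_, fun k hk => ?_⟩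
    · simp [Arg.eval, c2]
    · rw [c2, Function.update_of_ne (by omega), b3 k (by omega), a3 k hk]
  intro e
  induction e with
  | const k => intro d o s _ _ _ h; exact ⟨h, rfl, fun _ _ => rfl⟩
  | var x =>
    intro d o s hw _ _ h
    simp only [wf, decide_eq_true_eq] at hw
    exact ⟨h, h.rep.var x hw, fun _ _ => rfl⟩
  | add a b iha ihb =>
    intro d o s hw ho hc h
    have hlt := val_lt hE h.rep _ hw ho
    simp only [wf, Bool.and_eq_true, decide_eq_true_eq] at hw
    exact bin .add _ a b d o s iha ihb hw.1.1.1 hw.1.1.2 hw.1.2 ho.1 ho.2 rfl hlt rfl rfl hc h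
  | sub a b iha ihb =>
    intro d o s hw ho hc h
    have hlt := val_lt hE h.rep _ hw ho
    simp only [wf, Bool.and_eq_true, decide_eq_true_eq] at hw
    exact bin .sub _ a b d o s iha ihb hw.1.1 hw.1.2 hw.2 ho.1 ho.2 rfl hlt rfl rfl hc h
  | mul a b iha ihb =>
    intro d o s hw ho hc h
    have hlt := val_lt hE h.rep _ hw ho
    simp only [wf, Bool.and_eq_true, decide_eq_true_eq] at hw
    exact bin .mul _ a b d o s iha ihb hw.1.1.1 hw.1.1.2 hw.1.2 ho.1 ho.2 rfl hlt rfl rfl hc h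
  | div a b iha ihb =>
    intro d o s hw ho hc h
    have hlt := val_lt hE h.rep _ hw ho
    simp only [wf, Bool.and_eq_true, decide_eq_true_eq] at hw
    exact bin .div _ a b d o s iha ihb hw.1.1 hw.1.2 hw.2 ho.1 ho.2.1
      (by simp [Op.eval, ho.2.2, val]) hlt rfl rfl hc h
  | mod a b iha ihb =>
    intro d o s hw ho hc h
    simp only [wf, Bool.and_eq_true, decide_eq_true_eq] at hw
    have hlt := val_lt hE h.rep _ hw.1.1 ho.1
    rw [code, Env.codeAt_append, Env.codeAt_append, Env.codeAt_cons, Env.codeAt_cons,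
      Env.codeAt_cons] at hc
    obtain ⟨a1, a2, a3⟩ := iha hw.1.1 ho.1 hc.1 h
    obtain ⟨b1, b2, b3⟩ := ihb hw.1.2 ho.2.1 hc.2.1 a1
    have hd := hw.2
    have e1 := arg_eval_congr a hw.1.1 a1.rep b1.rep (b3 d (by omega))
    obtain ⟨c1, c2⟩ := b1.assign_temp hc.2.2.1 (y := a.val st / b.val st)
      (by rw [e1, a2, b2]; simp [Op.eval, ho.2.2]) (lt_of_le_of_lt (Nat.div_le_self _ _) hlt)
      (by omega) (by omega)
    have e2 := arg_eval_congr a hw.1.1 b1.rep c1.rep (by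
      rw [c2, Function.update_of_ne (by omega)])
    have e3 := arg_eval_congr b hw.1.2 b1.rep c1.rep (by
      rw [c2, Function.update_of_ne (by omega)])
    obtain ⟨f1, f2⟩ := c1.assign_temp hc.2.2.2.1 (y := a.val st / b.val st * b.val st)
      (by rw [e3, b2]; simp [Op.eval, Arg.eval, c2])
      (lt_of_le_of_lt (Nat.div_mul_le_self _ _) hlt) (by omega) (by omega)
    have e4 := arg_eval_congr a hw.1.1 c1.rep f1.rep (by
      rw [f2, Function.update_of_ne (by omega)])
    obtain ⟨g1, g2⟩ := f1.assign_temp hc.2.2.2.2.1 (y := a.val st % b.val st)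
      (by
        rw [e4, e2, e1, a2]
        simp only [Op.eval, Arg.eval, f2, Function.update_self, Option.some.injEq]
        have := Nat.div_add_mod' (a.val st) (b.val st)
        omega)
      (lt_of_le_of_lt (Nat.mod_le _ _) hlt) (by omega) (by omega)
    have hl : ((mod a b).code d).length = (a.code d).length + (b.code (d + 1)).length + 1 + 1 + 1 := by
      simp [code]; omega
    rw [hl, ← add_assoc, ← add_assoc, ← add_assoc, ← add_assoc, ← add_assoc, ← add_assoc,
      ← add_assoc, ← add_assoc]
    refine ⟨g1, ?_, fun k hk => ?_⟩
    · simp [Arg.eval, g2, arg, val]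
    · rw [g2, Function.update_of_ne (by omega), f2, Function.update_of_ne (by omega), c2,
        Function.update_of_ne (by omega), b3 k (by omega), a3 k hk]
  | load arr i ih =>
    intro d o s hw ho hc h
    simp only [wf, Bool.and_eq_true, decide_eq_true_eq] at hw
    rw [code, Env.codeAt_append, Env.codeAt_cons, Env.codeAt_cons] at hc
    obtain ⟨a1, a2, a3⟩ := ih hw.1.1 ho.1 hc.1 h
    have hd := hw.1.2
    have hi := lt_of_lt_of_le ho.2 hE.acc_le
    have hL := hE.L_le
    have hle : 104 + arr * E.L + i.val st ≤ E.B := by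
      have : arr * E.L ≤ 23 * E.L := Nat.mul_le_mul_right _ (by omega)
      omega
    obtain ⟨c1, c2⟩ := a1.assign_temp hc.2.1 (y := 104 + arr * E.L + i.val st)
      (by
        rw [a2]
        simp only [Op.eval, Arg.eval]
        rw [a1.rep.base (by have := ho.2; omega) arr hw.2])
      (Env.Good.lt_of_le hE hle) (by omega) (by omega)
    obtain ⟨g1, g2⟩ := c1.assign_temp hc.2.2.1 (y := st.a arr (i.val st))
      (by
        simp only [Op.eval, Arg.eval, c2, Function.update_self, add_zero, Option.some.injEq]
        rw [Function.update_of_ne (by omega), a1.rep.arr arr hw.2 _ hi])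
      (Env.Good.lt_of_le hE (h.rep.arr_lt arr hw.2 _ hi).le) (by omega) (by omega)
    have hl : ((load arr i).code d).length = (i.code d).length + 1 + 1 := by simp [code]
    rw [hl, ← add_assoc, ← add_assoc, ← add_assoc, ← add_assoc]
    refine ⟨g1, ?_, fun k hk => ?_⟩
    · simp [Arg.eval, g2, arg, val]
    · rw [g2, Function.update_of_ne (by omega), c2, Function.update_of_ne (by omega), a3 k hk]

end Exp

end LogRAM

namespace LogRAM

namespace St

/-- Assignment to a variable. -/
def set (st : St) (x y : ℕ) : St := { st with v := Function.update st.v x y }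

/-- Assignment to an array entry. -/
def put (st : St) (arr i y : ℕ) : St :=
  { st with a := Function.update st.a arr (Function.update (st.a arr) i y) }

variable (st : St) (x y z arr i b : ℕ)

@[simp] theorem set_v : (st.set x y).v z = if z = x then y else st.v z := by
  simp [set, Function.update_apply]
@[simp] theorem set_a : (st.set x y).a = st.a := rfl
@[simp] theorem set_out : (st.set x y).out = st.out := rfl
@[simp] theorem put_v : (st.put arr i y).v = st.v := rfl
@[simp] theorem put_a :
    (st.put arr i y).a b = if b = arr then Function.update (st.a arr) i y else st.a b := by
  simp [put, Function.update_apply]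
@[simp] theorem put_out : (st.put arr i y).out = st.out := rfl

end St

namespace Stmt

theorem length_code : ∀ (c : Stmt) (o : ℕ), (c.code o).length = c.len
  | skip, _ => rfl
  | set _ _, _ => by simp [code, len]
  | store _ _ _, _ => by simp [code, len]; omega
  | seq c d, o => by simp [code, len, length_code c, length_code d]
  | ifz _ c d, o => by simp [code, len, length_code c, length_code d]; omega
  | loop _ _ c, o => by simp [code, len, length_code c]; omega
  | input _ _ _, _ => by simp [code, len]; omega
  | output _ _, _ => by simp [code, len]

/-- The weakest precondition of a statement without loops. -/
def wp (E : Env) : Stmt → (St → Prop) → St → Prop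
  | skip, Q, st => Q st
  | set x e, Q, st => e.Ok E st ∧ e.val st < E.B ∧ Q (st.set x (e.val st))
  | store arr i e, Q, st => i.Ok E st ∧ e.Ok E st ∧ i.val st < E.acc ∧ e.val st < E.B ∧
      Q (st.put arr (i.val st) (e.val st))
  | seq c d, Q, st => c.wp E (d.wp E Q) st
  | ifz e c d, Q, st => e.Ok E st ∧ (e.val st = 0 → c.wp E Q st) ∧ (e.val st ≠ 0 → d.wp E Q st)
  | loop _ _ _, _, _ => False
  | input x a b, Q, st => a.Ok E st ∧ b.Ok E st ∧ a.val st ≤ b.val st ∧ b.val st < E.inp.length ∧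
      b.val st - a.val st + 1 ≤ E.w ∧
      ofBits ((E.inp.drop (a.val st)).take (b.val st - a.val st + 1)) < E.B ∧
      Q (st.set x (ofBits ((E.inp.drop (a.val st)).take (b.val st - a.val st + 1))))
  | output x e, Q, st => e.Ok E st ∧ e.val st ≤ E.w ∧
      Q { st with out := st.out ++ bits (e.val st) (st.v x) }

end Stmt

namespace Env

variable {E : Env}

theorem Rep.set {mem : ℕ → ℕ} {st : St} (h : E.Rep mem st) {x y : ℕ} (hx : x < 64)
    (hy : y < E.B) : E.Rep (Function.update mem x y) (st.set x y) where
  var z hz := by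
    rw [St.set_v, Function.update_apply]
    split_ifs
    · rfl
    · exact h.var z hz
  base hp a ha := by rw [Function.update_of_ne (by omega), h.base hp a ha]
  arr a ha i hi := by rw [Function.update_of_ne (by omega), h.arr a ha i hi]; rfl
  var_lt z hz := by
    rw [St.set_v]
    split_ifs
    · exact hy
    · exact h.var_lt z hz
  arr_lt := h.arr_lt

theorem Rep.put {mem : ℕ → ℕ} {st : St} (h : E.Rep mem st) {arr i y : ℕ} (ha : arr < 24)
    (hi : i < E.L) (hy : y < E.B) :
    E.Rep (Function.update mem (104 + arr * E.L + i) y) (st.put arr i y) where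
  var z hz := by rw [Function.update_of_ne (by omega), h.var z hz]; rfl
  base hp a ha := by rw [Function.update_of_ne (by omega), h.base hp a ha]
  arr a ha' j hj := by
    rw [St.put_a, Function.update_apply]
    by_cases hab : a = arr
    · subst hab
      rw [if_pos rfl, Function.update_apply]
      by_cases hij : j = i
      · simp [hij]
      · rw [if_neg (by omega), if_neg hij, h.arr a ha' j hj]
    · rw [if_neg hab, if_neg, h.arr a ha' j hj]
      intro he
      apply hab
      have h1 : (a * E.L + j) / E.L = a := by
        rw [mul_comm, Nat.mul_add_div (by omega), Nat.div_eq_of_lt hj]; rfl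
      have h2 : (arr * E.L + i) / E.L = arr := by
        rw [mul_comm, Nat.mul_add_div (by omega), Nat.div_eq_of_lt hi]; rfl
      rw [← h1, ← h2]
      congr 1
      omega
  var_lt := h.var_lt
  arr_lt a ha' j hj := by
    rw [St.put_a]
    split_ifs
    · rw [Function.update_apply]
      split_ifs
      · exact hy
      · exact h.arr_lt _ ha j hj
    · exact h.arr_lt _ ha' j hj

/-- Started at time `s` with the values `st`, the statement `c` takes at most `n` steps, all of
them allowed, and at its end time and for the final values `Q` is true. -/
def wpt (E : Env) (c : Stmt) (n : ℕ) (Q : ℕ → St → Prop) (s : ℕ) (st : St) : Prop :=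
  c.wf = true → ∀ o, E.CodeAt o (c.code o) → E.At s o st →
    ∃ t st', s ≤ t ∧ t ≤ s + n ∧ E.At t (o + c.len) st' ∧ Q t st'

theorem wpt_of_rep {c : Stmt} {n s : ℕ} {Q : ℕ → St → Prop} {st : St}
    (h : E.Rep (E.σ s).mem st → (E.σ s).out = st.out → E.wpt c n Q s st) : E.wpt c n Q s st :=
  fun hw o hc ha => h ha.rep ha.out hw o hc ha

theorem wpt_mono {c : Stmt} {n n' s : ℕ} {Q Q' : ℕ → St → Prop} {st : St}
    (h : E.wpt c n Q s st) (hn : n ≤ n')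
    (hQ : ∀ t st', s ≤ t → E.Rep (E.σ t).mem st' → (E.σ t).out = st'.out → Q t st' → Q' t st') :
    E.wpt c n' Q' s st := by
  intro hw o hc ha
  obtain ⟨t, st', h1, h2, h3, h4⟩ := h hw o hc ha
  exact ⟨t, st', h1, h2.trans (by omega), h3, hQ t st' h1 h3.rep h3.out h4⟩

theorem wpt_seq {c d : Stmt} {n n' k s : ℕ} {Q : ℕ → St → Prop} {st : St}
    (h : E.wpt c n (fun u st' => s ≤ u → E.wpt d n' Q u st') s st) (hk : n + n' ≤ k) :
    E.wpt (c ;; d) k Q s st := by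
  intro hw o hc ha
  simp only [Stmt.wf, Bool.and_eq_true] at hw
  rw [Stmt.code, codeAt_append, Stmt.length_code] at hc
  obtain ⟨t, st', h1, h2, h3, h4⟩ := h hw.1 o hc.1 ha
  obtain ⟨u, st'', k1, k2, k3, k4⟩ := h4 h1 hw.2 _ hc.2 h3
  exact ⟨u, st'', h1.trans k1, by omega, by rwa [Stmt.len, ← add_assoc], k4⟩

theorem wpt_ifz (hE : E.Good) {e : Exp} {c d : Stmt} {n s : ℕ} {Q : ℕ → St → Prop} {st : St}
    (ho : e.Ok E st) (hc : e.val st = 0 → ∀ u ≥ s, E.wpt c n Q u st)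
    (hd : e.val st ≠ 0 → ∀ u ≥ s, E.wpt d n (fun t st' => ∀ t' ≥ t, Q t' st') u st) :
    E.wpt (.ifz e c d) (n + (e.code 0).length + 2) Q s st := by
  intro hw o hcode ha
  simp only [Stmt.wf, Bool.and_eq_true] at hw
  rw [Stmt.code, codeAt_append, codeAt_append, codeAt_append, codeAt_append,
    Stmt.length_code] at hcode
  obtain ⟨h1, h2, h3, h4, h5⟩ := hcode
  obtain ⟨a1, a2, -⟩ := e.run_code hE hw.1.1 ho h1 ha
  have b1 := a1.jump (codeAt_cons.1 h2).1
  by_cases h0 : e.val st = 0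
  · rw [if_pos (by rw [a2]; exact h0)] at b1
    obtain ⟨t, st', k1, k2, k3, k4⟩ := hc h0 _ (by omega) hw.1.2 _ (by simpa using h5) b1
    refine ⟨t, st', by omega, by omega, ?_, k4⟩
    convert k3 using 1
    simp only [Stmt.len]; omega
  · rw [if_neg (by rw [a2]; exact h0)] at b1
    obtain ⟨t, st', k1, k2, k3, k4⟩ := hd h0 _ (by omega) hw.2 _ (by simpa using h3) b1
    have f1 := k3.jump (codeAt_cons.1 h4).1
    rw [if_pos rfl] at f1
    refine ⟨t + 1, st', by omega, by omega, ?_, k4 _ (by omega)⟩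
    convert f1 using 1
    simp only [Stmt.len]; omega

theorem wpt_set (hE : E.Good) {x : ℕ} {e : Exp} {s : ℕ} {Q : ℕ → St → Prop} {st : St}
    (ho : e.Ok E st) (hB : e.val st < E.B)
    (hQ : ∀ t ≥ s, Q t (st.set x (e.val st))) :
    E.wpt (.set x e) ((e.code 0).length + 1) Q s st := by
  intro hw o hc ha
  simp only [Stmt.wf, Bool.and_eq_true, decide_eq_true_eq] at hw
  rw [Stmt.code, codeAt_append, codeAt_cons] at hc
  obtain ⟨a1, a2, -⟩ := e.run_code hE hw.2 ho hc.1 ha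
  obtain ⟨b1, -⟩ := a1.assign (st' := st.set x (e.val st)) hc.2.1 (y := e.val st)
    (by rw [a2]; rfl) (Exp.Env.Good.lt_of_le hE hB.le) rfl (a1.rep.set hw.1 hB)
  exact ⟨_, _, by omega, by omega, b1, hQ _ (by omega)⟩

/-- A multiplication of two variables is done by a single multiplication instruction. -/
theorem wpt_set_mul (hE : E.Good) {x y z : ℕ} {s : ℕ} {Q : ℕ → St → Prop} {st : St}
    (hB : st.v y * st.v z < E.B)
    (hQ : ∀ t ≥ s, ExecutesMul E.prog (E.σ s) (st.v y) (st.v z) →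
      Q t (st.set x (st.v y * st.v z))) :
    E.wpt (.set x (.var y * .var z)) 2 Q s st := by
  intro hw o hc ha
  change E.CodeAt o ((Stmt.set x (.mul (.var y) (.var z))).code o) at hc
  refine wpt_set hE (e := .mul (.var y) (.var z)) (by exact ⟨trivial, trivial⟩) hB
    (fun t ht => ?_) hw o hc ha
  refine hQ t ht ?_
  simp only [Stmt.wf, Bool.and_eq_true, decide_eq_true_eq] at hw
  have h1 : (y < 64 ∧ z < 64) := by
    have := hw.2
    change (Exp.mul (.var y) (.var z)).wf 0 = true at this
    simp only [Exp.wf, Bool.and_eq_true, decide_eq_true_eq] at this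
    exact this.1.1
  refine ⟨.reg 64, .reg y, .reg z, ?_, ha.rep.var y h1.1, ha.rep.var z h1.2⟩
  rw [ha.pc]
  exact (codeAt_cons.1 hc).1

theorem wpt_of_wp (hE : E.Good) : ∀ (c : Stmt) {s : ℕ} {Q : St → Prop} {st : St},
    c.wp E Q st → E.wpt c c.len (fun _ => Q) s st
  | .skip, s, Q, st, h => fun _ o _ ha => ⟨s, st, le_rfl, by omega, ha, h⟩
  | .set x e, s, Q, st, h => wpt_set hE h.1 h.2.1 fun _ _ => h.2.2
  | .store arr i e, s, Q, st, h => by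
      intro hw o hc ha
      obtain ⟨hi, he, hi', hB, hQ⟩ := h
      simp only [Stmt.wf, Bool.and_eq_true, decide_eq_true_eq] at hw
      rw [Stmt.code, codeAt_append, codeAt_append, codeAt_cons, codeAt_cons] at hc
      obtain ⟨a1, a2, -⟩ := i.run_code hE hw.1.2 hi hc.1 ha
      obtain ⟨b1, b2, b3⟩ := e.run_code hE hw.2 he hc.2.1 a1
      have e1 := i.arg_eval_congr hw.1.2 a1.rep b1.rep (b3 0 (by omega))
      have hiL := lt_of_lt_of_le hi' hE.acc_le
      have hle : 104 + arr * E.L + i.val st ≤ E.B := by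
        have : arr * E.L ≤ 23 * E.L := Nat.mul_le_mul_right _ (by omega)
        have := hE.L_le
        omega
      obtain ⟨c1, c2⟩ := b1.assign_temp hc.2.2.1 (y := 104 + arr * E.L + i.val st)
        (by
          rw [e1, a2]
          simp only [Op.eval, Arg.eval]
          rw [b1.rep.base (by omega) arr hw.1.1])
        (Exp.Env.Good.lt_of_le hE hle) (by omega) (by omega)
      have e2 := e.arg_eval_congr hw.2 b1.rep c1.rep (by
        rw [c2, Function.update_of_ne (by omega)])
      obtain ⟨d1, -⟩ := c1.assign (st' := st.put arr (i.val st) (e.val st)) hc.2.2.2.1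
        (y := e.val st) (by rw [e2, b2]; rfl) (Exp.Env.Good.lt_of_le hE hB.le) rfl
        (by
          have := c1.rep.put hw.1.1 hiL hB
          simpa only [Dest.addr, c2, Function.update_self] using this)
      rw [show o + (i.code 0).length + (e.code 1).length + 1 + 1 =
        o + (Stmt.store arr i e).len by simp only [Stmt.len]; omega] at d1
      exact ⟨_, _, by omega, by simp only [Stmt.len]; omega, d1, hQ⟩
  | .seq c d, s, Q, st, h => by
      refine wpt_seq (wpt_mono (wpt_of_wp hE c h) le_rfl fun t st' _ _ _ hq _ => ?_) le_rfl
      exact wpt_of_wp hE d hq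
  | .ifz e c d, s, Q, st, h => by
      refine wpt_mono (wpt_ifz hE (n := c.len + d.len) h.1 (fun h0 u _ => ?_) (fun h0 u _ => ?_))
        (by simp only [Stmt.len]; omega) (fun _ _ _ _ _ hq => hq)
      · exact wpt_mono (wpt_of_wp hE c (h.2.1 h0)) (by omega) (fun _ _ _ _ _ hq => hq)
      · exact wpt_mono (wpt_of_wp hE d (h.2.2 h0)) (by omega) (fun _ _ _ _ _ hq _ _ => hq)
  | .loop _ _ _, s, Q, st, h => h.elim
  | .input x a b, s, Q, st, h => by
      intro hw o hc ha
      obtain ⟨hA, hB, h1, h2, h3, h4, hQ⟩ := h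
      simp only [Stmt.wf, Bool.and_eq_true, decide_eq_true_eq] at hw
      rw [Stmt.code, codeAt_append, codeAt_append, codeAt_cons] at hc
      obtain ⟨a1, a2, -⟩ := a.run_code hE hw.1.2 hA hc.1 ha
      obtain ⟨b1, b2, b3⟩ := b.run_code hE hw.2 hB hc.2.1 a1
      have e1 := a.arg_eval_congr hw.1.2 a1.rep b1.rep (b3 0 (by omega))
      rw [a2] at e1
      obtain ⟨d1, -⟩ := b1.exec (o' := o + (a.code 0).length + (b.code 1).length + 1)
        (mem := Function.update (E.σ (s + (a.code 0).length + (b.code 1).length)).mem x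
          (ofBits ((E.inp.drop (a.val st)).take (b.val st - a.val st + 1))))
        (st' := st.set x (ofBits ((E.inp.drop (a.val st)).take (b.val st - a.val st + 1))))
        hc.2.2.1 (out := st.out) (by
          simp only [Instr.exec, e1, b2, Config.write]
          rw [if_pos ⟨h1, h2, h3⟩, if_pos (Exp.Env.Good.lt_of_le hE h4.le)]
          simp only [b1.out, b1.pc, Dest.addr])
        rfl (b1.rep.set hw.1.1 h4)
      rw [show o + (a.code 0).length + (b.code 1).length + 1 =
        o + (Stmt.input x a b).len by simp only [Stmt.len]; omega] at d1
      exact ⟨_, _, by omega, by simp only [Stmt.len]; omega, d1, hQ⟩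
  | .output x e, s, Q, st, h => by
      intro hw o hc ha
      obtain ⟨he, h1, hQ⟩ := h
      simp only [Stmt.wf, Bool.and_eq_true, decide_eq_true_eq] at hw
      rw [Stmt.code, codeAt_append, codeAt_cons] at hc
      obtain ⟨a1, a2, -⟩ := e.run_code hE hw.2 he hc.1 ha
      obtain ⟨d1, -⟩ := a1.exec (o' := o + (e.code 0).length + 1) (mem := (E.σ (s + (e.code 0).length)).mem)
        (st' := { st with out := st.out ++ bits (e.val st) (st.v x) })
        hc.2.1 (out := st.out ++ bits (e.val st) (st.v x)) (by
          simp only [Instr.exec, a2, if_pos h1]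
          simp only [a1.out, a1.pc, a1.rep.var x hw.1])
        rfl ⟨a1.rep.var, a1.rep.base, a1.rep.arr, a1.rep.var_lt, a1.rep.arr_lt⟩
      exact ⟨_, _, by omega, by simp only [Stmt.len]; omega, d1, hQ⟩

/-- Loops with an invariant that is monotone in time. -/
theorem wpt_loop_sum (hE : E.Good) {x : ℕ} {e : Exp} {c : Stmt} {n s : ℕ} {T : ℕ → ℕ} {Q : ℕ → St → Prop}
    {st : St} (I : ℕ → ℕ → St → Prop) (hn : n < E.B)
    (hI : ∀ i t u st, t ≤ u → I i t st → I i u st) (h0 : I 0 s (st.set x 0))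
    (he : ∀ i ≤ n, ∀ t st, I i t st → st.v x = i → e.Ok E st ∧ e.val st = n)
    (hs : ∀ i < n, ∀ t ≥ s, ∀ st, st.v x = i → I i t st →
      E.wpt c (T i) (fun t' st' => st'.v x = i ∧ I (i + 1) t' (st'.set x (i + 1))) t st)
    (hQ : ∀ t ≥ s, ∀ st, I n t st → st.v x = n → Q t st) :
    E.wpt (.loop x e c) (∑ i ∈ Finset.range n, T i + (n + 1) * ((e.code 0).length + 4)) Q s st := by
  intro hw o hc ha
  simp only [Stmt.wf, Bool.and_eq_true, decide_eq_true_eq] at hw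
  rw [Stmt.code, codeAt_append, codeAt_append, codeAt_append, codeAt_append, codeAt_cons,
    codeAt_cons, codeAt_cons, codeAt_cons, Stmt.length_code] at hc
  obtain ⟨⟨c1, -⟩, c2, ⟨c3, -⟩, c4, c5, c6, -⟩ := hc
  simp only [List.length_singleton] at c2 c3 c4 c5 c6
  have hB := hE.B_ge
  obtain ⟨a1, -⟩ := ha.assign (st' := st.set x 0) c1 (y := 0) rfl
    (Exp.Env.Good.lt_of_le hE (by omega)) rfl (ha.rep.set hw.1.1 (by omega))
  have key : ∀ k i t st, i + k = n → s ≤ t → st.v x = i → I i t st → E.At t (o + 1) st →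
      ∃ t' st', t ≤ t' ∧ t' ≤ t + (∑ j ∈ Finset.Ico i n, T j + k * ((e.code 0).length + 3) + (e.code 0).length + 1) ∧
        E.At t' (o + (Stmt.loop x e c).len) st' ∧ Q t' st' := by
    intro k
    induction k with
    | zero =>
      intro i t st hik hst hx hi hat
      obtain rfl : i = n := by omega
      obtain ⟨ho, hv⟩ := he i le_rfl t st hi hx
      obtain ⟨b1, b2, -⟩ := e.run_code hE hw.1.2 ho c2 hat
      have b3 := b1.jump c3
      rw [b2, hv, if_pos (by simp only [Arg.eval]; rw [b1.rep.var x hw.1.1, hx])] at b3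
      rw [show o + 1 + (e.code 0).length + 1 + c.len + 2 = o + (Stmt.loop x e c).len by
        simp only [Stmt.len]; omega] at b3
      exact ⟨_, st, by omega, by omega, b3, hQ _ (by omega) st (hI _ t _ _ (by omega) hi) hx⟩
    | succ k ih =>
      intro i t st hik hst hx hi hat
      obtain ⟨ho, hv⟩ := he i (by omega) t st hi hx
      obtain ⟨b1, b2, -⟩ := e.run_code hE hw.1.2 ho c2 hat
      have b3 := b1.jump c3
      rw [b2, hv, if_neg (by simp only [Arg.eval]; rw [b1.rep.var x hw.1.1, hx]; omega)] at b3
      obtain ⟨u, st', k1, k2, k3, k4, k5⟩ := hs i (by omega) (t + (e.code 0).length + 1) (by omega)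
        st hx (hI _ t _ _ (by omega) hi) hw.2 _ (by simpa using c4) b3
      obtain ⟨d1, -⟩ := k3.assign (d := .reg x) (st' := st'.set x (i + 1)) (by simpa using c5) (y := i + 1)
        (by simp only [Arg.eval]; rw [k3.rep.var x hw.1.1, k4]; rfl)
        (Exp.Env.Good.lt_of_le hE (by omega)) rfl (k3.rep.set hw.1.1 (by omega))
      have d2 := d1.jump (by simpa using c6)
      rw [if_pos rfl] at d2
      obtain ⟨t', st'', m1, m2, m3, m4⟩ := ih (i + 1) _ _ (by omega) (by omega) (by simp)
        (hI _ u _ _ (by omega) k5) d2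
      refine ⟨t', st'', by omega, ?_, m3, m4⟩
      rw [Finset.sum_eq_sum_Ico_succ_bot (show i < n by omega), add_mul]
      omega
  obtain ⟨t', st', k1, k2, k3, k4⟩ := key n 0 _ _ (by omega) (by omega) (by simp)
    (hI _ s _ _ (by omega) h0) a1
  refine ⟨t', st', by omega, ?_, k3, k4⟩
  have : (n + 1) * ((e.code 0).length + 4) =
    n * ((e.code 0).length + 3) + n + (e.code 0).length + 4 := by ring
  rw [← Finset.range_eq_Ico] at k2
  omega

theorem wpt_loop (hE : E.Good) {x : ℕ} {e : Exp} {c : Stmt} {n T s : ℕ} {Q : ℕ → St → Prop}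
    {st : St} (I : ℕ → ℕ → St → Prop) (hn : n < E.B)
    (hI : ∀ i t u st, t ≤ u → I i t st → I i u st) (h0 : I 0 s (st.set x 0))
    (he : ∀ i ≤ n, ∀ t st, I i t st → st.v x = i → e.Ok E st ∧ e.val st = n)
    (hs : ∀ i < n, ∀ t ≥ s, ∀ st, st.v x = i → I i t st →
      E.wpt c T (fun t' st' => st'.v x = i ∧ I (i + 1) t' (st'.set x (i + 1))) t st)
    (hQ : ∀ t ≥ s, ∀ st, I n t st → st.v x = n → Q t st) :
    E.wpt (.loop x e c) ((n + 1) * (T + (e.code 0).length + 4)) Q s st := by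
  refine wpt_mono (wpt_loop_sum hE I hn hI h0 he hs hQ) ?_ fun _ _ _ _ _ h => h
  rw [Finset.sum_const, Finset.card_range, smul_eq_mul, add_assoc, mul_add (n + 1) T]
  have : n * T ≤ (n + 1) * T := Nat.mul_le_mul_right _ (by omega)
  omega

/-- Loops with an invariant that does not depend on time. -/
theorem wpt_loop' (hE : E.Good) {x : ℕ} {e : Exp} {c : Stmt} {n T k s : ℕ} {Q : ℕ → St → Prop}
    {st : St} (I : ℕ → St → Prop) (hn : n < E.B) (h0 : I 0 (st.set x 0))
    (he : ∀ i ≤ n, ∀ st, I i st → st.v x = i → e.Ok E st ∧ e.val st = n)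
    (hs : ∀ i < n, ∀ t ≥ s, ∀ st, st.v x = i → I i st →
      E.wpt c T (fun _ st' => st'.v x = i ∧ I (i + 1) (st'.set x (i + 1))) t st)
    (hk : (n + 1) * (T + (e.code 0).length + 4) ≤ k)
    (hQ : ∀ t ≥ s, ∀ st, I n st → st.v x = n → Q t st) :
    E.wpt (.loop x e c) k Q s st :=
  wpt_mono (wpt_loop hE (fun i _ st => I i st) hn (fun _ _ _ _ _ h => h) h0
    (fun i hi _ st => he i hi st) hs hQ) hk fun _ _ _ _ _ h => h

end Env

end LogRAM

namespace FR

/-! ## Correctness of the fast Fourier transform -/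

theorem bitRev_lt : ∀ k p, bitRev k p < 2 ^ k
  | 0, _ => by simp [bitRev]
  | k + 1, p => by
      have h := bitRev_lt k (p / 2)
      have h' : 2 ^ k * (p % 2) ≤ 2 ^ k * 1 := Nat.mul_le_mul_left _ (by omega)
      rw [bitRev, pow_succ]
      omega

theorem bitRev_two_mul_add (k b : ℕ) {c : ℕ} (hc : c < 2) :
    bitRev (k + 1) (2 * b + c) = 2 ^ k * c + bitRev k b := by
  rw [bitRev, show (2 * b + c) % 2 = c by omega, show (2 * b + c) / 2 = b by omega]

theorem bitRev_mod : ∀ k p, bitRev k (p % 2 ^ k) = bitRev k p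
  | 0, _ => rfl
  | k + 1, p => by
      rw [bitRev, bitRev, pow_succ', Nat.mod_mul_right_mod, Nat.mod_mul_right_div_self, bitRev_mod k]

theorem bitRev_top : ∀ (k a : ℕ) {r : ℕ}, a < 2 → r < 2 ^ k →
    bitRev (k + 1) (2 ^ k * a + r) = 2 * bitRev k r + a
  | 0, a, r, ha, hr => by
      obtain rfl : r = 0 := by simpa using hr
      simp [bitRev, Nat.mod_eq_of_lt ha]
  | k + 1, a, r, ha, hr => by
      have h := bitRev_top k a (r := r / 2) ha (by rw [pow_succ] at hr; omega)
      rw [show 2 ^ (k + 1) * a + r = 2 * (2 ^ k * a + r / 2) + r % 2 by rw [pow_succ]; grind,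
        bitRev_two_mul_add _ _ (by omega), h]
      conv_rhs => rw [bitRev]
      ring

theorem bitRev_bitRev : ∀ (k : ℕ) {p : ℕ}, p < 2 ^ k → bitRev k (bitRev k p) = p
  | 0, p, h => by simp [bitRev] at h ⊢; omega
  | k + 1, p, h => by
      conv_lhs => arg 2; rw [bitRev]
      rw [bitRev_top k _ (by omega) (bitRev_lt _ _), bitRev_bitRev k (by rw [pow_succ] at h; omega)]
      omega

section

variable {A : Type*} [CommRing A]

/-- Part of the discrete Fourier transform that has been computed after `l` levels. -/
def dftPart (Ω : A) (f : ℕ → A) (l e b x : ℕ) : A :=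
  ∑ s ∈ Finset.range (2 ^ l), f (x + s * 2 ^ e) * Ω ^ ((x + s * 2 ^ e) * bitRev l b)

theorem sum_range_two_mul (k : ℕ) (h : ℕ → A) :
    ∑ s ∈ Finset.range (2 * k), h s = ∑ s ∈ Finset.range k, (h (2 * s) + h (2 * s + 1)) := by
  induction k with
  | zero => simp
  | succ k ih =>
    rw [show 2 * (k + 1) = 2 * k + 1 + 1 by ring, Finset.sum_range_succ, Finset.sum_range_succ, ih,
      Finset.sum_range_succ]
    ring

theorem dftPart_succ {Ω : A} {l e : ℕ} (hΩ : Ω ^ 2 ^ (l + e) = -1) (f : ℕ → A) (b q : ℕ) {c : ℕ}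
    (hc : c < 2) :
    dftPart Ω f (l + 1) e (2 * b + c) q =
      (dftPart Ω f l (e + 1) b q + (-1) ^ c * dftPart Ω f l (e + 1) b (q + 2 ^ e)) *
        Ω ^ (2 ^ l * c * q) := by
  unfold dftPart
  rw [pow_succ', sum_range_two_mul, bitRev_two_mul_add _ _ hc, Finset.mul_sum,
    ← Finset.sum_add_distrib, Finset.sum_mul]
  refine Finset.sum_congr rfl fun s _ => ?_
  have key : ∀ t, Ω ^ ((q + (2 * s + t) * 2 ^ e) * (2 ^ l * c + bitRev l b)) =
      Ω ^ ((q + t * 2 ^ e + s * 2 ^ (e + 1)) * bitRev l b) * ((-1) ^ c) ^ t * Ω ^ (2 ^ l * c * q) := by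
    intro t
    have h1 : Ω ^ (2 ^ (l + e) * (c * (2 * s))) = 1 := by
      rw [pow_mul, hΩ, mul_comm c, mul_assoc, pow_mul]; simp
    have h2 : Ω ^ (2 ^ (l + e) * (c * t)) = ((-1) ^ c) ^ t := by rw [pow_mul, hΩ, pow_mul]
    rw [show (q + (2 * s + t) * 2 ^ e) * (2 ^ l * c + bitRev l b) =
      (q + t * 2 ^ e + s * 2 ^ (e + 1)) * bitRev l b + 2 ^ (l + e) * (c * t) + 2 ^ l * c * q +
        2 ^ (l + e) * (c * (2 * s)) by rw [pow_add, pow_succ]; ring,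
      pow_add, h1, mul_one, pow_add, pow_add, h2]
  have k0 := key 0
  have k1 := key 1
  simp only [add_zero, zero_mul, pow_zero, mul_one, pow_one, one_mul] at k0 k1
  rw [k0, k1, show q + 2 * s * 2 ^ e = q + s * 2 ^ (e + 1) by rw [pow_succ]; ring,
    show q + (2 * s + 1) * 2 ^ e = q + 2 ^ e + s * 2 ^ (e + 1) by rw [pow_succ]; ring]
  ring

theorem fftState_succ (N J : ℕ) (ω ξ : A) (f : ℕ → A) (l p : ℕ) :
    fftState N J ω ξ f (l + 1) p = if RoundEnds N J l then
        butterfly N J ξ l (fftState N J ω ξ f l) p * ω ^ twiddleExp N J l p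
      else butterfly N J ξ l (fftState N J ω ξ f l) p := rfl

theorem min_two_pow (a b : ℕ) : min (2 ^ a) (2 ^ b) = 2 ^ min a b := by
  rcases le_total a b with h | h
  · rw [min_eq_left h, min_eq_left (Nat.pow_le_pow_right (by norm_num) h)]
  · rw [min_eq_right h, min_eq_right (Nat.pow_le_pow_right (by norm_num) h)]

theorem butterfly_two_pow {lam r i e d : ℕ} (hi : i < lam) (hd : d = min lam (i + 1 + e)) (ξ : A)
    (f : ℕ → A) (p : ℕ) :
    butterfly (2 ^ (lam * r + i + 1 + e)) (2 ^ lam) ξ (lam * r + i) f p =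
      if p % 2 ^ (e + 1) < 2 ^ e then f p + f (p + 2 ^ e)
      else (f (p - 2 ^ e) - f p) *
        ξ ^ (2 ^ (lam - d) * 2 ^ i * ((p % 2 ^ (e + 1) - 2 ^ e) / 2 ^ (i + 1 + e - d))) := by
  have h1 : (lam * r + i) / lam = r := by
    rw [Nat.mul_add_div (by omega), Nat.div_eq_of_lt hi]; rfl
  have h2 : (lam * r + i) % lam = i := by rw [Nat.mul_add_mod, Nat.mod_eq_of_lt hi]
  unfold butterfly
  simp only [Nat.log_pow (by norm_num : 1 < 2), h1, h2, ← pow_mul]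
  rw [Nat.pow_div (by omega) (by norm_num), Nat.pow_div (by omega) (by norm_num), min_two_pow,
    show lam * r + i + 1 + e - lam * r = i + 1 + e by omega,
    show lam * r + i + 1 + e - (lam * r + i) = e + 1 by omega, ← hd,
    Nat.pow_div (by omega) (by norm_num), Nat.pow_div (by omega) (by norm_num),
    show 2 ^ (e + 1) / 2 = 2 ^ e by rw [pow_succ]; omega]

theorem butterfly_dftPart {lam r i e d : ℕ} (hi : i < lam) (hd : d = min lam (i + 1 + e))
    {Ω ξ : A} (hΩ : Ω ^ 2 ^ (lam * r + i + e) = -1)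
    (hξ : ξ ^ 2 ^ (lam - d) = Ω ^ 2 ^ (lam * r + i + 1 + e - d)) (f F : ℕ → A)
    (hF : ∀ p < 2 ^ (lam * r + i + 1 + e),
      F p * Ω ^ (2 ^ (lam * r) * (p % 2 ^ (i + 1 + e - d)) * bitRev i (p / 2 ^ (e + 1) % 2 ^ i)) =
        dftPart Ω f (lam * r + i) (e + 1) (p / 2 ^ (e + 1)) (p % 2 ^ (e + 1)))
    {p : ℕ} (hp : p < 2 ^ (lam * r + i + 1 + e)) :
    butterfly (2 ^ (lam * r + i + 1 + e)) (2 ^ lam) ξ (lam * r + i) F p *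
      Ω ^ (2 ^ (lam * r) * (p % 2 ^ (i + 1 + e - d)) * bitRev (i + 1) (p / 2 ^ e % 2 ^ (i + 1))) =
        dftPart Ω f (lam * r + i + 1) e (p / 2 ^ e) (p % 2 ^ e) := by
  rw [butterfly_two_pow hi hd]
  set g := i + 1 + e - d with hg
  have hge : g ≤ e := by omega
  obtain ⟨b, c, hc, hbc⟩ : ∃ b c, c < 2 ∧ p / 2 ^ e = 2 * b + c :=
    ⟨p / 2 ^ e / 2, p / 2 ^ e % 2, by omega, by omega⟩
  set q := p % 2 ^ e with hq
  have hqe : q < 2 ^ e := Nat.mod_lt _ (by positivity)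
  have hpe : p = 2 ^ e * (2 * b + c) + q := by rw [← hbc, hq, Nat.div_add_mod]
  have e0 : 0 < 2 ^ e := by positivity
  have hpow : 2 ^ (e + 1) = 2 * 2 ^ e := by rw [pow_succ]; ring
  have hdiv : ∀ c' < 2, (2 ^ e * (2 * b + c') + q) / 2 ^ (e + 1) = b := by
    intro c' hc'
    rw [pow_succ, ← Nat.div_div_eq_div_mul, Nat.mul_add_div e0, Nat.div_eq_of_lt hqe]
    omega
  have hmod : ∀ c' < 2, (2 ^ e * (2 * b + c') + q) % 2 ^ (e + 1) = q + c' * 2 ^ e := by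
    intro c' hc'
    rw [show 2 ^ e * (2 * b + c') + q = q + c' * 2 ^ e + 2 ^ (e + 1) * b by rw [hpow]; ring,
      Nat.add_mul_mod_self_left, Nat.mod_eq_of_lt]
    have : c' * 2 ^ e ≤ 1 * 2 ^ e := Nat.mul_le_mul_right _ (by omega)
    omega
  have hmodg : ∀ c', (2 ^ e * (2 * b + c') + q) % 2 ^ g = q % 2 ^ g := by
    intro c'
    rw [← Nat.add_sub_cancel' hge, pow_add, mul_assoc, Nat.mul_add_mod]
  have hrev : bitRev (i + 1) (p / 2 ^ e % 2 ^ (i + 1)) = 2 ^ i * c + bitRev i (b % 2 ^ i) := by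
    rw [bitRev_mod, hbc, bitRev_two_mul_add _ _ hc, bitRev_mod]
  have hlt : ∀ c' < 2, 2 ^ e * (2 * b + c') + q < 2 ^ (lam * r + i + 1 + e) := by
    intro c' hc'
    have h1 : 2 ^ e * (2 * b) < 2 ^ e * 2 ^ (lam * r + i + 1) := by
      rw [← pow_add, add_comm e]
      have := Nat.le_add_right (2 ^ e * (2 * b)) (2 ^ e * c + q)
      rw [hpe, mul_add] at hp
      omega
    have h2 := Nat.lt_of_mul_lt_mul_left h1
    have h3 : 2 * b + c' + 1 ≤ 2 ^ (lam * r + i + 1) := by rw [pow_succ] at h2 ⊢; omega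
    have h4 := Nat.mul_le_mul_left (2 ^ e) h3
    rw [← pow_add, mul_add (2 ^ e) _ 1, add_comm e] at h4
    omega
  have H0 := hF _ (hlt 0 (by norm_num))
  have H1 := hF _ (hlt 1 (by norm_num))
  rw [hdiv 0 (by norm_num), hmod 0 (by norm_num), hmodg] at H0
  rw [hdiv 1 (by norm_num), hmod 1 (by norm_num), hmodg] at H1
  rw [hrev, hbc, dftPart_succ hΩ f b q hc]
  have hp1 : p % 2 ^ (e + 1) = q + c * 2 ^ e := by rw [hpe]; exact hmod c hc
  have hp2 : p % 2 ^ g = q % 2 ^ g := by rw [hpe]; exact hmodg c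
  rw [hp1, hp2]
  simp only [zero_mul, add_zero, one_mul] at H0 H1
  rw [← H0, ← H1]
  interval_cases c
  · rw [if_pos (by omega)]
    simp only [add_zero] at hpe
    rw [← hpe, show p + 2 ^ e = 2 ^ e * (2 * b + 1) + q by rw [hpe]; ring]
    simp
    ring
  · rw [if_neg (by omega)]
    rw [← hpe, show p - 2 ^ e = 2 ^ e * (2 * b) + q by rw [hpe, mul_add]; omega]
    rw [mul_assoc (2 ^ (lam - d)), pow_mul, hξ, ← pow_mul]
    rw [show q + 1 * 2 ^ e - 2 ^ e = q by omega]
    have hexp : 2 ^ (lam * r + i) * 1 * q = 2 ^ (lam * r + i + 1 + e - d) * (2 ^ i * (q / 2 ^ g)) +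
        2 ^ (lam * r) * (q % 2 ^ g) * (2 ^ i) := by
      conv_lhs => rw [← Nat.div_add_mod q (2 ^ g)]
      rw [show lam * r + i + 1 + e - d = lam * r + g by omega, pow_add, pow_add]
      ring
    rw [hexp, mul_one, mul_add, pow_add, pow_add]
    ring

/-- The exponent of the factor that is still missing after `l` levels. -/
def deferredExp (n lam l p : ℕ) : ℕ :=
  2 ^ (lam * (l / lam)) *
    (p % 2 ^ (n - lam * (l / lam) - min lam (n - lam * (l / lam)))) *
      bitRev (l % lam) (p / 2 ^ (n - l) % 2 ^ (l % lam))

theorem fftState_mul_deferred {n lam : ℕ} (hlam : 1 ≤ lam) {Ω ω ξ : A}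
    (hΩ : 1 ≤ n → Ω ^ 2 ^ (n - 1) = -1)
    (hξ : ∀ r, lam * r < n →
      ξ ^ 2 ^ (lam - min lam (n - lam * r)) = Ω ^ 2 ^ (n - min lam (n - lam * r)))
    (hω : lam < n → ω = Ω) (f : ℕ → A) : ∀ l ≤ n, ∀ p < 2 ^ n,
    fftState (2 ^ n) (2 ^ lam) ω ξ f l p * Ω ^ deferredExp n lam l p =
      dftPart Ω f l (n - l) (p / 2 ^ (n - l)) (p % 2 ^ (n - l)) := by
  intro l
  induction l with
  | zero =>
    intro _ p hp
    simp [fftState, deferredExp, dftPart, bitRev, Nat.mod_eq_of_lt hp]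
  | succ l ih =>
    intro hl p hp
    obtain ⟨r, i, hi, hli⟩ : ∃ r i, i < lam ∧ l = lam * r + i :=
      ⟨l / lam, l % lam, Nat.mod_lt _ (by omega), (Nat.div_add_mod _ _).symm⟩
    obtain ⟨e, he⟩ : ∃ e, n = lam * r + i + 1 + e := ⟨n - (l + 1), by omega⟩
    have hdiv : l / lam = r := by
      rw [hli, Nat.mul_add_div (by omega), Nat.div_eq_of_lt hi]; rfl
    have hmod : l % lam = i := by rw [hli, Nat.mul_add_mod, Nat.mod_eq_of_lt hi]
    have hmin : n - lam * r = i + 1 + e := by omega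
    have hb := butterfly_dftPart (r := r) hi (d := min lam (i + 1 + e)) rfl (Ω := Ω) (ξ := ξ)
      (by rw [← hΩ (by omega)]; congr 2; omega)
      (by rw [← hmin, hξ r (by omega), hmin, he]) f (fftState (2 ^ n) (2 ^ lam) ω ξ f l) (by
        intro p hp
        have := ih (by omega) p (by rwa [he])
        unfold deferredExp at this
        rw [hdiv, hmod, hmin, show n - l = e + 1 by omega, ← hli] at *
        exact this) (p := p) (by rwa [← he])
    rw [← he, ← hli] at hb
    rw [show n - (l + 1) = e by omega, ← hb]
    by_cases hil : i + 1 < lam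
    · have hdiv' : (l + 1) / lam = r := by
        rw [hli, add_assoc, Nat.mul_add_div (by omega), Nat.div_eq_of_lt hil]; rfl
      have hmod' : (l + 1) % lam = i + 1 := by
        rw [hli, add_assoc, Nat.mul_add_mod, Nat.mod_eq_of_lt hil]
      rw [fftState_succ, if_neg, deferredExp, hdiv', hmod', hmin, show n - (l + 1) = e by omega]
      rintro ⟨h, -⟩
      rw [Nat.log_pow (by norm_num), hmod'] at h
      omega
    · obtain rfl : lam = i + 1 := by omega
      have hl' : l + 1 = (i + 1) * (r + 1) := by rw [hli]; ring
      have hdiv' : (l + 1) / (i + 1) = r + 1 := by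
        rw [hl', Nat.mul_div_cancel_left _ (by omega)]
      have hmod' : (l + 1) % (i + 1) = 0 := by rw [hl', Nat.mul_mod_right]
      rw [deferredExp, hdiv', hmod', bitRev, mul_zero, pow_zero, mul_one, fftState_succ]
      by_cases hR : RoundEnds (2 ^ n) (2 ^ (i + 1)) l
      · have hn : i + 1 < n := by
          have h := hR.2
          rw [Nat.log_pow (by norm_num), hdiv', ← pow_mul,
            Nat.pow_lt_pow_iff_right (by norm_num)] at h
          nlinarith
        have h0 : 0 < e := by
          have h := hR.2
          rw [Nat.log_pow (by norm_num), hdiv', ← pow_mul,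
            Nat.pow_lt_pow_iff_right (by norm_num)] at h
          omega
        rw [if_pos hR, hω hn, twiddleExp]
        simp only [Nat.log_pow (by norm_num : 1 < 2), hdiv, hdiv', ← pow_mul]
        rw [Nat.pow_div (by omega) (by norm_num), show n - (i + 1) * (r + 1) = e by omega,
          min_eq_left (by omega), show i + 1 + e - (i + 1) = e by omega]
      · rw [if_neg hR]
        have h0 : e = 0 := by
          by_contra h0
          apply hR
          refine ⟨by rw [Nat.log_pow (by norm_num), hmod'], ?_⟩
          rw [Nat.log_pow (by norm_num), hdiv', ← pow_mul]
          exact Nat.pow_lt_pow_right (by norm_num) (by omega)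
        subst h0
        simp [Nat.mod_one]

/-- The algorithm computes the discrete Fourier transform. -/
theorem fft_eq_sum {n lam : ℕ} (hlam : 1 ≤ lam) {Ω ω ξ : A}
    (hΩ : 1 ≤ n → Ω ^ 2 ^ (n - 1) = -1)
    (hξ : ∀ r, lam * r < n →
      ξ ^ 2 ^ (lam - min lam (n - lam * r)) = Ω ^ 2 ^ (n - min lam (n - lam * r)))
    (hω : lam < n → ω = Ω) (f : ℕ → A) {p : ℕ} (hp : p < 2 ^ n) :
    fft (2 ^ n) (2 ^ lam) ω ξ f p = ∑ q ∈ Finset.range (2 ^ n), f q * Ω ^ (q * p) := by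
  have h := fftState_mul_deferred hlam hΩ hξ hω f n le_rfl (bitRev n p) (bitRev_lt n p)
  have h0 : deferredExp n lam n (bitRev n p) = 0 := by
    unfold deferredExp
    have hm := Nat.mod_lt n (show 0 < lam by omega)
    have hd := Nat.div_add_mod n lam
    rw [min_eq_right (by omega), show n - lam * (n / lam) - (n - lam * (n / lam)) = 0 by omega]
    simp [Nat.mod_one]
  rw [h0, pow_zero, mul_one] at h
  rw [fft, Nat.log_pow (by norm_num), h, dftPart]
  simp [Nat.mod_one, bitRev_bitRev n hp]

/-- The sum of the powers of a root of unity of order `2 ^ n`. -/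
theorem sum_pow_eq_zero {n : ℕ} {Ω : A} (hΩ : 1 ≤ n → Ω ^ 2 ^ (n - 1) = -1) {d : ℕ}
    (hd : ¬ 2 ^ n ∣ d) : ∑ k ∈ Finset.range (2 ^ n), Ω ^ (k * d) = 0 := by
  induction n generalizing Ω d with
  | zero => simp at hd
  | succ n ih =>
    have h1 := hΩ (by omega)
    simp only [Nat.add_sub_cancel] at h1
    rw [pow_succ, mul_comm, two_mul, Finset.sum_range_add]
    rcases Nat.even_or_odd d with ⟨d', rfl⟩ | ho
    · have hdvd : ¬ 2 ^ n ∣ d' := fun h => hd (by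
        rw [pow_succ, ← two_mul, mul_comm]; exact Nat.mul_dvd_mul_left _ h)
      have h2 := ih (Ω := Ω ^ 2) (d := d') (fun hn => by
        rw [← pow_mul, ← pow_succ', Nat.sub_add_cancel hn, h1]) hdvd
      have h3 : ∀ k, Ω ^ ((2 ^ n + k) * (d' + d')) = Ω ^ (k * (d' + d')) := by
        intro k
        rw [show (2 ^ n + k) * (d' + d') = 2 ^ n * (2 * d') + k * (d' + d') by ring, pow_add,
          pow_mul, h1, pow_mul]
        simp
      have h4 : ∀ k, Ω ^ (k * (d' + d')) = (Ω ^ 2) ^ (k * d') := by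
        intro k; rw [← pow_mul]; congr 1; ring
      simp only [h3, h4, h2, add_zero]
    · rw [← Finset.sum_add_distrib]
      refine Finset.sum_eq_zero fun k _ => ?_
      rw [add_mul, pow_add, pow_mul Ω (2 ^ n), h1, ho.neg_one_pow]
      ring

theorem sum_pow_of_dvd {N : ℕ} {Ω : A} (hΩ : Ω ^ N = 1) {d : ℕ} (hd : N ∣ d) :
    ∑ k ∈ Finset.range N, Ω ^ (k * d) = N := by
  obtain ⟨c, rfl⟩ := hd
  have : ∀ k, Ω ^ (k * (N * c)) = 1 := fun k => by
    rw [show k * (N * c) = N * (k * c) by ring, pow_mul, hΩ, one_pow]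
  simp [this]

end

end FR

namespace FR

open Polynomial

/-! ## Negacyclic convolution -/

section

variable {A : Type*} [CommRing A]

theorem sum_odd_pow {k : ℕ} {θ : A} (hθ : θ ^ 2 ^ k = -1) (d : ℕ) :
    ∑ j ∈ Finset.range (2 ^ k), θ ^ ((2 * j + 1) * d) =
      if 2 ^ k ∣ d then θ ^ d * (2 ^ k : ℕ) else 0 := by
  have h : ∀ j, θ ^ ((2 * j + 1) * d) = θ ^ d * (θ ^ 2) ^ (j * d) := fun j => by
    rw [← pow_mul, ← pow_add]; congr 1; ring
  simp only [h, ← Finset.mul_sum]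
  split_ifs with hd
  · rw [sum_pow_of_dvd _ hd]
    rw [← pow_mul, mul_comm, pow_mul, hθ]; simp
  · rw [sum_pow_eq_zero _ hd, mul_zero]
    intro hk
    rw [← pow_mul, ← pow_succ', Nat.sub_add_cancel hk, hθ]

/-- The sign with which the product of coefficients `a` and `b` contributes to coefficient `j`. -/
def negSign (A : Type*) [CommRing A] (P a b j : ℕ) : A :=
  if a + b = j then 1 else if a + b = j + P then -1 else 0

/-- The product of two polynomials modulo `x ^ P + 1`. -/
def negconv (P : ℕ) (c d : ℕ → A) (j : ℕ) : A :=
  ∑ a ∈ Finset.range P, ∑ b ∈ Finset.range P, c a * d b * negSign A P a b j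

theorem sum_negSign {P a b : ℕ} (ha : a < P) (hb : b < P) {y : A} (hy : y ^ P = -1) :
    ∑ j ∈ Finset.range P, negSign A P a b j * y ^ j = y ^ (a + b) := by
  by_cases h : a + b < P
  · rw [Finset.sum_eq_single (a + b)]
    · simp [negSign]
    · intro j hj hne
      rw [Finset.mem_range] at hj
      rw [negSign, if_neg (Ne.symm hne), if_neg (by omega), zero_mul]
    · simp [h]
  · rw [Finset.sum_eq_single (a + b - P)]
    · rw [negSign, if_neg (by omega), if_pos (by omega)]
      conv_rhs => rw [show a + b = P + (a + b - P) by omega, pow_add, hy]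
    · intro j hj hne
      rw [Finset.mem_range] at hj
      rw [negSign, if_neg (by omega), if_neg (by omega), zero_mul]
    · intro h'
      exact absurd (Finset.mem_range.2 (by omega)) h'

theorem sum_mul_sum_eq_negconv {P : ℕ} (c d : ℕ → A) {y : A} (hy : y ^ P = -1) :
    (∑ a ∈ Finset.range P, c a * y ^ a) * (∑ b ∈ Finset.range P, d b * y ^ b) =
      ∑ j ∈ Finset.range P, negconv P c d j * y ^ j := by
  simp only [negconv, Finset.sum_mul]
  rw [Finset.sum_comm]
  refine Finset.sum_congr rfl fun a ha => ?_
  rw [Finset.mul_sum, Finset.sum_comm]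
  refine Finset.sum_congr rfl fun b hb => ?_
  simp only [mul_assoc (c a * d b), ← Finset.mul_sum]
  rw [sum_negSign (Finset.mem_range.1 ha) (Finset.mem_range.1 hb) hy, pow_add]
  ring

/-- Interpolation at the roots of `x ^ P + 1`. -/
theorem sum_eval_mul_pow {k : ℕ} {θ : A} (hθ : θ ^ 2 ^ k = -1) (c : ℕ → A) {j : ℕ}
    (hj : j < 2 ^ k) :
    ∑ i ∈ Finset.range (2 ^ k), (∑ a ∈ Finset.range (2 ^ k), c a * (θ ^ (2 * i + 1)) ^ a) *
      θ ^ ((2 * i + 1) * (2 * 2 ^ k - j)) = (2 ^ k : ℕ) * c j := by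
  simp only [Finset.sum_mul]
  rw [Finset.sum_comm]
  have h : ∀ a i, c a * (θ ^ (2 * i + 1)) ^ a * θ ^ ((2 * i + 1) * (2 * 2 ^ k - j)) =
      c a * θ ^ ((2 * i + 1) * (a + (2 * 2 ^ k - j))) := fun a i => by
    rw [mul_assoc, ← pow_mul, ← pow_add, ← mul_add]
  simp only [h, ← Finset.mul_sum]
  rw [Finset.sum_eq_single j]
  · rw [sum_odd_pow hθ, if_pos, Nat.add_sub_cancel' (by omega), mul_comm 2, pow_mul, hθ]
    · simp [mul_comm]
    · exact ⟨2, by omega⟩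
  · intro a ha hne
    rw [Finset.mem_range] at ha
    rw [sum_odd_pow hθ, if_neg, mul_zero]
    rintro ⟨q, hq⟩
    have h1 : 1 < q := by
      by_contra h1
      have : 2 ^ k * q ≤ 2 ^ k * 1 := Nat.mul_le_mul_left _ (by omega)
      omega
    have h2 : q < 3 := by
      by_contra h2
      have : 2 ^ k * 3 ≤ 2 ^ k * q := Nat.mul_le_mul_left _ (by omega)
      omega
    obtain rfl : q = 2 := by omega
    omega
  · intro h'
    exact absurd (Finset.mem_range.2 hj) h'

theorem map_negconv {A' : Type*} [CommRing A'] (φ : A →+* A') (P : ℕ) (c d : ℕ → A) (j : ℕ) :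
    φ (negconv P c d j) = negconv P (fun a => φ (c a)) (fun a => φ (d a)) j := by
  have : ∀ a b, φ (negSign A P a b j) = negSign A' P a b j := fun a b => by
    unfold negSign; split_ifs <;> simp
  simp [negconv, map_sum, this]

theorem negconv_congr {P : ℕ} {c c' d d' : ℕ → A} (hc : ∀ a < P, c a = c' a)
    (hd : ∀ a < P, d a = d' a) (j : ℕ) : negconv P c d j = negconv P c' d' j := by
  refine Finset.sum_congr rfl fun a ha => Finset.sum_congr rfl fun b hb => ?_
  rw [hc a (Finset.mem_range.1 ha), hd b (Finset.mem_range.1 hb)]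

end

theorem abs_negconv_le {P : ℕ} {c d : ℕ → ℤ} {X : ℤ} (hc : ∀ a < P, |c a| ≤ X)
    (hd : ∀ a < P, |d a| ≤ X) (j : ℕ) : |negconv P c d j| ≤ P * P * X ^ 2 := by
  refine (Finset.abs_sum_le_sum_abs _ _).trans ?_
  calc ∑ a ∈ Finset.range P, |∑ b ∈ Finset.range P, c a * d b * negSign ℤ P a b j|
      ≤ ∑ a ∈ Finset.range P, ∑ b ∈ Finset.range P, X ^ 2 := by
        refine Finset.sum_le_sum fun a ha => (Finset.abs_sum_le_sum_abs _ _).trans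
          (Finset.sum_le_sum fun b hb => ?_)
        have h1 := hc a (Finset.mem_range.1 ha)
        have h2 := hd b (Finset.mem_range.1 hb)
        have h3 : |negSign ℤ P a b j| ≤ 1 := by unfold negSign; split_ifs <;> simp
        rw [abs_mul, abs_mul]
        calc |c a| * |d b| * |negSign ℤ P a b j| ≤ X * X * 1 := by
              have := abs_nonneg (c a)
              gcongr
              · exact mul_nonneg (this.trans h1) (this.trans h1)
              · exact this.trans h1
          _ = X ^ 2 := by ring
    _ = P * P * X ^ 2 := by simp; ring

/-! ## Multiplication in the ring by FFTs modulo `2 ^ K + 1` -/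

namespace Params

variable {p : Params} {k : ℕ}

theorem theta_pow (hP : p.P = 2 ^ k) (hK : p.P ∣ p.K) : p.theta ^ 2 ^ k = -1 := by
  rw [theta, ← pow_mul, ← hP, Nat.div_mul_cancel hK]
  have : ((2 ^ p.K + 1 : ℕ) : p.Res) = 0 := ZMod.natCast_self _
  push_cast at this
  exact eq_neg_of_add_eq_zero_left this

theorem fft_inner (hP : p.P = 2 ^ k) {ξ : p.Res} (hξ : ξ ^ 2 ^ k = -1) (g : ℕ → p.Res) {i : ℕ}
    (hi : i < p.P) :
    fft p.P (2 * p.P) 1 ξ g i = ∑ a ∈ Finset.range p.P, g a * (ξ ^ 2) ^ (a * i) := by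
  rw [hP, ← pow_succ']
  rw [hP] at hi
  refine fft_eq_sum (by omega) (fun h => ?_) (fun r hr => ?_) (fun h => by omega) g hi
  · rw [← pow_mul, ← pow_succ', Nat.sub_add_cancel h, hξ]
  · obtain rfl : r = 0 := by
      by_contra h
      have : (k + 1) * 1 ≤ (k + 1) * r := Nat.mul_le_mul_left _ (by omega)
      omega
    rw [mul_zero, Nat.sub_zero, min_eq_right (by omega), Nat.sub_self, show k + 1 - k = 1 by omega]
    simp

theorem innerFFT_eq (hP : p.P = 2 ^ k) (hK : p.P ∣ p.K) (u : ℕ → ℤ) {i : ℕ} (hi : i < p.P) :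
    p.innerFFT u i = ∑ a ∈ Finset.range p.P, (u a : p.Res) * (p.theta ^ (2 * i + 1)) ^ a := by
  rw [innerFFT, fft_inner hP (theta_pow hP hK) _ hi]
  refine Finset.sum_congr rfl fun a _ => ?_
  rw [mul_assoc, ← pow_mul, ← pow_mul, ← pow_add]
  congr 2; ring

theorem inner_inverse (hP : p.P = 2 ^ k) (hK : p.P ∣ p.K) (w : ℕ → p.Res) (g : ℕ → p.Res)
    (hg : ∀ i < p.P, g i = ∑ a ∈ Finset.range p.P, w a * (p.theta ^ (2 * i + 1)) ^ a) {j : ℕ}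
    (hj : j < p.P) :
    fft p.P (2 * p.P) 1 (p.theta ^ (2 * p.P - 1)) g j * p.theta ^ (2 * p.P - j) = p.P * w j := by
  have hθ := theta_pow hP hK
  have h2 : p.theta ^ (2 * p.P) = 1 := by rw [mul_comm, pow_mul, hP, hθ]; simp
  have h1 : (p.theta ^ (2 * p.P - 1)) ^ 2 ^ k = -1 := by
    rw [← pow_mul, mul_comm, pow_mul, hθ, Odd.neg_one_pow]
    have : 0 < p.P := by rw [hP]; positivity
    exact ⟨p.P - 1, by omega⟩
  rw [fft_inner hP h1 g hj, Finset.sum_mul]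
  have := sum_eval_mul_pow hθ w (j := j) (by omega)
  rw [← hP] at this
  rw [← this]
  refine Finset.sum_congr rfl fun i hi => ?_
  rw [hg i (Finset.mem_range.1 hi), mul_assoc]
  congr 1
  obtain ⟨d, hd⟩ : ∃ d, 2 * p.P = j + 1 + d := ⟨2 * p.P - (j + 1), by omega⟩
  have key : p.theta ^ (2 * p.P * (2 * (i * j))) = 1 := by rw [pow_mul, h2, one_pow]
  have e1 : (2 * p.P - 1) * (2 * (i * j)) + (2 * p.P - j) + 2 * (i * j) =
      2 * p.P * (2 * (i * j)) + (2 * p.P - j) := by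
    rw [show 2 * p.P - 1 = j + d by omega, hd]
    generalize j + 1 + d - j = z
    ring
  have e2 : (2 * i + 1) * (2 * p.P - j) + 2 * (i * j) = 2 * p.P * (2 * i) + (2 * p.P - j) := by
    obtain ⟨z, hz⟩ : ∃ z, 2 * p.P = j + z := ⟨2 * p.P - j, by omega⟩
    rw [show 2 * p.P - j = z by omega, hz]; ring
  have hu : IsUnit (p.theta ^ (2 * (i * j))) :=
    (IsUnit.of_pow_eq_one h2 (by omega)).pow _
  apply hu.mul_right_cancel
  rw [← pow_mul, ← pow_mul, ← pow_add, ← pow_add, ← pow_add, e1, e2, pow_add, key, pow_add,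
    pow_mul _ (2 * p.P), h2, one_pow]

/-- The integers that represent the coefficients of a product. -/
def prodCoeff (P : ℕ) (u v : Fin 2 → ℕ → ℤ) : Fin 2 → ℕ → ℤ
  | 0 => fun j => negconv P (u 0) (v 0) j - negconv P (u 1) (v 1) j
  | 1 => fun j => negconv P (u 0) (v 1) j + negconv P (u 1) (v 0) j

theorem innerFFT_mul (hP : p.P = 2 ^ k) (hK : p.P ∣ p.K) (u v : ℕ → ℤ) {i : ℕ} (hi : i < p.P) :
    p.innerFFT u i * p.innerFFT v i = ∑ a ∈ Finset.range p.P,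
      ((negconv p.P u v a : ℤ) : p.Res) * (p.theta ^ (2 * i + 1)) ^ a := by
  rw [innerFFT_eq hP hK u hi, innerFFT_eq hP hK v hi, sum_mul_sum_eq_negconv]
  · refine Finset.sum_congr rfl fun a _ => ?_
    exact congrArg (· * _) (map_negconv (Int.castRingHom p.Res) p.P u v a).symm
  · rw [← pow_mul, mul_comm, pow_mul, hP, theta_pow hP hK, Odd.neg_one_pow ⟨i, rfl⟩]

theorem innerProduct_eq (hP : p.P = 2 ^ k) (hK : p.P ∣ p.K) (hK0 : p.K ≠ 0)
    (u v : Fin 2 → ℕ → ℤ) (e : Fin 2) {j : ℕ} (hj : j < p.P) :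
    p.innerProduct u v e j = (prodCoeff p.P u v e j : p.Res) := by
  have hco : Nat.Coprime p.P (2 ^ p.K + 1) := by
    rw [hP]
    refine Nat.Coprime.pow_left _ (Nat.coprime_two_left.2 ?_)
    exact (Nat.even_pow.2 ⟨even_two, hK0⟩).add_one
  rw [innerProduct, inner_inverse hP hK (fun a => (prodCoeff p.P u v e a : p.Res)) _ _ hj,
    mul_comm (p.P : p.Res), mul_assoc, ZMod.coe_mul_inv_eq_one _ hco, mul_one]
  intro i hi
  fin_cases e
  · simp only [pointwise, prodCoeff, innerFFT_mul hP hK _ _ hi]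
    rw [← Finset.sum_sub_distrib]
    refine Finset.sum_congr rfl fun a _ => ?_
    push_cast; ring
  · simp only [pointwise, prodCoeff, innerFFT_mul hP hK _ _ hi]
    rw [← Finset.sum_add_distrib]
    refine Finset.sum_congr rfl fun a _ => ?_
    push_cast; ring

theorem abs_prodCoeff_le {P : ℕ} {u v : Fin 2 → ℕ → ℤ} {X : ℤ} (hu : ∀ e, ∀ a < P, |u e a| ≤ X)
    (hv : ∀ e, ∀ a < P, |v e a| ≤ X) (e : Fin 2) (j : ℕ) :
    |prodCoeff P u v e j| ≤ 2 * (P * P * X ^ 2) := by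
  rw [two_mul]
  fin_cases e
  · exact (abs_sub _ _).trans (add_le_add (abs_negconv_le (hu 0) (hv 0) j)
      (abs_negconv_le (hu 1) (hv 1) j))
  · exact (abs_add_le _ _).trans (add_le_add (abs_negconv_le (hu 0) (hv 1) j)
      (abs_negconv_le (hu 1) (hv 0) j))

theorem valMinAbs_innerProduct (hP : p.P = 2 ^ k) (hK : p.P ∣ p.K)
    (hbig : 4 * (p.P * p.P * 2 ^ (2 * p.H)) < 2 ^ p.K) {u v : Fin 2 → ℕ → ℤ}
    (hu : ∀ e, ∀ a < p.P, |u e a| ≤ 2 ^ p.H) (hv : ∀ e, ∀ a < p.P, |v e a| ≤ 2 ^ p.H) (e : Fin 2)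
    {j : ℕ} (hj : j < p.P) :
    (p.innerProduct u v e j).valMinAbs = prodCoeff p.P u v e j := by
  have hK0 : p.K ≠ 0 := by
    intro h
    rw [h, pow_zero, Nat.lt_one_iff] at hbig
    have : 0 < p.P * p.P * 2 ^ (2 * p.H) := by rw [hP]; positivity
    omega
  rw [ZMod.valMinAbs_spec]
  refine ⟨innerProduct_eq hP hK hK0 u v e hj, ?_⟩
  have h1 := abs_le.1 (abs_prodCoeff_le hu hv e j)
  have h2 : (4 * (p.P * p.P * 2 ^ (2 * p.H)) : ℤ) < 2 ^ p.K := by exact_mod_cast hbig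
  rw [← pow_mul, mul_comm p.H 2] at h1
  push_cast
  constructor <;> [skip; skip] <;> nlinarith [h1.1, h1.2]

end Params

end FR

namespace FR

noncomputable section

open Polynomial

/-! ## Evaluation of elements of `ℂ[x] / (x ^ P + 1)` -/

/-- The root `exp (π i / P)` of `x ^ P + 1`. -/
def zeta (P : ℕ) : ℂ := Complex.exp (Real.pi * Complex.I / P)

theorem zeta_pow {P : ℕ} (hP : P ≠ 0) : zeta P ^ P = -1 := by
  have : (P : ℂ) ≠ 0 := by exact_mod_cast hP
  rw [zeta, ← Complex.exp_nat_mul, mul_div_cancel₀ _ this, Complex.exp_pi_mul_I]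

theorem norm_zeta (P : ℕ) : ‖zeta P‖ = 1 := by
  rw [zeta, Complex.norm_exp]
  simp [Complex.div_natCast_re]

theorem zeta_odd_pow {P : ℕ} (hP : P ≠ 0) (i : ℕ) : (zeta P ^ (2 * i + 1)) ^ P = -1 := by
  rw [← pow_mul, mul_comm, pow_mul, zeta_pow hP, Odd.neg_one_pow ⟨i, rfl⟩]

/-- Evaluation at `exp ((2 i + 1) π i / P)`. -/
def ev {P : ℕ} (hP : P ≠ 0) (i : ℕ) : PolyRing P →+* ℂ :=
  AdjoinRoot.lift (RingHom.id ℂ) (zeta P ^ (2 * i + 1)) (by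
    simp [zeta_odd_pow hP])

variable {P : ℕ} (hP : P ≠ 0)

@[simp] theorem ev_ringX (i : ℕ) : ev hP i (ringX P) = zeta P ^ (2 * i + 1) := by
  simp [ev, ringX]

@[simp] theorem ev_of (i : ℕ) (z : ℂ) : ev hP i (AdjoinRoot.of _ z) = z := by
  simp [ev]

theorem ev_ofCoeffs (i : ℕ) (c : ℕ → ℂ) :
    ev hP i (ofCoeffs P c) = ∑ a ∈ Finset.range P, c a * (zeta P ^ (2 * i + 1)) ^ a := by
  simp [ofCoeffs, map_sum]

theorem ringX_pow : ringX P ^ P = -1 := by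
  have h : AdjoinRoot.mk (X ^ P + 1 : ℂ[X]) (X ^ P + 1) = 0 := AdjoinRoot.mk_self
  rw [map_add, map_pow, AdjoinRoot.mk_X, map_one] at h
  exact eq_neg_of_add_eq_zero_left h

theorem ofCoeffs_mul (c d : ℕ → ℂ) :
    ofCoeffs P c * ofCoeffs P d = ofCoeffs P (negconv P c d) := by
  unfold ofCoeffs
  rw [sum_mul_sum_eq_negconv (fun a => AdjoinRoot.of _ (c a)) (fun a => AdjoinRoot.of _ (d a))
    ringX_pow]
  simp only [map_negconv]

theorem ofCoeffs_congr {c d : ℕ → ℂ} (h : ∀ j < P, c j = d j) : ofCoeffs P c = ofCoeffs P d :=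
  Finset.sum_congr rfl fun j hj => by rw [h j (Finset.mem_range.1 hj)]

theorem ofCoeffs_add (c d : ℕ → ℂ) :
    ofCoeffs P c + ofCoeffs P d = ofCoeffs P fun j => c j + d j := by
  simp [ofCoeffs, ← Finset.sum_add_distrib, add_mul]

theorem ofCoeffs_sub (c d : ℕ → ℂ) :
    ofCoeffs P c - ofCoeffs P d = ofCoeffs P fun j => c j - d j := by
  simp [ofCoeffs, ← Finset.sum_sub_distrib, sub_mul]

theorem of_mul_ofCoeffs (z : ℂ) (c : ℕ → ℂ) :
    AdjoinRoot.of _ z * ofCoeffs P c = ofCoeffs P fun j => z * c j := by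
  simp [ofCoeffs, Finset.mul_sum, mul_assoc]

include hP in
theorem exists_ofCoeffs (z : PolyRing P) : ∃ c, z = ofCoeffs P c := by
  obtain ⟨f, rfl⟩ := AdjoinRoot.mk_surjective z
  have hm : (X ^ P + 1 : ℂ[X]).Monic := by
    simpa using monic_X_pow_add_C (1 : ℂ) hP
  have hdeg : (X ^ P + 1 : ℂ[X]).natDegree = P := by
    simpa using natDegree_X_pow_add_C (n := P) (r := (1 : ℂ))
  have hlt : (f %ₘ (X ^ P + 1)).natDegree < P := by
    have := natDegree_modByMonic_lt f hm (fun h => by rw [h] at hdeg; simp at hdeg; omega)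
    rwa [hdeg] at this
  refine ⟨(f %ₘ (X ^ P + 1)).coeff, ?_⟩
  have h1 : AdjoinRoot.mk (X ^ P + 1 : ℂ[X]) f = AdjoinRoot.mk _ (f %ₘ (X ^ P + 1)) := by
    conv_lhs => rw [← modByMonic_add_div f (X ^ P + 1)]
    simp
  rw [h1]
  conv_lhs => rw [as_sum_range' _ P hlt]
  simp only [map_sum, ofCoeffs, ← C_mul_X_pow_eq_monomial, map_mul, map_pow, AdjoinRoot.mk_C,
    AdjoinRoot.mk_X]
  rfl

/-- All values of `z` at the roots of `x ^ P + 1` are at most `r`. -/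
def NormLE (z : PolyRing P) (r : ℝ) : Prop := ∀ i < P, ‖ev hP i z‖ ≤ r

variable {hP}

theorem NormLE.mono {z : PolyRing P} {r r' : ℝ} (h : NormLE hP z r) (hr : r ≤ r') :
    NormLE hP z r' := fun i hi => (h i hi).trans hr

theorem NormLE.add {z z' : PolyRing P} {r r' : ℝ} (h : NormLE hP z r) (h' : NormLE hP z' r') :
    NormLE hP (z + z') (r + r') := fun i hi => by
  rw [map_add]
  exact (norm_add_le _ _).trans (add_le_add (h i hi) (h' i hi))

theorem NormLE.sub {z z' : PolyRing P} {r r' : ℝ} (h : NormLE hP z r) (h' : NormLE hP z' r') :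
    NormLE hP (z - z') (r + r') := fun i hi => by
  rw [map_sub]
  exact (norm_sub_le _ _).trans (add_le_add (h i hi) (h' i hi))

theorem NormLE.mul {z z' : PolyRing P} {r r' : ℝ} (h : NormLE hP z r) (h' : NormLE hP z' r') :
    NormLE hP (z * z') (r * r') := fun i hi => by
  rw [map_mul, norm_mul]
  exact mul_le_mul (h i hi) (h' i hi) (norm_nonneg _) ((norm_nonneg _).trans (h i hi))

theorem NormLE.pow_one {z : PolyRing P} (h : NormLE hP z 1) (n : ℕ) : NormLE hP (z ^ n) 1 :=
  fun i hi => by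
    rw [map_pow, norm_pow]
    exact pow_le_one₀ (norm_nonneg _) (h i hi)

theorem normLE_ringX : NormLE hP (ringX P) 1 := fun i _ => by
  rw [ev_ringX, norm_pow, norm_zeta, _root_.one_pow]

theorem normLE_of (z : ℂ) : NormLE hP (AdjoinRoot.of _ z) ‖z‖ := fun i _ => by rw [ev_of]

theorem normLE_ofCoeffs {c : ℕ → ℂ} {r : ℝ} (h : ∀ j < P, ‖c j‖ ≤ r) :
    NormLE hP (ofCoeffs P c) (P * r) := fun i _ => by
  rw [ev_ofCoeffs]
  refine (norm_sum_le _ _).trans ?_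
  calc ∑ a ∈ Finset.range P, ‖c a * (zeta P ^ (2 * i + 1)) ^ a‖ ≤ ∑ a ∈ Finset.range P, r :=
        Finset.sum_le_sum fun a ha => by
          rw [norm_mul, norm_pow, norm_pow, norm_zeta]
          simpa using h a (Finset.mem_range.1 ha)
    _ = P * r := by simp

section

variable {k : ℕ} (hk : P = 2 ^ k)
include hk

theorem coeff_eq_sum_ev (c : ℕ → ℂ) {j : ℕ} (hj : j < P) :
    (P : ℂ) * c j = ∑ i ∈ Finset.range P, ev hP i (ofCoeffs P c) *
      zeta P ^ ((2 * i + 1) * (2 * P - j)) := by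
  have := sum_eval_mul_pow (k := k) (θ := zeta P) (by rw [← hk, zeta_pow hP]) c (j := j) (by omega)
  rw [← hk] at this
  simp only [ev_ofCoeffs, ← this]

theorem norm_coeff_le {c : ℕ → ℂ} {r : ℝ} (h : NormLE hP (ofCoeffs P c) r) {j : ℕ} (hj : j < P) :
    ‖c j‖ ≤ r := by
  have hp : (0 : ℝ) < P := by exact_mod_cast Nat.pos_of_ne_zero hP
  have h1 : ‖(P : ℂ) * c j‖ ≤ P * r := by
    rw [coeff_eq_sum_ev (hP := hP) hk c hj]
    refine (norm_sum_le _ _).trans ?_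
    calc _ ≤ ∑ i ∈ Finset.range P, r := Finset.sum_le_sum fun i hi => by
            rw [norm_mul, norm_pow, norm_zeta]
            simpa using h i (Finset.mem_range.1 hi)
      _ = P * r := by simp
  rw [norm_mul, Complex.norm_natCast] at h1
  exact le_of_mul_le_mul_left h1 hp

theorem eq_of_ev {z z' : PolyRing P} (h : ∀ i < P, ev hP i z = ev hP i z') : z = z' := by
  obtain ⟨c, hc⟩ := exists_ofCoeffs hP (z - z')
  have h0 : NormLE hP (ofCoeffs P c) 0 := fun i hi => by
    rw [← hc, map_sub, h i hi]; simp
  rw [← sub_eq_zero, hc]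
  refine (ofCoeffs_congr (d := fun _ => 0) fun j hj => ?_).trans (by simp [ofCoeffs])
  simpa using norm_coeff_le hk h0 hj

end

/-! ### The root of unity -/

/-- The root of unity `exp (2 π i / N)`. -/
def omega (N : ℕ) : ℂ := Complex.exp (2 * Real.pi * Complex.I / N)

theorem norm_omega (N : ℕ) : ‖omega N‖ = 1 := by
  rw [omega, Complex.norm_exp]
  simp [Complex.div_natCast_re]

theorem omega_pow {N : ℕ} (hN : N ≠ 0) : omega N ^ N = 1 := by
  have : (N : ℂ) ≠ 0 := by exact_mod_cast hN
  rw [omega, ← Complex.exp_nat_mul, mul_div_cancel₀ _ this, Complex.exp_two_pi_mul_I]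

theorem omega_pow_div {N : ℕ} (hN : N ≠ 0) (hd : 2 * P ∣ N) (hP : P ≠ 0) :
    omega N ^ (N / (2 * P)) = zeta P := by
  obtain ⟨c, rfl⟩ := hd
  have hc : (c : ℂ) ≠ 0 := by rintro h; simp_all
  have hp : (P : ℂ) ≠ 0 := by exact_mod_cast hP
  rw [Nat.mul_div_cancel_left _ (by omega), omega, zeta, ← Complex.exp_nat_mul]
  congr 1
  push_cast
  field_simp

variable (hP) in
theorem ev_rho {N i : ℕ} (hi : i < P) : ev hP i (rho P N) = omega N ^ (2 * i + 1) := by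
  have hp : (P : ℂ) ≠ 0 := by exact_mod_cast hP
  have hz : ∀ k : ℕ, Complex.exp ((2 * (k : ℕ) + 1) * Real.pi * Complex.I / P) =
      zeta P ^ (2 * k + 1) := fun k => by
    rw [zeta, ← Complex.exp_nat_mul]; congr 1; push_cast; ring
  have ho : ∀ k : ℕ, Complex.exp ((2 * (k : ℕ) + 1) * 2 * Real.pi * Complex.I / N) =
      omega N ^ (2 * k + 1) := fun k => by
    rw [omega, ← Complex.exp_nat_mul]; congr 1; push_cast; ring
  have hinj : Set.InjOn (fun k : Fin P => zeta P ^ (2 * (k : ℕ) + 1))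
      (Finset.univ : Finset (Fin P)) := by
    have hprim : IsPrimitiveRoot (zeta P) (2 * P) := by
      have := Complex.isPrimitiveRoot_exp (2 * P) (by omega)
      convert this using 1
      rw [zeta]; congr 1; push_cast; field_simp
    intro a _ b _ hab
    have := hprim.pow_inj (by omega) (by omega) hab
    exact Fin.ext (by omega)
  rw [rho, ev, AdjoinRoot.lift_mk]
  simp only [hz, ho]
  have := Lagrange.eval_interpolate_at_node (r := fun k : Fin P => omega N ^ (2 * (k : ℕ) + 1))
    hinj (Finset.mem_univ (⟨i, hi⟩ : Fin P))
  simpa [eval₂_eq_eval_map] using this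

theorem normLE_rho (N : ℕ) : NormLE hP (rho P N) 1 := fun i hi => by
  rw [ev_rho hP hi, norm_pow, norm_omega, _root_.one_pow]

theorem rho_pow_div {k N : ℕ} (hk : P = 2 ^ k) (hN : N ≠ 0) (hd : 2 * P ∣ N) :
    rho P N ^ (N / (2 * P)) = ringX P := by
  have hP : P ≠ 0 := by rw [hk]; positivity
  refine eq_of_ev (hP := hP) hk fun i hi => ?_
  rw [map_pow, ev_rho hP hi, ← pow_mul, mul_comm, pow_mul, omega_pow_div hN hd hP, ev_ringX]

theorem rho_pow_half {k N : ℕ} (hk : P = 2 ^ k) (hN : N ≠ 0) (hd : 2 * P ∣ N) :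
    rho P N ^ (N / 2) = -1 := by
  obtain ⟨c, hc⟩ := hd
  have hP : P ≠ 0 := by rw [hk]; positivity
  have h := rho_pow_div hk hN ⟨c, hc⟩
  have : N / 2 = N / (2 * P) * P := by
    rw [hc, Nat.mul_div_cancel_left _ (by omega), mul_assoc, Nat.mul_div_cancel_left _ (by omega)]
    ring
  rw [this, pow_mul, h, ringX_pow]

theorem rho_pow_self {k N : ℕ} (hk : P = 2 ^ k) (hN : N ≠ 0) (hd : 2 * P ∣ N) :
    rho P N ^ N = 1 := by
  have h := rho_pow_half hk hN hd
  have h2 : N = N / 2 * 2 := by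
    obtain ⟨c, hc⟩ := hd
    have : N = 2 * (P * c) := by rw [hc, mul_assoc]
    omega
  calc rho P N ^ N = (rho P N ^ (N / 2)) ^ 2 := by rw [← pow_mul, ← h2]
    _ = 1 := by rw [h]; simp

/-- The coefficients of a power of the root of unity. -/
theorem coeff_rho_pow {k N : ℕ} (hk : P = 2 ^ k) (hN : N ≠ 0) (hd : 2 * P ∣ N) (e : ℕ) {c : ℕ → ℂ}
    (hc : rho P N ^ e = ofCoeffs P c) {j : ℕ} (hj : j < P) :
    (P : ℂ) * c j = ∑ i ∈ Finset.range P,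
      omega N ^ ((2 * i + 1) * (e + N / (2 * P) * (2 * P - j)) % N) := by
  have hP : P ≠ 0 := by rw [hk]; positivity
  rw [coeff_eq_sum_ev (hP := hP) hk c hj, ← hc]
  refine Finset.sum_congr rfl fun i hi => ?_
  rw [map_pow, ev_rho hP (Finset.mem_range.1 hi), ← omega_pow_div hN hd hP, ← pow_mul, ← pow_mul,
    ← pow_add, pow_eq_pow_mod _ (omega_pow hN)]
  congr 2
  ring

end

end FR

namespace FR.Prog

open LogRAM LogRAM.Stmt

/-! ### Variables -/

abbrev vn : Exp := .var 0
abbrev vm : Exp := .var 1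
abbrev vP : Exp := .var 2
abbrev vN : Exp := .var 3
abbrev vlP : Exp := .var 4
abbrev vlN : Exp := .var 5
abbrev vJ : Exp := .var 7
abbrev vO : Exp := .var 8
abbrev vQ : Exp := .var 9
abbrev vM : Exp := .var 10
abbrev vL : Exp := .var 11
abbrev vI : Exp := .var 12
abbrev vb : Exp := .var 13
abbrev vt : Exp := .var 14
abbrev x (k : ℕ) : Exp := .var k

/-- `x = b ^ k` for a constant `k`. -/
def powCode (y : ℕ) (b : Exp) (k : ℕ) : Stmt :=
  set y 1 ;; loop 20 (.const k) (set y (.var y * b))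

/-- The parameters. -/
def paramCode : Stmt :=
  set 1 (vn / 2) ;; set 2 2 ;; set 4 1 ;; set 13 4 ;;
  loop 20 vn (ifz (vb - vm) (set 2 (2 * vP) ;; set 4 (vlP + 1) ;; set 13 (vb * vb)) skip) ;;
  set 7 (2 * vP) ;; set 3 vJ ;; set 5 (vlP + 1) ;;
  loop 20 vn (ifz (vN * vP * vP + 1 - 4 * vm) (set 3 (2 * vN) ;; set 5 (vlN + 1)) skip) ;;
  powCode 8 vb 120 ;; powCode 9 vb 100 ;; powCode 10 vb 250 ;; powCode 14 2 250 ;;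
  set 12 (vM + 1 - vM / vP) ;; set 10 (vM + 1) ;; set 11 (vJ * vN)

/-! ### Tables. Arrays: 0 bit reversals, 1 powers of two, 2 powers of `θ`, 3 roots of unity in `ℂ`,
4 powers of `ρ`. -/

def twoCode : Stmt :=
  store 1 0 1 ;; loop 20 vlN (store 1 (x 20 + 1) (2 * .load 1 (x 20)))

def revCode : Stmt :=
  store 0 1 0 ;;
  loop 20 vlN (loop 21 (.load 1 (x 20 + 1))
    (store 0 (.load 1 (x 20 + 1) + x 21)
      (.load 1 (x 20) * (x 21 % 2) + .load 0 (.load 1 (x 20) + x 21 / 2))))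

def thetaCode : Stmt :=
  store 2 0 1 ;; loop 20 vJ (store 2 (x 20 + 1) (vt * .load 2 (x 20) % vM))

/-- The integer square root of variable 21, into variable 22. -/
def sqrtCode : Stmt :=
  set 22 0 ;; set 23 (4 * vQ) ;;
  loop 24 (100 * vP + 2) (set 23 (x 23 / 2) ;;
    ifz ((x 22 + x 23) * (x 22 + x 23) - x 21) (set 22 (x 22 + x 23)) skip)

def cisCode : Stmt :=
  set 22 0 ;;
  loop 20 (vlN - 2) (set 21 (2 * vQ * vQ + vQ * x 22) ;; sqrtCode) ;;
  set 25 (x 22 / 2) ;; set 21 (4 * vQ * vQ - x 22 * x 22) ;; sqrtCode ;; set 26 (x 22 / 2) ;;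
  store 3 0 (vO + vQ) ;; store 3 1 vO ;;
  loop 20 (vN - 1) (
    store 3 (2 * x 20 + 2)
      ((.load 3 (2 * x 20) * x 25 + vO * x 26 + vO * vQ - vO * x 25
        - .load 3 (2 * x 20 + 1) * x 26) / vQ) ;;
    store 3 (2 * x 20 + 3)
      ((.load 3 (2 * x 20) * x 26 + .load 3 (2 * x 20 + 1) * x 25 + vO * vQ - vO * x 26
        - vO * x 25) / vQ))

def rhoCode : Stmt :=
  loop 20 vL (
    set 21 (x 20 / vJ + vN / vJ * (vJ - x 20 % vJ / 2)) ;; set 22 (x 20 % 2) ;; set 23 0 ;;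
    loop 24 vP (set 23 (x 23 + .load 3 (2 * ((2 * x 24 + 1) * x 21 % vN) + x 22))) ;;
    store 4 (x 20) (x 23 / vP))

/-! ### Multiplication in the ring. Offsets in variables 40, 41, 42 -/

/-- Inner FFT in array `F`, with buffer 11. -/
def innerFFTCode (F : ℕ) (s : Exp) : Stmt :=
  loop 45 vlP (
    set 46 (vP / .load 1 (x 45)) ;; set 44 (2 * .load 1 (x 45) * s) ;;
    loop 47 vP (
      set 48 (x 47 % x 46) ;;
      ifz (x 48 + 1 - x 46 / 2)
        (store 11 (x 47) ((.load F (x 47) + .load F (x 47 + x 46 / 2)) % vM))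
        (set 49 (x 44 * (x 48 - x 46 / 2) % vJ) ;;
          store 11 (x 47) ((.load F (x 47 - x 46 / 2) + vM - .load F (x 47)) * .load 2 (x 49) % vM))) ;;
    loop 47 vP (store F (x 47) (.load 11 (x 47))))

/-- Load component `e` of the element with offset `o` of array `A`. -/
def weightCode (F A o e : ℕ) : Stmt :=
  loop 47 vP (store F (x 47)
    ((.load A (x o + 2 * x 47 + .const e) + vM - vO) % vM * .load 2 (x 47) % vM))

def pointwiseCode : Stmt :=
  loop 47 vP (
    (set 48 (.load 0 (vP + x 47)) ;; set 52 (.load 12 (x 48)) ;; set 53 (.load 13 (x 48)) ;;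
      set 54 (.load 14 (x 48)) ;; set 55 (.load 15 (x 48))) ;;
    set 56 (x 52 * x 54) ;; set 57 (x 53 * x 55) ;; set 58 (x 52 * x 55) ;; set 59 (x 53 * x 54) ;;
    (store 16 (x 47) ((x 56 + vM - x 57 % vM) % vM) ;;
      store 17 (x 47) ((x 58 + x 59) % vM)))

/-- Round component `e` of the product, from array `G`, into array `A`. -/
def roundCode (G A e : ℕ) : Stmt :=
  loop 47 vP (
    set 48 (.load G (.load 0 (vP + x 47)) * .load 2 (vJ - x 47) % vM * vI % vM) ;;
    ifz (x 48 - vM / 2)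
      (store A (x 42 + 2 * x 47 + .const e) ((x 48 + vO * vQ) / vQ))
      (store A (x 42 + 2 * x 47 + .const e) ((x 48 + vO * vQ - vM) / vQ)))

def ringMulCode (X Z A : ℕ) : Stmt :=
  weightCode 12 X 40 0 ;; innerFFTCode 12 1 ;;
  weightCode 13 X 40 1 ;; innerFFTCode 13 1 ;;
  weightCode 14 Z 41 0 ;; innerFFTCode 14 1 ;;
  weightCode 15 Z 41 1 ;; innerFFTCode 15 1 ;;
  pointwiseCode ;;
  innerFFTCode 16 (vJ - 1) ;; innerFFTCode 17 (vJ - 1) ;;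
  roundCode 16 A 0 ;; roundCode 17 A 1

/-! ### Outer FFT of array `A` with buffer 7; the sign is in variable 16 -/

def levelCode : Stmt :=
  set 18 (.load 1 ((vlP + 1) * (x 17 / (vlP + 1)))) ;;
  set 19 (vN / x 18) ;;
  set 21 (vN / .load 1 (x 17) / 2) ;;
  set 22 (.load 1 ((vlP + 1) * ((x 17 + 1) / (vlP + 1)))) ;;
  ifz (vJ - x 19)
    (set 20 (.load 1 (x 17 % (vlP + 1)) * x 16) ;; set 19 (x 19 / vJ))
    (set 20 (vJ / x 19 * .load 1 (x 17 % (vlP + 1)) * x 16) ;; set 19 1)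

def butterflyCode (A : ℕ) : Stmt :=
  loop 32 vL (
    set 33 (x 32 / vJ) ;; set 34 (x 32 % vJ) ;; set 35 (x 33 % (2 * x 21)) ;;
    ifz (x 35 + 1 - x 21)
      (store 7 (x 32) (.load A (x 32) + .load A (x 32 + vJ * x 21) - vO))
      (set 36 (x 20 * ((x 35 - x 21) / x 19) % vJ) ;;
        set 37 ((x 34 + 2 * vJ - 2 * x 36) % (2 * vJ)) ;;
        ifz (x 37 + 1 - vJ)
          (set 38 (vJ * x 33 + x 37) ;;
            store 7 (x 32) (.load A (x 38 - vJ * x 21) + vO - .load A (x 38)))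
          (set 38 (vJ * x 33 + (x 37 - vJ)) ;;
            store 7 (x 32) (.load A (x 38) + vO - .load A (x 38 - vJ * x 21)))))

def twiddleCode (A : ℕ) : Stmt :=
  set 23 (vN / x 22) ;;
  loop 24 vN (
    set 25 (x 18 * (x 24 % x 23) * .load 0 (vJ + x 24 / x 23 % vJ)) ;;
    set 40 (vJ * x 24) ;; set 41 (vJ * (x 16 * x 25 % vN)) ;; set 42 (vJ * x 24) ;;
    ringMulCode 7 4 A)

def copyCode (A : ℕ) : Stmt := loop 32 vL (store A (x 32) (.load 7 (x 32)))

def fftCode (A : ℕ) : Stmt :=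
  loop 17 vlN (
    levelCode ;; butterflyCode A ;;
    ifz ((x 17 + 1) % (vlP + 1))
      (ifz (x 22 + 1 - vN) (twiddleCode A) (copyCode A)) (copyCode A))

/-! ### Input, products, output -/

def inputCode (A : ℕ) (base : Exp) : Stmt :=
  loop 20 vL (
    set 21 (x 20 % vJ) ;; set 22 (vP * (x 20 / vJ * (vP / 2) + x 21 / 2)) ;; set 23 0 ;;
    ifz (x 21 % 2) (ifz (x 21 + 1 - vP) (ifz (x 22 + 1 - vm)
      (input 23 (base + (vm - x 22 - vP)) (base + (vm - x 22 - 1)))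
      skip) skip) skip ;;
    store A (x 20) (x 23 * vQ + vO))

/-- Bit reversal of array `A`, into array `A'`. -/
def reorderCode (A A' : ℕ) : Stmt :=
  loop 20 vL (store A' (x 20) (.load A (vJ * .load 0 (vN + x 20 / vJ) + x 20 % vJ)))

def productCode : Stmt :=
  loop 24 vN (set 40 (vJ * x 24) ;; set 41 (vJ * x 24) ;; set 42 (vJ * x 24) ;; ringMulCode 8 9 10)

def divideCode (A A' : ℕ) : Stmt :=
  loop 20 vL (store A' (x 20)
    ((.load A (vJ * .load 0 (vN + x 20 / vJ) + x 20 % vJ) + vO * vN - vO) / vN))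

/-- Add the coefficients in array 8 to the digits in array 18. -/
def digitCode : Stmt :=
  loop 20 vL (ifz (x 20 % 2)
    (set 21 (x 20 / vJ * (vP / 2) + x 20 % vJ / 2) ;;
      store 18 (x 21) (.load 18 (x 21) + (.load 8 (x 20) + vQ / 2 - vO) / vQ)) skip)

def carryCode : Stmt :=
  set 21 0 ;;
  loop 20 ((vN + 1) * (vP / 2)) (
    set 22 (.load 18 (x 20) + x 21) ;; store 18 (x 20) (x 22 % vb) ;; set 21 (x 22 / vb))

def outputCode : Stmt :=
  set 21 (vn / vP) ;; set 22 (.load 18 (x 21)) ;; output 22 (vn % vP) ;;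
  loop 20 x21 (set 22 (.load 18 (x 21 - x 20 - 1)) ;; output 22 vP)
where x21 : Exp := .var 21

def mainCode : Stmt :=
  twoCode ;; revCode ;; thetaCode ;; cisCode ;; rhoCode ;;
  inputCode 5 0 ;; inputCode 6 vm ;; set 16 1 ;;
  fftCode 5 ;; fftCode 6 ;; reorderCode 5 8 ;; reorderCode 6 9 ;; productCode ;;
  set 16 (vN - 1) ;; fftCode 10 ;; divideCode 10 8 ;;
  digitCode ;; carryCode ;; outputCode

end FR.Prog

namespace LogRAM

/-! ### Simplification of expressions and states -/

namespace Exp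

variable (st : St) (E : Env) (a b : Exp)

@[simp] theorem val_add : (a + b).val st = a.val st + b.val st := rfl
@[simp] theorem val_sub : (a - b).val st = a.val st - b.val st := rfl
@[simp] theorem val_mul : (a * b).val st = a.val st * b.val st := rfl
@[simp] theorem val_div : (a / b).val st = a.val st / b.val st := rfl
@[simp] theorem val_mod : (a % b).val st = a.val st % b.val st := rfl
@[simp] theorem val_ofNat (n : ℕ) : Exp.val st (no_index (OfNat.ofNat n)) = n := rfl
@[simp] theorem val_const (n : ℕ) : Exp.val st (.const n) = n := rfl
@[simp] theorem val_var (x : ℕ) : Exp.val st (.var x) = st.v x := rfl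
@[simp] theorem val_load (arr : ℕ) : (load arr a).val st = st.a arr (a.val st) := rfl
@[simp] theorem ok_add : (a + b).Ok E st ↔ a.Ok E st ∧ b.Ok E st := Iff.rfl
@[simp] theorem ok_sub : (a - b).Ok E st ↔ a.Ok E st ∧ b.Ok E st := Iff.rfl
@[simp] theorem ok_mul : (a * b).Ok E st ↔ a.Ok E st ∧ b.Ok E st := Iff.rfl
@[simp] theorem ok_div : (a / b).Ok E st ↔ a.Ok E st ∧ b.Ok E st ∧ b.val st ≠ 0 := Iff.rfl
@[simp] theorem ok_mod : (a % b).Ok E st ↔ a.Ok E st ∧ b.Ok E st ∧ b.val st ≠ 0 := Iff.rfl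
@[simp] theorem ok_ofNat (n : ℕ) : Exp.Ok E st (no_index (OfNat.ofNat n)) := trivial
@[simp] theorem ok_const (n : ℕ) : Exp.Ok E st (.const n) := trivial
@[simp] theorem ok_var (x : ℕ) : Exp.Ok E st (.var x) := trivial
@[simp] theorem ok_load (arr : ℕ) :
    (load arr a).Ok E st ↔ a.Ok E st ∧ a.val st < E.acc := Iff.rfl

@[simp] theorem length_code_add (d : ℕ) :
    ((a + b).code d).length = (a.code d).length + ((b.code (d + 1)).length + 1) := by
  change (Exp.code (.add a b) d).length = _
  simp [code]
@[simp] theorem length_code_sub (d : ℕ) :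
    ((a - b).code d).length = (a.code d).length + ((b.code (d + 1)).length + 1) := by
  change (Exp.code (.sub a b) d).length = _
  simp [code]
@[simp] theorem length_code_mul (d : ℕ) :
    ((a * b).code d).length = (a.code d).length + ((b.code (d + 1)).length + 1) := by
  change (Exp.code (.mul a b) d).length = _
  simp [code]
@[simp] theorem length_code_div (d : ℕ) :
    ((a / b).code d).length = (a.code d).length + ((b.code (d + 1)).length + 1) := by
  change (Exp.code (.div a b) d).length = _
  simp [code]
@[simp] theorem length_code_mod (d : ℕ) :
    ((a % b).code d).length = (a.code d).length + ((b.code (d + 1)).length + 3) := by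
  change (Exp.code (.mod a b) d).length = _
  simp [code]
@[simp] theorem length_code_load (arr d : ℕ) :
    ((load arr a).code d).length = (a.code d).length + 2 := by simp [code]
@[simp] theorem length_code_var (y d : ℕ) : ((var y).code d).length = 0 := rfl
@[simp] theorem length_code_const (y d : ℕ) : ((const y).code d).length = 0 := rfl
@[simp] theorem length_code_ofNat (y d : ℕ) :
    (Exp.code (no_index (OfNat.ofNat y)) d).length = 0 := rfl

end Exp

/-- Only variables from number `k` on and the arrays in `D` have changed. -/
structure Frame (k : ℕ) (D : List ℕ) (st st' : St) : Prop where
  v : ∀ y < k, st'.v y = st.v y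
  a : ∀ b ∉ D, st'.a b = st.a b
  out : st'.out = st.out

namespace Frame

variable {k k' : ℕ} {D D' : List ℕ} {st st' st'' : St}

theorem refl (k : ℕ) (D : List ℕ) (st : St) : Frame k D st st := ⟨fun _ _ => rfl, fun _ _ => rfl, rfl⟩

theorem trans (h : Frame k D st st') (h' : Frame k D st' st'') : Frame k D st st'' :=
  ⟨fun y hy => (h'.v y hy).trans (h.v y hy), fun b hb => (h'.a b hb).trans (h.a b hb),
    h'.out.trans h.out⟩

theorem mono (h : Frame k D st st') (hk : k' ≤ k) (hD : D ⊆ D') : Frame k' D' st st' :=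
  ⟨fun y hy => h.v y (by omega), fun b hb => h.a b fun hb' => hb (hD hb'), h.out⟩

@[simp] theorem set_iff {x y : ℕ} (h : k ≤ x) :
    Frame k D st (st'.set x y) ↔ Frame k D st st' := by
  refine ⟨fun h' => ⟨fun z hz => ?_, h'.a, h'.out⟩, fun h' => ⟨fun z hz => ?_, h'.a, h'.out⟩⟩
  · rw [← h'.v z hz, St.set_v, if_neg (by omega)]
  · rw [← h'.v z hz, St.set_v, if_neg (by omega)]

@[simp] theorem put_iff {arr i y : ℕ} (h : arr ∈ D) :
    Frame k D st (st'.put arr i y) ↔ Frame k D st st' := by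
  refine ⟨fun h' => ⟨h'.v, fun b hb => ?_, h'.out⟩, fun h' => ⟨h'.v, fun b hb => ?_, h'.out⟩⟩
  · rw [← h'.a b hb, St.put_a, if_neg (by rintro rfl; exact hb h)]
  · rw [← h'.a b hb, St.put_a, if_neg (by rintro rfl; exact hb h)]

end Frame

theorem Env.wpt_body {E : Env} (hE : E.Good) {c : Stmt} {n s : ℕ} {Q : St → Prop} {st : St}
    (hn : c.len ≤ n) (h : c.wp E Q st) : E.wpt c n (fun _ => Q) s st :=
  wpt_mono (wpt_of_wp hE c h) hn fun _ _ _ _ _ h => h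

theorem Env.wpt_cons {E : Env} (hE : E.Good) {c d : Stmt} {n k s : ℕ} {Q : ℕ → St → Prop} {st : St}
    (hk : c.len + n ≤ k) (h : c.wp E (fun st' => ∀ u ≥ s, E.wpt d n Q u st') st) :
    E.wpt (c ;; d) k Q s st :=
  wpt_seq (wpt_mono (wpt_of_wp hE c h) le_rfl fun u _ hu _ _ h _ => h u hu) hk

theorem Env.wpt_cons' {E : Env} (hE : E.Good) {c d : Stmt} {n k s : ℕ} {R : St → Prop}
    {Q : ℕ → St → Prop} {st : St} (hk : c.len + n ≤ k) (h : c.wp E R st)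
    (h' : ∀ u ≥ s, ∀ st', R st' → E.wpt d n Q u st') : E.wpt (c ;; d) k Q s st :=
  wpt_seq (wpt_mono (wpt_of_wp hE c h) le_rfl fun u _ hu _ _ h _ => h' u hu _ h) hk

/-- A loop that fills the first `n` entries of array `D`. -/
theorem Env.wpt_fill {E : Env} (hE : E.Good) {x : ℕ} {e : Exp} {c : Stmt} {n T k K s : ℕ}
    {D : ℕ} {Ds : List ℕ} {Q : ℕ → St → Prop} {st : St} (F : ℕ → ℕ) (hn : n < E.B) (hx : k ≤ x)
    (he : ∀ st', Frame k Ds st st' → e.Ok E st' ∧ e.val st' = n)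
    (hs : ∀ i < n, ∀ t ≥ s, ∀ st', st'.v x = i → Frame k Ds st st' →
      (∀ z < i, st'.a D z = F z) →
      E.wpt c T (fun _ st'' => st''.v x = i ∧ Frame k Ds st' st'' ∧
        st''.a D = Function.update (st'.a D) i (F i)) t st')
    (hK : (n + 1) * (T + (e.code 0).length + 4) ≤ K)
    (hQ : ∀ t ≥ s, ∀ st', Frame k Ds st st' → (∀ z < n, st'.a D z = F z) → Q t st') :
    E.wpt (.loop x e c) K Q s st := by
  refine wpt_loop' hE (fun i st' => Frame k Ds st st' ∧ ∀ z < i, st'.a D z = F z) hn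
    ⟨(Frame.set_iff hx).2 (.refl _ _ _), by simp⟩ (fun i _ st' h _ => he st' h.1)
    (fun i hi t ht st' hv h => ?_) hK (fun t ht st' h _ => hQ t ht st' h.1 h.2)
  refine wpt_mono (hs i hi t ht st' hv h.1 h.2) le_rfl ?_
  rintro t' st'' _ _ _ ⟨h1, h2, h3⟩
  refine ⟨h1, (Frame.set_iff hx).2 (h.1.trans h2), fun z hz => ?_⟩
  rw [St.set_a, h3, Function.update_apply]
  split_ifs with hzi
  · rw [hzi]
  · exact h.2 z (by omega)

end LogRAM

namespace FR.Prog

open LogRAM LogRAM.Stmt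

/-- The setting: parameters, and a machine with suitable bounds. -/
structure Ctx (E : Env) (p : Params) (m k n : ℕ) : Prop where
  good : E.Good
  hP : p.P = 2 ^ k
  hk : 1 ≤ k
  hN : p.N = 2 ^ n
  hkn : k + 1 ≤ n
  hn : n ≤ 3 * p.P
  hS : p.S = 100 * p.P
  hH : p.H = 120 * p.P
  hK : p.K = 250 * p.P
  hL : E.L = 2 * p.P * p.N
  hacc : E.acc = 2 * p.P * p.N
  hB : E.B = 2 ^ (750 * p.P)
  hm' : m < 2 ^ p.P
  cap : m ≤ p.N / 2 * (p.P / 2 * p.P)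
  hw : p.P ≤ E.w

/-- The variables hold the parameters, and the first three tables are complete. -/
structure Base (p : Params) (m k n : ℕ) (st : St) : Prop where
  vars : st.v 0 = 2 * m ∧ st.v 1 = m ∧ st.v 2 = p.P ∧ st.v 3 = p.N ∧ st.v 4 = k ∧ st.v 5 = n ∧
    st.v 7 = 2 * p.P ∧ st.v 8 = 2 ^ p.H ∧ st.v 9 = 2 ^ p.S ∧ st.v 10 = 2 ^ p.K + 1 ∧
    st.v 11 = 2 * p.P * p.N ∧ st.v 12 = 2 ^ p.K + 1 - 2 ^ p.K / p.P ∧ st.v 13 = 2 ^ p.P ∧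
    st.v 14 = 2 ^ 250
  two : ∀ i ≤ n, st.a 1 i = 2 ^ i
  rev : ∀ i ≤ n, ∀ q < 2 ^ i, st.a 0 (2 ^ i + q) = bitRev i q
  pow : ∀ t ≤ 2 * p.P, st.a 2 t = (p.theta ^ t).val

variable {E : Env} {p : Params} {m k n : ℕ}

theorem Base.frame {st st' : St} (h : Base p m k n st) {y : ℕ} {D : List ℕ} (hf : Frame y D st st')
    (hy : 16 ≤ y) (hD : 0 ∉ D ∧ 1 ∉ D ∧ 2 ∉ D) : Base p m k n st' := by
  obtain ⟨⟨h0, h1, h2, h3, h4, h5, h7, h8, h9, h10, h11, h12, h13, h14⟩, b1, b2, b3⟩ := h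
  have hv : ∀ z < 16, st'.v z = st.v z := fun z hz => hf.v z (by omega)
  refine ⟨⟨?_, ?_, ?_, ?_, ?_, ?_, ?_, ?_, ?_, ?_, ?_, ?_, ?_, ?_⟩, ?_, ?_, ?_⟩
  all_goals first | (rw [hv _ (by norm_num)]; assumption) | skip
  · rwa [hf.a 1 hD.2.1]
  · rwa [hf.a 0 hD.1]
  · rwa [hf.a 2 hD.2.2]

namespace Ctx

variable (c : Ctx E p m k n)
include c

theorem P_pos : 2 ≤ p.P := by
  rw [c.hP]; exact (Nat.pow_le_pow_right (by norm_num) c.hk).trans' (by norm_num)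

theorem N_pos : 0 < p.N := by rw [c.hN]; positivity

theorem dvd_K : p.P ∣ p.K := c.hK ▸ Dvd.intro_left _ rfl

theorem pow_lt {a : ℕ} (h : a < 750) : 2 ^ (a * p.P) < E.B := by
  rw [c.hB]
  exact Nat.pow_lt_pow_right (by norm_num) (Nat.mul_lt_mul_of_pos_right h (by have := c.P_pos; omega))

omit c in
theorem P_lt : p.P < 2 ^ p.P := Nat.lt_two_pow_self

theorem two_le : 2 ≤ 2 ^ p.P := by
  have := Ctx.P_lt (p := p)
  have := c.P_pos
  omega

theorem N_le : p.N ≤ (2 ^ p.P) ^ 3 := by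
  rw [c.hN, ← pow_mul, mul_comm]
  exact Nat.pow_le_pow_right (by norm_num) c.hn

theorem lt_B {x a : ℕ} (hx : x ≤ (2 ^ p.P) ^ a) (h : a < 750) : x < E.B := by
  rw [← pow_mul, mul_comm] at hx
  exact lt_of_le_of_lt hx (c.pow_lt h)

theorem P_sq_lt : 2 * p.P * (2 * p.P) < E.B := by
  refine c.lt_B (a := 4) ?_ (by norm_num)
  have h1 := Ctx.P_lt (p := p).le
  have h2 := c.two_le
  calc 2 * p.P * (2 * p.P) ≤ 2 ^ p.P * 2 ^ p.P * (2 ^ p.P * 2 ^ p.P) := by gcongr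
    _ = (2 ^ p.P) ^ 4 := by ring

theorem M_sq_lt : (2 ^ p.K + 1) * (2 ^ p.K + 1) < E.B := by
  refine lt_of_le_of_lt ?_ (c.pow_lt (a := 502) (by norm_num))
  have h : 2 ^ p.K + 1 ≤ 2 ^ (251 * p.P) := by
    rw [c.hK]
    exact Nat.pow_lt_pow_right (by norm_num) (Nat.mul_lt_mul_of_pos_right (by norm_num)
      (by have := c.P_pos; omega))
  calc _ ≤ 2 ^ (251 * p.P) * 2 ^ (251 * p.P) := Nat.mul_le_mul h h
    _ = 2 ^ (502 * p.P) := by rw [← pow_add]; congr 1; ring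

theorem M_lt : 2 ^ p.K + 1 < E.B := lt_of_le_of_lt (Nat.le_mul_self _) c.M_sq_lt

theorem L_lt : 2 * p.P * p.N < E.B := by
  have := c.good.L_le
  rw [c.hL] at this
  omega

theorem P_le_L : 2 * p.P ≤ 2 * p.P * p.N := Nat.le_mul_of_pos_right _ c.N_pos

theorem N_le_L : 4 * p.N ≤ 2 * p.P * p.N := Nat.mul_le_mul_right _ (by have := c.P_pos; omega)

theorem n_lt : n < p.N := by rw [c.hN]; exact Nat.lt_two_pow_self

theorem k_lt : k < p.P := by rw [c.hP]; exact Nat.lt_two_pow_self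

end Ctx

/-! ### The inner FFT -/

theorem butterfly_inner (hP : p.P = 2 ^ k) {l : ℕ} (hl : l < k) {A : Type*} [CommRing A] (ξ : A)
    (f : ℕ → A) (q : ℕ) :
    butterfly p.P (2 * p.P) ξ l f q =
      if q % (p.P / 2 ^ l) < p.P / 2 ^ l / 2 then f q + f (q + p.P / 2 ^ l / 2)
      else (f (q - p.P / 2 ^ l / 2) - f q) *
        ξ ^ (2 * 2 ^ l * (q % (p.P / 2 ^ l) - p.P / 2 ^ l / 2)) := by
  have h1 : Nat.log 2 (2 * p.P) = k + 1 := by rw [hP, ← pow_succ', Nat.log_pow (by norm_num)]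
  have hp : 0 < p.P := by rw [hP]; positivity
  unfold butterfly
  simp only [h1, Nat.div_eq_of_lt (show l < k + 1 by omega), Nat.mod_eq_of_lt (show l < k + 1 by omega),
    pow_zero, Nat.div_one, min_eq_right (show p.P ≤ 2 * p.P by omega), Nat.div_self hp,
    Nat.mul_div_cancel _ hp]

theorem fftState_inner_succ (hP : p.P = 2 ^ k) {l : ℕ} (hl : l < k) {A : Type*} [CommRing A] (ξ : A)
    (f : ℕ → A) (q : ℕ) :
    fftState p.P (2 * p.P) 1 ξ f (l + 1) q =
      butterfly p.P (2 * p.P) ξ l (fftState p.P (2 * p.P) 1 ξ f l) q := by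
  rw [fftState_succ, if_neg]
  rintro ⟨h, -⟩
  rw [hP, ← pow_succ', Nat.log_pow (by norm_num), Nat.mod_eq_of_lt (by omega)] at h
  omega

theorem add_half_lt {W h P b i : ℕ} (hW : W = 2 * h) (hP : P = W * b) (hi : i < P)
    (hih : i % W < h) : i + h < P := by
  have h0 : 0 < W := by omega
  have h1 : i / W < b := Nat.div_lt_of_lt_mul (hP ▸ hi)
  have h2 := Nat.div_add_mod i W
  have h3 : W * (i / W) + W ≤ P := by
    rw [hP, ← Nat.mul_succ]; exact Nat.mul_le_mul_left _ h1
  omega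

theorem val_add_mod {M : ℕ} (x y : ZMod (M + 1)) : (x.val + y.val) % (M + 1) = (x + y).val :=
  (ZMod.val_add x y).symm

theorem val_sub_mod {M : ℕ} (x y : ZMod (M + 1)) :
    (((x.val + (M + 1) - y.val : ℕ)) : ZMod (M + 1)) = x - y := by
  have := ZMod.val_lt y
  rw [Nat.cast_sub (by omega), Nat.cast_add, ZMod.natCast_self, ZMod.natCast_zmod_val,
    ZMod.natCast_zmod_val, add_zero]

theorem mod_eq_val {M a : ℕ} {x : ZMod (M + 1)} (h : (a : ZMod (M + 1)) = x) :
    a % (M + 1) = x.val := by rw [← h, ZMod.val_natCast]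

end FR.Prog

namespace FR.Prog

open LogRAM LogRAM.Stmt

variable {E : Env} {p : Params} {m k n : ℕ}

theorem theta_two (c : Ctx E p m k n) : p.theta ^ (2 * p.P) = 1 := by
  rw [mul_comm, pow_mul, c.hP, Params.theta_pow c.hP c.dvd_K]; simp

/-- One level of the inner FFT, from array `F` into the buffer. -/
theorem innerLevel_spec (c : Ctx E p m k n) {F : ℕ} (hF : 12 ≤ F) {sv : ℕ}
    {ξ : p.Res} (hξ : ξ = p.theta ^ sv) (f : ℕ → p.Res) {l s : ℕ} (hl : l < k) {st : St}
    (hb : Base p m k n st) (hf : ∀ i < p.P, st.a F i = (f i).val)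
    (h46 : st.v 46 = p.P / 2 ^ l) (h44 : st.v 44 = 2 * 2 ^ l * sv) :
    E.wpt (loop 47 vP (
      set 48 (x 47 % x 46) ;;
      ifz (x 48 + 1 - x 46 / 2)
        (store 11 (x 47) ((.load F (x 47) + .load F (x 47 + x 46 / 2)) % vM))
        (set 49 (x 44 * (x 48 - x 46 / 2) % vJ) ;;
          store 11 (x 47)
            ((.load F (x 47 - x 46 / 2) + vM - .load F (x 47)) * .load 2 (x 49) % vM))))
      (100 * p.P)
      (fun _ st' => Frame 47 [11] st st' ∧
        ∀ i < p.P, st'.a 11 i = (butterfly p.P (2 * p.P) ξ l f i).val) s st := by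
  have hP := c.P_pos
  have hPL := c.P_le_L
  have hLB := c.L_lt
  obtain ⟨h, W, hW, hWh, hPW, hh⟩ : ∃ h W, p.P / 2 ^ l = W ∧ W = 2 * h ∧ p.P = W * 2 ^ l ∧ 0 < h := by
    refine ⟨2 ^ (k - l - 1), 2 ^ (k - l), ?_, ?_, ?_, by positivity⟩
    · rw [c.hP, Nat.pow_div hl.le (by norm_num)]
    · rw [← pow_succ']; congr 1; omega
    · rw [c.hP, ← pow_add]; congr 1; omega
  have hWP : W ≤ p.P := hW ▸ Nat.div_le_self _ _
  have hW2 : W / 2 = h := by omega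
  refine Env.wpt_fill c.good (n := p.P) (k := 47) (D := 11) (Ds := [11])
    (T := 60) (fun i => (butterfly p.P (2 * p.P) ξ l f i).val) (by omega) le_rfl ?_ ?_ ?_ ?_
  · intro st' hfr
    simp [(hb.frame hfr (by norm_num) (by decide)).vars]
  · intro i hi t _ st' hv hfr hz
    have hb' := hb.frame hfr (by norm_num) (by decide)
    have h46' : st'.v 46 = W := by rw [hfr.v 46 (by norm_num), h46, hW]
    have h44' : st'.v 44 = 2 * 2 ^ l * sv := by rw [hfr.v 44 (by norm_num), h44]
    have hF' : ∀ i < p.P, st'.a F i = (f i).val := by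
      rw [hfr.a F (by simp; omega)]; exact hf
    refine Env.wpt_body c.good (Nat.le_of_ble_eq_true rfl) ?_
    have hbf := butterfly_inner c.hP hl ξ f i
    rw [hW, hW2] at hbf
    rw [hbf]
    simp [Stmt.wp, hv, hb'.vars, h46', h44', c.hacc, hW2, Frame.refl]
    have hM := c.M_lt
    have hlt : ∀ a, a % (2 ^ p.K + 1) < E.B := fun a => (Nat.mod_lt _ (by positivity)).trans hM
    have hiW := Nat.mod_lt i (show 0 < W by omega)
    refine ⟨by omega, by omega, fun h0 => ?_, fun h0 => ?_⟩
    · have h1 := add_half_lt hWh hPW hi (by omega)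
      refine ⟨⟨by omega, by omega⟩, by omega, hlt _, ?_⟩
      rw [if_pos (by omega), hF' _ hi, hF' _ h1, val_add_mod]
    · have h1 : i - h < p.P := by omega
      have h2 := Nat.mod_lt (2 * 2 ^ l * sv * (i % W - h)) (show 0 < 2 * p.P by omega)
      refine ⟨by omega, by omega, ⟨⟨by omega, by omega⟩, by omega⟩, by omega, hlt _, ?_⟩
      rw [if_neg (by omega), hF' _ hi, hF' _ h1, hb'.pow _ h2.le]
      congr 1
      refine mod_eq_val ?_
      rw [Nat.cast_mul, val_sub_mod, ZMod.natCast_zmod_val, ← pow_eq_pow_mod _ (theta_two c), hξ,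
        ← pow_mul]
      congr 2
      ring
  · have : (vP.code 0).length = 0 := rfl
    rw [this]; nlinarith
  · exact fun t _ st' h1 h2 => ⟨h1, h2⟩

/-- Extension of a monotone sequence of times. -/
theorem exists_monotone_extend {τ : ℕ → ℕ} (hτ : Monotone τ) {l t : ℕ} (ht : τ l ≤ t) :
    ∃ τ' : ℕ → ℕ, Monotone τ' ∧ (∀ i ≤ l, τ' i = τ i) ∧ τ' (l + 1) = t := by
  refine ⟨fun i => if i ≤ l then τ i else t, fun i j hij => ?_, fun i hi => if_pos hi, ?_⟩
  · dsimp only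
    split_ifs with h1 h2 h2
    · exact hτ hij
    · exact (hτ h1).trans ht
    · omega
    · exact le_rfl
  · simp

theorem innerFFT_spec (c : Ctx E p m k n) {F : ℕ} (hF : 12 ≤ F) (hF' : F < 24) {se : Exp} {sv : ℕ}
    (hse : ∀ st, Base p m k n st → se.Ok E st ∧ se.val st = sv) 
    (hlen : ((2 * Exp.load 1 (x 45) * se).code 0).length ≤ 10)
    (hsv : sv < 2 * p.P) {ξ : p.Res} (hξ : ξ = p.theta ^ sv) (g : ℕ → p.Res) {s : ℕ} {st : St}
    (hb : Base p m k n st) (hg : ∀ i < p.P, st.a F i = (g i).val) :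
    E.wpt (innerFFTCode F se) (600 * (p.P * (k + 1)))
      (fun t st' => p.PassesInnerFFT E.σ s t ξ g ∧ Frame 44 [11, F] st st' ∧
        ∀ i < p.P, st'.a F i = (fftState p.P (2 * p.P) 1 ξ g k i).val) s st := by
  have hP := c.P_pos
  have hPL := c.P_le_L
  have hLB := c.L_lt
  have hNL := c.N_le_L
  have hkn := c.hkn
  have hnN := c.n_lt
  have hkP := c.k_lt
  have hlog : Nat.log 2 p.P = k := by rw [c.hP, Nat.log_pow (by norm_num)]
  have hPN : p.P ≤ p.N := by
    rw [c.hP, c.hN]; exact Nat.pow_le_pow_right (by norm_num) (by omega)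
  have hD : 0 ∉ [11, F] ∧ 1 ∉ [11, F] ∧ 2 ∉ [11, F] := by simp; omega
  refine Env.wpt_of_rep fun hrep _ => ?_
  refine Env.wpt_mono (Env.wpt_loop c.good (n := k) (T := 300 * p.P)
    (fun l t st' => (∃ τ : ℕ → ℕ, Monotone τ ∧ s ≤ τ 0 ∧ τ l ≤ t ∧ ∀ l' ≤ l,
        ∃ b, ∀ i < p.P, (E.σ (τ l')).mem (b + i) = (fftState p.P (2 * p.P) 1 ξ g l' i).val) ∧
      Frame 44 [11, F] st st' ∧
      ∀ i < p.P, st'.a F i = (fftState p.P (2 * p.P) 1 ξ g l i).val)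
    (by omega) ?_ ?_ ?_ ?_ (fun t _ st' h _ => h)) ?_ ?_
  · rintro l t u st' htu ⟨⟨τ, h1, h2, h3, h4⟩, h⟩
    exact ⟨⟨τ, h1, h2, h3.trans htu, h4⟩, h⟩
  · refine ⟨⟨fun _ => s, monotone_const, le_rfl, le_rfl, fun l' hl' => ?_⟩, ?_, hg⟩
    · obtain rfl : l' = 0 := by omega
      refine ⟨104 + F * E.L, fun i hi => ?_⟩
      rw [hrep.arr F hF' i (by rw [c.hL]; omega)]
      exact hg i hi
    · simp [Frame.refl]
  · rintro l _ t st' ⟨-, h, -⟩ _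
    simp [(hb.frame h (by norm_num) hD).vars]
  · rintro l hl t ht st' hv ⟨⟨τ, hτ1, hτ2, hτ3, hτ4⟩, hfr, hst⟩
    have hb' := hb.frame hfr (by norm_num) hD
    obtain ⟨se1, se2⟩ := hse _ (hb'.frame (st' := st'.set 46 (p.P / 2 ^ l)) (D := []) (y := 44)
      (by simp [Frame.refl]) (by norm_num) (by simp))
    have h2l : 2 ^ l ≤ p.P := by rw [c.hP]; exact Nat.pow_le_pow_right (by norm_num) hl.le
    refine Env.wpt_cons c.good (n := 240 * p.P) (by change 4 + _ ≤ _; omega) ?_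
    simp [Stmt.wp, hv, hb'.vars, c.hacc, hb'.two l (by omega)]
    refine ⟨by omega, lt_of_le_of_lt (Nat.div_le_self _ _) (by omega), fun u1 hu1 => ?_⟩
    refine Env.wpt_cons c.good (n := 220 * p.P)
      (by simp only [Stmt.len]; omega) ?_
    simp [Stmt.wp, hv, c.hacc, hb'.two l (by omega), se1, se2]
    refine ⟨by omega, lt_of_le_of_lt (Nat.mul_le_mul (show 2 * 2 ^ l ≤ 2 * p.P by omega) hsv.le)
      c.P_sq_lt, fun u2 hu2 => ?_⟩
    set st1 := (st'.set 46 (p.P / 2 ^ l)).set 44 (2 * 2 ^ l * sv) with hst1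
    have hfr1 : Frame 44 [11, F] st' st1 := by simp [hst1, Frame.refl]
    have hb1 := hb'.frame hfr1 (by norm_num) hD
    refine Env.wpt_seq (n := 100 * p.P) (n' := 100 * p.P) (Env.wpt_mono (innerLevel_spec c hF hξ
      (fftState p.P (2 * p.P) 1 ξ g l) hl hb1 hst (by simp [hst1]) (by simp [hst1])) le_rfl ?_)
      (by omega)
    rintro u3 st2 hu3 _ _ ⟨hfr2, hst2⟩ -
    have hfr2' : Frame 44 [11, F] st1 st2 := hfr2.mono (by norm_num) (by simp)
    have hb2 := hb1.frame hfr2' (by norm_num) hD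
    refine Env.wpt_mono (Env.wpt_fill c.good (n := p.P) (k := 47) (D := F) (Ds := [F]) (T := 20)
      (K := 100 * p.P)
      (Q := fun _ st3 => Frame 47 [F] st2 st3 ∧
        ∀ i < p.P, st3.a F i = (fftState p.P (2 * p.P) 1 ξ g (l + 1) i).val)
      (fun i => (fftState p.P (2 * p.P) 1 ξ g (l + 1) i).val) (by omega) le_rfl ?_ ?_ ?_ ?_) le_rfl ?_
    · intro st3 hfr3
      simp [(hb2.frame hfr3 (by norm_num) (by simp; omega)).vars]
    · intro i hi u4 _ st3 hv3 hfr3 _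
      refine Env.wpt_body c.good (Nat.le_of_ble_eq_true rfl) ?_
      have h11 : st3.a 11 i = (fftState p.P (2 * p.P) 1 ξ g (l + 1) i).val := by
        rw [hfr3.a 11 (by simp; omega), hst2 i hi, fftState_inner_succ c.hP hl]
      simp [Stmt.wp, hv3, c.hacc, h11, Frame.refl]
      exact ⟨by omega, (ZMod.val_lt _).trans c.M_lt⟩
    · have : (vP.code 0).length = 0 := rfl
      rw [this]; nlinarith
    · exact fun _ _ st3 h3 h3' => ⟨h3, h3'⟩
    · rintro u4 st3 hu4 hrep4 _ ⟨hfr3, hst3⟩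
      obtain ⟨τ', k1, k2, k3⟩ := exists_monotone_extend hτ1 (l := l) (t := u4) (by omega)
      refine ⟨?_, ⟨τ', k1, by rw [k2 0 (by omega)]; exact hτ2, k3.le, fun l' hl' => ?_⟩, ?_, hst3⟩
      · rw [hfr3.v 45 (by norm_num), hfr2.v 45 (by norm_num)]
        simp [hst1, hv]
      · rcases Nat.lt_or_ge l l' with h | h
        · obtain rfl : l' = l + 1 := by omega
          refine ⟨104 + F * E.L, fun i hi => ?_⟩
          rw [k3, hrep4.arr F hF' i (by rw [c.hL]; omega)]
          exact hst3 i hi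
        · rw [k2 l' h]
          exact hτ4 l' h
      · exact (hfr.trans hfr1).trans (hfr2'.trans (hfr3.mono (by norm_num) (by simp)))
  · have : (vlP.code 0).length = 0 := rfl
    rw [this]
    calc (k + 1) * (300 * p.P + 0 + 4) ≤ (k + 1) * (600 * p.P) := Nat.mul_le_mul_left _ (by omega)
      _ = 600 * (p.P * (k + 1)) := by ring
  · rintro t st' _ _ _ ⟨⟨τ, h1, h2, h3, h4⟩, h5, h6⟩
    exact ⟨⟨τ, h1, h2, by rwa [hlog], by rwa [hlog]⟩, h5, h6⟩

theorem weight_spec (c : Ctx E p m k n) {F A o e : ℕ} (hFA : A ≠ F) (hF2 : 12 ≤ F) (ho : o < 47)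
    (he : e < 2) {u : ℕ → ℤ} {s : ℕ} {st : St} (hb : Base p m k n st)
    (ho' : st.v o + 2 * p.P ≤ 2 * p.P * p.N)
    (hu : ∀ j < p.P, (st.a A (st.v o + 2 * j + e) : ℤ) = u j + 2 ^ p.H) :
    E.wpt (weightCode F A o e) (100 * p.P) (fun _ st' => Frame 47 [F] st st' ∧
      ∀ j < p.P, st'.a F j = ((u j : p.Res) * p.theta ^ j).val) s st := by
  have hP := c.P_pos
  have hPL := c.P_le_L
  have hLB := c.L_lt
  refine Env.wpt_fill c.good (n := p.P) (k := 47) (D := F) (Ds := [F]) (T := 60)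
    (fun j => ((u j : p.Res) * p.theta ^ j).val) (by omega) le_rfl ?_ ?_ ?_ ?_
  · intro st' hfr
    simp [(hb.frame hfr (by norm_num) (by simp; omega)).vars]
  · intro j hj t _ st' hv hfr _
    have hb' := hb.frame hfr (by norm_num) (by simp; omega)
    have ho1 : st'.v o = st.v o := hfr.v o ho
    have hA1 : st'.a A = st.a A := hfr.a A (by simp [hFA])
    refine Env.wpt_body c.good (Nat.le_of_ble_eq_true rfl) ?_
    have hM := c.M_lt
    have hlt : ∀ a, a % (2 ^ p.K + 1) < E.B := fun a => (Nat.mod_lt _ (by positivity)).trans hM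
    simp [Stmt.wp, hv, hb'.vars, c.hacc, ho1, hA1, hb'.pow j (by omega), Frame.refl, hlt]
    refine ⟨by omega, by omega, ?_⟩
    congr 1
    refine mod_eq_val ?_
    rw [Nat.cast_mul, ZMod.natCast_zmod_val, Nat.cast_sub, Nat.cast_add,
      ZMod.natCast_self, add_zero]
    · congr 1
      have h1 := congrArg (Int.cast : ℤ → p.Res) (hu j hj)
      push_cast at h1 ⊢
      rw [h1]; ring
    · have : 2 ^ p.H ≤ 2 ^ p.K := Nat.pow_le_pow_right (by norm_num) (by rw [c.hH, c.hK]; omega)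
      omega
  · have : (vP.code 0).length = 0 := rfl
    rw [this]; nlinarith
  · exact fun t _ st' h1 h2 => ⟨h1, h2⟩

theorem innerFFT_def (c : Ctx E p m k n) (u : ℕ → ℤ) (i : ℕ) : p.innerFFT u i =
    fftState p.P (2 * p.P) 1 p.theta (fun j => u j * p.theta ^ j) k (bitRev k i) := by
  have hlog : Nat.log 2 p.P = k := by rw [c.hP, Nat.log_pow (by norm_num)]
  rw [Params.innerFFT, fft, hlog]

theorem pointwise_spec (c : Ctx E p m k n) {u v : Fin 2 → ℕ → ℤ} {s : ℕ} {st : St}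
    (hb : Base p m k n st)
    (h12 : ∀ i < p.P, st.a 12 (bitRev k i) = (p.innerFFT (u 0) i).val)
    (h13 : ∀ i < p.P, st.a 13 (bitRev k i) = (p.innerFFT (u 1) i).val)
    (h14 : ∀ i < p.P, st.a 14 (bitRev k i) = (p.innerFFT (v 0) i).val)
    (h15 : ∀ i < p.P, st.a 15 (bitRev k i) = (p.innerFFT (v 1) i).val) :
    E.wpt pointwiseCode (200 * p.P) (fun t st' => Frame 47 [16, 17] st st' ∧
      (∀ e e', ∀ i < p.P, ∃ τ, s ≤ τ ∧ τ ≤ t ∧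
        ExecutesMul E.prog (E.σ τ) (p.innerFFT (u e) i).val (p.innerFFT (v e') i).val) ∧
      (∀ i < p.P, st'.a 16 i = (p.pointwise u v 0 i).val) ∧
      ∀ i < p.P, st'.a 17 i = (p.pointwise u v 1 i).val) s st := by
  have hP := c.P_pos
  have hPL := c.P_le_L
  have hLB := c.L_lt
  have hkn := c.hkn
  refine Env.wpt_mono (Env.wpt_loop c.good (n := p.P) (T := 120)
    (fun l t st' => Frame 47 [16, 17] st st' ∧
      (∀ e e', ∀ i < l, ∃ τ, s ≤ τ ∧ τ ≤ t ∧
        ExecutesMul E.prog (E.σ τ) (p.innerFFT (u e) i).val (p.innerFFT (v e') i).val) ∧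
      (∀ i < l, st'.a 16 i = (p.pointwise u v 0 i).val) ∧
      ∀ i < l, st'.a 17 i = (p.pointwise u v 1 i).val) (by omega) ?_ ?_ ?_ ?_
      (fun t _ st' h _ => h)) ?_ (fun _ _ _ _ _ h => h)
  · rintro i t w st' htw ⟨h1, h2, h3⟩
    refine ⟨h1, fun e e' i hi => ?_, h3⟩
    obtain ⟨τ, h⟩ := h2 e e' i hi
    exact ⟨τ, h.1, h.2.1.trans htw, h.2.2⟩
  · simp [Frame.refl]
  · rintro l _ t st' ⟨h, -⟩ _
    simp [(hb.frame h (by norm_num) (by decide)).vars]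
  · rintro i hi t ht st' hv ⟨hfr, hmul, h16, h17⟩
    have hb' := hb.frame hfr (by norm_num) (by decide)
    have hr : bitRev k i < p.P := c.hP ▸ bitRev_lt k i
    have hrev : st'.a 0 (p.P + i) = bitRev k i := by
      rw [c.hP]; exact hb'.rev k (by omega) i (by rw [← c.hP]; exact hi)
    have hM := c.M_lt
    have hM2 := c.M_sq_lt
    have hv1 : ∀ z : p.Res, z.val < E.B := fun z => (ZMod.val_lt z).trans hM
    have hlt : ∀ a, a % (2 ^ p.K + 1) < E.B := fun a => (Nat.mod_lt _ (by positivity)).trans hM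
    have hv2 : ∀ z z' : p.Res, z.val * z'.val < E.B := fun z z' =>
      (Nat.mul_lt_mul'' (ZMod.val_lt z) (ZMod.val_lt z')).trans hM2
    refine Env.wpt_cons' c.good (n := 60) (R := fun st1 => st1.v 47 = i ∧ Frame 47 [16, 17] st' st1 ∧
      st1.a = st'.a ∧ st1.v 52 = (p.innerFFT (u 0) i).val ∧ st1.v 53 = (p.innerFFT (u 1) i).val ∧
      st1.v 54 = (p.innerFFT (v 0) i).val ∧ st1.v 55 = (p.innerFFT (v 1) i).val)
      (Nat.le_of_ble_eq_true rfl) ?_ ?_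
    · simp [Stmt.wp, hv, hb'.vars, c.hacc, hrev, hfr.a 12, hfr.a 13, hfr.a 14, hfr.a 15, h12 i hi,
        h13 i hi, h14 i hi, h15 i hi, hv1, Frame.refl]
      have := c.N_le_L
      have := c.N_pos
      have : p.P ≤ p.N := by
        rw [c.hP, c.hN]; exact Nat.pow_le_pow_right (by norm_num) (by omega)
      omega
    rintro t1 ht1 st1 ⟨v47, fr1, a1, v52, v53, v54, v55⟩
    have hb1 := hb'.frame fr1 (by norm_num) (by decide)
    refine Env.wpt_seq (n := 2) (n' := 58) (Env.wpt_set_mul c.good ?_ ?_) (by norm_num)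
    · simp [v52, v54, hv2]
    intro t2 ht2 m2 _
    refine Env.wpt_seq (n := 2) (n' := 56) (Env.wpt_set_mul c.good ?_ ?_) (by norm_num)
    · simp [v52, v53, v54, v55, hv2]
    intro t3 ht3 m3 _
    refine Env.wpt_seq (n := 2) (n' := 54) (Env.wpt_set_mul c.good ?_ ?_) (by norm_num)
    · simp [v52, v53, v54, v55, hv2]
    intro t4 ht4 m4 _
    refine Env.wpt_seq (n := 2) (n' := 52) (Env.wpt_set_mul c.good ?_ ?_) (by norm_num)
    · simp [v52, v53, v54, v55, hv2]
    intro t5 ht5 m5 _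
    simp [v52, v53, v54, v55] at m2 m3 m4 m5
    refine Env.wpt_mono (Env.wpt_of_wp c.good _ (Q := fun st'' => st''.v 47 = i ∧
      Frame 47 [16, 17] st' st'' ∧ st''.a 16 = Function.update (st'.a 16) i (p.pointwise u v 0 i).val ∧
      st''.a 17 = Function.update (st'.a 17) i (p.pointwise u v 1 i).val) ?_)
      (Nat.le_of_ble_eq_true rfl) ?_
    · simp [Stmt.wp, v47, v52, v53, v54, v55, hb1.vars, c.hacc, fr1, a1, hlt]
      refine ⟨by omega, ?_, ?_⟩
      · congr 1
        refine mod_eq_val ?_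
        rw [Nat.cast_sub, Nat.cast_add, ZMod.natCast_self, add_zero, ZMod.natCast_mod, Nat.cast_mul,
          Nat.cast_mul]
        · simp only [ZMod.natCast_zmod_val]
          rfl
        · have := Nat.mod_lt ((p.innerFFT (u 1) i).val * (p.innerFFT (v 1) i).val)
            (show 0 < 2 ^ p.K + 1 by positivity)
          omega
      · congr 1
        refine mod_eq_val ?_
        rw [Nat.cast_add, Nat.cast_mul, Nat.cast_mul]
        simp only [ZMod.natCast_zmod_val]
        rfl
    · rintro t6 st6 ht6 _ _ ⟨k1, k2, k3, k4⟩
      refine ⟨k1, (Frame.set_iff le_rfl).2 (hfr.trans k2), fun e e' i' hi' => ?_, fun i' hi' => ?_,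
        fun i' hi' => ?_⟩
      · rcases Nat.lt_succ_iff_lt_or_eq.1 hi' with h | rfl
        · obtain ⟨τ, h1, h2, h3⟩ := hmul e e' i' h
          exact ⟨τ, h1, by omega, h3⟩
        · fin_cases e <;> fin_cases e'
          · exact ⟨t1, by omega, by omega, m2⟩
          · exact ⟨t3, by omega, by omega, m4⟩
          · exact ⟨t4, by omega, by omega, m5⟩
          · exact ⟨t2, by omega, by omega, m3⟩
      · rw [St.set_a, k3, Function.update_apply]
        split_ifs with h
        · rw [h]
        · exact h16 i' (by omega)
      · rw [St.set_a, k4, Function.update_apply]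
        split_ifs with h
        · rw [h]
        · exact h17 i' (by omega)
  · have : (vP.code 0).length = 0 := rfl
    rw [this]; nlinarith

theorem Ctx.K_ne_zero (c : Ctx E p m k n) : p.K ≠ 0 := by
  have := c.P_pos
  have := c.hK
  omega

theorem Ctx.P_dvd_pow_K (c : Ctx E p m k n) : p.P ∣ 2 ^ p.K := by
  have := c.k_lt
  have := c.hK
  rw [c.hP]; exact pow_dvd_pow _ (by omega)

theorem Ctx.cast_inv (c : Ctx E p m k n) :
    ((2 ^ p.K + 1 - 2 ^ p.K / p.P : ℕ) : p.Res) = (p.P : p.Res)⁻¹ := by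
  have hco : Nat.Coprime p.P (2 ^ p.K + 1) := by
    rw [c.hP]
    refine Nat.Coprime.pow_left _ (Nat.coprime_two_left.2 ?_)
    exact (Nat.even_pow.2 ⟨even_two, c.K_ne_zero⟩).add_one
  have h1 := ZMod.coe_mul_inv_eq_one p.P hco
  have h2 : ((2 ^ p.K / p.P : ℕ) : p.Res) * p.P = -1 := by
    rw [← Nat.cast_mul, Nat.div_mul_cancel c.P_dvd_pow_K, eq_neg_iff_add_eq_zero]
    exact_mod_cast ZMod.natCast_self (2 ^ p.K + 1)
  rw [Nat.cast_sub ((Nat.div_le_self _ _).trans (Nat.le_succ _)), ZMod.natCast_self, zero_sub]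
  linear_combination ((2 ^ p.K / p.P : ℕ) : p.Res) * h1 - (p.P : p.Res)⁻¹ * h2

theorem valMinAbs_cases {M : ℕ} (z : ZMod (M + 1)) :
    z.valMinAbs = if z.val ≤ (M + 1) / 2 then (z.val : ℤ) else z.val - (M + 1 : ℕ) := by
  rw [ZMod.valMinAbs_def_pos]

theorem round_spec (c : Ctx E p m k n) {G A e : ℕ} (hGA : A ≠ G) (hA : 3 ≤ A)
    (he : e < 2) {g : ℕ → p.Res} {w : ℕ → ℤ} {s : ℕ} {st : St} (hb : Base p m k n st)
    (ho : st.v 42 + 2 * p.P ≤ 2 * p.P * p.N)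
    (hg : ∀ j < p.P, st.a G (bitRev k j) = (g j).val)
    (hw : ∀ j < p.P, (g j * p.theta ^ (2 * p.P - j) * (p.P : p.Res)⁻¹).valMinAbs = w j)
    (hfit : ∀ j < p.P, |w j| ≤ 2 ^ p.H * 2 ^ p.S) :
    E.wpt (roundCode G A e) (100 * p.P) (fun _ st' => Frame 47 [A] st st' ∧
      (∀ j < p.P, (st'.a A (st.v 42 + 2 * j + e) : ℤ) = w j / 2 ^ p.S + 2 ^ p.H) ∧
      ∀ i, (∀ j < p.P, i ≠ st.v 42 + 2 * j + e) → st'.a A i = st.a A i) s st := by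
  have hP := c.P_pos
  have hPL := c.P_le_L
  have hLB := c.L_lt
  have hkn := c.hkn
  have hM := c.M_lt
  refine Env.wpt_loop' c.good (n := p.P) (T := 60) (fun l st' => Frame 47 [A] st st' ∧
      (∀ j < l, (st'.a A (st.v 42 + 2 * j + e) : ℤ) = w j / 2 ^ p.S + 2 ^ p.H) ∧
      ∀ i, (∀ j < l, i ≠ st.v 42 + 2 * j + e) → st'.a A i = st.a A i)
    (by omega) ?_ ?_ ?_ ?_ (fun t _ st' h _ => h)
  · simp [Frame.refl]
  · rintro l _ st' ⟨h, -⟩ _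
    simp [(hb.frame h (by norm_num) (by simp; omega)).vars]
  · rintro j hj t _ st' hv ⟨hfr, h1, h2⟩
    have hb' := hb.frame hfr (by norm_num) (by simp; omega)
    have hrev : st'.a 0 (p.P + j) = bitRev k j := by
      rw [c.hP]; exact hb'.rev k (by omega) j (by rw [← c.hP]; exact hj)
    have hr : bitRev k j < p.P := c.hP ▸ bitRev_lt k j
    have hG1 : st'.a G (bitRev k j) = (g j).val := by
      rw [hfr.a G (by simp; omega), hg j hj]
    have ho1 : st'.v 42 = st.v 42 := hfr.v 42 (by norm_num)
    have hlt : ∀ a, a % (2 ^ p.K + 1) < E.B := fun a => (Nat.mod_lt _ (by positivity)).trans hM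
    set z := g j * p.theta ^ (2 * p.P - j) * (p.P : p.Res)⁻¹ with hz
    have hzv : ((g j).val * (p.theta ^ (2 * p.P - j)).val *
        (2 ^ p.K + 1 - 2 ^ p.K / p.P)) % (2 ^ p.K + 1) = z.val := by
      refine mod_eq_val ?_
      rw [Nat.cast_mul, Nat.cast_mul, c.cast_inv, ZMod.natCast_zmod_val, ZMod.natCast_zmod_val]
    have hwj := hw j hj
    rw [← hz, valMinAbs_cases] at hwj
    have hfj := abs_le.1 (hfit j hj)
    have hQ : (0 : ℤ) < 2 ^ p.S := by positivity
    have hbound : (w j / 2 ^ p.S + 2 ^ p.H) < E.B := by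
      have h3 : w j / 2 ^ p.S ≤ 2 ^ p.H := by
        calc w j / 2 ^ p.S ≤ (2 ^ p.H * 2 ^ p.S) / 2 ^ p.S := Int.ediv_le_ediv hQ hfj.2
          _ = 2 ^ p.H := Int.mul_ediv_cancel _ hQ.ne'
      have h4 : 2 ^ p.H + 2 ^ p.H < E.B := by
        have := c.pow_lt (a := 121) (by norm_num)
        have h5 : 2 ^ p.H + 2 ^ p.H ≤ 2 ^ (121 * p.P) := by
          rw [← two_mul, ← pow_succ', c.hH]; exact Nat.pow_le_pow_right (by norm_num) (by omega)
        omega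
      have h5 : ((2 ^ p.H + 2 ^ p.H : ℕ) : ℤ) < E.B := by exact_mod_cast h4
      push_cast at h5
      linarith
    have hshift : (w j + 2 ^ p.H * 2 ^ p.S) / 2 ^ p.S = w j / 2 ^ p.S + 2 ^ p.H :=
      Int.add_mul_ediv_right _ _ hQ.ne'
    have hfin : ∀ y : ℕ, (y : ℤ) = w j / 2 ^ p.S + 2 ^ p.H → y < E.B ∧
        (∀ j' < j + 1, (Function.update (st'.a A) (st.v 42 + 2 * j + e) y (st.v 42 + 2 * j' + e) : ℤ) =
          w j' / 2 ^ p.S + 2 ^ p.H) ∧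
        ∀ i, (∀ j' < j + 1, i ≠ st.v 42 + 2 * j' + e) →
          Function.update (st'.a A) (st.v 42 + 2 * j + e) y i = st.a A i := by
      intro y hy
      refine ⟨by rw [← hy] at hbound; exact_mod_cast hbound, fun j' hj' => ?_, fun i hi => ?_⟩
      · rw [Function.update_apply]
        split_ifs with h
        · obtain rfl : j' = j := by omega
          exact hy
        · exact h1 j' (by omega)
      · rw [Function.update_of_ne (hi j (by omega))]
        exact h2 i fun j' hj' => hi j' (by omega)
    refine Env.wpt_body c.good (Nat.le_of_ble_eq_true rfl) ?_
    have hPN : p.P ≤ p.N := by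
      rw [c.hP, c.hN]; exact Nat.pow_le_pow_right (by norm_num) (by omega)
    have hNL := c.N_le_L
    simp only [Stmt.wp]
    simp only [Exp.ok_mod, Exp.ok_mul, Exp.ok_load, Exp.ok_add, Exp.ok_var, Exp.val_add,
      Exp.val_mul, Exp.val_mod, Exp.val_load, Exp.val_sub, Exp.val_var, Exp.ok_sub, Exp.ok_div,
      Exp.val_div, hb'.vars, hv, hrev, hG1, c.hacc, hb'.pow (2 * p.P - j) (by omega), St.set_v,
      St.set_a, Exp.val_ofNat, Exp.ok_ofNat, Nat.mod_mul_mod, hzv, Exp.val_const, Exp.ok_const, ho1]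
    simp only [ne_eq, Nat.add_eq_zero_iff, pow_eq_zero_iff', OfNat.ofNat_ne_zero, false_and, not_false_eq_true,
      one_ne_zero, and_false, and_true, true_and, if_true, Nat.reduceEqDiff, if_false]
    refine ⟨by omega, (ZMod.val_lt z).trans hM, fun h0 => ?_, fun h0 => ?_⟩
    · rw [if_pos (by omega)] at hwj
      obtain ⟨y1, y2, y3⟩ := hfin ((z.val + 2 ^ p.H * 2 ^ p.S) / 2 ^ p.S) (by
        push_cast; rw [hwj]; exact hshift)
      refine ⟨by omega, y1, by simp [hv], ?_, ?_⟩
      · simpa using hfr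
      · simpa using ⟨fun j' hj' => y2 j' (by omega), fun i hi => y3 i fun j' hj' => hi j' (by omega)⟩
    · rw [if_neg (by omega)] at hwj
      obtain ⟨y1, y2, y3⟩ := hfin ((z.val + 2 ^ p.H * 2 ^ p.S - (2 ^ p.K + 1)) / 2 ^ p.S) (by
        rw [Int.natCast_div, Nat.cast_sub]
        · push_cast
          push_cast at hwj
          rw [← hshift, ← hwj]; congr 1; ring
        · zify; push_cast at hwj; linarith)
      refine ⟨by omega, y1, by simp [hv], ?_, ?_⟩
      · simpa using hfr
      · simpa using ⟨fun j' hj' => y2 j' (by omega), fun i hi => y3 i fun j' hj' => hi j' (by omega)⟩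
  · have : (vP.code 0).length = 0 := rfl
    rw [this]; nlinarith

end FR.Prog

namespace FR

theorem Params.PassesInnerFFT.mono {p : Params} {σ : ℕ → LogRAM.Config} {s s' t t' : ℕ} {ξ : p.Res}
    {g : ℕ → p.Res} (h : p.PassesInnerFFT σ s t ξ g) (hs : s' ≤ s) (ht : t ≤ t') :
    p.PassesInnerFFT σ s' t' ξ g := by
  obtain ⟨τ, h1, h2, h3, h4⟩ := h
  exact ⟨τ, h1, hs.trans h2, h3.trans ht, h4⟩

theorem Params.RingMul.mono {p : Params} {prog : LogRAM.Program} {σ : ℕ → LogRAM.Config}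
    {s s' t t' : ℕ} {u v y : Fin 2 → ℕ → ℤ} (h : p.RingMul prog σ s t u v y) (hs : s' ≤ s)
    (ht : t ≤ t') : p.RingMul prog σ s' t' u v y := by
  obtain ⟨t₁, t₂, h1, h2, h3, h4, h5, h6, h7, h8⟩ := h
  exact ⟨t₁, t₂, hs.trans h1, h2, h3.trans ht, fun e => (h4 e).mono hs le_rfl,
    fun e => (h5 e).mono hs le_rfl, h6, fun e => (h7 e).mono le_rfl ht, h8⟩

namespace Prog

open LogRAM LogRAM.Stmt

variable {E : Env} {p : Params} {m k n : ℕ}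

theorem transform_seq (c : Ctx E p m k n) {F A o e : ℕ} (hFA : A ≠ F) (hF : 12 ≤ F) (hF' : F < 24)
    (ho : o < 44) (he : e < 2) {u : ℕ → ℤ} {d : Stmt} {K K' s : ℕ} {st : St} {Q : ℕ → St → Prop}
    (hb : Base p m k n st) (ho' : st.v o + 2 * p.P ≤ 2 * p.P * p.N)
    (hu : ∀ j < p.P, (st.a A (st.v o + 2 * j + e) : ℤ) = u j + 2 ^ p.H)
    (hK : 700 * (p.P * (k + 1)) + K' ≤ K)
    (hd : ∀ t ≥ s, ∀ st', p.PassesInnerFFT E.σ s t p.theta (fun j => u j * p.theta ^ j) →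
      Frame 44 [11, F] st st' → (∀ i < p.P, st'.a F (bitRev k i) = (p.innerFFT u i).val) →
      E.wpt d K' Q t st') :
    E.wpt (weightCode F A o e ;; innerFFTCode F 1 ;; d) K Q s st := by
  have hPk : p.P ≤ p.P * (k + 1) := Nat.le_mul_of_pos_right _ (by omega)
  refine Env.wpt_seq (n := 100 * p.P) (n' := 600 * (p.P * (k + 1)) + K')
    (Env.wpt_mono (weight_spec c hFA hF (by omega) he hb ho' hu) le_rfl ?_) (by omega)
  rintro t1 st1 ht1 _ _ ⟨hf1, h1⟩ -
  have hb1 := hb.frame hf1 (by norm_num) (by simp; omega)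
  refine Env.wpt_seq (Env.wpt_mono (innerFFT_spec c hF hF' (se := 1) (sv := 1) (fun st' _ => ⟨trivial, rfl⟩)
    (Nat.le_of_ble_eq_true rfl) (by have := c.P_pos; omega) (pow_one _).symm _ hb1 h1) le_rfl ?_) le_rfl
  rintro t2 st2 ht2 _ _ ⟨hp, hf2, h2⟩ -
  refine hd t2 (by omega) st2 (hp.mono ht1 le_rfl)
    ((hf1.mono (by norm_num) (by simp)).trans hf2) fun i hi => ?_
  rw [h2 _ (c.hP ▸ bitRev_lt k i), innerFFT_def c]

theorem ringMul_spec (c : Ctx E p m k n) {X Z A : ℕ} (hX : X < 11) (hZ : Z < 11) (hA : 3 ≤ A)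
    (hA' : A < 11) {u v : Fin 2 → ℕ → ℤ} {s : ℕ} {st : St} (hb : Base p m k n st)
    (h40 : st.v 40 + 2 * p.P ≤ 2 * p.P * p.N) (h41 : st.v 41 + 2 * p.P ≤ 2 * p.P * p.N)
    (h42 : st.v 42 + 2 * p.P ≤ 2 * p.P * p.N)
    (hu : ∀ e : Fin 2, ∀ j < p.P, (st.a X (st.v 40 + 2 * j + e) : ℤ) = u e j + 2 ^ p.H)
    (hv : ∀ e : Fin 2, ∀ j < p.P, (st.a Z (st.v 41 + 2 * j + e) : ℤ) = v e j + 2 ^ p.H)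
    (hu' : ∀ e, ∀ j < p.P, |u e j| ≤ 2 ^ p.H) (hv' : ∀ e, ∀ j < p.P, |v e j| ≤ 2 ^ p.H)
    (hfit : ∀ e, ∀ j < p.P, |Params.prodCoeff p.P u v e j| ≤ 2 ^ p.H * 2 ^ p.S) :
    E.wpt (ringMulCode X Z A) (5000 * (p.P * (k + 1))) (fun t st' =>
      (∀ y : Fin 2 → ℕ → ℤ, (∀ e, ∀ j < p.P, y e j = Params.prodCoeff p.P u v e j / 2 ^ p.S) →
        p.RingMul E.prog E.σ s t u v y) ∧
      Frame 44 [11, 12, 13, 14, 15, 16, 17, A] st st' ∧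
      (∀ e : Fin 2, ∀ j < p.P, (st'.a A (st.v 42 + 2 * j + e) : ℤ) =
        Params.prodCoeff p.P u v e j / 2 ^ p.S + 2 ^ p.H) ∧
      ∀ i, (i < st.v 42 ∨ st.v 42 + 2 * p.P ≤ i) → st'.a A i = st.a A i) s st := by
  have hP := c.P_pos
  have hPk : p.P ≤ p.P * (k + 1) := Nat.le_mul_of_pos_right _ (by omega)
  have hlog : Nat.log 2 p.P = k := by rw [c.hP, Nat.log_pow (by norm_num)]
  have hbig : 4 * (p.P * p.P * 2 ^ (2 * p.H)) < 2 ^ p.K := by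
    have h1 := (Ctx.P_lt (p := p)).le
    have h2 : 4 ≤ 2 ^ (2 * p.P) := (Nat.pow_le_pow_right (by norm_num)
      (show 2 ≤ 2 * p.P by omega)).trans' (by norm_num)
    calc 4 * (p.P * p.P * 2 ^ (2 * p.H))
        ≤ 2 ^ (2 * p.P) * (2 ^ p.P * 2 ^ p.P * 2 ^ (2 * p.H)) := by gcongr
      _ = 2 ^ (244 * p.P) := by rw [c.hH, ← pow_add, ← pow_add, ← pow_add]; congr 1; ring
      _ < 2 ^ p.K := by rw [c.hK]; exact Nat.pow_lt_pow_right (by norm_num) (by omega)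
  unfold ringMulCode
  refine transform_seq c (u := u 0) (K' := 4300 * (p.P * (k + 1))) (by omega) (by norm_num)
    (by norm_num) (by norm_num) (by norm_num) hb h40 (by simpa using hu 0) (by omega) ?_
  intro t1 ht1 st1 pa1 f1 b1
  have hb1 := hb.frame f1 (by norm_num) (by simp)
  refine transform_seq c (u := u 1) (K' := 3600 * (p.P * (k + 1))) (by omega) (by norm_num)
    (by norm_num) (by norm_num) (by norm_num) hb1 ?_ ?_ (by omega) ?_
  · rwa [f1.v 40 (by norm_num)]
  · rw [f1.v 40 (by norm_num), f1.a X (by simp; omega)]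
    simpa using hu 1
  intro t2 ht2 st2 pa2 f2 b2
  have hb2 := hb1.frame f2 (by norm_num) (by simp)
  refine transform_seq c (u := v 0) (K' := 2900 * (p.P * (k + 1))) (by omega) (by norm_num)
    (by norm_num) (by norm_num) (by norm_num) hb2 ?_ ?_ (by omega) ?_
  · rwa [f2.v 41 (by norm_num), f1.v 41 (by norm_num)]
  · rw [f2.v 41 (by norm_num), f1.v 41 (by norm_num), f2.a Z (by simp; omega),
      f1.a Z (by simp; omega)]
    simpa using hv 0
  intro t3 ht3 st3 pa3 f3 b3
  have hb3 := hb2.frame f3 (by norm_num) (by simp)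
  refine transform_seq c (u := v 1) (K' := 2200 * (p.P * (k + 1))) (by omega) (by norm_num)
    (by norm_num) (by norm_num) (by norm_num) hb3 ?_ ?_ (by omega) ?_
  · rwa [f3.v 41 (by norm_num), f2.v 41 (by norm_num), f1.v 41 (by norm_num)]
  · rw [f3.v 41 (by norm_num), f2.v 41 (by norm_num), f1.v 41 (by norm_num),
      f3.a Z (by simp; omega), f2.a Z (by simp; omega), f1.a Z (by simp; omega)]
    simpa using hv 1
  intro t4 ht4 st4 pa4 f4 b4
  have hb4 := hb3.frame f4 (by norm_num) (by simp)
  refine Env.wpt_seq (n := 200 * p.P) (n' := 2000 * (p.P * (k + 1))) (Env.wpt_mono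
    (pointwise_spec c (u := u) (v := v) hb4 (fun i hi => ?_) (fun i hi => ?_) (fun i hi => ?_) b4)
    le_rfl ?_) (by omega)
  · rw [f4.a 12 (by simp), f3.a 12 (by simp), f2.a 12 (by simp), b1 i hi]
  · rw [f4.a 13 (by simp), f3.a 13 (by simp), b2 i hi]
  · rw [f4.a 14 (by simp), b3 i hi]
  rintro t5 st5 ht5 _ _ ⟨f5, mul, b5, b5'⟩ -
  have hb5 := hb4.frame f5 (by norm_num) (by simp)
  have hse : ∀ st', Base p m k n st' → (vJ - 1).Ok E st' ∧ (vJ - 1).val st' = 2 * p.P - 1 := by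
    intro st' h
    simp [h.vars]
  refine Env.wpt_seq (n := 600 * (p.P * (k + 1))) (n' := 1400 * (p.P * (k + 1))) (Env.wpt_mono
    (innerFFT_spec c (F := 16) (by norm_num) (by norm_num) hse
    (Nat.le_of_ble_eq_true rfl) (by omega) rfl _ hb5 b5) le_rfl ?_) (by omega)
  rintro t6 st6 ht6 _ _ ⟨pa6, f6, b6⟩ -
  have hb6 := hb5.frame f6 (by norm_num) (by simp)
  refine Env.wpt_seq (n := 600 * (p.P * (k + 1))) (n' := 800 * (p.P * (k + 1))) (Env.wpt_mono
    (innerFFT_spec c (F := 17) (by norm_num) (by norm_num) hse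
    (Nat.le_of_ble_eq_true rfl) (by omega) rfl (p.pointwise u v 1) hb6 (fun i hi => ?_)) le_rfl ?_)
    (by omega)
  · rw [f6.a 17 (by simp), b5' i hi]
  rintro t7 st7 ht7 _ _ ⟨pa7, f7, b7⟩ -
  have hb7 := hb6.frame f7 (by norm_num) (by simp)
  have e42 : st7.v 42 = st.v 42 := by
    rw [f7.v 42 (by norm_num), f6.v 42 (by norm_num), f5.v 42 (by norm_num), f4.v 42 (by norm_num),
      f3.v 42 (by norm_num), f2.v 42 (by norm_num), f1.v 42 (by norm_num)]
  have eA : st7.a A = st.a A := by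
    rw [f7.a A (by simp; omega), f6.a A (by simp; omega), f5.a A (by simp; omega),
      f4.a A (by simp; omega), f3.a A (by simp; omega), f2.a A (by simp; omega),
      f1.a A (by simp; omega)]
  have hmin : ∀ e, ∀ j < p.P, (p.innerProduct u v e j).valMinAbs = Params.prodCoeff p.P u v e j :=
    fun e j hj => Params.valMinAbs_innerProduct c.hP c.dvd_K hbig hu' hv' e hj
  refine Env.wpt_seq (n := 100 * p.P) (n' := 100 * p.P) (Env.wpt_mono (round_spec c (G := 16)
    (g := fft p.P (2 * p.P) 1 (p.theta ^ (2 * p.P - 1)) (p.pointwise u v 0))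
    (w := Params.prodCoeff p.P u v 0) (by omega) hA (by norm_num) hb7 (by rwa [e42]) (fun j hj => ?_)
    (hmin 0) (hfit 0)) le_rfl ?_) (by omega)
  · rw [f7.a 16 (by simp), b6 _ (c.hP ▸ bitRev_lt k j), fft, hlog]
  rintro t8 st8 ht8 _ _ ⟨f8, b8, b8'⟩ -
  have hb8 := hb7.frame f8 (by norm_num) (by simp; omega)
  refine Env.wpt_mono (round_spec c (G := 17)
    (g := fft p.P (2 * p.P) 1 (p.theta ^ (2 * p.P - 1)) (p.pointwise u v 1))
    (w := Params.prodCoeff p.P u v 1) (by omega) hA (by norm_num) hb8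
    (by rwa [f8.v 42 (by norm_num), e42]) (fun j hj => ?_)
    (hmin 1) (hfit 1)) le_rfl ?_
  · rw [f8.a 17 (by simp; omega), b7 _ (c.hP ▸ bitRev_lt k j), fft, hlog]
  rintro t9 st9 ht9 _ _ ⟨f9, b9, b9'⟩
  rw [f8.v 42 (by norm_num), e42] at b9 b9'
  rw [e42] at b8 b8'
  refine ⟨fun y hy => ⟨t4, t5, by omega, by omega, by omega, ?_, ?_, ?_, ?_, ?_⟩, ?_, ?_, ?_⟩
  · intro e
    fin_cases e
    · exact pa1.mono (by omega) (by omega)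
    · exact pa2.mono (by omega) (by omega)
  · intro e
    fin_cases e
    · exact pa3.mono (by omega) (by omega)
    · exact pa4.mono (by omega) (by omega)
  · exact mul
  · intro e
    fin_cases e
    · exact pa6.mono (by omega) (by omega)
    · exact pa7.mono (by omega) (by omega)
  · intro e j hj
    rw [hmin e j hj, hy e j hj, abs_le]
    have h0 : (0 : ℤ) < 2 ^ p.S := by positivity
    have h1 := Int.mul_ediv_add_emod (Params.prodCoeff p.P u v e j) (2 ^ p.S)
    have h2 := Int.emod_nonneg (Params.prodCoeff p.P u v e j) h0.ne'
    have h3 := Int.emod_lt_of_pos (Params.prodCoeff p.P u v e j) h0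
    rw [mul_comm] at h1
    constructor <;> linarith
  · have q : ∀ {j D a b}, Frame j D a b → 44 ≤ j → D ⊆ [11, 12, 13, 14, 15, 16, 17, A] →
        Frame 44 [11, 12, 13, 14, 15, 16, 17, A] a b := fun h h1 h2 => h.mono h1 h2
    exact (((((((((q f1 (by norm_num) (by simp)).trans (q f2 (by norm_num) (by simp))).trans
      (q f3 (by norm_num) (by simp))).trans (q f4 (by norm_num) (by simp))).trans
      (q f5 (by norm_num) (by simp))).trans (q f6 (by norm_num) (by simp))).trans
      (q f7 (by norm_num) (by simp))).trans (q f8 (by norm_num) (by simp))).trans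
      (q f9 (by norm_num) (by simp)))
  · intro e j hj
    fin_cases e
    · rw [b9']
      · exact b8 j hj
      · intro j' _
        simp
        omega
    · exact b9 j hj
  · intro i hi
    rw [b9' i (fun j hj => by omega), b8' i (fun j hj => by omega), eA]

end Prog

end FR

namespace FR.Prog

open LogRAM LogRAM.Stmt

variable {E : Env} {p : Params} {m k n : ℕ}

/-- The integers computed by a level of the outer FFT, before the multiplications by powers of
`ρ`. -/
def butterflyInt (P h w a : ℕ) (U : ℕ → ℕ → ℤ) (i t : ℕ) : ℤ :=
  if i % (2 * h) < h then U i t + U (i + h) t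
  else
    let t' := (t + 2 * (2 * P) - 2 * (a * ((i % (2 * h) - h) / w) % (2 * P))) % (2 * (2 * P))
    if t' < 2 * P then U (i - h) t' - U i t' else U i (t' - 2 * P) - U (i - h) (t' - 2 * P)

theorem butterflyInt_abs_le {P h w a b N : ℕ} {X : ℤ} {U : ℕ → ℕ → ℤ} (hN : N = 2 * h * b)
    (hU : ∀ i < N, ∀ t < 2 * P, |U i t| ≤ X) {i t : ℕ} (hi : i < N) (ht : t < 2 * P) :
    |butterflyInt P h w a U i t| ≤ X + X := by
  have hlt := Nat.mod_lt (t + 2 * (2 * P) - 2 * (a * ((i % (2 * h) - h) / w) % (2 * P)))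
    (show 0 < 2 * (2 * P) by omega)
  unfold butterflyInt
  simp only
  split_ifs with h1 h2
  · exact (abs_add_le _ _).trans (add_le_add (hU i hi t ht) (hU _ (add_half_lt rfl hN hi h1) t ht))
  · exact (abs_sub _ _).trans (add_le_add (hU _ (by omega) _ h2) (hU i hi _ h2))
  · exact (abs_sub _ _).trans (add_le_add (hU i hi _ (by omega)) (hU _ (by omega) _ (by omega)))

theorem butterfly_spec (c : Ctx E p m k n) {A h w a b : ℕ} (hA' : A ≠ 7)
    {U : ℕ → ℕ → ℤ} {s : ℕ} {st : St} (hb : Base p m k n st)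
    (hw : 0 < w) (hh : 0 < h) (hN : p.N = 2 * h * b) (h19 : st.v 19 = w) (h20 : st.v 20 = a)
    (h21 : st.v 21 = h)
    (hU : ∀ i < p.N, ∀ t < 2 * p.P, (st.a A (2 * p.P * i + t) : ℤ) = U i t + 2 ^ p.H)
    (hU' : ∀ i < p.N, ∀ t < 2 * p.P, 2 * |U i t| ≤ 2 ^ p.H) :
    E.wpt (butterflyCode A) (200 * (2 * p.P * p.N)) (fun _ st' => Frame 32 [7] st st' ∧
      ∀ i < p.N, ∀ t < 2 * p.P,
        (st'.a 7 (2 * p.P * i + t) : ℤ) = butterflyInt p.P h w a U i t + 2 ^ p.H) s st := by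
  have hP := c.P_pos
  have hPL := c.P_le_L
  have hLB := c.L_lt
  have hN0 := c.N_pos
  have h4P : 2 * (2 * p.P) < E.B := lt_of_le_of_lt (Nat.mul_le_mul_right _ (by omega)) c.P_sq_lt
  have hOB : 2 * 2 ^ p.H < E.B := by
    have := c.pow_lt (a := 121) (by norm_num)
    have h5 : 2 * 2 ^ p.H ≤ 2 ^ (121 * p.P) := by
      rw [← pow_succ', c.hH]; exact Nat.pow_le_pow_right (by norm_num) (by omega)
    omega
  have hbd : ∀ i < p.N, ∀ t < 2 * p.P, |butterflyInt p.P h w a U i t| ≤ 2 ^ p.H := by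
    intro i hi t ht
    have h1 : ∀ i < p.N, ∀ t < 2 * p.P, |U i t| ≤ 2 ^ p.H / 2 := fun i hi t ht => by
      have := hU' i hi t ht; omega
    have := butterflyInt_abs_le (w := w) (a := a) hN h1 hi ht
    omega
  refine Env.wpt_fill c.good (n := 2 * p.P * p.N) (k := 32) (D := 7) (Ds := [7]) (T := 80)
    (fun z => (butterflyInt p.P h w a U (z / (2 * p.P)) (z % (2 * p.P)) + 2 ^ p.H).toNat)
    hLB le_rfl ?_ ?_ ?_ ?_
  · intro st' hfr
    simp [(hb.frame hfr (by norm_num) (by simp)).vars]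
  · intro z hz t _ st' hv hfr _
    have hb' := hb.frame hfr (by norm_num) (by simp)
    set i := z / (2 * p.P) with hi
    set q := z % (2 * p.P) with hq
    have hzi : z = 2 * p.P * i + q := (Nat.div_add_mod z (2 * p.P)).symm
    have hqP : q < 2 * p.P := Nat.mod_lt _ (by omega)
    have hiN : i < p.N := Nat.div_lt_of_lt_mul hz
    have e19 : st'.v 19 = w := by rw [hfr.v 19 (by norm_num), h19]
    have e20 : st'.v 20 = a := by rw [hfr.v 20 (by norm_num), h20]
    have e21 : st'.v 21 = h := by rw [hfr.v 21 (by norm_num), h21]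
    have eA : st'.a A = st.a A := hfr.a A (by simpa using hA')
    have hzB : z < E.B := by omega
    have hiz : i ≤ z := Nat.div_le_self _ _
    have hidx : ∀ i' < p.N, ∀ t' < 2 * p.P, 2 * p.P * i' + t' < 2 * p.P * p.N := by
      intro i' hi' t' ht'
      have : 2 * p.P * (i' + 1) ≤ 2 * p.P * p.N := Nat.mul_le_mul_left _ hi'
      rw [Nat.mul_succ] at this
      omega
    have hbi := hbd i hiN q hqP
    have hlo : ∀ i' < p.N, ∀ t' < 2 * p.P, 2 ^ p.H ≤ 2 * st.a A (2 * p.P * i' + t') := by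
      intro i' hi' t' ht'
      have h1 := hU i' hi' t' ht'
      have h2 := hU' i' hi' t' ht'
      zify
      rw [h1]
      have := neg_abs_le (U i' t')
      linarith
    have hhi : ∀ i' < p.N, ∀ t' < 2 * p.P, 2 * st.a A (2 * p.P * i' + t') ≤ 3 * 2 ^ p.H := by
      intro i' hi' t' ht'
      have h1 := hU i' hi' t' ht'
      have h2 := hU' i' hi' t' ht'
      zify
      rw [h1]
      have := le_abs_self (U i' t')
      linarith
    refine Env.wpt_body c.good (by simp [Stmt.len]) ?_
    simp [Stmt.wp, hv, hb'.vars, c.hacc, e19, e20, e21, eA, Frame.refl, ← hi, ← hq]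
    have hfin : ∀ y : ℕ, (y : ℤ) = butterflyInt p.P h w a U i q + 2 ^ p.H → y < E.B ∧
        Function.update (st'.a 7) z y =
          Function.update (st'.a 7) z (butterflyInt p.P h w a U i q + 2 ^ p.H).toNat := by
      intro y hy
      have h1 : (y : ℤ) ≤ (2 * 2 ^ p.H : ℕ) := by
        have := (abs_le.1 hbi).2
        push_cast
        linarith
      exact ⟨lt_of_le_of_lt (by exact_mod_cast h1) hOB, by rw [← hy, Int.toNat_natCast]⟩
    refine ⟨by omega, by omega, by omega, by omega, by omega,
      lt_of_le_of_lt (Nat.mod_le _ _) (by omega), fun h0 => ?_, fun h0 => ?_⟩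
    · have hih : i + h < p.N := add_half_lt rfl hN hiN (by omega)
      have hz2 : z + 2 * p.P * h = 2 * p.P * (i + h) + q := by rw [hzi]; ring
      have hx := hidx _ hih q hqP
      have h1 := hlo i hiN q hqP
      have h2 := hlo _ hih q hqP
      rw [hz2]
      refine ⟨by omega, by omega, hfin _ ?_⟩
      rw [← hzi] at h1
      rw [Nat.cast_sub (by omega), Nat.cast_add, hU _ hih q hqP, hzi, hU i hiN q hqP, butterflyInt,
        if_pos (by omega)]
      push_cast
      ring
    · have hlt' := Nat.mod_lt (q + 2 * (2 * p.P) - 2 * (a * ((i % (2 * h) - h) / w) % (2 * p.P)))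
        (show 0 < 2 * (2 * p.P) by omega)
      have hbf : butterflyInt p.P h w a U i q = _ := if_neg (by omega)
      have hlt2 := Nat.mod_lt (a * ((i % (2 * h) - h) / w)) (show 0 < 2 * p.P by omega)
      simp only at hbf
      generalize (q + 2 * (2 * p.P) - 2 * (a * ((i % (2 * h) - h) / w) % (2 * p.P))) %
        (2 * (2 * p.P)) = t' at hlt' hbf ⊢
      have him : h ≤ i := by
        have := Nat.mod_le i (2 * h)
        omega
      have hih : i - h < p.N := by omega
      have hsub : ∀ r, 2 * p.P * i + r - 2 * p.P * h = 2 * p.P * (i - h) + r := by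
        intro r
        have : 2 * p.P * h ≤ 2 * p.P * i := Nat.mul_le_mul_left _ him
        rw [Nat.mul_sub]
        omega
      refine ⟨by omega, by omega, by omega, by omega, fun h1 => ?_, fun h1 => ?_⟩
      · have ht' : t' < 2 * p.P := by omega
        have hx := hidx _ hih t' ht'
        have hx' := hidx _ hiN t' ht'
        have h2 := hlo _ hih t' ht'
        have h3 := hhi _ hiN t' ht'
        rw [hsub]
        refine ⟨by omega, by omega, by omega, hfin _ ?_⟩
        rw [Nat.cast_sub (by omega), Nat.cast_add, hU _ hih t' ht', hU i hiN t' ht', hbf, if_pos ht']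
        push_cast
        ring
      · have ht' : t' - 2 * p.P < 2 * p.P := by omega
        have hx := hidx _ hih _ ht'
        have hx' := hidx _ hiN _ ht'
        have h2 := hlo _ hiN _ ht'
        have h3 := hhi _ hih _ ht'
        rw [hsub]
        refine ⟨by omega, by omega, by omega, hfin _ ?_⟩
        rw [Nat.cast_sub (by omega), Nat.cast_add, hU _ hih _ ht', hU i hiN _ ht', hbf,
          if_neg (by omega)]
        push_cast
        ring
  · have : (vL.code 0).length = 0 := rfl
    rw [this]; omega
  · intro t _ st' h1 h2
    refine ⟨h1, fun i hi t' ht' => ?_⟩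
    have h3 : 2 * p.P * (i + 1) ≤ 2 * p.P * p.N := Nat.mul_le_mul_left _ hi
    rw [Nat.mul_succ] at h3
    rw [h2 _ (by omega), Nat.mul_add_div (by omega), Nat.div_eq_of_lt ht', add_zero, Nat.mul_add_mod,
      Nat.mod_eq_of_lt ht', Int.toNat_of_nonneg]
    have := abs_le.1 (hbd i hi t' ht')
    linarith

end FR.Prog

namespace FR

open Complex

noncomputable section

namespace Params

/-- The ring element whose coefficients are stored as the integers `u`. -/
def stdVal (p : Params) (u : Fin 2 → ℕ → ℤ) : PolyRing p.P :=
  ofCoeffs p.P fun j => ((u 0 j : ℂ) + u 1 j * I) / 2 ^ p.S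

/-- The interleaved sequence of the real and the imaginary parts. -/
def split (U : ℕ → ℤ) : Fin 2 → ℕ → ℤ := fun e j => U (2 * j + e)

end Params

theorem ofCoeffs_mul_ringX {P : ℕ} (hP : P ≠ 0) (c : ℕ → ℂ) :
    ofCoeffs P c * ringX P = ofCoeffs P fun j => if j = 0 then -c (P - 1) else c (j - 1) := by
  obtain ⟨Q, rfl⟩ := Nat.exists_eq_succ_of_ne_zero hP
  simp only [ofCoeffs, Finset.sum_mul, Nat.succ_eq_add_one]
  have h := ringX_pow (P := Q + 1)
  rw [Finset.sum_range_succ, Finset.sum_range_succ']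
  congr 1
  · exact Finset.sum_congr rfl fun j _ => by
      rw [if_neg (Nat.succ_ne_zero _), Nat.add_sub_cancel,
        pow_succ (ringX (Q + 1)) j, mul_assoc]
  · rw [if_pos rfl, mul_assoc, ← pow_succ, h, Nat.add_sub_cancel, map_neg]; ring

theorem ofCoeffs_mul_ringX_pow {P : ℕ} (hP : P ≠ 0) (c : ℕ → ℂ) : ∀ {e : ℕ}, e < 2 * P →
    ofCoeffs P c * ringX P ^ e = ofCoeffs P fun j =>
      if (j + 2 * P - e) % (2 * P) < P then c ((j + 2 * P - e) % (2 * P))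
      else -c ((j + 2 * P - e) % (2 * P) - P)
  | 0, _ => by
      rw [pow_zero, mul_one]
      refine ofCoeffs_congr fun j hj => ?_
      have : (j + 2 * P - 0) % (2 * P) = j := by
        rw [Nat.sub_zero, Nat.add_mod_right, Nat.mod_eq_of_lt (by omega)]
      rw [this, if_pos hj]
  | e + 1, he => by
      rw [pow_succ, ← mul_assoc, ofCoeffs_mul_ringX_pow hP c (by omega), ofCoeffs_mul_ringX hP]
      refine ofCoeffs_congr fun j hj => ?_
      by_cases hj0 : j = 0
      · subst hj0
        rw [if_pos rfl]
        have h1 : (0 + 2 * P - (e + 1)) % (2 * P) = 2 * P - (e + 1) := by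
          rw [zero_add, Nat.mod_eq_of_lt (by omega)]
        rw [h1]
        by_cases h : e < P
        · have h2 : (P - 1 + 2 * P - e) % (2 * P) = P - 1 - e := by
            rw [show P - 1 + 2 * P - e = P - 1 - e + 2 * P by omega, Nat.add_mod_right,
              Nat.mod_eq_of_lt (by omega)]
          rw [h2, if_pos (by omega), if_neg (by omega)]
          congr 2; omega
        · have h2 : (P - 1 + 2 * P - e) % (2 * P) = P - 1 + 2 * P - e := Nat.mod_eq_of_lt (by omega)
          rw [h2, if_neg (by omega), if_pos (by omega), neg_neg]
          congr 1; omega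
      · rw [if_neg hj0, show j - 1 + 2 * P - e = j + 2 * P - (e + 1) by omega]

namespace Params

variable {p : Params} {k : ℕ} {hP0 : p.P ≠ 0}

theorem stdVal_congr {u v : Fin 2 → ℕ → ℤ} (h : ∀ e, ∀ j < p.P, u e j = v e j) :
    p.stdVal u = p.stdVal v := ofCoeffs_congr fun j hj => by rw [h 0 j hj, h 1 j hj]

theorem stdVal_add (u v : Fin 2 → ℕ → ℤ) :
    p.stdVal u + p.stdVal v = p.stdVal fun e j => u e j + v e j := by
  rw [stdVal, stdVal, ofCoeffs_add]
  refine ofCoeffs_congr fun j _ => ?_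
  push_cast; ring

theorem stdVal_sub (u v : Fin 2 → ℕ → ℤ) :
    p.stdVal u - p.stdVal v = p.stdVal fun e j => u e j - v e j := by
  rw [stdVal, stdVal, ofCoeffs_sub]
  refine ofCoeffs_congr fun j _ => ?_
  push_cast; ring

theorem stdVal_butterflyInt (hP0 : p.P ≠ 0) (h w a : ℕ) (U : ℕ → ℕ → ℤ) (i : ℕ) :
    p.stdVal (split (Prog.butterflyInt p.P h w a U i)) =
      if i % (2 * h) < h then p.stdVal (split (U i)) + p.stdVal (split (U (i + h)))
      else (p.stdVal (split (U (i - h))) - p.stdVal (split (U i))) *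
        ringX p.P ^ (a * ((i % (2 * h) - h) / w)) := by
  split_ifs with hi
  · rw [stdVal_add]
    refine stdVal_congr fun e j _ => ?_
    simp [split, Prog.butterflyInt, if_pos hi]
  · have h1 : ringX p.P ^ (2 * p.P) = 1 := by rw [mul_comm, pow_mul, ringX_pow]; norm_num
    rw [← Nat.div_add_mod (a * ((i % (2 * h) - h) / w)) (2 * p.P), pow_add, pow_mul, h1, one_pow,
      one_mul, stdVal_sub, stdVal, stdVal,
      ofCoeffs_mul_ringX_pow hP0 _ (Nat.mod_lt _ (by omega))]
    refine ofCoeffs_congr fun j hj => ?_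
    have hlt := Nat.mod_lt (a * ((i % (2 * h) - h) / w)) (show 0 < 2 * p.P by omega)
    simp only [split, Prog.butterflyInt, if_neg hi]
    generalize a * ((i % (2 * h) - h) / w) % (2 * p.P) = e at hlt ⊢
    have key : ∀ c < 2, (2 * j + c + 2 * (2 * p.P) - 2 * e) % (2 * (2 * p.P)) =
        2 * ((j + 2 * p.P - e) % (2 * p.P)) + c := by
      intro c hc
      have h3 := Nat.div_add_mod (j + 2 * p.P - e) (2 * p.P)
      have h4 := Nat.mod_lt (j + 2 * p.P - e) (show 0 < 2 * p.P by omega)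
      rw [show 2 * j + c + 2 * (2 * p.P) - 2 * e =
        2 * ((j + 2 * p.P - e) % (2 * p.P)) + c + 2 * (2 * p.P) * ((j + 2 * p.P - e) / (2 * p.P)) by
          have : 2 * (2 * p.P) * ((j + 2 * p.P - e) / (2 * p.P)) =
            2 * (2 * p.P * ((j + 2 * p.P - e) / (2 * p.P))) := by ring
          omega, Nat.add_mul_mod_self_left, Nat.mod_eq_of_lt (by omega)]
    have k0 := key 0 (by norm_num)
    have k1 := key 1 (by norm_num)
    simp only [Fin.val_zero, Fin.val_one, k0, k1]
    generalize (j + 2 * p.P - e) % (2 * p.P) = r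
    by_cases hr : r < p.P
    · rw [if_pos (by omega), if_pos (by omega), if_pos hr]
    · rw [if_neg (by omega), if_neg (by omega), if_neg hr,
        show 2 * r + 0 - 2 * p.P = 2 * (r - p.P) + 0 by omega,
        show 2 * r + 1 - 2 * p.P = 2 * (r - p.P) + 1 by omega]
      push_cast
      ring

theorem stdVal_mul (u v : Fin 2 → ℕ → ℤ) : p.stdVal u * p.stdVal v =
    ofCoeffs p.P fun j =>
      ((prodCoeff p.P u v 0 j : ℂ) + prodCoeff p.P u v 1 j * I) / (2 ^ p.S * 2 ^ p.S) := by
  rw [stdVal, stdVal, ofCoeffs_mul]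
  refine ofCoeffs_congr fun j _ => ?_
  have hc : ∀ f g : ℕ → ℤ, ((negconv p.P f g j : ℤ) : ℂ) =
      negconv p.P (fun a => (f a : ℂ)) (fun a => (g a : ℂ)) j := fun f g =>
    map_negconv (Int.castRingHom ℂ) p.P f g j
  simp only [prodCoeff]
  push_cast
  rw [hc, hc, hc, hc]
  simp only [negconv]
  rw [← Finset.sum_sub_distrib, ← Finset.sum_add_distrib, Finset.sum_mul, ← Finset.sum_add_distrib,
    Finset.sum_div]
  refine Finset.sum_congr rfl fun a _ => ?_
  rw [← Finset.sum_sub_distrib, ← Finset.sum_add_distrib, Finset.sum_mul, ← Finset.sum_add_distrib,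
    Finset.sum_div]
  refine Finset.sum_congr rfl fun b _ => ?_
  have := I_mul_I
  field_simp
  linear_combination ((u 1 a : ℂ) * v 1 b * negSign ℂ p.P a b j) * this

theorem re_div_two_pow (x y : ℤ) (S : ℕ) :
    (((x : ℂ) + y * I) / 2 ^ S).re = x / 2 ^ S ∧ (((x : ℂ) + y * I) / 2 ^ S).im = y / 2 ^ S := by
  have : ((x : ℂ) + y * I) / 2 ^ S = ((x / 2 ^ S : ℝ) : ℂ) + ((y / 2 ^ S : ℝ) : ℂ) * I := by
    push_cast; ring
  rw [this]
  constructor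
  · rw [Complex.add_re, Complex.re_ofReal_mul, Complex.ofReal_re, Complex.I_re, mul_zero, add_zero]
  · rw [Complex.add_im, Complex.im_ofReal_mul, Complex.ofReal_im, Complex.I_im, mul_one, zero_add]

theorem abs_le_of_normLE (hk : p.P = 2 ^ k) {u : Fin 2 → ℕ → ℤ} {r : ℝ}
    (h : NormLE hP0 (p.stdVal u) r) (e : Fin 2) {j : ℕ} (hj : j < p.P) :
    |(u e j : ℝ)| ≤ r * 2 ^ p.S := by
  have h1 := norm_coeff_le hk h hj
  obtain ⟨h2, h3⟩ := re_div_two_pow (u 0 j) (u 1 j) p.S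
  have h4 := (Complex.abs_re_le_norm _).trans h1
  have h5 := (Complex.abs_im_le_norm _).trans h1
  rw [h2, abs_div, abs_of_pos (show (0 : ℝ) < 2 ^ p.S by positivity),
    div_le_iff₀ (by positivity)] at h4
  rw [h3, abs_div, abs_of_pos (show (0 : ℝ) < 2 ^ p.S by positivity),
    div_le_iff₀ (by positivity)] at h5
  fin_cases e
  exacts [h4, h5]

theorem approximates_of_normLE (hk : p.P = 2 ^ k) {u : Fin 2 → ℕ → ℤ} {z : PolyRing p.P} {r ε : ℝ}
    (hz : NormLE hP0 z r) (h : NormLE hP0 (p.stdVal u - z) ε) (hε : ε ≤ 1 / 2 ^ p.P)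
    (hr : (ε + r) * 2 ^ p.S ≤ 2 ^ p.H) : p.Approximates u z := by
  obtain ⟨c, rfl⟩ := exists_ofCoeffs hP0 z
  have hu : NormLE hP0 (p.stdVal u) (ε + r) := by simpa using h.add hz
  refine ⟨c, rfl, fun j hj => ⟨fun e => ?_, ?_⟩⟩
  · have := (abs_le_of_normLE hk hu e hj).trans hr
    exact_mod_cast this
  · rw [stdVal, ofCoeffs_sub] at h
    have h1 := (norm_coeff_le hk h hj).trans hε
    obtain ⟨h2, h3⟩ := re_div_two_pow (u 0 j) (u 1 j) p.S
    rw [← h2, ← h3, ← Complex.sub_re, ← Complex.sub_im]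
    exact ⟨(Complex.abs_re_le_norm _).trans h1, (Complex.abs_im_le_norm _).trans h1⟩

theorem abs_prodCoeff_le_of_normLE (hk : p.P = 2 ^ k) {u v : Fin 2 → ℕ → ℤ} {r : ℝ}
    (h : NormLE hP0 (p.stdVal u * p.stdVal v) r) (e : Fin 2) {j : ℕ} (hj : j < p.P) :
    |(prodCoeff p.P u v e j : ℝ)| ≤ r * (2 ^ p.S * 2 ^ p.S) := by
  rw [stdVal_mul] at h
  have h1 := norm_coeff_le hk h hj
  simp only [← pow_add] at h1 ⊢
  obtain ⟨h2, h3⟩ := re_div_two_pow (prodCoeff p.P u v 0 j) (prodCoeff p.P u v 1 j) (p.S + p.S)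
  have h4 := (Complex.abs_re_le_norm _).trans h1
  have h5 := (Complex.abs_im_le_norm _).trans h1
  rw [h2, abs_div, abs_of_pos (show (0 : ℝ) < 2 ^ (p.S + p.S) by positivity),
    div_le_iff₀ (by positivity)] at h4
  rw [h3, abs_div, abs_of_pos (show (0 : ℝ) < 2 ^ (p.S + p.S) by positivity),
    div_le_iff₀ (by positivity)] at h5
  fin_cases e
  exacts [h4, h5]

theorem normLE_round {u v y : Fin 2 → ℕ → ℤ}
    (hy : ∀ e, ∀ j < p.P, y e j = prodCoeff p.P u v e j / 2 ^ p.S) :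
    NormLE hP0 (p.stdVal y - p.stdVal u * p.stdVal v) (p.P * (2 / 2 ^ p.S)) := by
  rw [stdVal_mul, stdVal, ofCoeffs_sub]
  refine normLE_ofCoeffs fun j hj => ?_
  have hfl : ∀ x : ℤ, |((x / 2 ^ p.S : ℤ) : ℝ) * 2 ^ p.S - x| ≤ 2 ^ p.S := by
    intro x
    have h0 : (0 : ℤ) < 2 ^ p.S := by positivity
    have h1 := Int.mul_ediv_add_emod x (2 ^ p.S)
    have h2 := Int.emod_nonneg x h0.ne'
    have h3 := Int.emod_lt_of_pos x h0
    have : |(x / 2 ^ p.S) * 2 ^ p.S - x| ≤ 2 ^ p.S := by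
      rw [mul_comm] at h1
      rw [abs_le]; constructor <;> linarith
    exact_mod_cast this
  have hS : (0 : ℝ) < 2 ^ p.S := by positivity
  set a := prodCoeff p.P u v 0 j
  set b := prodCoeff p.P u v 1 j
  have e1 : (((y 0 j : ℂ) + y 1 j * I) / 2 ^ p.S - ((a : ℂ) + b * I) / (2 ^ p.S * 2 ^ p.S)) =
      (((((a / 2 ^ p.S : ℤ) : ℝ) * 2 ^ p.S - a : ℝ) : ℂ) +
        ((((b / 2 ^ p.S : ℤ) : ℝ) * 2 ^ p.S - b : ℝ) : ℂ) * I) / ((2 ^ p.S * 2 ^ p.S : ℝ) : ℂ) := by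
    rw [hy 0 j hj, hy 1 j hj]
    push_cast
    field_simp
    ring
  rw [e1, norm_div, Complex.norm_real, Real.norm_of_nonneg (by positivity),
    div_le_div_iff₀ (by positivity) hS]
  refine (mul_le_mul_of_nonneg_right (norm_add_le _ _) hS.le).trans ?_
  rw [norm_mul, norm_I, mul_one, Complex.norm_real, Complex.norm_real, Real.norm_eq_abs,
    Real.norm_eq_abs]
  have := hfl a
  have := hfl b
  nlinarith

theorem normLE_mul_error {a f v g y : PolyRing p.P} {ε R δ r η : ℝ} (h1 : NormLE hP0 (a - f) ε)
    (h2 : NormLE hP0 f R) (h3 : NormLE hP0 (v - g) δ) (h4 : NormLE hP0 g r)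
    (h5 : NormLE hP0 (y - a * v) η) : NormLE hP0 (y - f * g) (η + (ε * (δ + r) + R * δ)) := by
  have : y - f * g = (y - a * v) + ((a - f) * ((v - g) + g) + f * (v - g)) := by ring
  rw [this]
  exact h5.add ((h1.mul (h3.add h4)).add (h2.mul h3))

end Params

end

end FR

namespace FR

namespace Params

theorem Approximates.congr {p : Params} {u v : Fin 2 → ℕ → ℤ} {z : PolyRing p.P}
    (h : p.Approximates u z) (huv : ∀ e, ∀ j < p.P, v e j = u e j) : p.Approximates v z := by
  obtain ⟨c, h1, h2⟩ := h
  refine ⟨c, h1, fun j hj => ?_⟩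
  rw [huv 0 j hj, huv 1 j hj]
  exact ⟨fun e => by rw [huv e j hj]; exact (h2 j hj).1 e, (h2 j hj).2⟩

theorem prodCoeff_congr {P : ℕ} {u u' v v' : Fin 2 → ℕ → ℤ} (hu : ∀ e, ∀ j < P, u e j = u' e j)
    (hv : ∀ e, ∀ j < P, v e j = v' e j) (e : Fin 2) (j : ℕ) :
    prodCoeff P u v e j = prodCoeff P u' v' e j := by
  fin_cases e <;> simp only [prodCoeff] <;>
    rw [negconv_congr (hu 0) (hv _) j, negconv_congr (hu 1) (hv _) j]

/-- The first `l` levels of an FFT. -/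
def PassesLevels (p : Params) (prog : LogRAM.Program) (σ : ℕ → LogRAM.Config) (b b' s t l : ℕ)
    (ω ξ : PolyRing p.P) (F : ℕ → PolyRing p.P) : Prop :=
  ∃ τ τ' : ℕ → ℕ, s ≤ τ 0 ∧ τ l ≤ t ∧
    (∀ l' < l, τ l' ≤ τ' l' ∧ τ' l' ≤ τ (l' + 1)) ∧
    (∀ l' ≤ l, p.HoldsArray (σ (τ l')) b (fftState p.N (2 * p.P) ω ξ F l')) ∧
    ∀ l' < l, RoundEnds p.N (2 * p.P) l' →
      p.HoldsArray (σ (τ' l')) b'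
        (butterfly p.N (2 * p.P) ξ l' (fftState p.N (2 * p.P) ω ξ F l')) ∧
      ∀ i < p.N, ∃ t₀ d, τ' l' ≤ t₀ ∧ t₀ ≤ τ (l' + 1) ∧
        p.Approximates (p.stored (σ t₀) d 0) (ω ^ twiddleExp p.N (2 * p.P) l' i) ∧
        p.RingMul prog σ t₀ (τ (l' + 1)) (p.stored (σ (τ' l')) b' i)
          (p.stored (σ t₀) d 0) (p.stored (σ (τ (l' + 1))) b i)

variable {p : Params} {prog : LogRAM.Program} {σ : ℕ → LogRAM.Config} {b b' s t u l : ℕ}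
  {ω ξ : PolyRing p.P} {F : ℕ → PolyRing p.P}

theorem PassesLevels.mono (h : p.PassesLevels prog σ b b' s t l ω ξ F) (htu : t ≤ u) :
    p.PassesLevels prog σ b b' s u l ω ξ F := by
  obtain ⟨τ, τ', h1, h2, h3⟩ := h
  exact ⟨τ, τ', h1, h2.trans htu, h3⟩

theorem PassesLevels.passesFFT (h : p.PassesLevels prog σ b b' s t l ω ξ F)
    (hl : l = Nat.log 2 p.N) : p.PassesFFT prog σ s t ω ξ F := by
  obtain ⟨τ, τ', h1, h2, h3, h4, h5⟩ := h
  subst hl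
  exact ⟨τ, τ', h1, h2, h3, fun _ => b, fun _ => b', h4, h5⟩

theorem passesLevels_zero (h : p.HoldsArray (σ s) b F) : p.PassesLevels prog σ b b' s s 0 ω ξ F :=
  ⟨fun _ => s, fun _ => s, le_rfl, le_rfl, by simp, fun l' hl' => by
    obtain rfl : l' = 0 := by omega
    exact h, by simp⟩

theorem PassesLevels.succ (h : p.PassesLevels prog σ b b' s t l ω ξ F) {t₁ t₂ : ℕ} (h1 : t ≤ t₁)
    (h2 : t₁ ≤ t₂) (hold : p.HoldsArray (σ t₂) b (fftState p.N (2 * p.P) ω ξ F (l + 1)))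
    (hr : RoundEnds p.N (2 * p.P) l →
      p.HoldsArray (σ t₁) b' (butterfly p.N (2 * p.P) ξ l (fftState p.N (2 * p.P) ω ξ F l)) ∧
      ∀ i < p.N, ∃ t₀ d, t₁ ≤ t₀ ∧ t₀ ≤ t₂ ∧
        p.Approximates (p.stored (σ t₀) d 0) (ω ^ twiddleExp p.N (2 * p.P) l i) ∧
        p.RingMul prog σ t₀ t₂ (p.stored (σ t₁) b' i) (p.stored (σ t₀) d 0)
          (p.stored (σ t₂) b i)) :
    p.PassesLevels prog σ b b' s t₂ (l + 1) ω ξ F := by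
  obtain ⟨τ, τ', k1, k2, k3, k4, k5⟩ := h
  have e1 : ∀ l' ≤ l, Function.update τ (l + 1) t₂ l' = τ l' := fun l' hl' =>
    Function.update_of_ne (by omega) _ _
  have e2 : ∀ l' < l, Function.update τ' l t₁ l' = τ' l' := fun l' hl' =>
    Function.update_of_ne (by omega) _ _
  refine ⟨Function.update τ (l + 1) t₂, Function.update τ' l t₁, ?_, ?_, fun l' hl' => ?_,
    fun l' hl' => ?_, fun l' hl' hre => ?_⟩
  · rwa [e1 0 (by omega)]
  · rw [Function.update_self]
  · rcases Nat.lt_or_ge l' l with h | h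
    · rw [e1 l' h.le, e2 l' h, e1 (l' + 1) h]
      exact k3 l' h
    · obtain rfl : l' = l := by omega
      rw [e1 l' le_rfl, Function.update_self, Function.update_self]
      omega
  · rcases Nat.lt_or_ge l l' with h | h
    · obtain rfl : l' = l + 1 := by omega
      rwa [Function.update_self]
    · rw [e1 l' h]
      exact k4 l' h
  · rcases Nat.lt_or_ge l' l with h | h
    · rw [e2 l' h, e1 (l' + 1) h]
      exact k5 l' h hre
    · obtain rfl : l' = l := by omega
      rw [Function.update_self, Function.update_self]
      exact hr hre

end Params

namespace Prog

open LogRAM LogRAM.Stmt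

variable {E : Env} {p : Params} {m k n : ℕ}

/-- The integers stored in array `A`. -/
def arrInt (p : Params) (st : St) (A i t : ℕ) : ℤ := (st.a A (2 * p.P * i + t) : ℤ) - 2 ^ p.H

theorem idx_lt {P N i t : ℕ} (hi : i < N) (ht : t < 2 * P) : 2 * P * i + t < 2 * P * N := by
  have : 2 * P * (i + 1) ≤ 2 * P * N := Nat.mul_le_mul_left _ hi
  rw [Nat.mul_succ] at this
  omega

theorem Ctx.stored_eq (c : Ctx E p m k n) {t : ℕ} {st : St} (h : E.Rep (E.σ t).mem st) {A i : ℕ}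
    (hA : A < 24) (hi : i < p.N) (e : Fin 2) {j : ℕ} (hj : j < p.P) :
    p.stored (E.σ t) (104 + A * E.L) i e j = Params.split (arrInt p st A i) e j := by
  have h1 : 2 * p.P * i + (2 * j + e) < E.L := by
    rw [c.hL]; exact idx_lt hi (by omega)
  rw [Params.stored, Params.split, arrInt, ← h.arr A hA _ h1]
  congr 3; ring

theorem level_spec (c : Ctx E p m k n) {l sv s : ℕ} {st : St} (hl : l < n) (hb : Base p m k n st)
    (h16 : st.v 16 = sv) (h17 : st.v 17 = l) (hsv : sv < p.N) :
    E.wpt levelCode 60 (fun _ st' => Frame 18 [] st st' ∧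
      st'.v 18 = (2 * p.P) ^ (l / (k + 1)) ∧
      st'.v 19 = p.N / (2 * p.P) ^ (l / (k + 1)) /
        min (2 * p.P) (p.N / (2 * p.P) ^ (l / (k + 1))) ∧
      st'.v 20 = 2 * p.P / min (2 * p.P) (p.N / (2 * p.P) ^ (l / (k + 1))) * 2 ^ (l % (k + 1)) * sv ∧
      st'.v 21 = p.N / 2 ^ l / 2 ∧ st'.v 22 = (2 * p.P) ^ ((l + 1) / (k + 1))) s st := by
  have hP := c.P_pos
  have hPL := c.P_le_L
  have hLB := c.L_lt
  have hN0 := c.N_pos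
  have hJ : 2 * p.P = 2 ^ (k + 1) := by rw [c.hP, pow_succ']
  have d1 : (k + 1) * (l / (k + 1)) ≤ l := Nat.mul_div_le _ _
  have d2 : (k + 1) * ((l + 1) / (k + 1)) ≤ l + 1 := Nat.mul_div_le _ _
  have d3 : l % (k + 1) < k + 1 := Nat.mod_lt _ (by omega)
  have hnN := c.n_lt
  have hNL := c.N_le_L
  have hkn := c.hkn
  have hpow : ∀ i ≤ n, 2 ^ i ≤ p.N := fun i hi => by
    rw [c.hN]; exact Nat.pow_le_pow_right (by norm_num) hi
  have e1 := hb.two _ (show (k + 1) * (l / (k + 1)) ≤ n by omega)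
  have e2 := hb.two _ (show (k + 1) * ((l + 1) / (k + 1)) ≤ n by omega)
  have e3 := hb.two _ (show l % (k + 1) ≤ n by omega)
  have e4 := hb.two l hl.le
  rw [hJ, ← pow_mul, ← pow_mul, ← hJ]
  have p1 := hpow _ (show (k + 1) * (l / (k + 1)) ≤ n by omega)
  have p2 := hpow _ (show (k + 1) * ((l + 1) / (k + 1)) ≤ n by omega)
  have p3 := hpow _ (show l % (k + 1) ≤ n by omega)
  have p0 : 0 < 2 ^ ((k + 1) * (l / (k + 1))) := by positivity
  generalize 2 ^ ((k + 1) * (l / (k + 1))) = G at *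
  generalize 2 ^ ((k + 1) * ((l + 1) / (k + 1))) = G' at *
  have hM0 : 0 < p.N / G := Nat.div_pos p1 p0
  have hMN : p.N / G ≤ p.N := Nat.div_le_self _ _
  have hhN : p.N / 2 ^ l / 2 ≤ p.N := (Nat.div_le_self _ _).trans (Nat.div_le_self _ _)
  have hbig : 2 * p.P * p.N * p.N < E.B := by
    refine c.lt_B (a := 8) ?_ (by norm_num)
    have h1 := (Ctx.P_lt (p := p)).le
    have h2 := c.two_le
    have h3 := c.N_le
    calc 2 * p.P * p.N * p.N ≤ 2 ^ p.P * 2 ^ p.P * (2 ^ p.P) ^ 3 * (2 ^ p.P) ^ 3 := by gcongr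
      _ = (2 ^ p.P) ^ 8 := by ring
  refine Env.wpt_body c.good (by simp [levelCode, Stmt.len]) ?_
  simp [levelCode, Stmt.wp, hb.vars, c.hacc, h16, h17, e1, e2, e3, e4, Frame.refl]
  have a1 : ∀ x y, x ≤ 2 * p.P → y ≤ p.N → x * y * sv < E.B := fun x y hx hy =>
    lt_of_le_of_lt (Nat.mul_le_mul (Nat.mul_le_mul hx hy) hsv.le) hbig
  refine ⟨by omega, by omega, by omega, by omega, by omega, by omega, by omega, by omega, ?_, ?_⟩
  · intro h
    have hD : min (2 * p.P) (p.N / G) = 2 * p.P := min_eq_left (by omega)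
    rw [hD, Nat.div_self (by omega)]
    have := a1 1 (2 ^ (l % (k + 1))) (by omega) p3
    rw [one_mul] at this
    have : p.N / G / (2 * p.P) ≤ p.N / G := Nat.div_le_self _ _
    refine ⟨by omega, by omega, by omega, by omega, rfl, .inl rfl⟩
  · intro h
    have hD : min (2 * p.P) (p.N / G) = p.N / G := min_eq_right (by omega)
    rw [hD, Nat.div_self hM0]
    have h1 : 2 * p.P / (p.N / G) ≤ 2 * p.P := Nat.div_le_self _ _
    have := a1 _ _ h1 p3
    have := c.good.B_ge
    refine ⟨by omega, by omega, by omega, rfl, .inl rfl⟩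

theorem copy_spec (c : Ctx E p m k n) {A s : ℕ} {st : St} (hA : A ≠ 7) (hA' : 3 ≤ A)
    (hb : Base p m k n st) (h7 : ∀ z < 2 * p.P * p.N, st.a 7 z < E.B) :
    E.wpt (copyCode A) (20 * (2 * p.P * p.N)) (fun _ st' => Frame 32 [A] st st' ∧
      ∀ z < 2 * p.P * p.N, st'.a A z = st.a 7 z) s st := by
  have hP := c.P_pos
  have hPL := c.P_le_L
  refine Env.wpt_fill c.good (n := 2 * p.P * p.N) (k := 32) (D := A) (Ds := [A]) (T := 10)
    (fun z => st.a 7 z) c.L_lt le_rfl ?_ ?_ ?_ fun _ _ st' h1 h2 => ⟨h1, h2⟩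
  · intro st' hfr
    simp [(hb.frame hfr (by norm_num) (by simp; omega)).vars]
  · intro z hz t _ st' hv hfr _
    refine Env.wpt_body c.good (by simp [Stmt.len]) ?_
    simp [Stmt.wp, hv, c.hacc, Frame.refl, hfr.a 7 (by simp; omega), hz, h7 z hz]
  · have : (vL.code 0).length = 0 := rfl
    rw [this]; omega

end Prog

end FR

namespace FR.Prog

open LogRAM LogRAM.Stmt

variable {E : Env} {p : Params} {m k n : ℕ}

theorem twiddle_spec (c : Ctx E p m k n) {A sv G G' s : ℕ} {st : St} (hA : 5 ≤ A) (hA' : A < 11)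
    (hA7 : A ≠ 7) (hb : Base p m k n st) (h16 : st.v 16 = sv) (h18 : st.v 18 = G)
    (h22 : st.v 22 = G') (hG : G ≤ p.N) (hG' : G' ≤ p.N) (hG0 : 0 < G')
    (hX : ∀ i < p.N, ∀ e, ∀ j < p.P, |Params.split (arrInt p st 7 i) e j| ≤ 2 ^ p.H)
    (hV : ∀ i < p.N, ∀ e, ∀ j < p.P, |Params.split (arrInt p st 4 i) e j| ≤ 2 ^ p.H)
    (hfit : ∀ i < p.N, ∀ i' < p.N, ∀ e, ∀ j < p.P,
      |Params.prodCoeff p.P (Params.split (arrInt p st 7 i)) (Params.split (arrInt p st 4 i')) e j| ≤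
        2 ^ p.H * 2 ^ p.S)
    (x : ℕ → ℕ) (hx : ∀ i, x i = sv *
      (G * (i % (p.N / G')) * bitRev (k + 1) (i / (p.N / G') % (2 * p.P))) % p.N) :
    E.wpt (twiddleCode A) (7000 * (p.P * (k + 1) * p.N)) (fun t st' =>
      Frame 23 [11, 12, 13, 14, 15, 16, 17, A] st st' ∧
      ∀ i < p.N, (∃ t₀ ≥ s, t₀ ≤ t ∧
        (∀ e, ∀ j < p.P, p.stored (E.σ t₀) (104 + 4 * E.L + 2 * p.P * x i) 0 e j =
          Params.split (arrInt p st 4 (x i)) e j) ∧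
        p.RingMul E.prog E.σ t₀ t (p.stored (E.σ s) (104 + 7 * E.L) i)
          (p.stored (E.σ t₀) (104 + 4 * E.L + 2 * p.P * x i) 0)
          (p.stored (E.σ t) (104 + A * E.L) i)) ∧
        ∀ e, ∀ j < p.P, Params.split (arrInt p st' A i) e j =
          Params.prodCoeff p.P (Params.split (arrInt p st 7 i))
            (Params.split (arrInt p st 4 (x i))) e j / 2 ^ p.S) s st := by
  have hP := c.P_pos
  have hPL := c.P_le_L
  have hLB := c.L_lt
  have hN0 := c.N_pos
  have hNL := c.N_le_L
  have hkn := c.hkn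
  have hJ : 2 * p.P = 2 ^ (k + 1) := by rw [c.hP, pow_succ']
  have hJN : 2 * p.P ≤ p.N := by
    rw [hJ, c.hN]; exact Nat.pow_le_pow_right (by norm_num) hkn
  have hW0 : 0 < p.N / G' := Nat.div_pos hG' hG0
  have hWN : p.N / G' ≤ p.N := Nat.div_le_self _ _
  have hbig : p.N * p.N * p.N < E.B := by
    refine c.lt_B (a := 9) ?_ (by norm_num)
    have h3 := c.N_le
    calc p.N * p.N * p.N ≤ (2 ^ p.P) ^ 3 * (2 ^ p.P) ^ 3 * (2 ^ p.P) ^ 3 := by gcongr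
      _ = (2 ^ p.P) ^ 9 := by ring
  have hxN : ∀ i, x i < p.N := fun i => by rw [hx]; exact Nat.mod_lt _ hN0
  have hD : 0 ∉ [11, 12, 13, 14, 15, 16, 17, A] ∧ 1 ∉ [11, 12, 13, 14, 15, 16, 17, A] ∧
      2 ∉ [11, 12, 13, 14, 15, 16, 17, A] := by simp; omega
  have h4D : 4 ∉ [11, 12, 13, 14, 15, 16, 17, A] := by simp; omega
  have h7D : 7 ∉ [11, 12, 13, 14, 15, 16, 17, A] := by simp; omega
  refine Env.wpt_of_rep fun hrep _ => ?_
  refine Env.wpt_cons' c.good (n := 6900 * (p.P * (k + 1) * p.N))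
    (R := fun st' => Frame 23 [11, 12, 13, 14, 15, 16, 17, A] st st' ∧ st'.v 23 = p.N / G') ?_ ?_ ?_
  · have : 1 ≤ p.P * (k + 1) * p.N := Nat.mul_pos (Nat.mul_pos (by omega) (by omega)) hN0
    simp [Stmt.len]; omega
  · simp [Stmt.wp, hb.vars, h22, Frame.refl]
    omega
  rintro t1 ht1 st1 ⟨fr1, e23⟩
  refine Env.wpt_mono (Env.wpt_loop c.good (n := p.N) (T := 5100 * (p.P * (k + 1)))
    (fun z t st' => (Frame 23 [11, 12, 13, 14, 15, 16, 17, A] st st' ∧ st'.v 23 = p.N / G') ∧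
      ∀ i < z, (∃ t₀ ≥ s, t₀ ≤ t ∧
        (∀ e, ∀ j < p.P, p.stored (E.σ t₀) (104 + 4 * E.L + 2 * p.P * x i) 0 e j =
          Params.split (arrInt p st 4 (x i)) e j) ∧
        ∀ y : Fin 2 → ℕ → ℤ, (∀ e, ∀ j < p.P, y e j = 
            Params.prodCoeff p.P (Params.split (arrInt p st 7 i))
              (Params.split (arrInt p st 4 (x i))) e j / 2 ^ p.S) →
          p.RingMul E.prog E.σ t₀ t (p.stored (E.σ s) (104 + 7 * E.L) i)
            (p.stored (E.σ t₀) (104 + 4 * E.L + 2 * p.P * x i) 0) y) ∧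
        ∀ e, ∀ j < p.P, Params.split (arrInt p st' A i) e j =
          Params.prodCoeff p.P (Params.split (arrInt p st 7 i))
            (Params.split (arrInt p st 4 (x i))) e j / 2 ^ p.S)
    (by omega) ?_ ?_ ?_ ?_ (fun t _ st' h _ => h)) ?_ ?_
  · rintro z t u st' htu ⟨h1, h2⟩
    refine ⟨h1, fun i hi => ?_⟩
    obtain ⟨⟨t0, k1, k2, k3, k4⟩, k5⟩ := h2 i hi
    exact ⟨⟨t0, k1, k2.trans htu, k3, fun y hy => (k4 y hy).mono le_rfl htu⟩, k5⟩
  · simp [fr1, e23]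
  · rintro z _ t st' ⟨⟨h, -⟩, -⟩ _
    simp [(hb.frame h (by norm_num) hD).vars]
  · rintro i hi t ht st' hv ⟨⟨hfr, w23⟩, hall⟩
    have hb' := hb.frame hfr (by norm_num) hD
    have e16 : st'.v 16 = sv := by rw [hfr.v 16 (by norm_num), h16]
    have e18 : st'.v 18 = G := by rw [hfr.v 18 (by norm_num), h18]
    have hqJ : i / (p.N / G') % (2 * p.P) < 2 * p.P := Nat.mod_lt _ (by omega)
    have hrev : st'.a 0 (2 * p.P + i / (p.N / G') % (2 * p.P)) =
        bitRev (k + 1) (i / (p.N / G') % (2 * p.P)) := by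
      have := hb'.rev (k + 1) hkn (i / (p.N / G') % (2 * p.P)) (by rw [← hJ]; exact hqJ)
      rwa [← hJ] at this
    have hrl : bitRev (k + 1) (i / (p.N / G') % (2 * p.P)) ≤ p.N :=
      (bitRev_lt _ _).le.trans (hJ ▸ hJN)
    have hml : i % (p.N / G') ≤ p.N := (Nat.mod_lt _ hW0).le.trans hWN
    have hi1 : 2 * p.P * i + 2 * p.P ≤ 2 * p.P * p.N := by
      rw [← Nat.mul_succ]; exact Nat.mul_le_mul_left _ hi
    have hx1 : 2 * p.P * x i + 2 * p.P ≤ 2 * p.P * p.N := by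
      rw [← Nat.mul_succ]; exact Nat.mul_le_mul_left _ (hxN i)
    have hcost : 100 + 5000 * (p.P * (k + 1)) ≤ 5100 * (p.P * (k + 1)) := by
      have : 1 ≤ p.P * (k + 1) := Nat.mul_pos (by omega) (by omega)
      omega
    have hb25 : G * (i % (p.N / G')) * bitRev (k + 1) (i / (p.N / G') % (2 * p.P)) < E.B :=
      lt_of_le_of_lt (Nat.mul_le_mul (Nat.mul_le_mul hG hml) hrl) hbig
    refine Env.wpt_cons' c.good (n := 60 + 5000 * (p.P * (k + 1)))
      (R := fun st2 => Frame 23 [] st' st2 ∧ st2.v 23 = p.N / G' ∧ st2.v 24 = i ∧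
        st2.v 25 = G * (i % (p.N / G')) * bitRev (k + 1) (i / (p.N / G') % (2 * p.P))) ?_ ?_ ?_
    · simp [Stmt.len]; omega
    · simp [Stmt.wp, hv, hb'.vars, c.hacc, w23, e18, hrev, Frame.refl]
      exact ⟨by omega, hb25⟩
    rintro t2 ht2 st2 ⟨fr2, f23, f24, f25⟩
    have hb2 := hb'.frame fr2 (by norm_num) (by simp)
    have g16 : st2.v 16 = sv := by rw [fr2.v 16 (by norm_num), e16]
    refine Env.wpt_cons' c.good (n := 40 + 5000 * (p.P * (k + 1)))
      (R := fun st3 => Frame 23 [] st2 st3 ∧ st3.v 23 = p.N / G' ∧ st3.v 24 = i ∧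
        st3.v 25 = G * (i % (p.N / G')) * bitRev (k + 1) (i / (p.N / G') % (2 * p.P)) ∧
        st3.v 40 = 2 * p.P * i) ?_ ?_ ?_
    · simp [Stmt.len]; omega
    · simp [Stmt.wp, f23, f24, f25, hb2.vars, Frame.refl]
      omega
    rintro t3 ht3 st3 ⟨fr3, g23, g24, g25, g40⟩
    have hb3 := hb2.frame fr3 (by norm_num) (by simp)
    have i16 : st3.v 16 = sv := by rw [fr3.v 16 (by norm_num), g16]
    refine Env.wpt_cons' c.good (n := 20 + 5000 * (p.P * (k + 1)))
      (R := fun st4 => Frame 23 [] st3 st4 ∧ st4.v 23 = p.N / G' ∧ st4.v 24 = i ∧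
        st4.v 40 = 2 * p.P * i ∧ st4.v 41 = 2 * p.P * x i) ?_ ?_ ?_
    · simp [Stmt.len]; omega
    · simp [Stmt.wp, g23, g24, g25, g40, i16, hb3.vars, Frame.refl, ← hx]
      omega
    rintro t4 ht4 st4 ⟨fr4, i23, i24, i40, i41⟩
    have hb4 := hb3.frame fr4 (by norm_num) (by simp)
    refine Env.wpt_cons' c.good (n := 5000 * (p.P * (k + 1)))
      (R := fun st5 => Frame 23 [] st4 st5 ∧ st5.v 23 = p.N / G' ∧ st5.v 24 = i ∧
        st5.v 40 = 2 * p.P * i ∧ st5.v 41 = 2 * p.P * x i ∧ st5.v 42 = 2 * p.P * i) ?_ ?_ ?_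
    · simp [Stmt.len]
    · simp [Stmt.wp, i23, i24, i40, i41, hb4.vars, Frame.refl]
      omega
    rintro t5 ht5 st5 ⟨fr5, j23, j24, j40, j41, j42⟩
    have hb5 := hb4.frame fr5 (by norm_num) (by simp)
    have hfr5 : Frame 23 [11, 12, 13, 14, 15, 16, 17, A] st' st5 :=
      ((fr2.trans fr3).trans (fr4.trans fr5)).mono le_rfl (by simp)
    have hfrs := hfr.trans hfr5
    refine Env.wpt_of_rep fun hrep5 _ => ?_
    have hu : ∀ e, ∀ j < p.P, p.stored (E.σ s) (104 + 7 * E.L) i e j =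
        Params.split (arrInt p st 7 i) e j := fun e j hj => c.stored_eq hrep (by norm_num) hi e hj
    have hvv : ∀ e : Fin 2, ∀ j < p.P,
        p.stored (E.σ t5) (104 + 4 * E.L + 2 * p.P * x i) 0 e j =
          Params.split (arrInt p st 4 (x i)) e j := fun e j hj => by
      have h1 := c.stored_eq hrep5 (A := 4) (by norm_num) (hxN i) e hj
      rw [Params.split, arrInt, hfrs.a 4 h4D] at h1
      rw [Params.split, arrInt, ← h1, Params.stored, Params.stored, mul_zero, add_zero]
    have hpc : ∀ e j, Params.prodCoeff p.P (p.stored (E.σ s) (104 + 7 * E.L) i)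
        (p.stored (E.σ t5) (104 + 4 * E.L + 2 * p.P * x i) 0) e j =
        Params.prodCoeff p.P (Params.split (arrInt p st 7 i))
          (Params.split (arrInt p st 4 (x i))) e j := Params.prodCoeff_congr hu hvv
    refine Env.wpt_mono (ringMul_spec c (u := p.stored (E.σ s) (104 + 7 * E.L) i)
      (v := p.stored (E.σ t5) (104 + 4 * E.L + 2 * p.P * x i) 0) (by norm_num) (by norm_num)
      (by omega) hA' hb5 (by rw [j40]; exact hi1) (by rw [j41]; exact hx1) (by rw [j42]; exact hi1)
      ?_ ?_ ?_ ?_ ?_) le_rfl ?_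
    · intro e j hj
      rw [hu e j hj, Params.split, arrInt, j40, hfrs.a 7 h7D, sub_add_cancel, add_assoc]
    · intro e j hj
      rw [hvv e j hj, Params.split, arrInt, j41, hfrs.a 4 h4D, sub_add_cancel, add_assoc]
    · intro e j hj
      rw [hu e j hj]; exact hX i hi e j hj
    · intro e j hj
      rw [hvv e j hj]; exact hV _ (hxN i) e j hj
    · intro e j hj
      rw [hpc]; exact hfit i hi _ (hxN i) e j hj
    · rintro t6 st6 ht6 _ _ ⟨r1, r2, r3, r4⟩
      have r2' : Frame 23 [11, 12, 13, 14, 15, 16, 17, A] st5 st6 := r2.mono (by norm_num) (by simp)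
      refine ⟨by rw [r2.v 24 (by norm_num), j24], ⟨?_, ?_⟩, fun i' hi' => ?_⟩
      · rw [Frame.set_iff (by norm_num)]
        exact hfrs.trans r2'
      · rw [St.set_v, if_neg (by norm_num), r2.v 23 (by norm_num), j23]
      · rcases Nat.lt_succ_iff_lt_or_eq.1 hi' with h | rfl
        · obtain ⟨⟨t0, k1, k2, k3, k4⟩, k5⟩ := hall i' h
          refine ⟨⟨t0, k1, by omega, k3, fun y hy => (k4 y hy).mono le_rfl (by omega)⟩, fun e j hj => ?_⟩
          rw [← k5 e j hj]
          have h6 : 2 * p.P * i' + (2 * j + e) < 2 * p.P * i := idx_lt h (by omega)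
          simp only [Params.split, arrInt, St.set_a]
          rw [r4 _ (by rw [j42]; omega)]
          have : st5.a A = st'.a A := by rw [fr5.a A (by simp), fr4.a A (by simp), fr3.a A (by simp), fr2.a A (by simp)]
          rw [this]
        · refine ⟨⟨t5, by omega, ht6, hvv, fun y hy => r1 y fun e j hj => ?_⟩, fun e j hj => ?_⟩
          · rw [hpc, hy e j hj]
          · have := r3 e j hj
            rw [hpc, j42] at this
            simp only [Params.split, arrInt, St.set_a]
            rw [← add_assoc, this]; ring
  · have h1 : (vN.code 0).length = 0 := rfl
    rw [h1]
    have : 1 ≤ p.P * (k + 1) := Nat.mul_pos (by omega) (by omega)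
    calc (p.N + 1) * (5100 * (p.P * (k + 1)) + 0 + 4) ≤ (p.N + 1) * (5104 * (p.P * (k + 1))) :=
          Nat.mul_le_mul_left _ (by omega)
      _ = (5104 * (p.N + 1)) * (p.P * (k + 1)) := by ring
      _ ≤ (6900 * p.N) * (p.P * (k + 1)) := Nat.mul_le_mul_right _ (by omega)
      _ = 6900 * (p.P * (k + 1) * p.N) := by ring
  · rintro t st' ht hrep' _ ⟨⟨h1, -⟩, h2⟩
    refine ⟨h1, fun i hi => ?_⟩
    obtain ⟨⟨t0, k1, k2, k3, k4⟩, k5⟩ := h2 i hi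
    exact ⟨⟨t0, k1, k2, k3, k4 _ fun e j hj => by
      rw [c.stored_eq hrep' (by omega) hi e hj, k5 e j hj]⟩, k5⟩

end FR.Prog

namespace FR.Prog

open LogRAM LogRAM.Stmt

variable {E : Env} {p : Params} {m k n : ℕ} {hP0 : p.P ≠ 0}

/-- The ring element that is stored in array `A` with number `i`. -/
noncomputable def arrVal (p : Params) (st : St) (A i : ℕ) : PolyRing p.P :=
  p.stdVal (Params.split (arrInt p st A i))

theorem arrVal_congr {st st' : St} {A A' i i' : ℕ}
    (h : ∀ t < 2 * p.P, st'.a A' (2 * p.P * i' + t) = st.a A (2 * p.P * i + t)) :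
    arrVal p st' A' i' = arrVal p st A i :=
  Params.stdVal_congr fun e j hj => by
    simp only [Params.split, arrInt, h (2 * j + e) (by omega)]

theorem Ctx.holdsArray (c : Ctx E p m k n) {t : ℕ} {st : St} (hrep : E.Rep (E.σ t).mem st) {A : ℕ}
    (hA : A < 24) {F : ℕ → PolyRing p.P} {R ε : ℝ} (hF : ∀ i < p.N, NormLE hP0 (F i) R)
    (h : ∀ i < p.N, NormLE hP0 (arrVal p st A i - F i) ε) (hε : ε ≤ 1 / 2 ^ p.P)
    (hR : (1 + R) * 8 * 2 ^ p.S ≤ 2 ^ p.H) (hR0 : 0 ≤ R) :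
    p.HoldsArray (E.σ t) (104 + A * E.L) F := by
  intro i hi
  refine (Params.approximates_of_normLE c.hP (hF i hi) (h i hi) hε ?_).congr fun e j hj =>
    c.stored_eq hrep hA hi e hj
  refine le_trans (mul_le_mul_of_nonneg_right ?_ (by positivity)) hR
  have : (1 : ℝ) / 2 ^ p.P ≤ 1 := by
    rw [div_le_one (by positivity)]; exact one_le_pow₀ (by norm_num)
  nlinarith

theorem Ctx.log_two_P (c : Ctx E p m k n) : Nat.log 2 (2 * p.P) = k + 1 := by
  rw [c.hP, ← pow_succ', Nat.log_pow (by norm_num)]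

theorem Ctx.half_spec (c : Ctx E p m k n) {l : ℕ} (hl : l < n) :
    p.N / 2 ^ l = 2 * (p.N / 2 ^ l / 2) ∧ p.N = 2 * (p.N / 2 ^ l / 2) * 2 ^ l ∧
      0 < p.N / 2 ^ l / 2 := by
  obtain ⟨e, rfl⟩ := Nat.exists_eq_add_of_lt hl
  have h1 : p.N / 2 ^ l = 2 * 2 ^ e := by
    rw [c.hN, show l + e + 1 = (e + 1) + l by ring, pow_add, Nat.mul_div_cancel _ (by positivity),
      pow_succ']
  have h2 : p.N / 2 ^ l / 2 = 2 ^ e := by rw [h1]; simp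
  rw [h2, h1]
  refine ⟨rfl, ?_, by positivity⟩
  rw [c.hN, show l + e + 1 = (e + 1) + l by ring, pow_add, pow_succ']

theorem Ctx.butterfly_eq (c : Ctx E p m k n) {l : ℕ} (hl : l < n) {R : Type*} [CommRing R] (ξ : R)
    (f : ℕ → R) (i : ℕ) : butterfly p.N (2 * p.P) ξ l f i =
      if i % (2 * (p.N / 2 ^ l / 2)) < p.N / 2 ^ l / 2 then f i + f (i + p.N / 2 ^ l / 2)
      else (f (i - p.N / 2 ^ l / 2) - f i) *
        ξ ^ (2 * p.P / min (2 * p.P) (p.N / (2 * p.P) ^ (l / (k + 1))) * 2 ^ (l % (k + 1)) *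
          ((i % (2 * (p.N / 2 ^ l / 2)) - p.N / 2 ^ l / 2) /
            (p.N / (2 * p.P) ^ (l / (k + 1)) / min (2 * p.P) (p.N / (2 * p.P) ^ (l / (k + 1)))))) := by
  rw [← (c.half_spec hl).1, butterfly, c.log_two_P]

theorem Ctx.normLE_butterfly (c : Ctx E p m k n) {l : ℕ} (hl : l < n) {ξ : PolyRing p.P}
    (hξ : NormLE hP0 ξ 1) {f : ℕ → PolyRing p.P} {R : ℝ} (hf : ∀ i < p.N, NormLE hP0 (f i) R) {i : ℕ}
    (hi : i < p.N) : NormLE hP0 (butterfly p.N (2 * p.P) ξ l f i) (2 * R) := by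
  have hN := (c.half_spec hl).2.1
  rw [c.butterfly_eq hl, two_mul R]
  split_ifs with h
  · exact (hf i hi).add (hf _ (add_half_lt rfl hN hi h))
  · rw [← mul_one (R + R)]
    exact ((hf _ ((Nat.sub_le _ _).trans_lt hi)).sub (hf i hi)).mul (hξ.pow_one _)

theorem Ctx.normLE_fftState (c : Ctx E p m k n) {ω ξ : PolyRing p.P} (hω : NormLE hP0 ω 1)
    (hξ : NormLE hP0 ξ 1) {f : ℕ → PolyRing p.P} {R : ℝ} (hf : ∀ i < p.N, NormLE hP0 (f i) R) :
    ∀ {l : ℕ}, l ≤ n → ∀ i < p.N, NormLE hP0 (fftState p.N (2 * p.P) ω ξ f l i) (R * 2 ^ l)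
  | 0, _, i, hi => by simpa [fftState] using hf i hi
  | l + 1, hl, i, hi => by
      have h := c.normLE_butterfly (l := l) (by omega) hξ
        (fun i hi => c.normLE_fftState hω hξ hf (l := l) (by omega) i hi) hi
      rw [show 2 * (R * 2 ^ l) = R * 2 ^ (l + 1) by ring] at h
      rw [fftState_succ]
      split_ifs
      · have := h.mul (hω.pow_one (twiddleExp p.N (2 * p.P) l i))
        rwa [mul_one] at this
      · exact h

theorem Ctx.butterfly_error (c : Ctx E p m k n) {l sv : ℕ} (hl : l < n)
    {f : ℕ → PolyRing p.P} {ε : ℝ} {U : ℕ → ℕ → ℤ}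
    (hf : ∀ i < p.N, NormLE hP0 (p.stdVal (Params.split (U i)) - f i) ε) {i : ℕ} (hi : i < p.N) :
    NormLE hP0 (p.stdVal (Params.split (butterflyInt p.P (p.N / 2 ^ l / 2)
      (p.N / (2 * p.P) ^ (l / (k + 1)) / min (2 * p.P) (p.N / (2 * p.P) ^ (l / (k + 1))))
      (2 * p.P / min (2 * p.P) (p.N / (2 * p.P) ^ (l / (k + 1))) * 2 ^ (l % (k + 1)) * sv) U i)) -
        butterfly p.N (2 * p.P) (ringX p.P ^ sv) l f i) (2 * ε) := by
  have hN := (c.half_spec hl).2.1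
  rw [Params.stdVal_butterflyInt hP0, c.butterfly_eq hl, two_mul ε]
  split_ifs with h
  · rw [add_sub_add_comm]
    exact (hf i hi).add (hf _ (add_half_lt rfl hN hi h))
  · rw [← pow_mul, mul_assoc _ sv, mul_left_comm _ sv, ← sub_mul, sub_sub_sub_comm]
    have := ((hf (i - p.N / 2 ^ l / 2) ((Nat.sub_le _ _).trans_lt hi)).sub (hf i hi)).mul
      (normLE_ringX.pow_one (hP := hP0) (sv * (2 * p.P / min (2 * p.P) (p.N / (2 * p.P) ^ (l / (k + 1))) *
        2 ^ (l % (k + 1)) * ((i % (2 * (p.N / 2 ^ l / 2)) - p.N / 2 ^ l / 2) /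
            (p.N / (2 * p.P) ^ (l / (k + 1)) / min (2 * p.P) (p.N / (2 * p.P) ^ (l / (k + 1))))))))
    rw [mul_one] at this
    exact this

theorem sum_dvd_le (k X n : ℕ) :
    ∑ l ∈ Finset.range n, (if (l + 1) % (k + 1) = 0 then X else 0) = n / (k + 1) * X := by
  induction n with
  | zero => simp
  | succ n ih =>
    rw [Finset.sum_range_succ, ih, Nat.succ_div, add_mul]
    simp only [Nat.dvd_iff_mod_eq_zero]
    split_ifs <;> simp

/-- The numerical conditions under which the outer FFT is sufficiently precise, for entries bounded by
`R`, with errors `ε` in the entries and `δ` in the powers of `ρ`. -/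
structure Precise (p : Params) (n : ℕ) (R ε δ : ℝ) : Prop where
  R_nonneg : 0 ≤ R
  ε_nonneg : 0 ≤ ε
  δ_nonneg : 0 ≤ δ
  δ_le : δ ≤ 1 / 2 ^ p.P
  step : 2 * (R * 2 ^ n) * δ + p.P * (2 / 2 ^ p.S) ≤ 4 * ε
  final : ε * 8 ^ n ≤ 1 / 2 ^ p.P
  fits : (1 + R * 2 ^ n) * 8 * 2 ^ p.S ≤ 2 ^ p.H

theorem two_mul_abs_le (c : Ctx E p m k n) {z : PolyRing p.P} {r ε : ℝ} {U : ℕ → ℤ}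
    (hz : NormLE hP0 z r) (h : NormLE hP0 (p.stdVal (Params.split U) - z) ε)
    (hr : 2 * (ε + r) * 2 ^ p.S ≤ 2 ^ p.H) {t : ℕ} (ht : t < 2 * p.P) : 2 * |U t| ≤ 2 ^ p.H := by
  have hu : NormLE hP0 (p.stdVal (Params.split U)) (ε + r) := by simpa using h.add hz
  have h1 := Params.abs_le_of_normLE c.hP hu ⟨t % 2, Nat.mod_lt _ (by norm_num)⟩
    (show t / 2 < p.P by omega)
  rw [Params.split, Nat.div_add_mod] at h1
  have : 2 * |(U t : ℝ)| ≤ 2 ^ p.H := by linarith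
  exact_mod_cast this

theorem fft_spec (c : Ctx E p m k n) {A sv s : ℕ} {st : St} (hA : 5 ≤ A) (hA' : A < 11)
    (hA7 : A ≠ 7) (hb : Base p m k n st) (h16 : st.v 16 = sv) (hsv : sv < p.N) {R ε δ : ℝ}
    (hpr : Precise p n R ε δ) (hrho : ∀ i < p.N, NormLE hP0 (arrVal p st 4 i - rho p.P p.N ^ i) δ)
    {F : ℕ → PolyRing p.P} (hF : ∀ i < p.N, NormLE hP0 (F i) R)
    (hst : ∀ i < p.N, NormLE hP0 (arrVal p st A i - F i) ε) :
    E.wpt (fftCode A) (5000 * (n * (2 * p.P * p.N))) (fun t st' =>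
      p.PassesFFT E.prog E.σ s t (rho p.P p.N ^ sv) (ringX p.P ^ sv) F ∧
      Frame 17 [7, 11, 12, 13, 14, 15, 16, 17, A] st st' ∧
      ∀ i < p.N, NormLE hP0 (arrVal p st' A i -
        fftState p.N (2 * p.P) (rho p.P p.N ^ sv) (ringX p.P ^ sv) F n i) (ε * 8 ^ n)) s st := by
  set ω := rho p.P p.N ^ sv with hω
  set ξ := ringX p.P ^ sv with hξ
  have hω1 : NormLE hP0 ω 1 := (normLE_rho _).pow_one _
  have hξ1 : NormLE hP0 ξ 1 := normLE_ringX.pow_one _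
  have hP := c.P_pos
  have hPL := c.P_le_L
  have hLB := c.L_lt
  have hN0 := c.N_pos
  have hNL := c.N_le_L
  have hkn := c.hkn
  have hnN := c.n_lt
  have hJ : 2 * p.P = 2 ^ (k + 1) := by rw [c.hP, pow_succ']
  have hdvd : 2 * p.P ∣ p.N := by rw [hJ, c.hN]; exact pow_dvd_pow _ hkn
  have hlogN : Nat.log 2 p.N = n := by rw [c.hN, Nat.log_pow (by norm_num)]
  have hR0 := hpr.R_nonneg
  have hε0 := hpr.ε_nonneg
  have hδ0 := hpr.δ_nonneg
  have hS0 : (0 : ℝ) < 2 ^ p.S := by positivity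
  have h1P : (1 : ℝ) / 2 ^ p.P ≤ 1 := by
    rw [div_le_one (by positivity)]; exact one_le_pow₀ (by norm_num)
  have hδ1 : δ ≤ 1 := hpr.δ_le.trans h1P
  have hRl : ∀ l ≤ n, R * 2 ^ l ≤ R * 2 ^ n := fun l hl =>
    mul_le_mul_of_nonneg_left (pow_le_pow_right₀ (by norm_num) hl) hR0
  have hεl : ∀ l ≤ n, ε * 8 ^ l ≤ 1 / 2 ^ p.P := fun l hl =>
    (mul_le_mul_of_nonneg_left (pow_le_pow_right₀ (by norm_num) hl) hε0).trans hpr.final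
  have hFl : ∀ l ≤ n, ∀ i < p.N,
      NormLE hP0 (fftState p.N (2 * p.P) ω ξ F l i) (R * 2 ^ l) := fun l hl =>
    c.normLE_fftState hω1 hξ1 hF hl
  have hfits : ∀ r, r ≤ R * 2 ^ n → (1 + r) * 8 * 2 ^ p.S ≤ 2 ^ p.H := fun r hr =>
    le_trans (by gcongr) hpr.fits
  set Ds := [7, 11, 12, 13, 14, 15, 16, 17, A] with hDs
  have hD : 0 ∉ Ds ∧ 1 ∉ Ds ∧ 2 ∉ Ds := by simp [hDs]; omega
  have hD4 : 4 ∉ Ds := by simp [hDs]; omega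
  refine Env.wpt_of_rep fun hrep _ => ?_
  refine Env.wpt_mono (Env.wpt_loop_sum c.good (n := n)
    (T := fun l => 250 * (2 * p.P * p.N) +
      if (l + 1) % (k + 1) = 0 then 7000 * (p.P * (k + 1) * p.N) else 0)
    (fun l t st' => p.PassesLevels E.prog E.σ (104 + A * E.L) (104 + 7 * E.L) s t l ω ξ F ∧
      Frame 17 Ds st st' ∧ ∀ i < p.N, NormLE hP0 (arrVal p st' A i -
        fftState p.N (2 * p.P) ω ξ F l i) (ε * 8 ^ l))
    (by omega) ?_ ?_ ?_ ?_ (fun t _ st' h _ => h)) ?_ ?_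
  · rintro l t u st' htu ⟨h1, h2⟩
    exact ⟨h1.mono htu, h2⟩
  · refine ⟨Params.passesLevels_zero ?_, by simp [Frame.refl], fun i hi => by
      rw [pow_zero, mul_one]; exact hst i hi⟩
    exact c.holdsArray hrep (by omega) hF hst (by simpa using hεl 0 (by omega))
      (hfits _ (by simpa using hRl 0 (by omega))) hR0
  · rintro l _ t st' ⟨-, h, -⟩ _
    simp [(hb.frame h (by norm_num) hD).vars]
  · rintro l hl t ht st' hv ⟨hpass, hfr, herr⟩
    have hb' := hb.frame hfr (by norm_num) hD
    have e16 : st'.v 16 = sv := by rw [hfr.v 16 (by norm_num), h16]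
    obtain ⟨hB2, hN2, hh0⟩ := c.half_spec hl
    refine Env.wpt_seq (n := 60) (n' := 230 * (2 * p.P * p.N) +
      if (l + 1) % (k + 1) = 0 then 7000 * (p.P * (k + 1) * p.N) else 0)
      (Env.wpt_mono (level_spec c hl hb' e16 hv hsv) le_rfl ?_) (by omega)
    rintro t1 st1 ht1 _ _ ⟨fr1, v18, v19, v20, v21, v22⟩ -
    have hb1 := hb'.frame fr1 (by norm_num) (by simp)
    set M := p.N / (2 * p.P) ^ (l / (k + 1)) with hM
    have hG1 : (2 * p.P) ^ (l / (k + 1)) ≤ p.N := by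
      rw [hJ, ← pow_mul, c.hN]
      exact Nat.pow_le_pow_right (by norm_num) ((Nat.mul_div_le _ _).trans hl.le)
    have hG2 : (2 * p.P) ^ ((l + 1) / (k + 1)) ≤ p.N := by
      rw [hJ, ← pow_mul, c.hN]
      exact Nat.pow_le_pow_right (by norm_num) ((Nat.mul_div_le _ _).trans hl)
    have hM0 : 0 < M := Nat.div_pos hG1 (by positivity)
    have ha1 : st1.a = st'.a := by
      funext b
      exact fr1.a b (by simp)
    have herr1 : ∀ i < p.N, NormLE hP0 (p.stdVal (Params.split (arrInt p st1 A i)) -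
        fftState p.N (2 * p.P) ω ξ F l i) (ε * 8 ^ l) := fun i hi => by
      have := herr i hi
      rwa [arrVal, show arrInt p st' A i = arrInt p st1 A i by funext; rw [arrInt, arrInt, ha1]] at this
    have hsmall := hεl l hl.le
    have hb2fit : 2 * (ε * 8 ^ l + R * 2 ^ l) * 2 ^ p.S ≤ 2 ^ p.H := by
      refine le_trans ?_ (hfits _ (hRl l hl.le))
      have h0 : 0 ≤ R * 2 ^ l := by positivity
      refine mul_le_mul_of_nonneg_right ?_ hS0.le
      linarith
    refine Env.wpt_seq (n := 200 * (2 * p.P * p.N)) (n' := 30 * (2 * p.P * p.N) +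
      if (l + 1) % (k + 1) = 0 then 7000 * (p.P * (k + 1) * p.N) else 0)
      (Env.wpt_mono (butterfly_spec c (h := p.N / 2 ^ l / 2) (U := arrInt p st1 A)
        hA7 hb1 ?_ hh0 hN2 v19 v20 v21 ?_ ?_) le_rfl ?_) (by omega)
    · exact Nat.div_pos (min_le_right _ _) (lt_min (by omega) hM0)
    · intro i hi q hq
      rw [arrInt]; ring
    · intro i hi q hq
      exact two_mul_abs_le c (hFl l hl.le i hi) (herr1 i hi) hb2fit hq
    rintro t2 st2 ht2 hrep2 _ ⟨fr2, hbf⟩ -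
    have hb2 := hb1.frame fr2 (by norm_num) (by simp)
    have herr2 : ∀ i < p.N, NormLE hP0 (arrVal p st2 7 i -
        butterfly p.N (2 * p.P) ξ l (fftState p.N (2 * p.P) ω ξ F l) i) (2 * (ε * 8 ^ l)) := by
      intro i hi
      have h1 := c.butterfly_error hl (sv := sv) herr1 hi
      rw [arrVal, show p.stdVal (Params.split (arrInt p st2 7 i)) = _ from
        Params.stdVal_congr fun e j hj => ?_]
      · exact h1
      · rw [Params.split, Params.split, arrInt, hbf i hi _ (by omega)]
        ring
    have hRb : ∀ i < p.N, NormLE hP0 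
        (butterfly p.N (2 * p.P) ξ l (fftState p.N (2 * p.P) ω ξ F l) i) (R * 2 ^ (l + 1)) := by
      intro i hi
      have := c.normLE_butterfly hl hξ1 (hFl l hl.le) hi
      rwa [show 2 * (R * 2 ^ l) = R * 2 ^ (l + 1) by ring] at this
    have hsmall1 := hεl (l + 1) hl
    have hfit1 := hfits _ (hRl (l + 1) hl)
    have h20 : 2 * (ε * 8 ^ l) ≤ ε * 8 ^ (l + 1) := by
      have : 0 ≤ ε * 8 ^ l := by positivity
      rw [pow_succ]; linarith
    have hR10 : 0 ≤ R * 2 ^ (l + 1) := by positivity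
    have frA : Frame 17 Ds st st2 := (hfr.trans (fr1.mono (by norm_num) (by simp))).trans
      (fr2.mono (by norm_num) (by simp [hDs]))
    have w17 : st2.v 17 = l := by rw [fr2.v 17 (by norm_num), fr1.v 17 (by norm_num), hv]
    have hcopy : ¬ RoundEnds p.N (2 * p.P) l → ∀ u ≥ t2, E.wpt (copyCode A) (20 * (2 * p.P * p.N))
        (fun t' st'' => ∀ t'' ≥ t', st''.v 17 = l ∧
          p.PassesLevels E.prog E.σ (104 + A * E.L) (104 + 7 * E.L) s t'' (l + 1) ω ξ F ∧
          Frame 17 Ds st (st''.set 17 (l + 1)) ∧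
          ∀ i < p.N, NormLE hP0 (arrVal p (st''.set 17 (l + 1)) A i -
            fftState p.N (2 * p.P) ω ξ F (l + 1) i) (ε * 8 ^ (l + 1))) u st2 := by
      intro hre u hu
      refine Env.wpt_mono (copy_spec c hA7 (by omega) hb2 (fun z hz => hrep2.arr_lt 7 (by norm_num) z
        (by rw [c.hL]; exact hz))) le_rfl ?_
      rintro t3 st3 ht3 hrep3 _ ⟨fr3, h3⟩ t4 ht4
      have herr3 : ∀ i < p.N, NormLE hP0 (arrVal p st3 A i -
          fftState p.N (2 * p.P) ω ξ F (l + 1) i) (ε * 8 ^ (l + 1)) := by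
        intro i hi
        rw [fftState_succ, if_neg hre, arrVal_congr (st := st2) (A := 7) (i := i)
          fun q hq => h3 _ (idx_lt hi hq)]
        exact (herr2 i hi).mono h20
      refine ⟨by rw [fr3.v 17 (by norm_num), w17], ?_, ?_, herr3⟩
      · refine (hpass.succ (t₁ := t2) (t₂ := t3) (by omega) (by omega) ?_
          (fun h => absurd h hre)).mono ht4
        exact c.holdsArray hrep3 (by omega) (hFl (l + 1) hl) herr3 hsmall1 hfit1 hR10
      · rw [Frame.set_iff le_rfl]
        exact frA.trans (fr3.mono (by norm_num) (by simp [hDs]))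
    have hRE : RoundEnds p.N (2 * p.P) l ↔ (l + 1) % (k + 1) = 0 ∧
        (2 * p.P) ^ ((l + 1) / (k + 1)) < p.N := by
      rw [RoundEnds, c.log_two_P]
    have w22 : st2.v 22 = (2 * p.P) ^ ((l + 1) / (k + 1)) := by rw [fr2.v 22 (by norm_num), v22]
    have len1 : (((Prog.x 17 + 1) % (vlP + 1)).code 0).length = 5 := by simp
    have len2 : ((Prog.x 22 + 1 - vN).code 0).length = 2 := by simp
    refine Env.wpt_mono (Env.wpt_ifz c.good (n := 24 * (2 * p.P * p.N) +
      if (l + 1) % (k + 1) = 0 then 7000 * (p.P * (k + 1) * p.N) else 0) ?_ ?_ ?_) ?_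
      (fun _ _ _ _ _ h => h)
    · simp [hb2.vars]
    · intro h0 u hu
      simp only [Exp.val_mod, Exp.val_add, Exp.val_var, Exp.val_ofNat, w17, hb2.vars] at h0
      rw [if_pos h0]
      refine Env.wpt_mono (Env.wpt_ifz c.good (n := 20 * (2 * p.P * p.N) +
        7000 * (p.P * (k + 1) * p.N)) ?_ ?_ ?_) (by rw [len2]; omega) (fun _ _ _ _ _ h => h)
      · simp
      · intro h1 u' hu'
        simp only [Exp.val_sub, Exp.val_add, Exp.val_var, Exp.val_ofNat, w22, hb2.vars] at h1
        have hre : RoundEnds p.N (2 * p.P) l := hRE.2 ⟨h0, by omega⟩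
        have hR7 : ∀ i < p.N, NormLE hP0 (arrVal p st2 7 i) (1 + R * 2 ^ n) := by
          intro i hi
          have := (herr2 i hi).add (hRb i hi)
          rw [sub_add_cancel] at this
          exact this.mono (by linarith [hRl (l + 1) hl])
        have hrho2 : ∀ i < p.N, NormLE hP0 (arrVal p st2 4 i - rho p.P p.N ^ i) δ := by
          intro i hi
          rw [arrVal_congr (st := st) (A := 4) (i := i) fun q _ => by rw [frA.a 4 hD4]]
          exact hrho i hi
        have hR4 : ∀ i < p.N, NormLE hP0 (arrVal p st2 4 i) 2 := by
          intro i hi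
          have := (hrho2 i hi).add ((normLE_rho (hP := hP0) p.N).pow_one i)
          rw [sub_add_cancel] at this
          exact this.mono (by linarith [hδ1])
        have hbase : ∀ r, r ≤ (1 + R * 2 ^ n) * 8 → r * 2 ^ p.S ≤ 2 ^ p.H := fun r hr =>
          le_trans (mul_le_mul_of_nonneg_right hr hS0.le) hpr.fits
        have hRn0 : 0 ≤ R * 2 ^ n := by positivity
        refine Env.wpt_of_rep fun hrepu _ => ?_
        set x : ℕ → ℕ := fun i => sv * (twiddleExp p.N (2 * p.P) l i) % p.N with hx
        have hxN : ∀ i, x i < p.N := fun i => Nat.mod_lt _ hN0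
        have hxω : ∀ i, rho p.P p.N ^ x i = ω ^ twiddleExp p.N (2 * p.P) l i := by
          intro i
          rw [hω, ← pow_mul]
          conv_rhs => rw [← Nat.div_add_mod (sv * twiddleExp p.N (2 * p.P) l i) p.N, pow_add, pow_mul,
            rho_pow_self c.hP hN0.ne' hdvd, one_pow, one_mul]
        refine Env.wpt_mono (twiddle_spec c hA hA' hA7 hb2 (sv := sv) ?_ (G := (2 * p.P) ^ (l / (k + 1)))
          (G' := (2 * p.P) ^ ((l + 1) / (k + 1))) ?_ w22 hG1 hG2 (by positivity) ?_ ?_ ?_ x ?_)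
          (by omega) ?_
        · rw [frA.v 16 (by norm_num), h16]
        · rw [fr2.v 18 (by norm_num), v18]
        · intro i hi e j hj
          have := (Params.abs_le_of_normLE c.hP (hR7 i hi) e hj).trans (hbase _ (by linarith))
          exact_mod_cast this
        · intro i hi e j hj
          have := (Params.abs_le_of_normLE c.hP (hR4 i hi) e hj).trans (hbase _ (by linarith))
          exact_mod_cast this
        · intro i hi i' hi' e j hj
          have h5 := Params.abs_prodCoeff_le_of_normLE c.hP ((hR7 i hi).mul (hR4 i' hi')) e hj
          have h6 := hbase _ (show (1 + R * 2 ^ n) * 2 ≤ _ by linarith)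
          have h7 := h5.trans (show (1 + R * 2 ^ n) * 2 * (2 ^ p.S * 2 ^ p.S) ≤ 2 ^ p.H * 2 ^ p.S by
            rw [← mul_assoc]
            exact mul_le_mul_of_nonneg_right h6 hS0.le)
          exact_mod_cast h7
        · intro i
          rw [hx]
          simp only [twiddleExp, c.log_two_P]
        · rintro t3 st3 ht3 hrep3 _ ⟨fr3, h3⟩
          have herr3 : ∀ i < p.N, NormLE hP0 (arrVal p st3 A i -
              fftState p.N (2 * p.P) ω ξ F (l + 1) i) (ε * 8 ^ (l + 1)) := by
            intro i hi
            rw [fftState_succ, if_pos hre, ← hxω]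
            refine (Params.normLE_mul_error (herr2 i hi) (hRb i hi) (hrho2 _ (hxN i))
              ((normLE_rho p.N).pow_one _) (Params.normLE_round (h3 i hi).2)).mono ?_
            have h8 := hpr.step
            have h9 := mul_le_mul_of_nonneg_right (hRl (l + 1) hl) hδ0
            have h10 : ε ≤ ε * 8 ^ l := le_mul_of_one_le_right hε0 (one_le_pow₀ (by norm_num))
            have h11 : 2 * (ε * 8 ^ l) * (δ + 1) ≤ 2 * (ε * 8 ^ l) * 2 :=
              mul_le_mul_of_nonneg_left (by linarith [hδ1]) (by positivity)
            have h12 : 0 ≤ R * 2 ^ n * δ := by positivity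
            rw [pow_succ 8 l]
            linarith
          refine ⟨by rw [fr3.v 17 (by norm_num), w17], ?_, ?_, herr3⟩
          · refine hpass.succ (t₁ := u') (t₂ := t3) (by omega) (by omega) ?_ (fun _ => ⟨?_, ?_⟩)
            · exact c.holdsArray hrep3 (by omega) (hFl (l + 1) hl) herr3 hsmall1 hfit1 hR10
            · exact c.holdsArray hrepu (by norm_num) hRb herr2 (h20.trans hsmall1) hfit1 hR10
            · intro i hi
              obtain ⟨⟨t0, k1, k2, k3, k4⟩, -⟩ := h3 i hi
              refine ⟨t0, _, k1, k2, ?_, k4⟩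
              rw [← hxω]
              refine (Params.approximates_of_normLE c.hP ((normLE_rho p.N).pow_one _)
                (hrho2 _ (hxN i)) ?_ ?_).congr k3
              · exact hpr.δ_le
              · exact hbase _ (by linarith [hδ1])
          · rw [Frame.set_iff le_rfl]
            exact frA.trans (fr3.mono (by norm_num) (by simp [hDs]))
      · intro h1 u' hu'
        simp only [Exp.val_sub, Exp.val_add, Exp.val_var, Exp.val_ofNat, w22, hb2.vars] at h1
        exact Env.wpt_mono (hcopy (fun h => by have := (hRE.1 h).2; omega) u' (by omega)) (by omega)
          (fun _ _ _ _ _ h => h)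
    · intro h0 u hu
      simp only [Exp.val_mod, Exp.val_add, Exp.val_var, Exp.val_ofNat, w17, hb2.vars] at h0
      exact Env.wpt_mono (hcopy (fun h => h0 (hRE.1 h).1) u hu) (by omega) (fun _ _ _ _ _ h => h)
    · rw [len1]; omega
  · have h1 : (vlN.code 0).length = 0 := rfl
    rw [h1, Finset.sum_add_distrib, sum_dvd_le, Finset.sum_const, Finset.card_range, smul_eq_mul]
    have h2 : n / (k + 1) * (7000 * (p.P * (k + 1) * p.N)) ≤ 3500 * (n * (2 * p.P * p.N)) := by
      calc n / (k + 1) * (7000 * (p.P * (k + 1) * p.N)) =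
            (n / (k + 1) * (k + 1)) * (7000 * (p.P * p.N)) := by ring
        _ ≤ n * (7000 * (p.P * p.N)) := Nat.mul_le_mul_right _ (Nat.div_mul_le_self _ _)
        _ = _ := by ring
    have h3 : n ≤ n * (2 * p.P * p.N) := Nat.le_mul_of_pos_right _ (by omega)
    have h4 : 1 * 1 ≤ n * (2 * p.P * p.N) := Nat.mul_le_mul (by omega) (by omega)
    have h5 : n * (250 * (2 * p.P * p.N)) = 250 * (n * (2 * p.P * p.N)) := by ring
    omega
  · rintro t st' _ _ _ ⟨h1, h2, h3⟩
    exact ⟨h1.passesFFT hlogN.symm, h2, h3⟩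

end FR.Prog

namespace FR.Prog

open LogRAM LogRAM.Stmt

variable {E : Env} {p : Params} {m k n : ℕ}

/-- The variables hold the parameters. -/
def Vars (p : Params) (m k n : ℕ) (st : St) : Prop :=
  st.v 0 = 2 * m ∧ st.v 1 = m ∧ st.v 2 = p.P ∧ st.v 3 = p.N ∧ st.v 4 = k ∧ st.v 5 = n ∧
    st.v 7 = 2 * p.P ∧ st.v 8 = 2 ^ p.H ∧ st.v 9 = 2 ^ p.S ∧ st.v 10 = 2 ^ p.K + 1 ∧
    st.v 11 = 2 * p.P * p.N ∧ st.v 12 = 2 ^ p.K + 1 - 2 ^ p.K / p.P ∧ st.v 13 = 2 ^ p.P ∧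
    st.v 14 = 2 ^ 250

theorem Vars.vars {st : St} (h : Vars p m k n st) :
  st.v 0 = 2 * m ∧ st.v 1 = m ∧ st.v 2 = p.P ∧ st.v 3 = p.N ∧ st.v 4 = k ∧ st.v 5 = n ∧
    st.v 7 = 2 * p.P ∧ st.v 8 = 2 ^ p.H ∧ st.v 9 = 2 ^ p.S ∧ st.v 10 = 2 ^ p.K + 1 ∧
    st.v 11 = 2 * p.P * p.N ∧ st.v 12 = 2 ^ p.K + 1 - 2 ^ p.K / p.P ∧ st.v 13 = 2 ^ p.P ∧
    st.v 14 = 2 ^ 250 := h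

theorem Vars.frame {st st' : St} (h : Vars p m k n st) {y : ℕ} {D : List ℕ} (hf : Frame y D st st')
    (hy : 16 ≤ y) : Vars p m k n st' := by
  obtain ⟨h0, h1, h2, h3, h4, h5, h7, h8, h9, h10, h11, h12, h13, h14⟩ := h
  have hv : ∀ z < 16, st'.v z = st.v z := fun z hz => hf.v z (by omega)
  refine ⟨?_, ?_, ?_, ?_, ?_, ?_, ?_, ?_, ?_, ?_, ?_, ?_, ?_, ?_⟩
  all_goals rw [hv _ (by norm_num)]; assumption

theorem two_spec (c : Ctx E p m k n) {s : ℕ} {st : St} (hb : Vars p m k n st) :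
    E.wpt twoCode (40 * (2 * p.P * p.N)) (fun _ st' => Frame 20 [1] st st' ∧
      ∀ i ≤ n, st'.a 1 i = 2 ^ i) s st := by
  have hP := c.P_pos
  have hPL := c.P_le_L
  have hLB := c.L_lt
  have hNL := c.N_le_L
  have hnN := c.n_lt
  refine Env.wpt_cons' c.good (n := 38 * (2 * p.P * p.N)) (R := fun st' => Frame 20 [1] st st' ∧
    st'.a 1 0 = 1) ?_ ?_ ?_
  · simp [Stmt.len]; omega
  · simp [Stmt.wp, c.hacc, Frame.refl]
    have := c.good.B_ge
    exact ⟨⟨by omega, c.N_pos⟩, by omega⟩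
  rintro t1 _ st1 ⟨fr1, h0⟩
  refine Env.wpt_loop' c.good (n := n) (T := 20) (fun l st' => Frame 20 [1] st st' ∧
    ∀ i ≤ l, st'.a 1 i = 2 ^ i) (by omega) ?_ ?_ ?_ ?_ (fun _ _ st' h _ => h)
  · refine ⟨by simpa using fr1, fun i hi => ?_⟩
    obtain rfl : i = 0 := by omega
    simpa using h0
  · rintro l _ st' ⟨h, -⟩ _
    simp [(hb.frame h (by norm_num)).vars]
  · rintro l hl t _ st' hv ⟨hfr, h⟩
    have h2 : 2 * 2 ^ l ≤ p.N := by
      rw [← pow_succ', c.hN]; exact Nat.pow_le_pow_right (by norm_num) hl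
    refine Env.wpt_body c.good (by simp [Stmt.len]) ?_
    simp [Stmt.wp, hv, c.hacc, h l le_rfl, hfr]
    refine ⟨by omega, by omega, by omega, fun i hi => ?_⟩
    rw [Function.update_apply]
    split_ifs with h'
    · rw [h', pow_succ']
    · exact h i (by omega)
  · have : (vlN.code 0).length = 0 := rfl
    rw [this]; omega

theorem rev_spec (c : Ctx E p m k n) {s : ℕ} {st : St} (hb : Vars p m k n st)
    (htwo : ∀ i ≤ n, st.a 1 i = 2 ^ i) :
    E.wpt revCode (200 * (2 * p.P * p.N)) (fun _ st' => Frame 20 [0] st st' ∧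
      ∀ i ≤ n, ∀ q < 2 ^ i, st'.a 0 (2 ^ i + q) = bitRev i q) s st := by
  have hP := c.P_pos
  have hPL := c.P_le_L
  have hLB := c.L_lt
  have hNL := c.N_le_L
  have hnN := c.n_lt
  have hB := c.good.B_ge
  refine Env.wpt_cons' c.good (n := 190 * (2 * p.P * p.N)) (R := fun st' => Frame 20 [0] st st' ∧
    st'.a 0 1 = 0) ?_ ?_ ?_
  · simp [Stmt.len]; omega
  · simp [Stmt.wp, c.hacc, Frame.refl]
    omega
  rintro t1 _ st1 ⟨fr1, h0⟩
  refine Env.wpt_mono (Env.wpt_loop_sum c.good (n := n) (T := fun i => 60 * 2 ^ (i + 1))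
    (fun l _ st' => Frame 20 [0] st st' ∧
    ∀ i ≤ l, ∀ q < 2 ^ i, st'.a 0 (2 ^ i + q) = bitRev i q) (by omega) (fun _ _ _ _ _ h => h)
    ?_ ?_ ?_ (fun _ _ st' h _ => h)) ?_ (fun _ _ _ _ _ h => h)
  · refine ⟨by simpa using fr1, fun i hi q hq => ?_⟩
    obtain rfl : i = 0 := by omega
    obtain rfl : q = 0 := by simpa using hq
    simpa [bitRev] using h0
  · rintro l _ t st' ⟨h, -⟩ _
    simp [(hb.frame h (by norm_num)).vars]
  · rintro l hl t _ st' hv ⟨hfr, h⟩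
    have h2 : 2 ^ (l + 1) ≤ p.N := by
      rw [c.hN]; exact Nat.pow_le_pow_right (by norm_num) hl
    have hl2 : 2 ^ (l + 1) = 2 * 2 ^ l := pow_succ' 2 l
    have hl0 : 0 < 2 ^ l := by positivity
    refine Env.wpt_mono (Env.wpt_loop' c.good (n := 2 ^ (l + 1)) (T := 25)
      (Q := fun _ st'' => st''.v 20 = l ∧ Frame 20 [0] st st'' ∧
      (∀ i ≤ l, ∀ q < 2 ^ i, st''.a 0 (2 ^ i + q) = bitRev i q) ∧
      ∀ q < 2 ^ (l + 1), st''.a 0 (2 ^ (l + 1) + q) = bitRev (l + 1) q)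
      (fun z st'' => st''.v 20 = l ∧ Frame 20 [0] st st'' ∧
      (∀ i ≤ l, ∀ q < 2 ^ i, st''.a 0 (2 ^ i + q) = bitRev i q) ∧
      ∀ q < z, st''.a 0 (2 ^ (l + 1) + q) = bitRev (l + 1) q) (by omega) ?_ ?_ ?_ le_rfl
        (fun _ _ st' h _ => h)) ?_ ?_
    · simp [hfr, hv]
      exact h
    · rintro z _ st'' ⟨k1, k2, -⟩ k3
      have e1 : st''.a 1 (l + 1) = 2 ^ (l + 1) := by rw [k2.a 1 (by simp)]; exact htwo _ hl
      simp [k1, c.hacc, e1]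
      omega
    · rintro z hz t' _ st'' hv'' ⟨k1, k2, k3, k4⟩
      have e1 : st''.a 1 (l + 1) = 2 ^ (l + 1) := by rw [k2.a 1 (by simp)]; exact htwo _ hl
      have e2 : st''.a 1 l = 2 ^ l := by rw [k2.a 1 (by simp)]; exact htwo _ hl.le
      have e3 := k3 l le_rfl (z / 2) (by omega)
      have hbv : 2 ^ l * (z % 2) + bitRev l (z / 2) < E.B := by
        have := bitRev_lt (l + 1) z
        rw [bitRev] at this
        omega
      refine Env.wpt_body c.good (by simp [Stmt.len]) ?_
      simp [Stmt.wp, hv'', k1, c.hacc, e1, e2, e3, k2]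
      refine ⟨by omega, by omega, by omega, hbv, fun i hi q hq => ?_, fun q hq => ?_⟩
      · have : 2 ^ i * 2 ≤ 2 ^ (l + 1) := by
          rw [← pow_succ]; exact Nat.pow_le_pow_right (by norm_num) (by omega)
        rw [Function.update_of_ne (by omega)]
        exact k3 i hi q hq
      · rw [Function.update_apply]
        split_ifs with h'
        · obtain rfl : q = z := by omega
          rw [bitRev]
        · exact k4 q (by omega)
    · simp
      omega
    · rintro t' st'' _ _ _ ⟨k1, k2, k3, k4⟩
      refine ⟨k1, by simpa using k2, fun i hi q hq => ?_⟩
      rcases Nat.lt_or_ge l i with h' | h'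
      · obtain rfl : i = l + 1 := by omega
        exact k4 q hq
      · exact k3 i h' q hq
  · have h1 : (vlN.code 0).length = 0 := rfl
    have h2 : ∀ j, ∑ i ∈ Finset.range j, 60 * 2 ^ (i + 1) ≤ 120 * 2 ^ j := by
      intro j
      induction j with
      | zero => simp
      | succ j ih =>
        rw [Finset.sum_range_succ]
        have : 2 ^ (j + 1) = 2 * 2 ^ j := pow_succ' 2 j
        omega
    have := h2 n
    rw [← c.hN] at this
    rw [h1]
    omega

theorem theta_spec (c : Ctx E p m k n) {s : ℕ} {st : St} (hb : Vars p m k n st) :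
    E.wpt thetaCode (100 * (2 * p.P * p.N)) (fun _ st' => Frame 20 [2] st st' ∧
      ∀ t ≤ 2 * p.P, st'.a 2 t = (p.theta ^ t).val) s st := by
  have hP := c.P_pos
  have hPL := c.P_le_L
  have hLB := c.L_lt
  have hNL := c.N_le_L
  have hnN := c.n_lt
  have hB := c.good.B_ge
  have hN2 : 2 ≤ p.N := by
    have := c.hkn
    have := c.hk
    omega
  have hPL2 : 2 * p.P * 2 ≤ 2 * p.P * p.N := Nat.mul_le_mul_left _ hN2
  have hval1 : (1 : p.Res).val = 1 := ZMod.val_one'' (by have : 0 < 2 ^ p.K := (by positivity); omega)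
  refine Env.wpt_cons' c.good (n := 90 * (2 * p.P * p.N)) (R := fun st' => Frame 20 [2] st st' ∧
    st'.a 2 0 = 1) ?_ ?_ ?_
  · simp [Stmt.len]; omega
  · simp [Stmt.wp, c.hacc, Frame.refl]
    omega
  rintro t1 _ st1 ⟨fr1, h0⟩
  refine Env.wpt_loop' c.good (n := 2 * p.P) (T := 20) (fun l st' => Frame 20 [2] st st' ∧
    ∀ i ≤ l, st'.a 2 i = (p.theta ^ i).val) (by omega) ?_ ?_ ?_ ?_ (fun _ _ st' h _ => h)
  · refine ⟨by simpa using fr1, fun i hi => ?_⟩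
    obtain rfl : i = 0 := by omega
    simpa [hval1] using h0
  · rintro l _ st' ⟨h, -⟩ _
    simp [(hb.frame h (by norm_num)).vars]
  · rintro l hl t _ st' hv ⟨hfr, h⟩
    have hv' := hb.frame hfr (by norm_num)
    have key : 2 ^ 250 * (p.theta ^ l).val % (2 ^ p.K + 1) = (p.theta ^ (l + 1)).val := by
      refine mod_eq_val ?_
      have hd : p.K / p.P = 250 := by rw [c.hK, Nat.mul_div_cancel _ (by omega)]
      rw [Nat.cast_mul, ZMod.natCast_zmod_val, pow_succ' p.theta l, Nat.cast_pow, Params.theta, hd]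
      norm_num
    refine Env.wpt_body c.good (by simp [Stmt.len]) ?_
    simp only [Stmt.wp, Exp.ok_add, Exp.ok_var, Exp.ok_ofNat, Exp.val_add, Exp.val_var, hv,
      Exp.val_ofNat, Exp.ok_mod, Exp.ok_mul, Exp.ok_load, Exp.val_load, Exp.val_mul, Exp.val_mod,
      hv'.vars, h l le_rfl, key, c.hacc, true_and, St.put_v]
    refine ⟨⟨by omega, Nat.succ_ne_zero _⟩, by omega, (ZMod.val_lt _).trans c.M_lt, ?_, fun i hi => ?_⟩
    · simpa using hfr
    simp only [St.set_a, St.put_a, if_true, Function.update_apply]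
    split_ifs with h'
    · rw [h']
    · exact h i (by omega)
  · have : (vJ.code 0).length = 0 := rfl
    rw [this]; omega

theorem sqrt_spec (c : Ctx E p m k n) {s a : ℕ} {st : St} (hb : Vars p m k n st)
    (h21 : st.v 21 = a) (ha : a < 2 ^ (p.S + 2) * 2 ^ (p.S + 2)) :
    E.wpt sqrtCode (5000 * p.P) (fun _ st' => Frame 20 [] st st' ∧
      st'.v 20 = st.v 20 ∧ st'.v 25 = st.v 25 ∧ st'.v 22 = Nat.sqrt a) s st := by
  have hP := c.P_pos
  have hS := c.hS
  have hQB : 2 ^ (p.S + 2) < E.B := by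
    refine lt_of_le_of_lt ?_ (c.pow_lt (a := 101) (by norm_num))
    exact Nat.pow_le_pow_right (by norm_num) (by omega)
  have h4Q : 4 * 2 ^ p.S = 2 ^ (p.S + 2) := by rw [pow_add]; ring
  have hSB : p.S + 2 < E.B := lt_trans Nat.lt_two_pow_self hQB
  refine Env.wpt_cons' c.good (n := 4950 * p.P) (R := fun st' => Frame 20 [] st st' ∧
    st'.v 20 = st.v 20 ∧ st'.v 21 = a ∧ st'.v 25 = st.v 25 ∧ st'.v 22 = 0) ?_ ?_ ?_
  · simp [Stmt.len]; omega
  · simp [Stmt.wp, Frame.refl, h21]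
    omega
  rintro t1 _ st1 ⟨fr1, a1, b1, b1', c1⟩
  have hb1 := hb.frame fr1 (by norm_num)
  refine Env.wpt_cons' c.good (n := 4900 * p.P) (R := fun st' => Frame 20 [] st st' ∧
    st'.v 20 = st.v 20 ∧ st'.v 21 = a ∧ st'.v 25 = st.v 25 ∧ st'.v 22 = 0 ∧
    st'.v 23 = 2 ^ (p.S + 2)) ?_ ?_ ?_
  · simp [Stmt.len]; omega
  · simp [Stmt.wp, fr1, hb1.vars, a1, b1, b1', c1, h4Q, hQB]
  rintro t2 _ st2 ⟨fr2, a2, b2, b2', c2, d2⟩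
  refine Env.wpt_loop' c.good (n := p.S + 2) (T := 20) (fun i st' => Frame 20 [] st st' ∧
    st'.v 20 = st.v 20 ∧ st'.v 21 = a ∧ st'.v 25 = st.v 25 ∧ st'.v 23 = 2 ^ (p.S + 2 - i) ∧
    st'.v 22 * st'.v 22 ≤ a ∧ a < (st'.v 22 + st'.v 23) * (st'.v 22 + st'.v 23) ∧
    st'.v 22 + st'.v 23 ≤ 2 ^ (p.S + 2)) hSB ?_ ?_ ?_ ?_ ?_
  · simp [fr2, a2, b2, b2', c2, d2, ha]
  · rintro i _ st' ⟨h, -⟩ _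
    simp [(hb.frame h (by norm_num)).vars, hS]
  · rintro i hi t _ st' hv ⟨g1, g2, g3, g3', g4, g5, g6, g7⟩
    refine Env.wpt_body c.good (by simp [Stmt.len]) ?_
    have hdbl : st'.v 23 = 2 * 2 ^ (p.S + 1 - i) := by
      rw [g4, show p.S + 2 - i = p.S + 1 - i + 1 by omega, pow_succ']
    have hhalf : st'.v 23 / 2 = 2 ^ (p.S + 1 - i) := by omega
    simp [Stmt.wp, hv, g1, g2, g3, g3', hhalf]
    generalize 2 ^ (p.S + 1 - i) = y at *
    rw [hdbl] at g6 g7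
    refine ⟨by omega, fun h0 => ⟨by omega, by omega, ?_, by omega⟩, fun h0 => ⟨g5, by omega, by omega⟩⟩
    rw [add_assoc, ← two_mul]
    exact g6
  · have : ((100 * vP + 2).code 0).length = 2 := by simp
    rw [this, hS]; omega
  · rintro t _ st' ⟨g1, g2, g3, g3', g4, g5, g6, g7⟩ _
    have h23 : st'.v 23 = 1 := by rw [g4]; simp
    have hr : st'.v 22 = Nat.sqrt a := by
      rw [h23] at g6
      exact Nat.eq_sqrt.2 ⟨g5, g6⟩
    exact ⟨g1, g2, g3', hr⟩

/-! ### The roots of unity -/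

/-- Approximations of `2 cos (π / 2 ^ (i + 1))`. -/
def cosApprox (Q : ℕ) : ℕ → ℕ
  | 0 => 0
  | i + 1 => Nat.sqrt (2 * Q * Q + Q * cosApprox Q i)

theorem cosApprox_le (Q : ℕ) : ∀ i, cosApprox Q i ≤ 2 * Q
  | 0 => by simp [cosApprox]
  | i + 1 => by
      have := cosApprox_le Q i
      calc Nat.sqrt (2 * Q * Q + Q * cosApprox Q i) ≤ Nat.sqrt (2 * Q * (2 * Q)) :=
            Nat.sqrt_le_sqrt (by nlinarith)
        _ = 2 * Q := Nat.sqrt_eq _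

theorem sqrt_sub_natSqrt {a : ℕ} : (Nat.sqrt a : ℝ) ≤ √(a : ℝ) ∧ √(a : ℝ) ≤ Nat.sqrt a + 1 := by
  constructor
  · exact Real.le_sqrt_of_sq_le (by exact_mod_cast Nat.sqrt_le' a)
  · rw [Real.sqrt_le_left (by positivity)]
    exact_mod_cast (Nat.lt_succ_sqrt' a).le

theorem abs_cosApprox {Q : ℕ} (hQ : 0 < Q) : ∀ i,
    |(cosApprox Q i : ℝ) / Q - Real.sqrtTwoAddSeries 0 i| ≤ 2 / Q
  | 0 => by simp [cosApprox]; positivity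
  | i + 1 => by
      have ih := abs_cosApprox hQ i
      have hQ' : (0 : ℝ) < Q := by exact_mod_cast hQ
      set x : ℝ := (cosApprox Q i : ℝ) / Q with hx
      set y := Real.sqrtTwoAddSeries 0 i with hy
      have hx0 : 0 ≤ x := by positivity
      have hy0 : 0 ≤ y := Real.sqrtTwoAddSeries_zero_nonneg i
      have e1 : √((2 * Q * Q + Q * cosApprox Q i : ℕ) : ℝ) = Q * √(2 + x) := by
        rw [show ((2 * Q * Q + Q * cosApprox Q i : ℕ) : ℝ) = Q ^ 2 * (2 + x) by
          rw [hx]; push_cast; field_simp, Real.sqrt_mul (by positivity), Real.sqrt_sq hQ'.le]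
      obtain ⟨h1, h2⟩ := sqrt_sub_natSqrt (a := 2 * Q * Q + Q * cosApprox Q i)
      rw [e1] at h1 h2
      rw [cosApprox, Real.sqrtTwoAddSeries, ← hy]
      set z : ℝ := (Nat.sqrt (2 * Q * Q + Q * cosApprox Q i) : ℝ)
      have hz : |z / Q - √(2 + x)| ≤ 1 / Q := by
        rw [abs_le]
        constructor
        · rw [neg_le_sub_iff_le_add, ← add_div, le_div_iff₀ hQ']; linarith
        · rw [sub_le_iff_le_add, div_le_iff₀ hQ', add_mul, div_mul_cancel₀ _ hQ'.ne']; linarith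
      have hs : |√(2 + x) - √(2 + y)| ≤ |x - y| / 2 := by
        have hx1 : 1 ≤ √(2 + x) := Real.one_le_sqrt.2 (by linarith)
        have hy1 : 1 ≤ √(2 + y) := Real.one_le_sqrt.2 (by linarith)
        have : (√(2 + x) - √(2 + y)) * (√(2 + x) + √(2 + y)) = x - y := by
          have := Real.mul_self_sqrt (show 0 ≤ 2 + x by linarith)
          have := Real.mul_self_sqrt (show 0 ≤ 2 + y by linarith)
          linarith
        rw [← this, abs_mul, abs_of_pos (show 0 < √(2 + x) + √(2 + y) by linarith)]
        have := abs_nonneg (√(2 + x) - √(2 + y))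
        nlinarith
      have := abs_sub_le (z / Q) (√(2 + x)) (√(2 + y))
      have e2 : (2 : ℝ) / Q / 2 + 1 / Q = 2 / Q := by ring
      linarith

theorem abs_sqrt_sub_sqrt_le {a b : ℝ} (ha : 0 ≤ a) (hb : 0 ≤ b) : |√a - √b| ≤ √|a - b| := by
  refine Real.abs_le_sqrt ?_
  have h1 := Real.mul_self_sqrt ha
  have h2 := Real.mul_self_sqrt hb
  have : |a - b| = |√a - √b| * (√a + √b) := by
    rw [← abs_of_nonneg (add_nonneg (Real.sqrt_nonneg a) (Real.sqrt_nonneg b)), ← abs_mul]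
    congr 1; linarith
  rw [this, ← sq_abs, sq]
  refine mul_le_mul_of_nonneg_left ?_ (abs_nonneg _)
  rw [abs_le]
  constructor <;> linarith [Real.sqrt_nonneg a, Real.sqrt_nonneg b]

/-- The approximations of the cosine and the sine of `2 π / 2 ^ n`. -/
theorem abs_cos_sin_le {Q D n : ℕ} (hD : 1 ≤ D) (hQ : Q = D * D) (hn : 2 ≤ n) :
    |((cosApprox Q (n - 2) / 2 : ℕ) : ℝ) / Q - Real.cos (2 * Real.pi / 2 ^ n)| ≤ 4 / D ∧
    |((Nat.sqrt (4 * Q * Q - cosApprox Q (n - 2) * cosApprox Q (n - 2)) / 2 : ℕ) : ℝ) / Q -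
      Real.sin (2 * Real.pi / 2 ^ n)| ≤ 4 / D := by
  obtain ⟨i, rfl⟩ := Nat.exists_eq_add_of_le hn
  have hD' : (1 : ℝ) ≤ D := by exact_mod_cast hD
  have hQD : (Q : ℝ) = D * D := by exact_mod_cast hQ
  have hQ0 : (0 : ℝ) < Q := by rw [hQD]; positivity
  have hQ1 : 0 < Q := by exact_mod_cast hQ0
  have harg : 2 * Real.pi / 2 ^ (2 + i) = Real.pi / 2 ^ (i + 1) := by
    rw [show 2 + i = (i + 1) + 1 by ring, pow_succ (2 : ℝ) (i + 1)]; field_simp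
  rw [harg, Nat.add_sub_cancel_left]
  have hle := cosApprox_le Q i
  have herr := abs_cosApprox hQ1 i
  set X := cosApprox Q i
  have hc : Real.cos (Real.pi / 2 ^ (i + 1)) = Real.sqrtTwoAddSeries 0 i / 2 :=
    Real.cos_pi_over_two_pow i
  set y := Real.sqrtTwoAddSeries 0 i
  have hy0 : 0 ≤ y := Real.sqrtTwoAddSeries_zero_nonneg i
  have hy2 : y ≤ 2 := (Real.sqrtTwoAddSeries_lt_two i).le
  set x : ℝ := (X : ℝ) / Q with hx
  have hx0 : 0 ≤ x := by positivity
  have hx2 : x ≤ 2 := by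
    rw [hx, div_le_iff₀ hQ0]; exact_mod_cast hle
  have hhalf : ∀ a : ℕ, |((a / 2 : ℕ) : ℝ) / Q - (a : ℝ) / Q / 2| ≤ 1 / Q := by
    intro a
    have h1 : ((a / 2 : ℕ) : ℝ) * 2 ≤ a := by exact_mod_cast (show a / 2 * 2 ≤ a by omega)
    have h2 : (a : ℝ) ≤ ((a / 2 : ℕ) : ℝ) * 2 + 1 := by exact_mod_cast (show a ≤ a / 2 * 2 + 1 by omega)
    rw [div_div, mul_comm (Q : ℝ) 2, ← div_div, ← sub_div, abs_div, abs_of_pos hQ0]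
    refine div_le_div_of_nonneg_right ?_ hQ0.le
    rw [abs_le]; constructor <;> linarith
  have hDQ : (1 : ℝ) / Q ≤ 1 / D := by
    rw [hQD]; exact one_div_le_one_div_of_le (by linarith) (by nlinarith)
  have hD0 : (0 : ℝ) < 1 / D := by positivity
  have e2 : (2 : ℝ) / Q = 2 * (1 / Q) := by ring
  have e4 : (4 : ℝ) / D = 4 * (1 / D) := by ring
  constructor
  · rw [hc, e4]
    have h1 := hhalf X
    rw [← hx] at h1
    have h2 := abs_sub_le (((X / 2 : ℕ) : ℝ) / Q) (x / 2) (y / 2)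
    rw [← sub_div, abs_div, abs_of_pos (show (0 : ℝ) < 2 by norm_num)] at h2
    linarith
  · have hs : Real.sin (Real.pi / 2 ^ (i + 1)) = √(4 - y ^ 2) / 2 := by
      have hs0 : 0 ≤ Real.sin (Real.pi / 2 ^ (i + 1)) :=
        Real.sin_nonneg_of_nonneg_of_le_pi (by positivity)
          (div_le_self Real.pi_pos.le (one_le_pow₀ (by norm_num)))
      rw [eq_div_iff (by norm_num), ← Real.sqrt_sq (mul_nonneg hs0 (by norm_num : (0 : ℝ) ≤ 2)),
        mul_pow, Real.sin_sq, hc]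
      congr 1; ring
    obtain ⟨h1, h2⟩ := sqrt_sub_natSqrt (a := 4 * Q * Q - X * X)
    have hsub : X * X ≤ 4 * Q * Q := by nlinarith
    have e1 : √((4 * Q * Q - X * X : ℕ) : ℝ) = Q * √(4 - x ^ 2) := by
      rw [show ((4 * Q * Q - X * X : ℕ) : ℝ) = Q ^ 2 * (4 - x ^ 2) by
        rw [hx, Nat.cast_sub hsub]; push_cast; field_simp, Real.sqrt_mul (by positivity),
        Real.sqrt_sq hQ0.le]
    rw [e1] at h1 h2
    set Y := Nat.sqrt (4 * Q * Q - X * X)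
    have hz : |(Y : ℝ) / Q - √(4 - x ^ 2)| ≤ 1 / Q := by
      rw [abs_le]
      constructor
      · rw [neg_le_sub_iff_le_add, ← add_div, le_div_iff₀ hQ0]; linarith
      · rw [sub_le_iff_le_add, div_le_iff₀ hQ0, add_mul, div_mul_cancel₀ _ hQ0.ne']; linarith
    have hss : |√(4 - x ^ 2) - √(4 - y ^ 2)| ≤ 3 / D := by
      refine (abs_sqrt_sub_sqrt_le (by nlinarith) (by nlinarith)).trans ?_
      rw [Real.sqrt_le_left (by positivity)]
      have h3 : |4 - x ^ 2 - (4 - y ^ 2)| = |x - y| * (x + y) := by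
        rw [← abs_of_nonneg (show 0 ≤ x + y by linarith), ← abs_mul, ← abs_neg]
        congr 1; ring
      rw [h3, div_pow, sq (D : ℝ), ← hQD]
      calc |x - y| * (x + y) ≤ 2 / Q * 4 := mul_le_mul herr (by linarith) (by linarith) (by positivity)
        _ ≤ 3 ^ 2 / Q := by rw [div_mul_eq_mul_div]; exact div_le_div_of_nonneg_right (by norm_num) hQ0.le
    have h3 := hhalf Y
    have h4 := abs_sub_le (((Y / 2 : ℕ) : ℝ) / Q) ((Y : ℝ) / Q / 2) (√(4 - y ^ 2) / 2)
    rw [← sub_div, abs_div, abs_of_pos (show (0 : ℝ) < 2 by norm_num)] at h4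
    have h5 := abs_sub_le ((Y : ℝ) / Q) (√(4 - x ^ 2)) (√(4 - y ^ 2))
    have e3 : (3 : ℝ) / D = 3 * (1 / D) := by ring
    rw [hs, e4]
    linarith

/-- The computed real and imaginary parts of the powers of a root of unity. -/
def cisInt (Q C D : ℤ) : ℕ → ℤ × ℤ
  | 0 => (Q, 0)
  | r + 1 => (((cisInt Q C D r).1 * C - (cisInt Q C D r).2 * D) / Q,
      ((cisInt Q C D r).1 * D + (cisInt Q C D r).2 * C) / Q)

open Complex in
theorem norm_cisInt_le {Q C D : ℤ} (hQ : 0 < Q) {ω : ℂ} (hω : ‖ω‖ = 1) {d : ℝ}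
    (hC : |(C : ℝ) / Q - ω.re| ≤ d) (hD : |(D : ℝ) / Q - ω.im| ≤ d) (hd : 1 / (Q : ℝ) ≤ d) :
    ∀ r : ℕ, r * (8 * d) ≤ 1 →
      ‖(((cisInt Q C D r).1 : ℂ) + (cisInt Q C D r).2 * I) / Q - ω ^ r‖ ≤ r * (8 * d) := by
  have hQ' : (0 : ℝ) < Q := by exact_mod_cast hQ
  have hQc : (Q : ℂ) ≠ 0 := by exact_mod_cast hQ.ne'
  have hd0 : 0 < d := lt_of_lt_of_le (by positivity) hd
  intro r
  induction r with
  | zero => intro _; simp [cisInt, hQc]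
  | succ r ih =>
    intro hr
    push_cast at hr
    have ih' := ih (by linarith)
    set a := (cisInt Q C D r).1 with ha
    set b := (cisInt Q C D r).2 with hb
    set g : ℂ := ((C : ℂ) + D * I) / Q with hg
    set z : ℂ := ((a : ℂ) + b * I) / Q with hz
    have hgω : ‖g - ω‖ ≤ 2 * d := by
      have h1 : (g - ω).re = (C : ℝ) / Q - ω.re := by
        rw [sub_re, hg, show ((C : ℂ) + D * I) / Q = ((C / Q : ℝ) : ℂ) + ((D / Q : ℝ) : ℂ) * I by
          push_cast; ring, add_re, re_ofReal_mul, ofReal_re, I_re, mul_zero, add_zero]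
      have h2 : (g - ω).im = (D : ℝ) / Q - ω.im := by
        rw [sub_im, hg, show ((C : ℂ) + D * I) / Q = ((C / Q : ℝ) : ℂ) + ((D / Q : ℝ) : ℂ) * I by
          push_cast; ring, add_im, im_ofReal_mul, ofReal_im, I_im, mul_one, zero_add]
      refine (norm_le_abs_re_add_abs_im _).trans ?_
      rw [h1, h2]; linarith
    have hfl : ∀ y : ℤ, |((y / Q : ℤ) : ℝ) / Q - y / (Q * Q)| ≤ d := by
      intro y
      refine le_trans ?_ hd
      have h1 := Int.mul_ediv_add_emod y Q
      have h2 := Int.emod_nonneg y hQ.ne'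
      have h3 := Int.emod_lt_of_pos y hQ
      have h4 : (y : ℝ) = Q * ((y / Q : ℤ) : ℝ) + ((y % Q : ℤ) : ℝ) := by exact_mod_cast h1.symm
      have h5 : (0 : ℝ) ≤ ((y % Q : ℤ) : ℝ) := by exact_mod_cast h2
      have h6 : ((y % Q : ℤ) : ℝ) ≤ Q := by exact_mod_cast h3.le
      have h7 : ((y / Q : ℤ) : ℝ) / Q - y / (Q * Q) = -(((y % Q : ℤ) : ℝ) / (Q * Q)) := by
        rw [h4]; field_simp; ring
      rw [h7, abs_neg, abs_of_nonneg (by positivity), div_le_div_iff₀ (by positivity) hQ']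
      nlinarith
    set z' : ℂ := (((cisInt Q C D (r + 1)).1 : ℂ) + (cisInt Q C D (r + 1)).2 * I) / Q with hz'
    have hzg : ‖z' - z * g‖ ≤ 2 * d := by
      have h0 : z' - z * g =
          (((((a * C - b * D) / Q : ℤ) : ℝ) / Q - ((a * C - b * D : ℤ) : ℝ) / (Q * Q) : ℝ) : ℂ) +
          (((((a * D + b * C) / Q : ℤ) : ℝ) / Q - ((a * D + b * C : ℤ) : ℝ) / (Q * Q) : ℝ) : ℂ) * I := by
        rw [hz', hz, hg, cisInt]
        simp only [← ha, ← hb]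
        push_cast
        field_simp
        ring_nf
        simp only [I_sq]
        ring
      have h1 := hfl (a * C - b * D)
      have h2 := hfl (a * D + b * C)
      rw [h0]
      refine (norm_add_le _ _).trans ?_
      rw [norm_mul, norm_I, mul_one, norm_real, norm_real, Real.norm_eq_abs, Real.norm_eq_abs]
      linarith
    have hzn : ‖z‖ ≤ 2 := by
      have h1 : z = (z - ω ^ r) + ω ^ r := by ring
      rw [h1]
      refine (norm_add_le _ _).trans ?_
      rw [norm_pow, hω, one_pow]
      linarith
    have h0 : z' - ω ^ (r + 1) = (z' - z * g) + z * (g - ω) + (z - ω ^ r) * ω := by ring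
    rw [h0]
    refine (norm_add₃_le).trans ?_
    rw [norm_mul, norm_mul, hω, mul_one]
    push_cast
    have : ‖z‖ * ‖g - ω‖ ≤ 2 * (2 * d) := mul_le_mul hzn hgω (norm_nonneg _) (by norm_num)
    linarith

theorem abs_cisInt_le {Q C D : ℤ} (hQ : 0 < Q) {z : ℂ} (hz : ‖z‖ = 1) {r : ℕ} {d : ℝ}
    (h : ‖(((cisInt Q C D r).1 : ℂ) + (cisInt Q C D r).2 * Complex.I) / Q - z‖ ≤ d) (hd : d ≤ 1) :
    |(cisInt Q C D r).1| ≤ 2 * Q ∧ |(cisInt Q C D r).2| ≤ 2 * Q := by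
  have hQ' : (0 : ℝ) < Q := by exact_mod_cast hQ
  set a := (cisInt Q C D r).1
  set b := (cisInt Q C D r).2
  have h1 : ‖((a : ℂ) + b * Complex.I) / Q‖ ≤ 2 := by
    have := norm_sub_norm_le (((a : ℂ) + b * Complex.I) / Q) z
    rw [hz] at this
    linarith
  have h2 : ((a : ℂ) + b * Complex.I) / Q = ((a / Q : ℝ) : ℂ) + ((b / Q : ℝ) : ℂ) * Complex.I := by
    push_cast; ring
  rw [h2] at h1
  have h3 := (Complex.abs_re_le_norm _).trans h1
  have h4 := (Complex.abs_im_le_norm _).trans h1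
  rw [Complex.add_re, Complex.re_ofReal_mul, Complex.ofReal_re, Complex.I_re, mul_zero, add_zero,
    abs_div, abs_of_pos hQ', div_le_iff₀ hQ'] at h3
  rw [Complex.add_im, Complex.im_ofReal_mul, Complex.ofReal_im, Complex.I_im, mul_one, zero_add,
    abs_div, abs_of_pos hQ', div_le_iff₀ hQ'] at h4
  exact ⟨by exact_mod_cast h3, by exact_mod_cast h4⟩

theorem cis_step {O Q C D x y : ℕ} {a b : ℤ} (hx : (x : ℤ) = O + a) (hy : (y : ℤ) = O + b)
    (ha : |a| ≤ 2 * Q) (hb : |b| ≤ 2 * Q) (hC : C ≤ Q) (hD : D ≤ Q) (hO : 4 * Q ≤ O) (hQ : 0 < Q) :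
    ((((x * C + O * D + O * Q - O * C - y * D) / Q : ℕ) : ℤ) = O + (a * C - b * D) / Q ∧
      (((x * D + y * C + O * Q - O * D - O * C) / Q : ℕ) : ℤ) = O + (a * D + b * C) / Q) ∧
      (x * C + O * D + O * Q - O * C - y * D) / Q ≤ 2 * O ∧
      (x * D + y * C + O * Q - O * D - O * C) / Q ≤ 2 * O := by
  have hC' : (C : ℤ) ≤ Q := by exact_mod_cast hC
  have hD' : (D : ℤ) ≤ Q := by exact_mod_cast hD
  have hO' : 4 * (Q : ℤ) ≤ O := by exact_mod_cast hO
  have hQ' : (0 : ℤ) < Q := by exact_mod_cast hQ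
  have hC0 : (0 : ℤ) ≤ C := by positivity
  have hD0 : (0 : ℤ) ≤ D := by positivity
  have mul_bd : ∀ u : ℤ, |u| ≤ 2 * Q → ∀ v : ℤ, 0 ≤ v → v ≤ Q →
      -(2 * (Q : ℤ) * Q) ≤ u * v ∧ u * v ≤ 2 * Q * Q := by
    intro u hu v h0 h1
    rw [← abs_le, abs_mul, abs_of_nonneg h0]
    exact mul_le_mul hu h1 h0 (by positivity)
  have hOQ : 4 * (Q : ℤ) * Q ≤ O * Q := by nlinarith
  obtain ⟨a1, a2⟩ := mul_bd a ha C hC0 hC'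
  obtain ⟨a3, a4⟩ := mul_bd a ha D hD0 hD'
  obtain ⟨b1, b2⟩ := mul_bd b hb C hC0 hC'
  obtain ⟨b3, b4⟩ := mul_bd b hb D hD0 hD'
  have hOD : (0 : ℤ) ≤ O * D := by positivity
  have e1 : ((x * C + O * D + O * Q - O * C - y * D : ℕ) : ℤ) = a * C - b * D + O * Q := by
    have k1 : O * C ≤ x * C + O * D + O * Q := by zify; rw [hx]; linarith
    have k2 : y * D ≤ x * C + O * D + O * Q - O * C := by
      zify [k1]; rw [hx, hy]; linarith
    rw [Nat.cast_sub k2, Nat.cast_sub k1]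
    push_cast
    rw [hx, hy]; ring
  have e2 : ((x * D + y * C + O * Q - O * D - O * C : ℕ) : ℤ) = a * D + b * C + O * Q := by
    have k1 : O * D ≤ x * D + y * C + O * Q := by
      zify; rw [hx, hy]; have : (0 : ℤ) ≤ O * C := (by positivity); linarith
    have k2 : O * C ≤ x * D + y * C + O * Q - O * D := by
      zify [k1]; rw [hx, hy]; linarith
    rw [Nat.cast_sub k2, Nat.cast_sub k1]
    push_cast
    rw [hx, hy]; ring
  refine ⟨⟨?_, ?_⟩, ?_, ?_⟩
  · rw [Int.natCast_div, e1, Int.add_mul_ediv_right _ _ hQ'.ne', add_comm]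
  · rw [Int.natCast_div, e2, Int.add_mul_ediv_right _ _ hQ'.ne', add_comm]
  · refine Nat.div_le_of_le_mul ?_
    zify; rw [e1]; nlinarith
  · refine Nat.div_le_of_le_mul ?_
    zify; rw [e2]; nlinarith

/-- The real and imaginary parts of the powers of `exp (2 π i / N)` are in array 3. -/
def HoldsRoots (p : Params) (st : St) : Prop :=
  ∃ re im : ℕ → ℤ, ∀ r < p.N, (st.a 3 (2 * r) : ℤ) = 2 ^ p.H + re r ∧
    (st.a 3 (2 * r + 1) : ℤ) = 2 ^ p.H + im r ∧
    |re r| ≤ 2 * 2 ^ p.S ∧ |im r| ≤ 2 * 2 ^ p.S ∧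
    ‖((re r : ℂ) + im r * Complex.I) / 2 ^ p.S - omega p.N ^ r‖ ≤ 1 / 2 ^ (44 * p.P)

theorem Ctx.norm_cisInt (c : Ctx E p m k n) {r : ℕ} (hr : r < p.N) :
    ‖(((cisInt (2 ^ p.S : ℕ) (cosApprox (2 ^ p.S) (n - 2) / 2 : ℕ)
        (Nat.sqrt (4 * 2 ^ p.S * 2 ^ p.S - cosApprox (2 ^ p.S) (n - 2) *
          cosApprox (2 ^ p.S) (n - 2)) / 2 : ℕ) r).1 : ℂ) +
      (cisInt (2 ^ p.S : ℕ) (cosApprox (2 ^ p.S) (n - 2) / 2 : ℕ)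
        (Nat.sqrt (4 * 2 ^ p.S * 2 ^ p.S - cosApprox (2 ^ p.S) (n - 2) *
          cosApprox (2 ^ p.S) (n - 2)) / 2 : ℕ) r).2 * Complex.I) / ((2 ^ p.S : ℕ) : ℤ) -
        omega p.N ^ r‖ ≤ 1 / 2 ^ (44 * p.P) := by
  have hn2 : 2 ≤ n := by have := c.hkn; have := c.hk; omega
  have hP := c.P_pos
  have hQ : 2 ^ p.S = 2 ^ (50 * p.P) * 2 ^ (50 * p.P) := by
    rw [← pow_add, c.hS]; congr 1; ring
  obtain ⟨h1, h2⟩ := abs_cos_sin_le (D := 2 ^ (50 * p.P)) Nat.one_le_two_pow hQ hn2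
  have hω : omega p.N = Complex.exp (((2 * Real.pi / 2 ^ n : ℝ) : ℂ) * Complex.I) := by
    rw [omega, c.hN]; congr 1; push_cast; ring
  have hre : (omega p.N).re = Real.cos (2 * Real.pi / 2 ^ n) := by
    rw [hω, Complex.exp_ofReal_mul_I_re]
  have him : (omega p.N).im = Real.sin (2 * Real.pi / 2 ^ n) := by
    rw [hω, Complex.exp_ofReal_mul_I_im]
  rw [← hre] at h1
  rw [← him] at h2
  have key : (r : ℝ) * (8 * (4 / ((2 ^ (50 * p.P) : ℕ) : ℝ))) ≤ 1 / 2 ^ (44 * p.P) := by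
    have hr' : (r : ℝ) ≤ 2 ^ (3 * p.P) := by
      have : r ≤ 2 ^ (3 * p.P) := hr.le.trans (by
        rw [mul_comm, pow_mul]; exact c.N_le)
      exact_mod_cast this
    have h32 : (32 : ℝ) ≤ 2 ^ (3 * p.P) := by
      calc (32 : ℝ) = 2 ^ 5 := by norm_num
        _ ≤ 2 ^ (3 * p.P) := pow_le_pow_right₀ (by norm_num) (by omega)
    have he : (2 : ℝ) ^ (50 * p.P) = 2 ^ (3 * p.P) * 2 ^ (3 * p.P) * 2 ^ (44 * p.P) := by
      rw [← pow_add, ← pow_add]; congr 1; ring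
    push_cast
    rw [he, show (r : ℝ) * (8 * (4 / (2 ^ (3 * p.P) * 2 ^ (3 * p.P) * 2 ^ (44 * p.P)))) =
      (r * 32) / (2 ^ (3 * p.P) * 2 ^ (3 * p.P)) * (1 / 2 ^ (44 * p.P)) by field_simp; ring]
    refine mul_le_of_le_one_left (by positivity) ?_
    rw [div_le_one (by positivity)]
    exact mul_le_mul hr' h32 (by norm_num) (by positivity)
  refine (norm_cisInt_le (by positivity) (norm_omega _) (by rwa [Int.cast_natCast, Int.cast_natCast])
    (by rwa [Int.cast_natCast, Int.cast_natCast]) ?_ r (key.trans ?_)).trans key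
  · rw [hQ]
    push_cast
    have h1 : (1 : ℝ) ≤ 2 ^ (50 * p.P) := one_le_pow₀ (by norm_num)
    rw [div_le_div_iff₀ (by positivity) (by positivity)]
    nlinarith
  · rw [div_le_one (by positivity)]
    exact one_le_pow₀ (by norm_num)

set_option maxHeartbeats 1000000 in
theorem cis_spec (c : Ctx E p m k n) {s : ℕ} {st : St} (hb : Vars p m k n st) :
    E.wpt cisCode (10000 * (2 * p.P * p.N)) (fun _ st' => Frame 20 [3] st st' ∧
      HoldsRoots p st') s st := by
  have hP := c.P_pos
  have hPL := c.P_le_L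
  have hLB := c.L_lt
  have hNL := c.N_le_L
  have hnN := c.n_lt
  have hB := c.good.B_ge
  have hn2 : 2 ≤ n := by have := c.hkn; have := c.hk; omega
  have hN4 : 4 ≤ p.N := by
    rw [c.hN]; exact (Nat.pow_le_pow_right (by norm_num) hn2).trans' (by norm_num)
  have hS4 : 2 ^ (p.S + 2) = 4 * 2 ^ p.S := by rw [pow_add]; ring
  have hQ0 : 0 < 2 ^ p.S := by positivity
  have hOQ : 4 * 2 ^ p.S ≤ 2 ^ p.H := by
    rw [← hS4]; exact Nat.pow_le_pow_right (by norm_num) (by rw [c.hS, c.hH]; omega)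
  have hO2 : 2 * 2 ^ p.H < E.B := by
    refine lt_of_le_of_lt ?_ (c.pow_lt (a := 121) (by norm_num))
    rw [← pow_succ']; exact Nat.pow_le_pow_right (by norm_num) (by rw [c.hH]; omega)
  have hQQ : 4 * 2 ^ p.S * (4 * 2 ^ p.S) < E.B := by
    refine lt_of_le_of_lt ?_ (c.pow_lt (a := 202) (by norm_num))
    rw [← hS4, ← pow_add]; exact Nat.pow_le_pow_right (by norm_num) (by rw [c.hS]; omega)
  have hacc := c.hacc
  have hnorm := fun r => @Ctx.norm_cisInt E p m k n c r
  have hcl := fun i => cosApprox_le (2 ^ p.S) i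
  have hvars : ∀ {st'}, Frame 20 [3] st st' → Vars p m k n st' := fun h => hb.frame h (by norm_num)
  have hsq := @sqrt_spec E p m k n c
  rw [hS4] at hsq
  have hOH : ((2 ^ p.H : ℕ) : ℤ) = 2 ^ p.H := by push_cast; rfl
  have hQS : ((2 ^ p.S : ℕ) : ℂ) = 2 ^ p.S := by push_cast; rfl
  have hQS' : ((2 ^ p.S : ℕ) : ℤ) = 2 ^ p.S := by push_cast; rfl
  have hv := hb.vars
  unfold HoldsRoots
  rw [← hOH, ← hQS, ← hQS']
  have hH8 : st.v 8 = 2 ^ p.H := hv.2.2.2.2.2.2.2.1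
  have hS9 : st.v 9 = 2 ^ p.S := hv.2.2.2.2.2.2.2.2.1
  generalize 2 ^ p.S = Q at *
  generalize 2 ^ p.H = O at *
  clear hOH hQS hQS' hS4
  have q1 : 4 * Q * (4 * Q) = 16 * (Q * Q) := by ring
  have q2 : 2 * Q * Q = 2 * (Q * Q) := by ring
  have q3 : Q * (2 * Q) = 2 * (Q * Q) := by ring
  have q4 : 4 * Q * Q = 4 * (Q * Q) := by ring
  have q5 : Q ≤ Q * Q := Nat.le_mul_self Q
  have e8 : ∀ {st'}, Frame 20 [3] st st' → st'.v 8 = O := fun h => by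
    rw [h.v 8 (by norm_num), hH8]
  have e9 : ∀ {st'}, Frame 20 [3] st st' → st'.v 9 = Q := fun h => by
    rw [h.v 9 (by norm_num), hS9]
  refine Env.wpt_cons' c.good (n := 9900 * (2 * p.P * p.N)) (R := fun st' => Frame 20 [3] st st' ∧
    st'.v 22 = 0) ?_ ?_ ?_
  · simp [Stmt.len]; omega
  · simp [Stmt.wp, Frame.refl]
    omega
  rintro t1 _ st1 ⟨fr1, h1⟩
  -- the cosine
  refine Env.wpt_seq (n := 5100 * (p.P * n)) (n' := 5050 * p.P + 300 * p.N) (Env.wpt_loop' c.good (n := n - 2)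
    (T := 5000 * p.P + 20) (fun i st' => Frame 20 [3] st st' ∧ st'.v 22 = cosApprox Q i)
    (by omega) ?_ ?_ ?_ ?_ ?_) ?_
  · simp [fr1, h1, cosApprox]
  · rintro i _ st' ⟨h, -⟩ _
    simp [(hvars h).vars]
  · rintro i hi t _ st' hi' ⟨h, h22⟩
    have := hcl i
    have hb1 : Q * cosApprox Q i ≤ Q * (2 * Q) := Nat.mul_le_mul_left _ this
    have hb2 : 2 * Q * Q + Q * cosApprox Q i < E.B := by omega
    refine Env.wpt_cons' c.good (n := 5000 * p.P) (R := fun st'' => Frame 20 [3] st st'' ∧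
      st''.v 20 = i ∧ st''.v 21 = 2 * Q * Q + Q * cosApprox Q i) ?_ ?_ ?_
    · simp [Stmt.len]; omega
    · simp [Stmt.wp, h, h22, hi', e9 h, hb2]
    rintro t2 _ st2 ⟨fr2, i2, h2⟩
    refine Env.wpt_mono (hsq (hvars fr2) h2 (by omega)) le_rfl ?_
    rintro t3 st3 - - - ⟨k1, k2, -, k3⟩
    refine ⟨k2.trans i2, ?_⟩
    simp [fr2.trans (k1.mono le_rfl (List.nil_subset _)), k3, cosApprox]
  · have : ((vlN - 2).code 0).length = 1 := by simp
    rw [this]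
    calc (n - 2 + 1) * (5000 * p.P + 20 + 1 + 4) ≤ n * (5100 * p.P) :=
          Nat.mul_le_mul (by omega) (by omega)
      _ = _ := by ring
  swap
  · have : p.P * n ≤ p.P * p.N := Nat.mul_le_mul_left _ hnN.le
    have : p.P * 4 ≤ p.P * p.N := Nat.mul_le_mul_left _ (by omega)
    have : 2 * p.N ≤ p.P * p.N := Nat.mul_le_mul_right _ (by omega)
    have : 2 * p.P * p.N = 2 * (p.P * p.N) := by ring
    omega
  rintro t2 _ st2 ⟨fr2, h22⟩ _ _
  set X := cosApprox Q (n - 2) with hX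
  have hX2 : X ≤ 2 * Q := hcl _
  refine Env.wpt_cons' c.good (n := 5040 * p.P + 300 * p.N) (R := fun st' => Frame 20 [3] st st' ∧
    st'.v 22 = X ∧ st'.v 25 = X / 2) ?_ ?_ ?_
  · simp [Stmt.len]; omega
  · simp [Stmt.wp, fr2, h22]
    omega
  rintro t3 _ st3 ⟨fr3, h3, h3'⟩
  refine Env.wpt_cons' c.good (n := 5030 * p.P + 300 * p.N) (R := fun st' => Frame 20 [3] st st' ∧
    st'.v 21 = 4 * Q * Q - X * X ∧ st'.v 25 = X / 2) ?_ ?_ ?_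
  · simp [Stmt.len]; omega
  · simp [Stmt.wp, fr3, h3, h3', e9 fr3]
    refine lt_of_le_of_lt (Nat.sub_le _ _) ?_
    omega
  rintro t4 _ st4 ⟨fr4, h4, h4'⟩
  refine Env.wpt_seq (n := 5000 * p.P) (n' := 30 * p.P + 300 * p.N) (Env.wpt_mono (hsq (hvars fr4) h4
    (lt_of_le_of_lt (Nat.sub_le _ _) (by omega))) le_rfl ?_) (by omega)
  rintro t5 st5 - - - ⟨fr5, -, h5, h5'⟩ _
  replace fr5 := fr4.trans (fr5.mono le_rfl (List.nil_subset [3]))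
  rw [h4'] at h5
  set Y := Nat.sqrt (4 * Q * Q - X * X) with hY
  have hY2 : Y ≤ 2 * Q := by
    rw [hY, ← Nat.sqrt_eq (2 * Q)]
    exact Nat.sqrt_le_sqrt ((Nat.sub_le _ _).trans (le_of_eq (by ring)))
  set C := X / 2 with hC
  set D := Y / 2 with hD
  refine Env.wpt_cons' c.good (n := 29 * p.P + 300 * p.N) (R := fun st' => Frame 20 [3] st st' ∧
    st'.v 25 = C ∧ st'.v 26 = D) ?_ ?_ ?_
  · simp [Stmt.len]; omega
  · simp [Stmt.wp, fr5, h5, h5', ← hD]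
    omega
  rintro t6 _ st6 ⟨fr6, h6, h6'⟩
  refine Env.wpt_cons' c.good (n := 27 * p.P + 300 * p.N) (R := fun st' => Frame 20 [3] st st' ∧
    st'.v 25 = C ∧ st'.v 26 = D ∧ st'.a 3 0 = O + Q) ?_ ?_ ?_
  · simp [Stmt.len]; omega
  · simp [Stmt.wp, fr6, h6, h6', e8 fr6, e9 fr6, hacc]
    omega
  rintro t7 _ st7 ⟨fr7, h7, h7', h7''⟩
  refine Env.wpt_cons' c.good (n := 24 * p.P + 300 * p.N) (R := fun st' => Frame 20 [3] st st' ∧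
    st'.v 25 = C ∧ st'.v 26 = D ∧ st'.a 3 0 = O + Q ∧ st'.a 3 1 = O) ?_ ?_ ?_
  · simp [Stmt.len]; omega
  · simp [Stmt.wp, fr7, h7, h7', h7'', e8 fr7, hacc]
    omega
  rintro t8 _ st8 ⟨fr8, h8, h8', h8'', h8'''⟩
  refine Env.wpt_loop' c.good (n := p.N - 1) (T := 100) (fun i st' => Frame 20 [3] st st' ∧
    st'.v 25 = C ∧ st'.v 26 = D ∧ ∀ r ≤ i, (st'.a 3 (2 * r) : ℤ) = O + (cisInt Q C D r).1 ∧
      (st'.a 3 (2 * r + 1) : ℤ) = O + (cisInt Q C D r).2) (by omega) ?_ ?_ ?_ ?_ ?_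
  · refine ⟨by simpa using fr8, by simpa using h8, by simpa using h8', fun r hr => ?_⟩
    obtain rfl : r = 0 := by omega
    simp [cisInt, h8'', h8''']
  · rintro i _ st' ⟨h, -⟩ _
    simp [(hvars h).vars]
  · rintro i hi t _ st' hv' ⟨g1, g2, g3, g4⟩
    obtain ⟨g5, g6⟩ := g4 i le_rfl
    have hi' : i < p.N := by omega
    obtain ⟨b1, b2⟩ := abs_cisInt_le (Q := Q) (by exact_mod_cast hQ0) (by
      rw [norm_pow, norm_omega, one_pow]) (hnorm i hi') (by
      rw [div_le_one (by positivity)]; exact one_le_pow₀ (by norm_num))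
    obtain ⟨⟨s1, s2⟩, s3, s4⟩ := cis_step g5 g6 b1 b2 (by omega : C ≤ Q) (by omega : D ≤ Q) hOQ hQ0
    refine Env.wpt_body c.good (by simp [Stmt.len]) ?_
    simp [Stmt.wp, hv', g1, g2, g3, e8 g1, e9 g1, hacc, Function.update_apply]
    generalize hx : (st'.a 3 (2 * i) * C + O * D + O * Q - O * C - st'.a 3 (2 * i + 1) * D) / Q = x at *
    generalize hy : (st'.a 3 (2 * i) * D + st'.a 3 (2 * i + 1) * C + O * Q - O * D - O * C) / Q = y at *
    refine ⟨by omega, by omega, by omega, ?_, by omega, by omega, fun r hr => ?_⟩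
    · omega
    · rcases Nat.lt_or_ge i r with h' | h'
      · obtain rfl : r = i + 1 := by omega
        rw [if_neg (by omega), if_pos (by omega), if_pos (by omega), ← Int.natCast_div,
          ← Int.natCast_div, hx, hy, s1, s2]
        simp [cisInt]
      · rw [if_neg (by omega), if_neg (by omega), if_neg (by omega), if_neg (by omega)]
        exact g4 r h'
  · have : ((vN - 1).code 0).length = 1 := by simp
    rw [this]; omega
  · rintro t _ st' ⟨g1, g2, g3, g4⟩ _
    refine ⟨g1, fun r => (cisInt Q C D r).1, fun r => (cisInt Q C D r).2, fun r hr => ?_⟩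
    obtain ⟨b1, b2⟩ := abs_cisInt_le (Q := Q) (by exact_mod_cast hQ0) (by
      rw [norm_pow, norm_omega, one_pow]) (hnorm r hr) (by
      rw [div_le_one (by positivity)]; exact one_le_pow₀ (by norm_num))
    refine ⟨(g4 r (by omega)).1, (g4 r (by omega)).2, b1, b2, ?_⟩
    have := hnorm r hr
    simpa using this

end FR.Prog

namespace FR.Prog

open LogRAM LogRAM.Stmt

variable {E : Env} {p : Params} {m k n : ℕ} {hP0 : p.P ≠ 0}

/-- The entries of the table of the powers of `ρ`, from those of the table of roots of unity. -/
def rhoEntry (p : Params) (a : ℕ → ℕ) (q : ℕ) : ℕ :=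
  (∑ i ∈ Finset.range p.P, a (2 * ((2 * i + 1) * (q / (2 * p.P) + p.N / (2 * p.P) *
    (2 * p.P - q % (2 * p.P) / 2)) % p.N) + q % 2)) / p.P

open Complex in
theorem norm_average_le {Q : ℝ} (hQ : 0 < Q) {P : ℕ} (hP : 0 < P) {re im : ℕ → ℤ} {w : ℕ → ℂ} {z : ℂ} {d : ℝ}
    (hz : (P : ℂ) * z = ∑ i ∈ Finset.range P, w i)
    (h : ∀ i < P, ‖((re i : ℂ) + im i * I) / Q - w i‖ ≤ d) :
    ‖((((∑ i ∈ Finset.range P, re i) / P : ℤ) : ℂ) + ((∑ i ∈ Finset.range P, im i) / P : ℤ) * I) / Q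
      - z‖ ≤ 2 / Q + d := by
  have hP' : (0 : ℝ) < P := by exact_mod_cast hP
  have hPc : (P : ℂ) ≠ 0 := by exact_mod_cast hP.ne'
  have hQc : (Q : ℂ) ≠ 0 := by exact_mod_cast hQ.ne'
  have hfl : ∀ x : ℤ, |((x / P : ℤ) : ℝ) - x / P| ≤ 1 := by
    intro x
    have h1 := Int.mul_ediv_add_emod x P
    have h2 := Int.emod_nonneg x (b := P) (by omega)
    have h3 := Int.emod_lt_of_pos x (b := P) (by omega)
    have h4 : (x : ℝ) = P * ((x / P : ℤ) : ℝ) + ((x % P : ℤ) : ℝ) := by exact_mod_cast h1.symm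
    have h5 : (0 : ℝ) ≤ ((x % P : ℤ) : ℝ) := by exact_mod_cast h2
    have h6 : ((x % P : ℤ) : ℝ) ≤ P := by exact_mod_cast h3.le
    have h7 : ((x / P : ℤ) : ℝ) - x / P = -(((x % P : ℤ) : ℝ) / P) := by
      rw [h4]; field_simp; ring
    rw [h7, abs_neg, abs_of_nonneg (by positivity), div_le_one hP']
    exact h6
  set A := ∑ i ∈ Finset.range P, re i with hA
  set B := ∑ i ∈ Finset.range P, im i with hB
  have e1 : (((A / P : ℤ) : ℂ) + (B / P : ℤ) * I) / Q - z =
      (((((A / P : ℤ) : ℝ) - A / P : ℝ) : ℂ) + ((((B / P : ℤ) : ℝ) - B / P : ℝ) : ℂ) * I) / Q +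
      (∑ i ∈ Finset.range P, (((re i : ℂ) + im i * I) / Q - w i)) / P := by
    rw [Finset.sum_sub_distrib, ← hz, ← Finset.sum_div, Finset.sum_add_distrib, ← Finset.sum_mul,
      ← Int.cast_sum, ← Int.cast_sum, ← hA, ← hB]
    push_cast
    field_simp
    ring
  rw [e1]
  refine (norm_add_le _ _).trans (add_le_add ?_ ?_)
  · rw [norm_div, norm_real, Real.norm_eq_abs, abs_of_pos hQ]
    refine div_le_div_of_nonneg_right ((norm_add_le _ _).trans ?_) hQ.le
    rw [norm_mul, norm_I, mul_one, norm_real, norm_real, Real.norm_eq_abs, Real.norm_eq_abs]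
    linarith [hfl A, hfl B]
  · rw [norm_div, norm_natCast, div_le_iff₀ hP']
    refine (norm_sum_le _ _).trans ((Finset.sum_le_sum fun i hi => h i (Finset.mem_range.1 hi)).trans ?_)
    rw [Finset.sum_const, Finset.card_range, nsmul_eq_mul, mul_comm]

theorem Ctx.dvd_N (c : Ctx E p m k n) : 2 * p.P ∣ p.N := by
  rw [c.hP, c.hN, ← pow_succ']
  exact pow_dvd_pow _ c.hkn

theorem Ctx.rho_error (c : Ctx E p m k n) {st st' : St} (hr : HoldsRoots p st)
    (h : ∀ q < 2 * p.P * p.N, st'.a 4 q = rhoEntry p (st.a 3) q) {e : ℕ} (he : e < p.N) :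
    NormLE hP0 (arrVal p st' 4 e - rho p.P p.N ^ e) (1 / 2 ^ (42 * p.P)) := by
  obtain ⟨re, im, hr⟩ := hr
  have hP := c.P_pos
  have hN := c.N_pos
  obtain ⟨d, hd⟩ := exists_ofCoeffs hP0 (rho p.P p.N ^ e)
  have hmul : p.P * (2 / (2 : ℝ) ^ p.S + 1 / 2 ^ (44 * p.P)) ≤ 1 / 2 ^ (42 * p.P) := by
    have h1 : (p.P : ℝ) ≤ 2 ^ p.P := by exact_mod_cast (Ctx.P_lt (p := p)).le
    have h2 : (2 : ℝ) ≤ 2 ^ p.P := by exact_mod_cast c.two_le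
    have h3 : 2 / (2 : ℝ) ^ p.S ≤ 1 / 2 ^ (44 * p.P) := by
      rw [div_le_div_iff₀ (by positivity) (by positivity), ← pow_succ', one_mul]
      exact pow_le_pow_right₀ (by norm_num) (by rw [c.hS]; omega)
    have h4 : (2 : ℝ) ^ (44 * p.P) = 2 ^ p.P * 2 ^ p.P * 2 ^ (42 * p.P) := by
      rw [← pow_add, ← pow_add]; congr 1; ring
    calc p.P * (2 / (2 : ℝ) ^ p.S + 1 / 2 ^ (44 * p.P))
        ≤ 2 ^ p.P * (2 ^ p.P * (1 / 2 ^ (44 * p.P))) := by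
          refine mul_le_mul h1 ?_ (by positivity) (by positivity)
          have : (0 : ℝ) ≤ 1 / 2 ^ (44 * p.P) := by positivity
          nlinarith
      _ = 1 / 2 ^ (42 * p.P) := by rw [h4]; field_simp
  have key : ∀ j < p.P, ∀ b < 2, ∀ f : ℕ → ℤ,
      (∀ r < p.N, (st.a 3 (2 * r + b) : ℤ) = 2 ^ p.H + f r) →
      arrInt p st' 4 e (2 * j + b) = (∑ i ∈ Finset.range p.P,
        f ((2 * i + 1) * (e + p.N / (2 * p.P) * (2 * p.P - j)) % p.N)) / p.P := by
    intro j hj b hb f hf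
    have hq : 2 * p.P * e + (2 * j + b) < 2 * p.P * p.N := idx_lt he (by omega)
    have e1 : (2 * p.P * e + (2 * j + b)) / (2 * p.P) = e := by
      rw [Nat.mul_add_div (by omega), Nat.div_eq_of_lt (by omega), add_zero]
    have e2 : (2 * p.P * e + (2 * j + b)) % (2 * p.P) = 2 * j + b := by
      rw [Nat.mul_add_mod, Nat.mod_eq_of_lt (by omega)]
    have e3 : (2 * p.P * e + (2 * j + b)) % 2 = b := by
      rw [mul_assoc, ← add_assoc, ← mul_add, Nat.mul_add_mod, Nat.mod_eq_of_lt hb]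
    rw [arrInt, h _ hq, rhoEntry, e1, e2, e3, show (2 * j + b) / 2 = j by omega, Int.natCast_div,
      Nat.cast_sum]
    simp_rw [hf _ (Nat.mod_lt _ hN)]
    rw [Finset.sum_add_distrib, Finset.sum_const, Finset.card_range, nsmul_eq_mul, mul_comm,
      Int.add_comm (_ * _), Int.add_mul_ediv_right _ _ (by omega)]
    ring
  rw [hd, arrVal, Params.stdVal, ofCoeffs_sub]
  refine NormLE.mono (normLE_ofCoeffs fun j hj => ?_) hmul
  have hz := coeff_rho_pow c.hP hN.ne' c.dvd_N e hd hj
  simp only [Params.split]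
  rw [show ((0 : Fin 2) : ℕ) = 0 from rfl, show ((1 : Fin 2) : ℕ) = 1 from rfl,
    key j hj 0 (by norm_num) re fun r hr' => (hr r hr').1,
    key j hj 1 (by norm_num) im fun r hr' => (hr r hr').2.1]
  have := norm_average_le (Q := 2 ^ p.S) (by positivity) (by omega) hz
    (fun i _ => by
      have := (hr _ (Nat.mod_lt ((2 * i + 1) * (e + p.N / (2 * p.P) * (2 * p.P - j))) hN)).2.2.2.2
      push_cast
      exact this)
  push_cast at this ⊢
  exact this

theorem Ctx.sum_roots_lt (c : Ctx E p m k n) {st : St} (hr : HoldsRoots p st) {r : ℕ → ℕ} {b j : ℕ}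
    (hr' : ∀ i, r i < p.N) (hb : b < 2) (hj : j ≤ p.P) :
    ∑ i ∈ Finset.range j, st.a 3 (2 * r i + b) < E.B := by
  obtain ⟨re, im, hr⟩ := hr
  have hent : ∀ i, st.a 3 (2 * r i + b) ≤ 2 ^ p.H + 2 * 2 ^ p.S := by
    intro i
    obtain ⟨a1, a2, a3, a4, -⟩ := hr _ (hr' i)
    have a3' := (abs_le.1 a3).2
    have a4' := (abs_le.1 a4).2
    obtain rfl | rfl : b = 0 ∨ b = 1 := by omega
    · zify; rw [add_zero, a1]; linarith
    · zify; rw [a2]; linarith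
  have hP := c.P_pos
  have h2 : 2 * 2 ^ p.S ≤ 2 ^ p.H := by
    rw [← pow_succ']; exact Nat.pow_le_pow_right (by norm_num) (by rw [c.hS, c.hH]; omega)
  have h5 : 2 ^ p.H + 2 * 2 ^ p.S ≤ 2 ^ p.P * 2 ^ p.H :=
    (by omega : _ ≤ 2 * 2 ^ p.H).trans (Nat.mul_le_mul_right _ c.two_le)
  have h6 : 2 ^ p.P * (2 ^ p.P * 2 ^ p.H) = 2 ^ (122 * p.P) := by
    rw [← pow_add, ← pow_add, c.hH]; congr 1; ring
  refine lt_of_le_of_lt ?_ (c.pow_lt (a := 122) (by norm_num))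
  rw [← h6]
  calc _ ≤ ∑ i ∈ Finset.range j, (2 ^ p.H + 2 * 2 ^ p.S) := Finset.sum_le_sum fun i _ => hent i
    _ = j * (2 ^ p.H + 2 * 2 ^ p.S) := by rw [Finset.sum_const, Finset.card_range, smul_eq_mul]
    _ ≤ _ := Nat.mul_le_mul (hj.trans (Ctx.P_lt (p := p)).le) h5

theorem rho_spec (c : Ctx E p m k n) {s : ℕ} {st : St} (hb : Vars p m k n st)
    (hr : HoldsRoots p st) :
    E.wpt rhoCode (200 * (p.P * (2 * p.P * p.N))) (fun _ st' => Frame 20 [4] st st' ∧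
      ∀ e < p.N, NormLE hP0 (arrVal p st' 4 e - rho p.P p.N ^ e) (1 / 2 ^ (42 * p.P))) s st := by
  have hP := c.P_pos
  have hPL := c.P_le_L
  have hLB := c.L_lt
  have hNL := c.N_le_L
  have hB := c.good.B_ge
  have hN := c.N_pos
  refine Env.wpt_fill c.good (n := 2 * p.P * p.N) (T := 50 * p.P + 60) (k := 20) (D := 4)
    (Ds := [4]) (rhoEntry p (st.a 3)) hLB le_rfl ?_ ?_ ?_ ?_
  · intro st' h
    simp [(hb.frame h (by norm_num)).vars]
  · rintro q hq t _ st' hv fr -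
    have hvars := (hb.frame fr (by norm_num)).vars
    have hqJ : q / (2 * p.P) < p.N := Nat.div_lt_of_lt_mul hq
    have hNJ : p.N / (2 * p.P) * (2 * p.P - q % (2 * p.P) / 2) ≤ p.N := by
      refine (Nat.mul_le_mul_left _ (Nat.sub_le _ _)).trans ?_
      exact Nat.div_mul_le_self _ _
    set X := q / (2 * p.P) + p.N / (2 * p.P) * (2 * p.P - q % (2 * p.P) / 2) with hX
    refine Env.wpt_cons' c.good (n := 50 * p.P + 46) (R := fun st'' => st''.a 4 = st'.a 4 ∧ Frame 20 [4] st' st'' ∧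
      st''.v 20 = q ∧ st''.v 21 = X) ?_ ?_ ?_
    · simp [Stmt.len]; omega
    · simp [Stmt.wp, hv, hvars, Frame.refl, ← hX]
      omega
    rintro t1 _ st1 ⟨a1, fr1, h20, h21⟩
    refine Env.wpt_cons' c.good (n := 50 * p.P + 42) (R := fun st'' => st''.a 4 = st'.a 4 ∧ Frame 20 [4] st' st'' ∧
      st''.v 20 = q ∧ st''.v 21 = X ∧ st''.v 22 = q % 2) ?_ ?_ ?_
    · simp [Stmt.len]; omega
    · simp [Stmt.wp, a1, h20, h21, fr1]
      omega
    rintro t2 _ st2 ⟨a2, fr2, g20, g21, g22⟩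
    refine Env.wpt_cons' c.good (n := 50 * p.P + 41) (R := fun st'' => st''.a 4 = st'.a 4 ∧ Frame 20 [4] st' st'' ∧
      st''.v 20 = q ∧ st''.v 21 = X ∧ st''.v 22 = q % 2 ∧ st''.v 23 = 0) ?_ ?_ ?_
    · simp [Stmt.len]; omega
    · simp [Stmt.wp, a2, g20, g21, g22, fr2]
      omega
    rintro t3 _ st3 ⟨a3, fr3, f20, f21, f22, f23⟩
    have hsum : ∀ j ≤ p.P, ∑ i ∈ Finset.range j, st.a 3 (2 * ((2 * i + 1) * X % p.N) + q % 2) < E.B :=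
      fun j hj => c.sum_roots_lt hr (fun i => Nat.mod_lt _ hN) (Nat.mod_lt _ (by norm_num)) hj
    refine Env.wpt_seq (n := 50 * p.P + 30) (n' := 8) (Env.wpt_loop' c.good (n := p.P) (T := 21)
      (fun j st'' => st''.a 4 = st'.a 4 ∧ Frame 20 [4] st' st'' ∧ st''.v 20 = q ∧ st''.v 21 = X ∧ st''.v 22 = q % 2 ∧
        st''.v 23 = ∑ i ∈ Finset.range j, st.a 3 (2 * ((2 * i + 1) * X % p.N) + q % 2)) (by omega)
        ?_ ?_ ?_ ?_ ?_) ?_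
    · simp [a3, f20, f21, f22, f23, fr3]
    · rintro j _ st'' ⟨-, h, -⟩ _
      simp [(hb.frame (fr.trans h) (by norm_num)).vars]
    · rintro j hj t' _ st'' hj' ⟨k0, k1, k2, k3, k4, k5⟩
      have hv'' := (hb.frame (fr.trans k1) (by norm_num)).vars
      have e3 : st''.a 3 = st.a 3 := (fr.trans k1).a 3 (by simp)
      have hlt := Nat.mod_lt ((2 * j + 1) * X) hN
      have hq2 := Nat.mod_lt q (show 0 < 2 by norm_num)
      have hs1 := hsum (j + 1) hj
      rw [Finset.sum_range_succ] at hs1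
      refine Env.wpt_body c.good (by simp [Stmt.len]) ?_
      simp [Stmt.wp, hj', k0, k1, k2, k3, k4, k5, hv'', e3, c.hacc, hs1, Finset.sum_range_succ]
      omega
    · have : (vP.code 0).length = 0 := rfl
      rw [this]; omega
    · rintro t' _ st'' ⟨k0, k1, k2, k3, k4, k5⟩ _
      intro _
      have hv'' := (hb.frame (fr.trans k1) (by norm_num)).vars
      refine Env.wpt_body c.good (by simp [Stmt.len]) ?_
      simp [Stmt.wp, k0, k1, k2, k5, hv'', c.hacc, rhoEntry, ← hX]
      have := hsum p.P le_rfl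
      exact ⟨by omega, hq, (Nat.div_le_self _ _).trans_lt this⟩
    · omega
  · have : (vL.code 0).length = 0 := rfl
    rw [this]
    have h1 : 2 * (2 * p.P * p.N) ≤ p.P * (2 * p.P * p.N) := Nat.mul_le_mul_right _ hP
    have h2 : p.P * 1 ≤ p.P * (2 * p.P * p.N) := Nat.mul_le_mul_left _ (by omega)
    have h3 : (2 * p.P * p.N + 1) * (50 * p.P + 60 + 0 + 4) =
        50 * (p.P * (2 * p.P * p.N)) + 64 * (2 * p.P * p.N) + 50 * p.P + 64 := by ring
    omega
  · intro t _ st' fr h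
    exact ⟨fr, fun e he => c.rho_error hr h he⟩

end FR.Prog

namespace LogRAM

@[simp] theorem length_bits (l x : ℕ) : (bits l x).length = l := by simp [bits]

theorem bits_succ (l x : ℕ) : bits (l + 1) x = x.testBit l :: bits l x := by
  unfold bits
  rw [List.range_succ_eq_map, List.map_cons, List.map_map]
  refine congrArg₂ _ (by simp) (List.map_congr_left fun i hi => ?_)
  simp only [Function.comp_apply]
  congr 1
  omega

theorem bits_append (l l' x : ℕ) : bits (l + l') x = bits l (x / 2 ^ l') ++ bits l' x := by
  induction l with
  | zero => simp [bits]
  | succ l ih =>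
    rw [show l + 1 + l' = l + l' + 1 by ring, bits_succ, bits_succ, ih, Nat.testBit_div_two_pow]
    simp

theorem bits_mod (l x : ℕ) : bits l (x % 2 ^ l) = bits l x := by
  unfold bits
  refine List.map_congr_left fun i hi => ?_
  rw [List.mem_range] at hi
  rw [Nat.testBit_mod_two_pow]
  simp; omega

theorem bits_concat (l x : ℕ) : bits (l + 1) x = bits l (x / 2) ++ [x.testBit 0] := by
  have := bits_append l 1 x
  simpa [bits] using this

theorem ofBits_bits (l x : ℕ) : ofBits (bits l x) = x % 2 ^ l := by
  induction l generalizing x with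
  | zero => simp [bits, ofBits, Nat.mod_one]
  | succ l ih =>
    rw [bits_concat, ofBits, List.foldl_append]
    have : (bits l (x / 2)).foldl (fun x b => 2 * x + b.toNat) 0 = x / 2 % 2 ^ l := ih (x / 2)
    rw [this, pow_succ', Nat.mod_mul]
    simp only [List.foldl_cons, List.foldl_nil, Nat.testBit_zero]
    rcases Nat.mod_two_eq_zero_or_one x with h | h <;> simp [h]
    omega

theorem ofBits_drop_take {m s l a : ℕ} (h : s + l ≤ m) (r : List Bool) :
    ofBits (((bits m a ++ r).drop s).take l) = a / 2 ^ (m - s - l) % 2 ^ l := by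
  have e : bits m a = bits s (a / 2 ^ (m - s)) ++ (bits l (a / 2 ^ (m - s - l)) ++ bits (m - s - l) a) := by
    rw [← bits_append, show l + (m - s - l) = m - s by omega, ← bits_append,
      Nat.add_sub_cancel' (by omega)]
  rw [e, List.append_assoc, List.append_assoc, List.drop_left' (length_bits _ _),
    List.take_left' (length_bits _ _), ofBits_bits]

end LogRAM

namespace FR.Prog

open LogRAM LogRAM.Stmt

variable {E : Env} {p : Params} {m k n : ℕ} {hP0 : p.P ≠ 0}

/-- The entries of the array for the factor `a`. -/
def inputEntry (p : Params) (a q : ℕ) : ℕ :=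
  (if q % 2 = 0 ∧ q % (2 * p.P) < p.P then
    a / 2 ^ (p.P * (q / (2 * p.P) * (p.P / 2) + q % (2 * p.P) / 2)) % 2 ^ p.P else 0) * 2 ^ p.S + 2 ^ p.H

theorem Ctx.even (c : Ctx E p m k n) : p.P = 2 * (p.P / 2) := by
  obtain ⟨j, rfl⟩ := Nat.exists_eq_add_of_le c.hk
  rw [c.hP, pow_add]; omega

theorem Ctx.arrVal_input (c : Ctx E p m k n) {st : St} {A a : ℕ}
    (h : ∀ q < 2 * p.P * p.N, st.a A q = inputEntry p a q) {i : ℕ} (hi : i < p.N) :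
    arrVal p st A i = decompose p.P a i := by
  have hP := c.P_pos
  have he := c.even
  refine ofCoeffs_congr fun j hj => ?_
  have key : ∀ b < 2, arrInt p st A i (2 * j + b) = (if b = 0 ∧ j < p.P / 2 then
      a / 2 ^ (p.P * (i * (p.P / 2) + j)) % 2 ^ p.P else 0 : ℕ) * 2 ^ p.S := by
    intro b hb
    have e1 : (2 * p.P * i + (2 * j + b)) / (2 * p.P) = i := by
      rw [Nat.mul_add_div (by omega), Nat.div_eq_of_lt (by omega), add_zero]
    have e2 : (2 * p.P * i + (2 * j + b)) % (2 * p.P) = 2 * j + b := by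
      rw [Nat.mul_add_mod, Nat.mod_eq_of_lt (by omega)]
    have e3 : (2 * p.P * i + (2 * j + b)) % 2 = b := by
      rw [mul_assoc, ← add_assoc, ← mul_add, Nat.mul_add_mod, Nat.mod_eq_of_lt hb]
    rw [arrInt, h _ (idx_lt hi (by omega)), inputEntry, e1, e2, e3, show (2 * j + b) / 2 = j by omega]
    have e4 : (b = 0 ∧ 2 * j + b < p.P) ↔ (b = 0 ∧ j < p.P / 2) := by omega
    simp only [e4]
    push_cast
    ring
  simp only [Params.split]
  rw [show ((0 : Fin 2) : ℕ) = 0 from rfl, show ((1 : Fin 2) : ℕ) = 1 from rfl, key 0 (by norm_num),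
    key 1 (by norm_num)]
  simp only [true_and, one_ne_zero, false_and, if_false, Nat.cast_zero, zero_mul, Int.cast_zero, add_zero]
  rw [Int.cast_mul, Int.cast_pow, Int.cast_ofNat, mul_div_cancel_right₀ _ (pow_ne_zero _ two_ne_zero)]
  rw [Int.cast_natCast]
  split_ifs
  · rfl
  · simp

theorem normLE_decompose (a i : ℕ) :
    NormLE hP0 (decompose p.P a i) (2 ^ (2 * p.P)) := by
  refine NormLE.mono (normLE_ofCoeffs (r := 2 ^ p.P) fun j hj => ?_) ?_
  · split_ifs
    · rw [Complex.norm_natCast]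
      exact_mod_cast (Nat.mod_lt _ (by positivity)).le
    · simp
  · rw [two_mul, pow_add]
    exact mul_le_mul_of_nonneg_right (by exact_mod_cast (Ctx.P_lt (p := p)).le) (by positivity)

theorem Ctx.pos_lt (c : Ctx E p m k n) {i w : ℕ} (hi : i < p.N) (hw : w < 2 * p.P) :
    p.P * (i * (p.P / 2) + w / 2) < E.B := by
  refine c.lt_B (a := 6) ?_ (by norm_num)
  have h1 := (Ctx.P_lt (p := p)).le
  have h3 : i * (p.P / 2) + w / 2 ≤ (2 ^ p.P) ^ 5 := by
    calc i * (p.P / 2) + w / 2 ≤ p.N * p.P + p.N * p.P :=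
          add_le_add (Nat.mul_le_mul hi.le (by omega))
            ((by omega : w / 2 ≤ p.P).trans (Nat.le_mul_of_pos_left _ c.N_pos))
      _ = 2 * (p.N * p.P) := by ring
      _ ≤ 2 ^ p.P * ((2 ^ p.P) ^ 3 * 2 ^ p.P) :=
          Nat.mul_le_mul c.two_le (Nat.mul_le_mul c.N_le h1)
      _ = _ := by ring
  calc _ ≤ 2 ^ p.P * (2 ^ p.P) ^ 5 := Nat.mul_le_mul h1 h3
    _ = (2 ^ p.P) ^ 6 := by ring

set_option maxHeartbeats 1000000 in
theorem input_spec (c : Ctx E p m k n) {s bv a A : ℕ} {base : Exp} {st : St} (hb : Vars p m k n st)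
    (hbase : base = 0 ∧ bv = 0 ∨ base = vm ∧ bv = m) (ha : a < 2 ^ m)
    (hin : ∀ s l, s + l ≤ m →
      ofBits ((E.inp.drop (bv + s)).take l) = a / 2 ^ (m - s - l) % 2 ^ l)
    (hlen : bv + m ≤ E.inp.length) :
    E.wpt (inputCode A base) (100 * (2 * p.P * p.N)) (fun _ st' => Frame 20 [A] st st' ∧
      ∀ i < p.N, arrVal p st' A i = decompose p.P a i) s st := by
  have hP := c.P_pos
  have hPL := c.P_le_L
  have hLB := c.L_lt
  have hNL := c.N_le_L
  have hB := c.good.B_ge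
  have hN := c.N_pos
  have heven := c.even
  have hmB : m < E.B := lt_trans c.hm' (c.lt_B (a := 1) (by simp) (by norm_num))
  have hlen0 : ∀ d, (base.code d).length = 0 := by
    rcases hbase with ⟨rfl, -⟩ | ⟨rfl, -⟩ <;> intro d <;> rfl
  refine Env.wpt_fill c.good (n := 2 * p.P * p.N) (T := 60) (k := 20) (D := A)
    (Ds := [A]) (inputEntry p a) hLB le_rfl ?_ ?_ ?_ ?_
  · intro st' h
    simp [(hb.frame h (by norm_num)).vars]
  · rintro q hq t _ st' hv fr -
    have hvars := (hb.frame fr (by norm_num)).vars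
    set i := q / (2 * p.P) with hi
    set w := q % (2 * p.P) with hw
    have hw2 : w % 2 = q % 2 := by rw [hw, Nat.mod_mul_right_mod]
    have hwJ : w < 2 * p.P := Nat.mod_lt _ (by omega)
    have hiN : i < p.N := Nat.div_lt_of_lt_mul hq
    set pos := p.P * (i * (p.P / 2) + w / 2) with hpos
    have hposB : pos < E.B := c.pos_lt hiN hwJ
    refine Env.wpt_cons' c.good (n := 55) (R := fun st'' => st''.a A = st'.a A ∧
      Frame 20 [A] st' st'' ∧ st''.v 20 = q ∧ st''.v 21 = w) ?_ ?_ ?_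
    · simp [Stmt.len]
    · simp [Stmt.wp, hv, hvars, Frame.refl, ← hw]
      omega
    rintro t1 _ st1 ⟨a1, fr1, h20, h21⟩
    have hvars1 := (hb.frame (fr.trans fr1) (by norm_num)).vars
    refine Env.wpt_cons' c.good (n := 45) (R := fun st'' => st''.a A = st'.a A ∧
      Frame 20 [A] st' st'' ∧ st''.v 20 = q ∧ st''.v 21 = w ∧ st''.v 22 = pos) ?_ ?_ ?_
    · simp [Stmt.len]
    · simp [Stmt.wp, h20, h21, hvars1, ← hi, ← hpos, a1, fr1]
      omega
    rintro t2 _ st2 ⟨a2, fr2, g20, g21, g22⟩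
    have hvars2 := (hb.frame (fr.trans fr2) (by norm_num)).vars
    refine Env.wpt_cons' c.good (n := 44) (R := fun st'' => st''.a A = st'.a A ∧
      Frame 20 [A] st' st'' ∧ st''.v 20 = q ∧ st''.v 21 = w ∧ st''.v 22 = pos ∧ st''.v 23 = 0) ?_ ?_ ?_
    · simp [Stmt.len]
    · simp [Stmt.wp, g20, g21, g22, a2, fr2]
      omega
    rintro t3 _ st3 ⟨a3, fr3, f20, f21, f22, f23⟩
    have hvars3 := (hb.frame (fr.trans fr3) (by norm_num)).vars
    have hbo : base.Ok E st3 ∧ base.val st3 = bv := by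
      rcases hbase with ⟨rfl, rfl⟩ | ⟨rfl, rfl⟩
      · exact ⟨trivial, rfl⟩
      · exact ⟨trivial, hvars3.2.1⟩
    set V := if q % 2 = 0 ∧ w < p.P then a / 2 ^ pos % 2 ^ p.P else 0 with hV
    have hVlt : V < 2 ^ p.P := by
      rw [hV]; split_ifs
      · exact Nat.mod_lt _ (by positivity)
      · positivity
    refine Env.wpt_cons' c.good (n := 8) (R := fun st'' => st''.a A = st'.a A ∧
      Frame 20 [A] st' st'' ∧ st''.v 20 = q ∧ st''.v 23 = V) ?_ ?_ ?_
    · simp [Stmt.len, hlen0]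
    · have hval : q % 2 = 0 → w < p.P → pos < m → ofBits ((E.inp.drop (bv + (m - pos - p.P))).take
          (bv + (m - pos - 1) - (bv + (m - pos - p.P)) + 1)) = V := by
        intro h1 h2 h3
        rw [hV, if_pos ⟨h1, h2⟩, hin _ _ (by omega)]
        rcases Nat.lt_or_ge m (pos + p.P) with h4 | h4
        · rw [show m - pos - p.P = 0 by omega,
            show bv + (m - pos - 1) - (bv + 0) + 1 = m - pos by omega,
            show m - 0 - (m - pos) = pos by omega]
          have h5 : a / 2 ^ pos < 2 ^ (m - pos) := by
            rw [Nat.div_lt_iff_lt_mul (by positivity), ← pow_add, Nat.sub_add_cancel h3.le]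
            exact ha
          rw [Nat.mod_eq_of_lt h5, Nat.mod_eq_of_lt]
          exact lt_of_lt_of_le h5 (Nat.pow_le_pow_right (by norm_num) (by omega))
        · rw [show bv + (m - pos - 1) - (bv + (m - pos - p.P)) + 1 = p.P by omega,
            show m - (m - pos - p.P) - p.P = pos by omega]
      have hzero : ¬ pos < m → V = 0 := by
        intro h3
        rw [hV]
        split_ifs
        · rw [Nat.div_eq_of_lt (lt_of_lt_of_le ha (Nat.pow_le_pow_right (by norm_num) (by omega)))]
          simp
        · rfl
      have hPB : 2 ^ p.P < E.B := c.lt_B (a := 1) (by simp) (by norm_num)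
      have hPw := c.hw
      by_cases h1 : q % 2 = 0
      · by_cases h2 : w < p.P
        · by_cases h3 : pos < m
          · have := hval h1 h2 h3
            have z1 : w + 1 - p.P = 0 := by omega
            have z2 : pos + 1 - m = 0 := by omega
            simp [Stmt.wp, hbo, f20, f21, f22, f23, hvars3, a3, fr3, hw2, h1, z1, z2, this]
            omega
          · have z1 : w + 1 - p.P = 0 := by omega
            have z2 : ¬ pos + 1 - m = 0 := by omega
            simp only [Stmt.wp, Exp.ok_var, Exp.ok_mod, Exp.ok_add, Exp.ok_sub, Exp.ok_ofNat, Exp.val_mod,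
              Exp.val_add, Exp.val_sub, Exp.val_var, Exp.val_ofNat, f20, f21, f22, f23, hvars3, a3, fr3, hw2, h1, z1, z2,
              hzero h3]
            simp
        · have z1 : ¬ w + 1 - p.P = 0 := by omega
          have : V = 0 := by rw [hV, if_neg (by omega)]
          simp only [Stmt.wp, Exp.ok_var, Exp.ok_mod, Exp.ok_add, Exp.ok_sub, Exp.ok_ofNat, Exp.val_mod,
              Exp.val_add, Exp.val_sub, Exp.val_var, Exp.val_ofNat, f20, f21, f22, f23, hvars3, a3, fr3, hw2, h1, z1, this]
          simp
      · have : V = 0 := by rw [hV, if_neg (by omega)]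
        simp only [Stmt.wp, Exp.ok_var, Exp.ok_mod, Exp.ok_add, Exp.ok_sub, Exp.ok_ofNat, Exp.val_mod,
              Exp.val_add, Exp.val_sub, Exp.val_var, Exp.val_ofNat, f20, f21, f22, f23, hvars3, a3, fr3, hw2, h1, this]
        simp
    rintro t4 _ st4 ⟨a4, fr4, i20, i23⟩
    have hvars4 := (hb.frame (fr.trans fr4) (by norm_num)).vars
    have hent : V * 2 ^ p.S + 2 ^ p.H = inputEntry p a q := rfl
    have hlt : inputEntry p a q < E.B := by
      refine lt_of_le_of_lt ?_ (c.pow_lt (a := 121) (by norm_num))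
      rw [← hent]
      have h1 : V * 2 ^ p.S ≤ 2 ^ p.H := by
        calc V * 2 ^ p.S ≤ 2 ^ p.P * 2 ^ p.S := Nat.mul_le_mul_right _ hVlt.le
          _ ≤ 2 ^ p.H := by
            rw [← pow_add]; exact Nat.pow_le_pow_right (by norm_num) (by rw [c.hS, c.hH]; omega)
      calc V * 2 ^ p.S + 2 ^ p.H ≤ 2 * 2 ^ p.H := by omega
        _ ≤ 2 ^ p.P * 2 ^ p.H := Nat.mul_le_mul_right _ c.two_le
        _ = _ := by rw [← pow_add, c.hH]; congr 1; ring
    refine Env.wpt_body c.good (by simp [Stmt.len]) ?_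
    simp [Stmt.wp, a4, i20, i23, hvars4, c.hacc, hent, hlt, hq, fr4]
  · have : (vL.code 0).length = 0 := rfl
    rw [this]; omega
  · intro t _ st' fr h
    exact ⟨fr, fun i hi => c.arrVal_input h hi⟩

theorem Ctx.rev_idx_lt (c : Ctx E p m k n) (q : ℕ) :
    2 * p.P * bitRev n (q / (2 * p.P)) + q % (2 * p.P) < 2 * p.P * p.N := by
  refine idx_lt ?_ (Nat.mod_lt _ (by have := c.P_pos; omega))
  rw [c.hN]; exact bitRev_lt _ _

theorem reorder_spec (c : Ctx E p m k n) {s A A' : ℕ} {st : St} (hb : Base p m k n st)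
    (hA : A < 24) (hAA : A ≠ A') (hA' : 3 ≤ A') :
    E.wpt (reorderCode A A') (50 * (2 * p.P * p.N)) (fun _ st' => Frame 20 [A'] st st' ∧
      ∀ i < p.N, arrVal p st' A' i = arrVal p st A (bitRev n i)) s st := by
  have hP := c.P_pos
  have hPL := c.P_le_L
  have hLB := c.L_lt
  have hNL := c.N_le_L
  have hB := c.good.B_ge
  have hN := c.N_pos
  refine Env.wpt_of_rep fun hrep _ => ?_
  refine Env.wpt_fill c.good (n := 2 * p.P * p.N) (T := 25) (k := 20) (D := A') (Ds := [A'])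
    (fun q => st.a A (2 * p.P * bitRev n (q / (2 * p.P)) + q % (2 * p.P))) hLB le_rfl ?_ ?_ ?_ ?_
  · intro st' h
    simp [(hb.frame h (by norm_num) (by simp; omega)).vars]
  · rintro q hq t _ st' hv fr -
    have hb' := hb.frame fr (by norm_num) (by simp; omega)
    have hqN : q / (2 * p.P) < p.N := Nat.div_lt_of_lt_mul hq
    have hrev := hb'.rev n le_rfl (q / (2 * p.P)) (by rw [← c.hN]; exact hqN)
    rw [← c.hN] at hrev
    have hidx := c.rev_idx_lt q
    have heA : st'.a A = st.a A := fr.a A (by simp [hAA])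
    refine Env.wpt_body c.good (by simp [Stmt.len]) ?_
    simp [Stmt.wp, hv, hb'.vars, c.hacc, hrev, heA, hq, hidx, Frame.refl]
    exact ⟨by omega, hrep.arr_lt A hA _ (by rw [c.hL]; exact hidx)⟩
  · have : (vL.code 0).length = 0 := rfl
    rw [this]; omega
  · intro t _ st' fr h
    refine ⟨fr, fun i hi => arrVal_congr fun t ht => ?_⟩
    have h1 := h _ (idx_lt hi ht)
    rwa [Nat.mul_add_div (by omega), Nat.div_eq_of_lt ht, add_zero, Nat.mul_add_mod,
      Nat.mod_eq_of_lt ht] at h1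

theorem divide_spec (c : Ctx E p m k n) {s A A' : ℕ} {st : St} (hb : Base p m k n st)
    (hAA : A ≠ A') (hA' : 3 ≤ A')
    (hfit : ∀ i < p.N, ∀ t < 2 * p.P, |arrInt p st A i t| ≤ 2 ^ p.H) :
    E.wpt (divideCode A A') (50 * (2 * p.P * p.N)) (fun _ st' => Frame 20 [A'] st st' ∧
      ∀ i < p.N, ∀ t < 2 * p.P, arrInt p st' A' i t = arrInt p st A (bitRev n i) t / p.N) s st := by
  have hP := c.P_pos
  have hPL := c.P_le_L
  have hLB := c.L_lt
  have hNL := c.N_le_L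
  have hB := c.good.B_ge
  have hN := c.N_pos
  have hkey : ∀ i < p.N, ∀ t < 2 * p.P,
      (((st.a A (2 * p.P * i + t) + 2 ^ p.H * p.N - 2 ^ p.H) / p.N : ℕ) : ℤ) =
        arrInt p st A i t / p.N + 2 ^ p.H ∧
      (st.a A (2 * p.P * i + t) + 2 ^ p.H * p.N - 2 ^ p.H) / p.N < E.B := by
    intro i hi t ht
    have h1 := hfit i hi t ht
    have hx : (st.a A (2 * p.P * i + t) : ℤ) = arrInt p st A i t + 2 ^ p.H := by
      rw [arrInt]; ring
    have hle : 2 ^ p.H ≤ 2 ^ p.H * p.N := Nat.le_mul_of_pos_right _ hN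
    have e1 : ((st.a A (2 * p.P * i + t) + 2 ^ p.H * p.N - 2 ^ p.H : ℕ) : ℤ) =
        arrInt p st A i t + 2 ^ p.H * p.N := by
      rw [Nat.cast_sub (by omega)]
      push_cast
      rw [hx]; ring
    constructor
    · rw [Int.natCast_div, e1, Int.add_mul_ediv_right _ _ (by omega)]
    · refine lt_of_le_of_lt (Nat.div_le_of_le_mul ?_) (c.pow_lt (a := 121) (by norm_num))
      have h2 : 2 * 2 ^ p.H ≤ 2 ^ (121 * p.P) := by
        rw [← pow_succ']; exact Nat.pow_le_pow_right (by norm_num) (by rw [c.hH]; omega)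
      refine le_trans ?_ (Nat.mul_le_mul_left _ h2)
      have h3 : st.a A (2 * p.P * i + t) ≤ 2 * 2 ^ p.H := by
        zify; rw [hx]; linarith [(abs_le.1 h1).2]
      have : p.N * (2 * 2 ^ p.H) = 2 ^ p.H * p.N + 2 ^ p.H * p.N := by ring
      omega
  refine Env.wpt_fill c.good (n := 2 * p.P * p.N) (T := 30) (k := 20) (D := A') (Ds := [A'])
    (fun q => (st.a A (2 * p.P * bitRev n (q / (2 * p.P)) + q % (2 * p.P)) + 2 ^ p.H * p.N - 2 ^ p.H) /
      p.N) hLB le_rfl ?_ ?_ ?_ ?_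
  · intro st' h
    simp [(hb.frame h (by norm_num) (by simp; omega)).vars]
  · rintro q hq t _ st' hv fr -
    have hb' := hb.frame fr (by norm_num) (by simp; omega)
    have hqN : q / (2 * p.P) < p.N := Nat.div_lt_of_lt_mul hq
    have hrev := hb'.rev n le_rfl (q / (2 * p.P)) (by rw [← c.hN]; exact hqN)
    rw [← c.hN] at hrev
    have hidx := c.rev_idx_lt q
    have heA : st'.a A = st.a A := fr.a A (by simp [hAA])
    have hlt := (hkey (bitRev n (q / (2 * p.P))) (by rw [c.hN]; exact bitRev_lt _ _) (q % (2 * p.P))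
      (Nat.mod_lt _ (by omega))).2
    refine Env.wpt_body c.good (by simp [Stmt.len]) ?_
    simp [Stmt.wp, hv, hb'.vars, c.hacc, hrev, heA, hq, hidx, hlt, Frame.refl]
    omega
  · have : (vL.code 0).length = 0 := rfl
    rw [this]; omega
  · intro t _ st' fr h
    refine ⟨fr, fun i hi t ht => ?_⟩
    have h1 := h _ (idx_lt hi ht)
    rw [Nat.mul_add_div (by omega), Nat.div_eq_of_lt ht, add_zero, Nat.mul_add_mod,
      Nat.mod_eq_of_lt ht] at h1
    rw [arrInt, h1, (hkey (bitRev n i) (by rw [c.hN]; exact bitRev_lt _ _) t ht).1]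
    ring

theorem norm_floor_div_le {Q N : ℝ} {N' : ℕ} (hN' : (N' : ℝ) = N) (hQ : 0 < Q) (hN : 0 < N) (x y : ℤ) :
    ‖(((x / N' : ℤ) : ℂ) + (y / N' : ℤ) * Complex.I) / Q - (N : ℂ)⁻¹ * (((x : ℂ) + y * Complex.I) / Q)‖ ≤
      2 / Q := by
  subst hN'
  have hN0 : 0 < N' := by exact_mod_cast hN
  have h := norm_average_le hQ hN0 (re := fun i => if i = 0 then x else 0)
    (im := fun i => if i = 0 then y else 0)
    (w := fun i => if i = 0 then ((x : ℂ) + y * Complex.I) / Q else 0)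
    (z := (N' : ℂ)⁻¹ * (((x : ℂ) + y * Complex.I) / Q)) (d := 0) ?_ ?_
  · simpa [Finset.sum_ite_eq', hN0] using h
  · rw [← mul_assoc, mul_inv_cancel₀ (by exact_mod_cast hN0.ne')]
    simp [Finset.sum_ite_eq', hN0]
  · intro i _
    by_cases hi : i = 0 <;> simp [hi]

theorem Ctx.normLE_divide (c : Ctx E p m k n) {u v : Fin 2 → ℕ → ℤ}
    (h : ∀ e, ∀ j < p.P, v e j = u e j / p.N) :
    NormLE hP0 (p.stdVal v - AdjoinRoot.of _ (p.N : ℂ)⁻¹ * p.stdVal u) (p.P * (2 / 2 ^ p.S)) := by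
  rw [Params.stdVal, Params.stdVal, of_mul_ofCoeffs, ofCoeffs_sub]
  refine normLE_ofCoeffs fun j hj => ?_
  rw [h 0 j hj, h 1 j hj]
  have := norm_floor_div_le (Q := 2 ^ p.S) (N := p.N) rfl (by positivity)
    (by exact_mod_cast c.N_pos) (u 0 j) (u 1 j)
  push_cast at this ⊢
  exact this

theorem product_spec (c : Ctx E p m k n) {s : ℕ} {st : St} (hb : Base p m k n st)
    (hX : ∀ i < p.N, ∀ e, ∀ j < p.P, |Params.split (arrInt p st 8 i) e j| ≤ 2 ^ p.H)
    (hV : ∀ i < p.N, ∀ e, ∀ j < p.P, |Params.split (arrInt p st 9 i) e j| ≤ 2 ^ p.H)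
    (hfit : ∀ i < p.N, ∀ e, ∀ j < p.P,
      |Params.prodCoeff p.P (Params.split (arrInt p st 8 i)) (Params.split (arrInt p st 9 i)) e j| ≤
        2 ^ p.H * 2 ^ p.S) :
    E.wpt productCode (7000 * (p.P * (k + 1) * p.N)) (fun t st' =>
      Frame 24 [11, 12, 13, 14, 15, 16, 17, 10] st st' ∧
      ∀ i < p.N, p.RingMul E.prog E.σ s t (p.stored (E.σ s) (104 + 8 * E.L) i)
          (p.stored (E.σ s) (104 + 9 * E.L) i) (p.stored (E.σ t) (104 + 10 * E.L) i) ∧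
        ∀ e, ∀ j < p.P, Params.split (arrInt p st' 10 i) e j =
          Params.prodCoeff p.P (Params.split (arrInt p st 8 i))
            (Params.split (arrInt p st 9 i)) e j / 2 ^ p.S) s st := by
  have hP := c.P_pos
  have hPL := c.P_le_L
  have hLB := c.L_lt
  have hN0 := c.N_pos
  have hNL := c.N_le_L
  have hD : 0 ∉ [11, 12, 13, 14, 15, 16, 17, 10] ∧ 1 ∉ [11, 12, 13, 14, 15, 16, 17, 10] ∧
      2 ∉ [11, 12, 13, 14, 15, 16, 17, 10] := by simp
  refine Env.wpt_of_rep fun hrep _ => ?_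
  have hu : ∀ i < p.N, ∀ e, ∀ j < p.P, p.stored (E.σ s) (104 + 8 * E.L) i e j =
      Params.split (arrInt p st 8 i) e j := fun i hi e j hj => c.stored_eq hrep (by norm_num) hi e hj
  have hw : ∀ i < p.N, ∀ e, ∀ j < p.P, p.stored (E.σ s) (104 + 9 * E.L) i e j =
      Params.split (arrInt p st 9 i) e j := fun i hi e j hj => c.stored_eq hrep (by norm_num) hi e hj
  refine Env.wpt_mono (Env.wpt_loop c.good (n := p.N) (T := 5100 * (p.P * (k + 1)))
    (fun z t st' => Frame 24 [11, 12, 13, 14, 15, 16, 17, 10] st st' ∧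
      ∀ i < z, (∀ y : Fin 2 → ℕ → ℤ, (∀ e, ∀ j < p.P, y e j = 
            Params.prodCoeff p.P (Params.split (arrInt p st 8 i))
              (Params.split (arrInt p st 9 i)) e j / 2 ^ p.S) →
          p.RingMul E.prog E.σ s t (p.stored (E.σ s) (104 + 8 * E.L) i)
            (p.stored (E.σ s) (104 + 9 * E.L) i) y) ∧
        ∀ e, ∀ j < p.P, Params.split (arrInt p st' 10 i) e j =
          Params.prodCoeff p.P (Params.split (arrInt p st 8 i))
            (Params.split (arrInt p st 9 i)) e j / 2 ^ p.S)
    (by omega) ?_ ?_ ?_ ?_ (fun t _ st' h _ => h)) ?_ ?_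
  · rintro z t u st' htu ⟨h1, h2⟩
    exact ⟨h1, fun i hi => ⟨fun y hy => ((h2 i hi).1 y hy).mono le_rfl htu, (h2 i hi).2⟩⟩
  · simp [Frame.refl]
  · rintro z _ t st' ⟨h, -⟩ _
    simp [(hb.frame h (by norm_num) hD).vars]
  · rintro i hi t ht st' hv ⟨hfr, hall⟩
    have hb' := hb.frame hfr (by norm_num) hD
    have hi1 : 2 * p.P * i + 2 * p.P ≤ 2 * p.P * p.N := by
      rw [← Nat.mul_succ]; exact Nat.mul_le_mul_left _ hi
    have hcost : 100 + 5000 * (p.P * (k + 1)) ≤ 5100 * (p.P * (k + 1)) := by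
      have : 1 ≤ p.P * (k + 1) := Nat.mul_pos (by omega) (by omega)
      omega
    refine Env.wpt_cons' c.good (n := 60 + 5000 * (p.P * (k + 1)))
      (R := fun st2 => Frame 24 [] st' st2 ∧ st2.v 24 = i ∧ st2.v 40 = 2 * p.P * i) ?_ ?_ ?_
    · simp [Stmt.len]; omega
    · simp [Stmt.wp, hv, hb'.vars, Frame.refl]
      omega
    rintro t2 ht2 st2 ⟨fr2, f24, f40⟩
    have hb2 := hb'.frame fr2 (by norm_num) (by simp)
    refine Env.wpt_cons' c.good (n := 40 + 5000 * (p.P * (k + 1)))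
      (R := fun st2 => Frame 24 [] st' st2 ∧ st2.v 24 = i ∧ st2.v 40 = 2 * p.P * i ∧
        st2.v 41 = 2 * p.P * i) ?_ ?_ ?_
    · simp [Stmt.len]; omega
    · simp [Stmt.wp, fr2, f24, f40, hb2.vars]
      omega
    rintro t3 ht3 st3 ⟨fr3, g24, g40, g41⟩
    have hb3 := hb'.frame fr3 (by norm_num) (by simp)
    refine Env.wpt_cons' c.good (n := 5000 * (p.P * (k + 1)))
      (R := fun st2 => Frame 24 [] st' st2 ∧ st2.v 24 = i ∧ st2.v 40 = 2 * p.P * i ∧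
        st2.v 41 = 2 * p.P * i ∧ st2.v 42 = 2 * p.P * i) ?_ ?_ ?_
    · simp [Stmt.len]
    · simp [Stmt.wp, fr3, g24, g40, g41, hb3.vars]
      omega
    rintro t5 ht5 st5 ⟨fr5, j24, j40, j41, j42⟩
    have hb5 := hb'.frame fr5 (by norm_num) (by simp)
    have hfrs := hfr.trans (fr5.mono le_rfl (List.nil_subset _))
    have hpc : ∀ e j, Params.prodCoeff p.P (p.stored (E.σ s) (104 + 8 * E.L) i)
        (p.stored (E.σ s) (104 + 9 * E.L) i) e j =
        Params.prodCoeff p.P (Params.split (arrInt p st 8 i))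
          (Params.split (arrInt p st 9 i)) e j := Params.prodCoeff_congr (hu i hi) (hw i hi)
    refine Env.wpt_mono (ringMul_spec c (u := p.stored (E.σ s) (104 + 8 * E.L) i)
      (v := p.stored (E.σ s) (104 + 9 * E.L) i) (by norm_num) (by norm_num)
      (by norm_num) (by norm_num) hb5 (by rw [j40]; exact hi1) (by rw [j41]; exact hi1)
      (by rw [j42]; exact hi1) ?_ ?_ ?_ ?_ ?_) le_rfl ?_
    · intro e j hj
      rw [hu i hi e j hj, Params.split, arrInt, j40, hfrs.a 8 (by simp), sub_add_cancel, add_assoc]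
    · intro e j hj
      rw [hw i hi e j hj, Params.split, arrInt, j41, hfrs.a 9 (by simp), sub_add_cancel, add_assoc]
    · intro e j hj
      rw [hu i hi e j hj]; exact hX i hi e j hj
    · intro e j hj
      rw [hw i hi e j hj]; exact hV i hi e j hj
    · intro e j hj
      rw [hpc]; exact hfit i hi e j hj
    · rintro t6 st6 ht6 _ _ ⟨r1, r2, r3, r4⟩
      refine ⟨by rw [r2.v 24 (by norm_num), j24], ?_, fun i' hi' => ?_⟩
      · rw [Frame.set_iff (by norm_num)]
        exact hfrs.trans (r2.mono (by norm_num) (by simp))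
      · rcases Nat.lt_succ_iff_lt_or_eq.1 hi' with h | rfl
        · obtain ⟨k4, k5⟩ := hall i' h
          refine ⟨fun y hy => (k4 y hy).mono le_rfl (by omega), fun e j hj => ?_⟩
          rw [← k5 e j hj]
          have h6 : 2 * p.P * i' + (2 * j + e) < 2 * p.P * i := idx_lt h (by omega)
          simp only [Params.split, arrInt, St.set_a]
          rw [r4 _ (by rw [j42]; omega), fr5.a 10 (by simp)]
        · refine ⟨fun y hy => (r1 y fun e j hj => ?_).mono (by omega) le_rfl, fun e j hj => ?_⟩
          · rw [hpc, hy e j hj]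
          · have := r3 e j hj
            rw [hpc, j42] at this
            simp only [Params.split, arrInt, St.set_a]
            rw [← add_assoc, this]; ring
  · have h1 : (vN.code 0).length = 0 := rfl
    rw [h1]
    have : 1 ≤ p.P * (k + 1) := Nat.mul_pos (by omega) (by omega)
    calc (p.N + 1) * (5100 * (p.P * (k + 1)) + 0 + 4) ≤ (p.N + 1) * (5104 * (p.P * (k + 1))) :=
          Nat.mul_le_mul_left _ (by omega)
      _ = (5104 * (p.N + 1)) * (p.P * (k + 1)) := by ring
      _ ≤ (7000 * p.N) * (p.P * (k + 1)) := Nat.mul_le_mul_right _ (by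
        have := c.hkn; have := c.n_lt; have := c.hk; omega)
      _ = 7000 * (p.P * (k + 1) * p.N) := by ring
  · rintro t st' ht hrep' _ ⟨h1, h2⟩
    refine ⟨h1, fun i hi => ⟨(h2 i hi).1 _ fun e j hj => ?_, (h2 i hi).2⟩⟩
    rw [c.stored_eq hrep' (by norm_num) hi e hj, (h2 i hi).2 e j hj]

end FR.Prog

namespace FR

section

variable {R : Type*} [CommRing R]

/-- The fast Fourier transform with an odd power of `ρ` computes the discrete Fourier transform. -/
theorem fft_outer {k n : ℕ} (hkn : k + 1 ≤ n) {Ω ξ : R} (hΩ : Ω ^ 2 ^ (n - 1) = -1)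
    (hξ : ξ = Ω ^ 2 ^ (n - (k + 1))) (f : ℕ → R) {i : ℕ} (hi : i < 2 ^ n) :
    fft (2 ^ n) (2 ^ (k + 1)) Ω ξ f i = ∑ q ∈ Finset.range (2 ^ n), f q * Ω ^ (q * i) := by
  refine fft_eq_sum (by omega) (fun _ => hΩ) (fun r hr => ?_) (fun _ => rfl) f hi
  rw [hξ, ← pow_mul, ← pow_add]
  congr 2
  omega

/-- Multiplication of transforms and transformation back give the convolution. -/
theorem dft_convolution {n : ℕ} (hn : 1 ≤ n) {Ω : R} (hΩ : Ω ^ 2 ^ (n - 1) = -1) (f g : ℕ → R)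
    (hf : ∀ q, 2 ^ n ≤ 2 * q → f q = 0) (hg : ∀ q, 2 ^ n ≤ 2 * q → g q = 0) {i : ℕ} (hi : i < 2 ^ n) :
    ∑ a ∈ Finset.range (2 ^ n), ((∑ q ∈ Finset.range (2 ^ n), f q * Ω ^ (q * a)) *
      ∑ r ∈ Finset.range (2 ^ n), g r * Ω ^ (r * a)) * (Ω ^ (2 ^ n - 1)) ^ (a * i) =
      ((2 ^ n : ℕ) : R) * ∑ q ∈ Finset.range (2 ^ n), ∑ r ∈ Finset.range (2 ^ n),
        if q + r = i then f q * g r else 0 := by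
  have hone : Ω ^ 2 ^ n = 1 := by
    rw [show n = n - 1 + 1 by omega, pow_succ, pow_mul, hΩ]; norm_num
  have h1 : ∀ a, ((∑ q ∈ Finset.range (2 ^ n), f q * Ω ^ (q * a)) *
      ∑ r ∈ Finset.range (2 ^ n), g r * Ω ^ (r * a)) * (Ω ^ (2 ^ n - 1)) ^ (a * i) =
      ∑ q ∈ Finset.range (2 ^ n), ∑ r ∈ Finset.range (2 ^ n),
        f q * g r * Ω ^ (a * (q + r + (2 ^ n - 1) * i)) := by
    intro a
    rw [Finset.sum_mul_sum, Finset.sum_mul]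
    refine Finset.sum_congr rfl fun q _ => ?_
    rw [Finset.sum_mul]
    refine Finset.sum_congr rfl fun r _ => ?_
    rw [← pow_mul, show a * (q + r + (2 ^ n - 1) * i) = q * a + r * a + (2 ^ n - 1) * (a * i) by ring,
      pow_add, pow_add]
    ring
  simp only [h1]
  rw [Finset.sum_comm, Finset.mul_sum]
  refine Finset.sum_congr rfl fun q hq => ?_
  rw [Finset.sum_comm, Finset.mul_sum]
  refine Finset.sum_congr rfl fun r hr => ?_
  rw [← Finset.mul_sum]
  by_cases hq' : 2 ^ n ≤ 2 * q
  · simp [hf q hq']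
  by_cases hr' : 2 ^ n ≤ 2 * r
  · simp [hg r hr']
  have hpos : 0 < 2 ^ n := by positivity
  have hM : (2 ^ n - 1) * i + i = 2 ^ n * i := by
    rw [← Nat.succ_mul, Nat.succ_eq_add_one, Nat.sub_add_cancel hpos]
  split_ifs with h
  · rw [sum_pow_of_dvd hone ⟨i, by rw [h, add_comm, hM]⟩]; ring
  · rw [sum_pow_eq_zero (fun _ => hΩ), mul_zero, mul_zero]
    rintro ⟨d, hd⟩
    apply h
    have e : q + r + 2 ^ n * i = 2 ^ n * d + i := by omega
    have e2 := congrArg (· % 2 ^ n) e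
    simp only [Nat.add_mul_mod_self_left, Nat.mul_add_mod] at e2
    rwa [Nat.mod_eq_of_lt (by omega), Nat.mod_eq_of_lt hi] at e2

end

theorem sum_convolution {R : Type*} [CommSemiring R] {M : ℕ} {F : ℕ → ℕ → R}
    (hF : ∀ q < M, ∀ r < M, M ≤ q + r → F q r = 0) (w : ℕ → R) :
    ∑ i ∈ Finset.range M, (∑ q ∈ Finset.range M, ∑ r ∈ Finset.range M,
      if q + r = i then F q r else 0) * w i =
      ∑ q ∈ Finset.range M, ∑ r ∈ Finset.range M, F q r * w (q + r) := by
  simp only [Finset.sum_mul]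
  rw [Finset.sum_comm]
  refine Finset.sum_congr rfl fun q hq => ?_
  rw [Finset.sum_comm]
  refine Finset.sum_congr rfl fun r hr => ?_
  rw [Finset.mem_range] at hq hr
  by_cases h : q + r < M
  · rw [Finset.sum_eq_single (q + r)]
    · simp
    · intro i _ hne
      rw [if_neg hne.symm, zero_mul]
    · intro hn
      exact absurd (Finset.mem_range.2 h) hn
  · rw [hF q hq r hr (by omega)]
    simp

theorem sum_range_mul {R : Type*} [AddCommMonoid R] (N h : ℕ) (g : ℕ → R) :
    ∑ t ∈ Finset.range (N * h), g t = ∑ q ∈ Finset.range N, ∑ s ∈ Finset.range h, g (q * h + s) := by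
  induction N with
  | zero => simp
  | succ N ih => rw [Nat.succ_mul, Finset.sum_range_add, ih, Finset.sum_range_succ]

theorem sum_digits (β a : ℕ) : ∀ T, ∑ t ∈ Finset.range T, a / β ^ t % β * β ^ t = a % β ^ T
  | 0 => by simp [Nat.mod_one]
  | T + 1 => by
      rw [Finset.sum_range_succ, sum_digits β a T, pow_succ, Nat.mod_mul]
      ring

/-- The digit `s` of the element number `q` of the array for `a`. -/
def digit (P a q s : ℕ) : ℕ :=
  if s < P / 2 then a / 2 ^ (P * (q * (P / 2) + s)) % 2 ^ P else 0

/-- The coefficients of the product. -/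
def digitConv (P a b q r j : ℕ) : ℕ :=
  ∑ s ∈ Finset.range P, ∑ t ∈ Finset.range P, if s + t = j then digit P a q s * digit P b r t else 0

/-- The coefficients of the convolution of the arrays for `a` and `b`. -/
def convCoeff (P N a b i j : ℕ) : ℕ :=
  ∑ q ∈ Finset.range N, ∑ r ∈ Finset.range N, if q + r = i then digitConv P a b q r j else 0

theorem digit_mul_eq_zero (P a b q r : ℕ) : ∀ s < P, ∀ t < P, P ≤ s + t →
    digit P a q s * digit P b r t = 0 := by
  intro s _ t _ h
  unfold digit
  by_cases hs : s < P / 2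
  · rw [if_neg (show ¬ t < P / 2 by omega), mul_zero]
  · rw [if_neg hs, zero_mul]

theorem decompose_eq (P a i : ℕ) : decompose P a i = ofCoeffs P fun j => (digit P a i j : ℂ) := by
  refine ofCoeffs_congr fun j _ => ?_
  unfold digit
  split_ifs <;> simp

theorem decompose_mul (P a b q r : ℕ) : decompose P a q * decompose P b r =
    ofCoeffs P fun j => (digitConv P a b q r j : ℂ) := by
  have h := sum_convolution (R := PolyRing P) (M := P) (F := fun s t =>
    ((digit P a q s * digit P b r t : ℕ) : PolyRing P))
    (fun s hs t ht hst => by rw [digit_mul_eq_zero P a b q r s hs t ht hst]; simp) (fun j => ringX P ^ j)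
  rw [decompose_eq, decompose_eq]
  unfold ofCoeffs
  rw [Finset.sum_mul_sum]
  simp only [map_natCast]
  refine Eq.trans ?_ (h.symm.trans ?_)
  · refine Finset.sum_congr rfl fun s _ => Finset.sum_congr rfl fun t _ => ?_
    rw [pow_add (ringX P)]
    push_cast
    ring
  · refine Finset.sum_congr rfl fun j _ => ?_
    congr 1
    unfold digitConv
    push_cast
    rfl

theorem digit_eq_zero {P N a q : ℕ} (ha : a < 2 ^ (N / 2 * (P / 2 * P))) (hq : N / 2 ≤ q) (s : ℕ) :
    digit P a q s = 0 := by
  unfold digit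
  split_ifs
  · rw [Nat.div_eq_of_lt (lt_of_lt_of_le ha (Nat.pow_le_pow_right (by norm_num) ?_)), Nat.zero_mod]
    calc N / 2 * (P / 2 * P) = P * (N / 2 * (P / 2)) := by ring
      _ ≤ P * (q * (P / 2) + s) :=
        Nat.mul_le_mul_left _ ((Nat.mul_le_mul_right _ hq).trans (Nat.le_add_right _ _))
  · rfl

theorem sum_digit {P N a : ℕ} (ha : a < 2 ^ (N / 2 * (P / 2 * P))) :
    ∑ q ∈ Finset.range N, (∑ s ∈ Finset.range P, digit P a q s * (2 ^ P) ^ s) *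
      (2 ^ P) ^ (q * (P / 2)) = a := by
  have h1 : ∀ q, ∑ s ∈ Finset.range P, digit P a q s * (2 ^ P) ^ s =
      ∑ s ∈ Finset.range (P / 2), digit P a q s * (2 ^ P) ^ s := by
    intro q
    refine (Finset.sum_subset (Finset.range_subset_range.2 (Nat.div_le_self _ _)) fun s _ hs => ?_).symm
    rw [Finset.mem_range] at hs
    rw [digit, if_neg hs, zero_mul]
  have h2 := sum_digits (2 ^ P) a (N * (P / 2))
  rw [sum_range_mul, Nat.mod_eq_of_lt] at h2
  · conv_rhs => rw [← h2]
    refine Finset.sum_congr rfl fun q _ => ?_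
    rw [h1, Finset.sum_mul]
    refine Finset.sum_congr rfl fun s hs => ?_
    rw [digit, if_pos (Finset.mem_range.1 hs), pow_add, pow_mul]
    ring_nf
  · refine lt_of_lt_of_le ha ?_
    rw [← pow_mul]
    refine Nat.pow_le_pow_right (by norm_num) ?_
    calc N / 2 * (P / 2 * P) ≤ N * (P / 2 * P) := Nat.mul_le_mul_right _ (Nat.div_le_self _ _)
      _ = P * (N * (P / 2)) := by ring

theorem sum_digitConv (P a b q r : ℕ) (β : ℕ) :
    ∑ j ∈ Finset.range P, digitConv P a b q r j * β ^ j =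
      (∑ s ∈ Finset.range P, digit P a q s * β ^ s) * ∑ t ∈ Finset.range P, digit P b r t * β ^ t := by
  unfold digitConv
  rw [sum_convolution (digit_mul_eq_zero P a b q r), Finset.sum_mul_sum]
  refine Finset.sum_congr rfl fun s _ => Finset.sum_congr rfl fun t _ => ?_
  rw [pow_add]; ring

theorem digitConv_eq_zero {P N a b q r : ℕ} (hN : 2 ∣ N) (ha : a < 2 ^ (N / 2 * (P / 2 * P)))
    (hb : b < 2 ^ (N / 2 * (P / 2 * P))) (h : N ≤ q + r) (j : ℕ) : digitConv P a b q r j = 0 := by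
  refine Finset.sum_eq_zero fun s _ => Finset.sum_eq_zero fun t _ => ?_
  split_ifs
  · by_cases hq : N / 2 ≤ q
    · rw [digit_eq_zero ha hq, zero_mul]
    · rw [digit_eq_zero hb (show N / 2 ≤ r by omega), mul_zero]
  · rfl

theorem sum_convCoeff {P N a b : ℕ} (hN : 2 ∣ N) (ha : a < 2 ^ (N / 2 * (P / 2 * P)))
    (hb : b < 2 ^ (N / 2 * (P / 2 * P))) :
    ∑ i ∈ Finset.range N, ∑ j ∈ Finset.range P, convCoeff P N a b i j *
      (2 ^ P) ^ (i * (P / 2) + j) = a * b := by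
  have h1 : ∀ i, ∑ j ∈ Finset.range P, convCoeff P N a b i j * (2 ^ P) ^ (i * (P / 2) + j) =
      (∑ q ∈ Finset.range N, ∑ r ∈ Finset.range N, if q + r = i then
        ∑ j ∈ Finset.range P, digitConv P a b q r j * (2 ^ P) ^ j else 0) * (2 ^ P) ^ (i * (P / 2)) := by
    intro i
    simp only [convCoeff, Finset.sum_mul]
    rw [Finset.sum_comm]
    refine Finset.sum_congr rfl fun q _ => ?_
    rw [Finset.sum_comm]
    refine Finset.sum_congr rfl fun r _ => ?_
    split_ifs
    · rw [Finset.sum_mul]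
      refine Finset.sum_congr rfl fun j _ => ?_
      rw [pow_add]; ring
    · simp
  simp only [h1]
  rw [sum_convolution (w := fun i => (2 ^ P) ^ (i * (P / 2)))]
  · conv_rhs => rw [← sum_digit ha, ← sum_digit hb, Finset.sum_mul_sum]
    refine Finset.sum_congr rfl fun q _ => Finset.sum_congr rfl fun r _ => ?_
    rw [sum_digitConv, add_mul, pow_add]; ring
  · intro q _ r _ h
    refine Finset.sum_eq_zero fun j _ => ?_
    rw [digitConv_eq_zero hN ha hb h, zero_mul]

end FR

namespace FR.Prog

open LogRAM

variable {E : Env} {p : Params} {m k n : ℕ} {hP0 : p.P ≠ 0}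

theorem Ctx.rho_half (c : Ctx E p m k n) : rho p.P p.N ^ 2 ^ (n - 1) = -1 := by
  have h := rho_pow_half c.hP c.N_pos.ne' c.dvd_N
  have hk := c.hkn
  rwa [show p.N / 2 = 2 ^ (n - 1) by
    rw [c.hN, show n = n - 1 + 1 by omega, pow_succ, Nat.add_sub_cancel]; omega] at h

theorem Ctx.ringX_eq (c : Ctx E p m k n) : ringX p.P = rho p.P p.N ^ 2 ^ (n - (k + 1)) := by
  rw [← rho_pow_div c.hP c.N_pos.ne' c.dvd_N]
  congr 1
  rw [c.hN, c.hP, ← pow_succ', Nat.pow_div c.hkn (by norm_num)]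

theorem Ctx.fft_rho (c : Ctx E p m k n) {sv : ℕ} (hs : Odd sv) (f : ℕ → PolyRing p.P) {i : ℕ}
    (hi : i < p.N) : fft p.N (2 * p.P) (rho p.P p.N ^ sv) (ringX p.P ^ sv) f i =
      ∑ q ∈ Finset.range p.N, f q * (rho p.P p.N ^ sv) ^ (q * i) := by
  have hJ : 2 * p.P = 2 ^ (k + 1) := by rw [c.hP, pow_succ']
  have h := fft_outer c.hkn (Ω := rho p.P p.N ^ sv) (ξ := ringX p.P ^ sv)
    (by rw [← pow_mul, mul_comm, pow_mul, c.rho_half, hs.neg_one_pow])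
    (by rw [c.ringX_eq, ← pow_mul, ← pow_mul, mul_comm]) f (i := i) (by rw [← c.hN]; exact hi)
  rw [← c.hN, ← hJ] at h
  exact h

theorem Ctx.inverse_eq (c : Ctx E p m k n) {a b : ℕ} (ha : a < 2 ^ m) (hb : b < 2 ^ m) {i : ℕ}
    (hi : i < p.N) :
    AdjoinRoot.of _ (p.N : ℂ)⁻¹ * fft p.N (2 * p.P) (rho p.P p.N ^ (p.N - 1))
      (ringX p.P ^ (p.N - 1)) (fun i => fft p.N (2 * p.P) (rho p.P p.N) (ringX p.P) (decompose p.P a) i *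
        fft p.N (2 * p.P) (rho p.P p.N) (ringX p.P) (decompose p.P b) i) i =
      ofCoeffs p.P fun j => (convCoeff p.P p.N a b i j : ℂ) := by
  have hn1 : 1 ≤ n := by have := c.hkn; omega
  have hN := c.N_pos
  have hodd : Odd (p.N - 1) := by
    rw [c.hN]
    exact Nat.Even.sub_odd Nat.one_le_two_pow ((Nat.even_pow' (by omega)).2 even_two) odd_one
  have h2 : 2 ^ n = 2 * (p.N / 2) := by
    rw [c.hN, show n = n - 1 + 1 by omega, pow_succ]; omega
  have hzero : ∀ d < 2 ^ m, ∀ q, 2 ^ n ≤ 2 * q → decompose p.P d q = 0 := by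
    intro d hd q hq
    rw [decompose_eq]
    have hd' : d < 2 ^ (p.N / 2 * (p.P / 2 * p.P)) :=
      lt_of_lt_of_le hd (Nat.pow_le_pow_right (by norm_num) c.cap)
    refine Finset.sum_eq_zero fun j _ => ?_
    change AdjoinRoot.of _ ((digit p.P d q j : ℕ) : ℂ) * _ = 0
    rw [digit_eq_zero hd' (show p.N / 2 ≤ q by omega), Nat.cast_zero, map_zero, zero_mul]
  have hf : ∀ d, ∀ i < p.N, fft p.N (2 * p.P) (rho p.P p.N) (ringX p.P) (decompose p.P d) i =
      ∑ q ∈ Finset.range p.N, decompose p.P d q * rho p.P p.N ^ (q * i) := by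
    intro d i hi
    have := c.fft_rho odd_one (decompose p.P d) hi
    simpa only [pow_one (rho p.P p.N), pow_one (ringX p.P)] using this
  rw [c.fft_rho hodd _ hi]
  have key := dft_convolution hn1 c.rho_half (decompose p.P a) (decompose p.P b) (hzero a ha) (hzero b hb)
    (i := i) (by rw [← c.hN]; exact hi)
  rw [← c.hN] at key
  rw [Finset.sum_congr rfl fun q hq => by rw [hf a q (Finset.mem_range.1 hq), hf b q (Finset.mem_range.1 hq)],
    key, ← mul_assoc]
  have h1 : AdjoinRoot.of (Polynomial.X ^ p.P + 1) (p.N : ℂ)⁻¹ * ((p.N : ℕ) : PolyRing p.P) = 1 := by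
    rw [← map_natCast (AdjoinRoot.of (Polynomial.X ^ p.P + 1 : Polynomial ℂ)), ← map_mul,
      inv_mul_cancel₀ (by exact_mod_cast hN.ne'), map_one]
  rw [h1, one_mul]
  simp only [decompose_mul]
  have hcoe : ∀ j, AdjoinRoot.of (Polynomial.X ^ p.P + 1) ((convCoeff p.P p.N a b i j : ℕ) : ℂ) =
      ∑ q ∈ Finset.range p.N, ∑ r ∈ Finset.range p.N,
        if q + r = i then ((digitConv p.P a b q r j : ℕ) : PolyRing p.P) else 0 := by
    intro j
    rw [map_natCast, convCoeff]
    push_cast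
    rfl
  unfold ofCoeffs
  simp only [hcoe, map_natCast, Finset.sum_mul]
  refine Eq.symm ?_
  rw [Finset.sum_comm]
  refine Finset.sum_congr rfl fun q _ => ?_
  rw [Finset.sum_comm]
  refine Finset.sum_congr rfl fun r _ => ?_
  split_ifs <;> simp

end FR.Prog

namespace FR.Prog

open LogRAM LogRAM.Stmt

variable {E : Env} {p : Params} {m k n : ℕ} {hP0 : p.P ≠ 0}

theorem sum_update_add (f : ℕ → ℕ) (β v : ℕ) {t D : ℕ} (ht : t < D) :
    ∑ s ∈ Finset.range D, Function.update f t (f t + v) s * β ^ s =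
      ∑ s ∈ Finset.range D, f s * β ^ s + v * β ^ t := by
  have h : ∀ s, Function.update f t (f t + v) s * β ^ s =
      f s * β ^ s + if s = t then v * β ^ t else 0 := by
    intro s
    rw [Function.update_apply]
    split_ifs with hs
    · subst hs; ring
    · simp
  simp only [h, Finset.sum_add_distrib, Finset.sum_ite_eq', Finset.mem_range, ht, if_true]

theorem digit_spec (c : Ctx E p m k n) {s Y : ℕ} {st : St} (hb : Vars p m k n st)
    (h18 : ∀ t < 2 * p.P * p.N, st.a 18 t = 0) (co : ℕ → ℕ → ℕ)
    (hco : ∀ i < p.N, ∀ j < p.P,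
      (st.a 8 (2 * p.P * i + 2 * j) + 2 ^ p.S / 2 - 2 ^ p.H) / 2 ^ p.S = co i j)
    (hY : ∀ i < p.N, ∀ j < p.P, co i j ≤ Y) (hYB : 2 * p.P * p.N * Y < E.B) :
    E.wpt digitCode (60 * (2 * p.P * p.N)) (fun _ st' => Frame 20 [18] st st' ∧
      (∀ t < 2 * p.P * p.N, st'.a 18 t ≤ 2 * p.P * p.N * Y) ∧
      ∑ t ∈ Finset.range ((p.N + 1) * (p.P / 2)), st'.a 18 t * (2 ^ p.P) ^ t =
        ∑ i ∈ Finset.range p.N, ∑ j ∈ Finset.range p.P, co i j * (2 ^ p.P) ^ (i * (p.P / 2) + j)) s st := by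
  have hP := c.P_pos
  have hPL := c.P_le_L
  have hLB := c.L_lt
  have hNL := c.N_le_L
  have hB := c.good.B_ge
  have hN := c.N_pos
  have heven := c.even
  set h := p.P / 2 with hh
  set β := 2 ^ p.P with hβ
  set g : ℕ → ℕ := fun q => if q % 2 = 0 then
    co (q / (2 * p.P)) (q % (2 * p.P) / 2) * β ^ (q / (2 * p.P) * h + q % (2 * p.P) / 2) else 0 with hg
  have hDL : (p.N + 1) * h ≤ 2 * p.P * p.N := by
    calc (p.N + 1) * h ≤ (2 * p.N) * p.P := Nat.mul_le_mul (by omega) (by omega)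
      _ = _ := by ring
  refine Env.wpt_loop' c.good (n := 2 * p.P * p.N) (T := 40) (fun q st' => Frame 20 [18] st st' ∧
    (∀ t < 2 * p.P * p.N, st'.a 18 t ≤ q * Y) ∧
    ∑ t ∈ Finset.range ((p.N + 1) * h), st'.a 18 t * β ^ t = ∑ q' ∈ Finset.range q, g q')
    hLB ?_ ?_ ?_ ?_ ?_
  · refine ⟨by simp [Frame.refl], fun t ht => by simp [h18 t ht], ?_⟩
    rw [Finset.range_zero, Finset.sum_empty]
    refine Finset.sum_eq_zero fun t ht => ?_
    rw [Finset.mem_range] at ht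
    simp [h18 t (by omega)]
  · rintro q _ st' ⟨h1, -⟩ _
    simp [(hb.frame h1 (by norm_num)).vars]
  · rintro q hq t _ st' hv ⟨fr, hle, hsum⟩
    have hvars := (hb.frame fr (by norm_num)).vars
    set i := q / (2 * p.P) with hi
    set w := q % (2 * p.P) with hw
    have hiN : i < p.N := Nat.div_lt_of_lt_mul hq
    have hwJ : w < 2 * p.P := Nat.mod_lt _ (by omega)
    have hqe : 2 * p.P * i + w = q := Nat.div_add_mod _ _
    have hw2 : w % 2 = q % 2 := by rw [hw, Nat.mod_mul_right_mod]
    have hidx : i * h + w / 2 < (p.N + 1) * h := by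
      have : (i + 1) * h ≤ p.N * h := Nat.mul_le_mul_right _ hiN
      have e1 : (i + 1) * h = i * h + h := by ring
      have e2 : (p.N + 1) * h = p.N * h + h := by ring
      omega
    have hgq : g q = if q % 2 = 0 then co i (w / 2) * β ^ (i * h + w / 2) else 0 := rfl
    have hqY : q * Y + Y = (q + 1) * Y := by ring
    refine Env.wpt_body c.good (by simp [Stmt.len]) ?_
    by_cases h0 : q % 2 = 0
    · have hcoq := hco i hiN (w / 2) (by omega)
      rw [show 2 * p.P * i + 2 * (w / 2) = q by omega] at hcoq
      have e8 : st'.a 8 = st.a 8 := fr.a 8 (by simp)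
      have hle' := hle (i * h + w / 2) (by omega)
      have hYc := hY i hiN (w / 2) (by omega)
      have hsm : (q + 1) * Y ≤ 2 * p.P * p.N * Y := Nat.mul_le_mul_right _ hq
      simp [Stmt.wp, hv, hvars, c.hacc, h0, e8, hcoq, fr, ← hi, ← hw, ← hh]
      refine ⟨by omega, by omega, by omega, by omega, by omega, fun t ht => ?_, ?_⟩
      · rw [Function.update_apply]
        split_ifs
        · omega
        · have := hle t ht; omega
      · rw [sum_update_add _ _ _ hidx, hsum, Finset.sum_range_succ, hgq, if_pos h0]
    · simp only [Stmt.wp, Exp.ok_mod, Exp.ok_var, Exp.ok_ofNat, Exp.val_mod, Exp.val_var, Exp.val_ofNat,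
        hv, h0]
      simp [hv, fr]
      refine fun _ => ⟨fun t ht => ?_, ?_⟩
      · have := hle t ht; omega
      · rw [hsum, Finset.sum_range_succ, hgq, if_neg h0, add_zero]
  · have : (vL.code 0).length = 0 := rfl
    rw [this]; omega
  · rintro t _ st' ⟨fr, hle, hsum⟩ _
    refine ⟨fr, hle, ?_⟩
    rw [hsum, mul_comm, sum_range_mul]
    refine Finset.sum_congr rfl fun i _ => ?_
    have hg' : ∀ t < 2 * p.P, g (i * (2 * p.P) + t) =
        if t % 2 = 0 then co i (t / 2) * β ^ (i * h + t / 2) else 0 := by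
      intro t ht
      have e1 : (i * (2 * p.P) + t) / (2 * p.P) = i := by
        rw [mul_comm, Nat.mul_add_div (by omega), Nat.div_eq_of_lt ht, add_zero]
      have e2 : (i * (2 * p.P) + t) % (2 * p.P) = t := by
        rw [mul_comm, Nat.mul_add_mod, Nat.mod_eq_of_lt ht]
      have e3 : (i * (2 * p.P) + t) % 2 = t % 2 := by
        rw [show i * (2 * p.P) + t = 2 * (i * p.P) + t by ring, Nat.mul_add_mod]
      simp only [hg, e1, e2, e3]
    rw [Finset.sum_congr rfl fun t ht => hg' t (Finset.mem_range.1 ht)]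
    rw [mul_comm 2 p.P, sum_range_mul]
    refine Finset.sum_congr rfl fun j _ => ?_
    rw [Finset.sum_range_succ, Finset.sum_range_one]
    have e1 : (j * 2 + 0) % 2 = 0 := by omega
    have e2 : (j * 2 + 1) % 2 = 1 := by omega
    rw [if_pos e1, if_neg (by omega), show (j * 2 + 0) / 2 = j by omega, add_zero]

theorem carry_spec (c : Ctx E p m k n) {s Y V : ℕ} {st : St} (hb : Vars p m k n st)
    (hle : ∀ t < 2 * p.P * p.N, st.a 18 t ≤ Y) (hYB : 2 * Y < E.B)
    (hV : ∑ t ∈ Finset.range ((p.N + 1) * (p.P / 2)), st.a 18 t * (2 ^ p.P) ^ t = V) :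
    E.wpt carryCode (60 * (2 * p.P * p.N)) (fun _ st' => Frame 20 [18] st st' ∧
      ∀ t < (p.N + 1) * (p.P / 2), st'.a 18 t = V / (2 ^ p.P) ^ t % 2 ^ p.P) s st := by
  have hP := c.P_pos
  have hPL := c.P_le_L
  have hLB := c.L_lt
  have hNL := c.N_le_L
  have hB := c.good.B_ge
  have hN := c.N_pos
  have hβ2 := c.two_le
  have h13 : st.v 13 = 2 ^ p.P := hb.vars.2.2.2.2.2.2.2.2.2.2.2.2.1
  have hDL : (p.N + 1) * (p.P / 2) ≤ p.P * p.N := by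
    calc (p.N + 1) * (p.P / 2) ≤ (2 * p.N) * (p.P / 2) := Nat.mul_le_mul_right _ (by omega)
      _ = (2 * (p.P / 2)) * p.N := by ring
      _ ≤ p.P * p.N := Nat.mul_le_mul_right _ (by omega)
  have hL2 : 2 * p.P * p.N = 2 * (p.P * p.N) := by ring
  have hdeg : (2 ^ p.P) < E.B := c.lt_B (a := 1) (by simp) (by norm_num)
  generalize hβ : 2 ^ p.P = β at *
  set D := (p.N + 1) * (p.P / 2) with hD
  refine Env.wpt_cons' c.good (n := 59 * (2 * p.P * p.N)) (R := fun st' => Frame 20 [18] st st' ∧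
    st'.v 21 = 0 ∧ st'.a 18 = st.a 18) ?_ ?_ ?_
  · simp [Stmt.len]; omega
  · simp [Stmt.wp, Frame.refl]
    omega
  rintro t1 _ st1 ⟨fr1, h21, e18⟩
  refine Env.wpt_loop' c.good (n := D) (T := 30) (fun t st' => Frame 20 [18] st st' ∧
    st'.v 21 ≤ Y ∧ st'.v 21 + ∑ z ∈ Finset.range (D - t), st.a 18 (t + z) * β ^ z = V / β ^ t ∧
    (∀ z < t, st'.a 18 z = V / β ^ z % β) ∧ ∀ z ≥ t, st'.a 18 z = st.a 18 z)
    (by omega) ?_ ?_ ?_ ?_ ?_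
  · refine ⟨by simpa using fr1, by simp [h21], ?_, by simp, by simp [e18]⟩
    simpa [h21] using hV
  · rintro t _ st' ⟨h1, -⟩ _
    simp [(hb.frame h1 (by norm_num)).vars, hD]
  · rintro t ht t2 _ st' hv ⟨fr, hY1, hinv, hlo, hhi⟩
    have hvars := (hb.frame fr (by norm_num)).vars
    have e13 : st'.v 13 = β := by rw [fr.v 13 (by norm_num), h13]
    have et : st'.a 18 t = st.a 18 t := hhi t le_rfl
    have hent := hle t (by omega)
    have hsplit : V / β ^ t = (st.a 18 t + st'.v 21) +
        β * ∑ z ∈ Finset.range (D - (t + 1)), st.a 18 (t + 1 + z) * β ^ z := by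
      rw [← hinv, show D - t = D - (t + 1) + 1 by omega, Finset.sum_range_succ', Finset.mul_sum]
      have : ∀ z, st.a 18 (t + (z + 1)) * β ^ (z + 1) = β * (st.a 18 (t + 1 + z) * β ^ z) := by
        intro z
        rw [show t + (z + 1) = t + 1 + z by ring, pow_succ]; ring
      simp only [this]
      simp
      ring
    have hmod : (st.a 18 t + st'.v 21) % β = V / β ^ t % β := by
      rw [hsplit, Nat.add_mul_mod_self_left]
    have hdiv : (st.a 18 t + st'.v 21) / β + ∑ z ∈ Finset.range (D - (t + 1)), st.a 18 (t + 1 + z) * β ^ z =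
        V / β ^ (t + 1) := by
      rw [pow_succ, ← Nat.div_div_eq_div_mul, hsplit, Nat.add_mul_div_left _ _ (by omega)]
    have hcl : (st.a 18 t + st'.v 21) / β ≤ Y := by
      refine Nat.div_le_of_le_mul ?_
      calc st.a 18 t + st'.v 21 ≤ 2 * Y := by omega
        _ ≤ β * Y := Nat.mul_le_mul_right _ hβ2
    have hml : V / β ^ t % β < β := Nat.mod_lt _ (by omega)
    refine Env.wpt_body c.good (by simp [Stmt.len]) ?_
    simp [Stmt.wp, hv, e13, c.hacc, et, fr, hmod, hcl, hdiv]
    refine ⟨by omega, by omega, by omega, by omega, by omega, by omega, by omega, fun z hz => ?_, fun z hz => ?_⟩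
    · rw [Function.update_apply]
      split_ifs with hzt
      · rw [hzt]
      · exact hlo z (by omega)
    · rw [Function.update_of_ne (by omega)]
      exact hhi z (by omega)
  · have : (((vN + 1) * (vP / 2)).code 0).length = 3 := by simp
    rw [this]; omega
  · rintro t _ st' ⟨h1, -, -, h2, -⟩ _
    exact ⟨h1, h2⟩

theorem output_spec (c : Ctx E p m k n) {s V : ℕ} {st : St} (hb : Vars p m k n st)
    (hout : st.out = [])
    (hdig : ∀ t < (p.N + 1) * (p.P / 2), st.a 18 t = V / (2 ^ p.P) ^ t % 2 ^ p.P) :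
    E.wpt outputCode (60 * (2 * p.P * p.N)) (fun _ st' => st'.out = bits (2 * m) V) s st := by
  have hP := c.P_pos
  have hPL := c.P_le_L
  have hLB := c.L_lt
  have hNL := c.N_le_L
  have hB := c.good.B_ge
  have hN := c.N_pos
  have heven := c.even
  have hw := c.hw
  have hDL : (p.N + 1) * (p.P / 2) ≤ p.P * p.N := by
    calc (p.N + 1) * (p.P / 2) ≤ (2 * p.N) * (p.P / 2) := Nat.mul_le_mul_right _ (by omega)
      _ = (2 * (p.P / 2)) * p.N := by ring
      _ ≤ p.P * p.N := Nat.mul_le_mul_right _ (by omega)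
  have hL2 : 2 * p.P * p.N = 2 * (p.P * p.N) := by ring
  have hdeg : (2 ^ p.P) < E.B := c.lt_B (a := 1) (by simp) (by norm_num)
  set D := (p.N + 1) * (p.P / 2) with hD
  set T := 2 * m / p.P with hT
  have hTD : T < D := by
    have h1 : 2 * m ≤ p.N * (p.P / 2) * p.P := by
      calc 2 * m ≤ 2 * (p.N / 2 * (p.P / 2 * p.P)) := Nat.mul_le_mul_left _ c.cap
        _ = (2 * (p.N / 2)) * (p.P / 2 * p.P) := by ring
        _ ≤ p.N * (p.P / 2 * p.P) := Nat.mul_le_mul_right _ (by omega)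
        _ = _ := by ring
    have h2 : T ≤ p.N * (p.P / 2) := Nat.div_le_of_le_mul (h1.trans (le_of_eq (mul_comm _ _)))
    have h3 : D = p.N * (p.P / 2) + p.P / 2 := by rw [hD]; ring
    omega
  have hdlt : ∀ t < D, st.a 18 t < E.B := fun t ht => by
    rw [hdig t ht]; exact (Nat.mod_lt _ (by positivity)).trans hdeg
  have hbits : ∀ t < D, ∀ l ≤ p.P, bits l (st.a 18 t) = bits l (V / 2 ^ (p.P * t)) := by
    intro t ht l hl
    rw [hdig t ht, ← pow_mul, ← bits_mod l (_ % _), Nat.mod_mod_of_dvd _ (pow_dvd_pow 2 hl), bits_mod]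
  have hr : 2 * m % p.P < p.P := Nat.mod_lt _ (by omega)
  refine Env.wpt_cons' c.good (n := 59 * (2 * p.P * p.N)) (R := fun st' => Frame 20 [18] st st' ∧
    st'.v 21 = T ∧ st'.a 18 = st.a 18) ?_ ?_ ?_
  · simp [Stmt.len]; omega
  · simp [Stmt.wp, Frame.refl, hb.vars, ← hT]
    omega
  rintro t1 _ st1 ⟨fr1, h21, e18⟩
  refine Env.wpt_cons' c.good (n := 57 * (2 * p.P * p.N)) (R := fun st' => Frame 20 [18] st st' ∧
    st'.v 21 = T ∧ st'.a 18 = st.a 18 ∧ st'.v 22 = st.a 18 T) ?_ ?_ ?_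
  · simp [Stmt.len]; omega
  · have := hdlt T hTD
    simp [Stmt.wp, fr1, h21, e18, c.hacc]
    omega
  rintro t2 _ st2 ⟨fr2, h21, e18, h22⟩
  have hv2 := (hb.frame fr2 (by norm_num)).vars
  refine Env.wpt_cons' c.good (n := 50 * (2 * p.P * p.N)) (R := fun st' => (∀ y < 20, st'.v y = st.v y) ∧
    st'.v 21 = T ∧ st'.a 18 = st.a 18 ∧ st'.out = bits (2 * m % p.P) (V / 2 ^ (p.P * T))) ?_ ?_ ?_
  · simp [Stmt.len]; omega
  · simp [Stmt.wp, h21, e18, h22, hv2]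
    refine ⟨by omega, by omega, fr2.v, ?_⟩
    rw [fr2.out, hout, hbits T hTD _ hr.le]; rfl
  rintro t3 _ st3 ⟨fr3, h21, e18, hout3⟩
  refine Env.wpt_loop' c.good (n := T) (T := 20) (fun i st' => (∀ y < 20, st'.v y = st.v y) ∧
    st'.v 21 = T ∧ st'.a 18 = st.a 18 ∧
    st'.out = bits (2 * m % p.P + p.P * i) (V / 2 ^ (p.P * (T - i)))) (by omega) ?_ ?_ ?_ ?_ ?_
  · refine ⟨fun y hy => ?_, by simp [h21], by simp [e18], by simpa using hout3⟩
    rw [St.set_v, if_neg (by omega), fr3 y hy]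
  · rintro i _ st' ⟨-, h1, -⟩ _
    simp [outputCode.x21, h1]
  · rintro i hi t _ st' hv ⟨g1, g2, g3, g4⟩
    have hv' : st'.v 2 = p.P := by rw [g1 2 (by norm_num)]; exact hb.vars.2.2.1
    have hlt := hdlt (T - i - 1) (by omega)
    refine Env.wpt_body c.good (by simp [Stmt.len]) ?_
    simp [Stmt.wp, hv, g2, g3, g4, c.hacc, hv', hw]
    refine ⟨by omega, hlt, fun y hy => ?_, ?_⟩
    · rw [if_neg (by omega), if_neg (by omega), g1 y hy]
    · have e1 : V / 2 ^ (p.P * (T - i)) = V / 2 ^ (p.P * (T - i - 1)) / 2 ^ p.P := by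
        rw [Nat.div_div_eq_div_mul, ← pow_add, ← Nat.mul_succ, show (T - i - 1).succ = T - i by omega]
      have e2 : 2 * m % p.P + p.P * (i + 1) = 2 * m % p.P + p.P * i + p.P := by ring
      rw [hbits _ (by omega) _ le_rfl, e1, ← bits_append, e2, Nat.sub_sub]
  · have : (outputCode.x21.code 0).length = 0 := rfl
    rw [this]; omega
  · rintro t _ st' ⟨-, -, -, h4⟩ _
    rw [h4]
    simp [hT, Nat.mod_add_div]

/-! ### Numerical bounds, in terms of `β = 2 ^ P` -/

theorem mul_one_div_pow_le {β c : ℝ} (hβ : 4 ≤ β) (a d : ℕ) (hc : c ≤ 4 ^ d) :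
    c * (1 / β ^ (a + d)) ≤ 1 / β ^ a := by
  have hb : 0 < β := by linarith
  rw [mul_one_div, div_le_div_iff₀ (by positivity) (by positivity), one_mul, pow_add, mul_comm]
  exact mul_le_mul_of_nonneg_left (hc.trans (pow_le_pow_left₀ (by norm_num) hβ d)) (by positivity)

theorem pow_mul_one_div_pow {β : ℝ} (hβ : 4 ≤ β) (r e : ℕ) : β ^ r * (1 / β ^ (r + e)) = 1 / β ^ e := by
  have hb : 0 < β := by linarith
  rw [pow_add]
  field_simp

theorem mul_pow_le_pow {β c : ℝ} (hβ : 4 ≤ β) (a d : ℕ) (hc : c ≤ 4 ^ d) : c * β ^ a ≤ β ^ (a + d) := by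
  have hb : 0 < β := by linarith
  rw [pow_add, mul_comm]
  exact mul_le_mul_of_nonneg_left (hc.trans (pow_le_pow_left₀ (by norm_num) hβ d)) (by positivity)

namespace Ctx

variable (c : Ctx E p m k n)
include c

theorem four_le : (4 : ℝ) ≤ 2 ^ p.P := by
  calc (4 : ℝ) = 2 ^ 2 := by norm_num
    _ ≤ 2 ^ p.P := pow_le_pow_right₀ (by norm_num) c.P_pos

theorem pow_n_le : (2 : ℝ) ^ n ≤ (2 ^ p.P) ^ 3 := by
  have := c.N_le
  rw [c.hN] at this
  exact_mod_cast this

theorem eight_pow_n_le : (8 : ℝ) ^ n ≤ (2 ^ p.P) ^ 9 := by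
  calc (8 : ℝ) ^ n = (2 ^ n) ^ 3 := by rw [← pow_mul, mul_comm, pow_mul]; norm_num
    _ ≤ ((2 ^ p.P) ^ 3) ^ 3 := pow_le_pow_left₀ (by positivity) c.pow_n_le 3
    _ = _ := by rw [← pow_mul]

theorem two_pow_S : (2 : ℝ) ^ p.S = (2 ^ p.P) ^ 100 := by rw [c.hS, ← pow_mul, mul_comm]

theorem two_pow_H : (2 : ℝ) ^ p.H = (2 ^ p.P) ^ 120 := by rw [c.hH, ← pow_mul, mul_comm]

omit c in
theorem P_le_pow : (p.P : ℝ) ≤ 2 ^ p.P := by exact_mod_cast (Ctx.P_lt (p := p)).le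

theorem round_le : p.P * (2 / (2 : ℝ) ^ p.S) ≤ 2 * (1 / (2 ^ p.P) ^ 99) := by
  rw [c.two_pow_S]
  have hβ := c.four_le
  have hP := P_le_pow (p := p)
  generalize (2 : ℝ) ^ p.P = β at *
  have hb : 0 < β := by linarith
  calc p.P * (2 / β ^ 100) ≤ β * (2 / β ^ 100) := mul_le_mul_of_nonneg_right hP (by positivity)
    _ = 2 * (β ^ 1 * (1 / β ^ (1 + 99))) := by ring
    _ = 2 * (1 / β ^ 99) := by rw [pow_mul_one_div_pow hβ]

theorem precise {r e : ℕ} (hr : r ≤ 15) (he : 10 ≤ e) (hre : r + 3 + e ≤ 42) :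
    Precise p n ((2 ^ p.P) ^ r) (1 / (2 ^ p.P) ^ e) (1 / 2 ^ (42 * p.P)) := by
  have hβ := c.four_le
  have hn := c.pow_n_le
  have h8 := c.eight_pow_n_le
  have hround := c.round_le
  have e42 : (2 : ℝ) ^ (42 * p.P) = (2 ^ p.P) ^ 42 := by rw [← pow_mul, mul_comm]
  have hS := c.two_pow_S
  have hH := c.two_pow_H
  have h1P : (1 : ℝ) / 2 ^ p.P = 1 / (2 ^ p.P) ^ 1 := by rw [pow_one]
  refine ⟨by positivity, by positivity, by positivity, ?_, ?_, ?_, ?_⟩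
  · rw [e42, h1P]
    exact one_div_pow_le_one_div_pow_of_le (by linarith) (by norm_num)
  · refine (add_le_add_right hround _).trans ?_
    rw [e42]
    generalize (2 : ℝ) ^ p.P = β at *
    have hb : 0 < β := by linarith
    have h1 : β ^ r * 2 ^ n * (1 / β ^ 42) ≤ 1 / β ^ e := by
      calc β ^ r * 2 ^ n * (1 / β ^ 42) ≤ β ^ r * β ^ 3 * (1 / β ^ 42) := by gcongr
        _ = β ^ (r + 3) * (1 / β ^ 42) := by rw [pow_add]
        _ ≤ β ^ (r + 3) * (1 / β ^ (r + 3 + e)) := by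
          refine mul_le_mul_of_nonneg_left ?_ (by positivity)
          exact one_div_pow_le_one_div_pow_of_le (by linarith) hre
        _ = 1 / β ^ e := pow_mul_one_div_pow hβ _ _
    have h2 : 1 / β ^ 99 ≤ 1 / β ^ e := one_div_pow_le_one_div_pow_of_le (by linarith) (by omega)
    linarith
  · rw [h1P]
    generalize (2 : ℝ) ^ p.P = β at *
    have hb : 0 < β := by linarith
    calc 1 / β ^ e * 8 ^ n ≤ 1 / β ^ 10 * β ^ 9 :=
          mul_le_mul (one_div_pow_le_one_div_pow_of_le (by linarith) he) h8 (by positivity) (by positivity)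
      _ = β ^ 9 * (1 / β ^ (9 + 1)) := by ring
      _ = 1 / β ^ 1 := pow_mul_one_div_pow hβ _ _
  · rw [hS, hH]
    generalize (2 : ℝ) ^ p.P = β at *
    have hb : 1 ≤ β := by linarith
    have h1 : β ^ r * 2 ^ n ≤ β ^ 18 := by
      calc β ^ r * 2 ^ n ≤ β ^ 15 * β ^ 3 :=
            mul_le_mul (pow_le_pow_right₀ hb hr) hn (by positivity) (by positivity)
        _ = β ^ 18 := by ring
    have h2 : 1 ≤ β ^ 18 := one_le_pow₀ hb
    calc (1 + β ^ r * 2 ^ n) * 8 * β ^ 100 ≤ (2 * β ^ 18) * 8 * β ^ 100 := by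
          gcongr; linarith
      _ = 16 * β ^ 118 := by ring
      _ ≤ β ^ (118 + 2) := mul_pow_le_pow hβ _ _ (by norm_num)
      _ = β ^ 120 := by norm_num

end Ctx

theorem Ctx.abs_split_le (c : Ctx E p m k n) {u : Fin 2 → ℕ → ℤ} {z : PolyRing p.P} {ε : ℝ} {r : ℕ}
    (hr : r ≤ 18) (hε : ε ≤ 1) (h : NormLE hP0 (p.stdVal u - z) ε) (hz : NormLE hP0 z ((2 ^ p.P) ^ r))
    (e : Fin 2) {j : ℕ} (hj : j < p.P) : |u e j| ≤ 2 ^ p.H := by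
  have h1 := Params.abs_le_of_normLE c.hP (by simpa using h.add hz) e hj
  have hβ := c.four_le
  have : |(u e j : ℝ)| ≤ 2 ^ p.H := by
    refine h1.trans ?_
    rw [c.two_pow_S, c.two_pow_H]
    generalize (2 : ℝ) ^ p.P = β at *
    have hb : 1 ≤ β := by linarith
    have h2 : β ^ r ≤ β ^ 18 := pow_le_pow_right₀ hb hr
    have h3 : 1 ≤ β ^ 18 := one_le_pow₀ hb
    calc (ε + β ^ r) * β ^ 100 ≤ (2 * β ^ 18) * β ^ 100 := by gcongr; linarith
      _ = 2 * β ^ 118 := by ring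
      _ ≤ β ^ (118 + 2) := mul_pow_le_pow hβ _ _ (by norm_num)
      _ = β ^ 120 := by norm_num
  exact_mod_cast this

theorem Ctx.abs_prodCoeff_le (c : Ctx E p m k n) {u v : Fin 2 → ℕ → ℤ} {z w : PolyRing p.P} {ε : ℝ} {r : ℕ}
    (hr : r ≤ 8) (hε : ε ≤ 1) (h : NormLE hP0 (p.stdVal u - z) ε) (hz : NormLE hP0 z ((2 ^ p.P) ^ r))
    (h' : NormLE hP0 (p.stdVal v - w) ε) (hw : NormLE hP0 w ((2 ^ p.P) ^ r))
    (e : Fin 2) {j : ℕ} (hj : j < p.P) :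
    |Params.prodCoeff p.P u v e j| ≤ 2 ^ p.H * 2 ^ p.S := by
  have hu : NormLE hP0 (p.stdVal u) (ε + (2 ^ p.P) ^ r) := by simpa using h.add hz
  have hv : NormLE hP0 (p.stdVal v) (ε + (2 ^ p.P) ^ r) := by simpa using h'.add hw
  have h1 := Params.abs_prodCoeff_le_of_normLE c.hP (hu.mul hv) e hj
  have hβ := c.four_le
  have hε0 : 0 ≤ ε + (2 ^ p.P) ^ r := (norm_nonneg _).trans (hu 0 (by have := c.P_pos; omega))
  have : |(Params.prodCoeff p.P u v e j : ℝ)| ≤ 2 ^ p.H * 2 ^ p.S := by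
    refine h1.trans ?_
    rw [c.two_pow_S, c.two_pow_H]
    generalize (2 : ℝ) ^ p.P = β at *
    have hb : 1 ≤ β := by linarith
    have h2 : β ^ r ≤ β ^ 8 := pow_le_pow_right₀ hb hr
    have h3 : 1 ≤ β ^ 8 := one_le_pow₀ hb
    have h4 : ε + β ^ r ≤ 2 * β ^ 8 := by linarith
    calc (ε + β ^ r) * (ε + β ^ r) * (β ^ 100 * β ^ 100)
        ≤ (2 * β ^ 8) * (2 * β ^ 8) * (β ^ 100 * β ^ 100) := by gcongr
      _ = 4 * β ^ 216 := by ring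
      _ ≤ β ^ (216 + 4) := mul_pow_le_pow hβ _ _ (by norm_num)
      _ = β ^ 120 * β ^ 100 := by ring
  exact_mod_cast this

theorem Ctx.product_error (c : Ctx E p m k n) {u v y : Fin 2 → ℕ → ℤ} {z w : PolyRing p.P}
    (h : NormLE hP0 (p.stdVal u - z) (1 / (2 ^ p.P) ^ 25)) (hz : NormLE hP0 z ((2 ^ p.P) ^ 5))
    (h' : NormLE hP0 (p.stdVal v - w) (1 / (2 ^ p.P) ^ 25)) (hw : NormLE hP0 w ((2 ^ p.P) ^ 5))
    (hy : ∀ e, ∀ j < p.P, y e j = Params.prodCoeff p.P u v e j / 2 ^ p.S) :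
    NormLE hP0 (p.stdVal y - z * w) (1 / (2 ^ p.P) ^ 18) := by
  refine (Params.normLE_mul_error h hz h' hw (Params.normLE_round hy)).mono ?_
  refine (add_le_add_left c.round_le _).trans ?_
  have hβ := c.four_le
  generalize (2 : ℝ) ^ p.P = β at *
  have hb : 1 ≤ β := by linarith
  have hb0 : 0 < β := by linarith
  have h1 : 1 / β ^ 99 ≤ 1 / β ^ 20 := one_div_pow_le_one_div_pow_of_le hb (by norm_num)
  have h2 : β ^ 5 * (1 / β ^ 25) = 1 / β ^ 20 := pow_mul_one_div_pow hβ 5 20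
  have h3 : 1 / β ^ 25 * (1 / β ^ 25 + β ^ 5) ≤ 1 / β ^ 20 + 1 / β ^ 20 := by
    rw [mul_add, mul_comm _ (β ^ 5), h2]
    refine add_le_add_left ?_ _
    have h4 : 1 / β ^ 25 ≤ 1 := by
      rw [div_le_one (by positivity)]; exact one_le_pow₀ hb
    have h5 : 1 / β ^ 25 ≤ 1 / β ^ 20 := one_div_pow_le_one_div_pow_of_le hb (by norm_num)
    exact (mul_le_of_le_one_right (by positivity) h4).trans h5
  have h6 := mul_one_div_pow_le (c := 5) hβ 18 2 (by norm_num)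
  norm_num at h6 ⊢
  norm_num at h1 h2 h3
  linarith

theorem Ctx.round_eq (c : Ctx E p m k n) {u : Fin 2 → ℕ → ℤ} {d : ℕ → ℕ} {ε : ℝ} (hε : ε ≤ 1 / 4)
    (h : NormLE hP0 (p.stdVal u - ofCoeffs p.P fun j => (d j : ℂ)) ε) {j x : ℕ} (hj : j < p.P)
    (hx : (x : ℤ) = u 0 j + 2 ^ p.H) : (x + 2 ^ p.S / 2 - 2 ^ p.H) / 2 ^ p.S = d j := by
  rw [Params.stdVal, ofCoeffs_sub] at h
  have h1 := (norm_coeff_le c.hP h hj).trans hε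
  have h2 := (Complex.abs_re_le_norm _).trans h1
  rw [Complex.sub_re, (Params.re_div_two_pow _ _ _).1, Complex.natCast_re] at h2
  have hQ : (0 : ℝ) < 2 ^ p.S := by positivity
  have hS1 : 1 ≤ p.S := by rw [c.hS]; have := c.P_pos; omega
  have hQ2 : 2 ^ p.S = 2 * (2 ^ p.S / 2) := by
    rw [show p.S = p.S - 1 + 1 by omega, pow_succ]; omega
  have h3 : |(u 0 j : ℝ) - d j * 2 ^ p.S| ≤ 1 / 4 * 2 ^ p.S := by
    have : (u 0 j : ℝ) - d j * 2 ^ p.S = (u 0 j / 2 ^ p.S - d j) * 2 ^ p.S := by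
      field_simp
    rw [this, abs_mul, abs_of_pos hQ]
    exact mul_le_mul_of_nonneg_right h2 hQ.le
  have h4 : 4 * |u 0 j - d j * 2 ^ p.S| ≤ 2 ^ p.S := by
    have : 4 * |(u 0 j : ℝ) - d j * 2 ^ p.S| ≤ 2 ^ p.S := by linarith
    exact_mod_cast this
  have hQ' : ((2 ^ p.S : ℕ) : ℤ) = 2 ^ p.S := by push_cast; rfl
  have hH' : ((2 ^ p.H : ℕ) : ℤ) = 2 ^ p.H := by push_cast; rfl
  have hQ0 : 0 < 2 ^ p.S := by positivity
  rw [← hQ', ← Nat.cast_mul] at h4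
  rw [← hH'] at hx
  have h5 := abs_le.1 (show |u 0 j - ((d j * 2 ^ p.S : ℕ) : ℤ)| ≤ ((2 ^ p.S : ℕ) : ℤ) / 4 by omega)
  have h6 : (d j + 1) * 2 ^ p.S = d j * 2 ^ p.S + 2 ^ p.S := by ring
  refine Nat.div_eq_of_lt_le ?_ ?_
  · generalize d j * 2 ^ p.S = X at *
    generalize 2 ^ p.S = Q at *
    generalize 2 ^ p.H = O at *
    omega
  · rw [h6]
    generalize d j * 2 ^ p.S = X at *
    generalize 2 ^ p.S = Q at *
    generalize 2 ^ p.H = O at *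
    omega

/-! ### The whole algorithm -/

theorem _root_.LogRAM.Env.wpt_then {c d : Stmt} {j j' l s : ℕ} {R Q : ℕ → St → Prop} {st : St}
    (h : E.wpt c j R s st) (hl : j + j' ≤ l)
    (hd : ∀ u st', s ≤ u → E.Rep (E.σ u).mem st' → (E.σ u).out = st'.out → R u st' →
      E.wpt d j' Q u st') : E.wpt (c ;; d) l Q s st :=
  Env.wpt_seq (Env.wpt_mono h le_rfl fun u st' hu hr ho hR _ => hd u st' hu hr ho hR) hl

theorem _root_.FR.Params.PassesFFT.mono {prog : Program} {σ : ℕ → Config} {s t s' t' : ℕ}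
    {ω ξ : PolyRing p.P} {F : ℕ → PolyRing p.P} (h : p.PassesFFT prog σ s t ω ξ F) (hs : s' ≤ s)
    (ht : t ≤ t') : p.PassesFFT prog σ s' t' ω ξ F := by
  obtain ⟨τ, τ', h1, h2, h3⟩ := h
  exact ⟨τ, τ', hs.trans h1, h2.trans ht, h3⟩

/-- The tables are complete. -/
structure Tables (hP0 : p.P ≠ 0) (m k n : ℕ) (st : St) : Prop where
  base : Base p m k n st
  root : ∀ e < p.N, NormLE hP0 (arrVal p st 4 e - rho p.P p.N ^ e) (1 / 2 ^ (42 * p.P))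

theorem arrVal_frame {st st' : St} {y A : ℕ} {D : List ℕ} (hf : Frame y D st st') (hA : A ∉ D) (i : ℕ) :
    arrVal p st' A i = arrVal p st A i :=
  arrVal_congr fun t _ => by rw [hf.a A hA]

theorem Tables.frame {st st' : St} (h : Tables hP0 m k n st) {y : ℕ} {D : List ℕ}
    (hf : Frame y D st st') (hy : 16 ≤ y) (hD : (0 ∉ D ∧ 1 ∉ D ∧ 2 ∉ D) ∧ 4 ∉ D) :
    Tables hP0 m k n st' :=
  ⟨h.base.frame hf hy hD.1, fun e he => by rw [arrVal_frame hf hD.2]; exact h.root e he⟩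

theorem Base.toVars {st : St} (h : Base p m k n st) : Vars p m k n st := h.vars

theorem Ctx.cost_le (c : Ctx E p m k n) : 2 * p.P * p.N ≤ p.P * (2 * p.P * p.N) ∧
    n * (2 * p.P * p.N) ≤ 3 * (p.P * (2 * p.P * p.N)) ∧
    p.P * (k + 1) * p.N ≤ p.P * (2 * p.P * p.N) ∧ 2 ≤ 2 * p.P * p.N := by
  have h1 := c.P_pos
  have h2 := c.k_lt
  refine ⟨Nat.le_mul_of_pos_left _ (by omega), ?_, ?_, ?_⟩
  · rw [← mul_assoc 3]; exact Nat.mul_le_mul_right _ c.hn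
  · rw [mul_assoc]; exact Nat.mul_le_mul_left _ (Nat.mul_le_mul_right _ (by omega))
  · have := c.P_le_L; omega

theorem tables_spec (c : Ctx E p m k n) {s j : ℕ} {st : St} {Q : ℕ → St → Prop} {d : Stmt}
    (hb : Vars p m k n st)
    (hd : ∀ u st', s ≤ u → Frame 20 [0, 1, 2, 3, 4] st st' → Tables hP0 m k n st' →
      E.wpt d j Q u st') :
    E.wpt (twoCode ;; revCode ;; thetaCode ;; cisCode ;; rhoCode ;; d)
      (20000 * (p.P * (2 * p.P * p.N)) + j) Q s st := by
  obtain ⟨hL, -, -, -⟩ := c.cost_le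
  generalize hW : p.P * (2 * p.P * p.N) = W at hL
  refine Env.wpt_then (j' := 19000 * W + j) (two_spec c hb) (by omega) fun u1 s1 hu1 _ _ h1 => ?_
  have v1 := hb.frame h1.1 (by norm_num)
  refine Env.wpt_then (j' := 18000 * W + j) (rev_spec c v1 h1.2) (by omega) fun u2 s2 hu2 _ _ h2 => ?_
  have v2 := v1.frame h2.1 (by norm_num)
  refine Env.wpt_then (j' := 17000 * W + j) (theta_spec c v2) (by omega) fun u3 s3 hu3 _ _ h3 => ?_
  have v3 := v2.frame h3.1 (by norm_num)
  have b3 : Base p m k n s3 := by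
    refine ⟨v3, ?_, ?_, h3.2⟩
    · rw [h3.1.a 1 (by simp), h2.1.a 1 (by simp)]; exact h1.2
    · rw [h3.1.a 0 (by simp)]; exact h2.2
  refine Env.wpt_then (j' := 1000 * W + j) (cis_spec c v3) (by omega) fun u4 s4 hu4 _ _ h4 => ?_
  have v4 := v3.frame h4.1 (by norm_num)
  refine Env.wpt_then (j' := j) (rho_spec (hP0 := hP0) c v4 h4.2) (by rw [hW]; omega)
    fun u5 s5 hu5 _ _ h5 => ?_
  refine hd u5 s5 (by omega) ?_ ⟨(b3.frame h4.1 (by norm_num) (by simp)).frame h5.1 (by norm_num)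
    (by simp), h5.2⟩
  refine ⟨fun y hy => ?_, fun b hb => ?_, ?_⟩
  · rw [h5.1.v y hy, h4.1.v y hy, h3.1.v y hy, h2.1.v y hy, h1.1.v y hy]
  · simp only [List.mem_cons, List.not_mem_nil, or_false, not_or] at hb
    rw [h5.1.a b (by simp; omega), h4.1.a b (by simp; omega), h3.1.a b (by simp; omega),
      h2.1.a b (by simp; omega), h1.1.a b (by simp; omega)]
  · rw [h5.1.out, h4.1.out, h3.1.out, h2.1.out, h1.1.out]

theorem Ctx.log_N (c : Ctx E p m k n) : Nat.log 2 p.N = n := by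
  rw [c.hN, Nat.log_pow (by norm_num)]

theorem Ctx.fft_eq (c : Ctx E p m k n) {R : Type*} [CommRing R] (ω ξ : R) (f : ℕ → R) (i : ℕ) :
    fft p.N (2 * p.P) ω ξ f i = fftState p.N (2 * p.P) ω ξ f n (bitRev n i) := by
  rw [fft, c.log_N]

theorem Ctx.bitRev_lt (c : Ctx E p m k n) (i : ℕ) : bitRev n i < p.N := c.hN ▸ FR.bitRev_lt n i

theorem Ctx.normLE_fft (c : Ctx E p m k n) {f : ℕ → PolyRing p.P} {r : ℕ} (sv : ℕ)
    (hf : ∀ i < p.N, NormLE hP0 (f i) ((2 ^ p.P) ^ r)) (i : ℕ) :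
    NormLE hP0 (fft p.N (2 * p.P) (rho p.P p.N ^ sv) (ringX p.P ^ sv) f i) ((2 ^ p.P) ^ (r + 3)) := by
  rw [c.fft_eq, pow_add]
  exact (c.normLE_fftState ((normLE_rho _).pow_one _) (normLE_ringX.pow_one _) hf le_rfl _
    (c.bitRev_lt i)).mono (mul_le_mul_of_nonneg_left c.pow_n_le (by positivity))

theorem transform_spec (c : Ctx E p m k n) {A sv s r e : ℕ} {st : St} (hA : 5 ≤ A) (hA' : A < 11)
    (hA7 : A ≠ 7) (hb : Tables hP0 m k n st) (h16 : st.v 16 = sv) (hsv : sv < p.N) (hr : r ≤ 15)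
    (he : 1 ≤ e) (hre : r + 12 + e ≤ 42) {F : ℕ → PolyRing p.P}
    (hF : ∀ i < p.N, NormLE hP0 (F i) ((2 ^ p.P) ^ r))
    (hst : ∀ i < p.N, NormLE hP0 (arrVal p st A i - F i) (1 / (2 ^ p.P) ^ (9 + e))) :
    E.wpt (fftCode A) (15000 * (p.P * (2 * p.P * p.N))) (fun t st' =>
      p.PassesFFT E.prog E.σ s t (rho p.P p.N ^ sv) (ringX p.P ^ sv) F ∧
      Frame 17 [7, 11, 12, 13, 14, 15, 16, 17, A] st st' ∧
      ∀ i < p.N, NormLE hP0 (arrVal p st' A i -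
        fftState p.N (2 * p.P) (rho p.P p.N ^ sv) (ringX p.P ^ sv) F n i) (1 / (2 ^ p.P) ^ e)) s st := by
  refine Env.wpt_mono (fft_spec c hA hA' hA7 hb.base h16 hsv
    (c.precise (r := r) (e := 9 + e) hr (by omega) (by omega)) hb.root hF hst)
    (by have := c.cost_le.2.1; omega) fun t st' _ _ _ ⟨h1, h2, h3⟩ => ⟨h1, h2, fun i hi =>
      (h3 i hi).mono ?_⟩
  rw [mul_comm, ← pow_mul_one_div_pow c.four_le 9 e]
  exact mul_le_mul_of_nonneg_right c.eight_pow_n_le (by positivity)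

theorem decompose_le (a i : ℕ) : NormLE hP0 (decompose p.P a i) ((2 ^ p.P) ^ 2) := by
  rw [← pow_mul, mul_comm]; exact normLE_decompose a i

/-- The transform of a factor. -/
noncomputable def transform (p : Params) (a : ℕ) : ℕ → PolyRing p.P :=
  fft p.N (2 * p.P) (rho p.P p.N) (ringX p.P) (decompose p.P a)

theorem Ctx.normLE_transform (c : Ctx E p m k n) (a i : ℕ) :
    NormLE hP0 (transform p a i) ((2 ^ p.P) ^ 5) := by
  have := c.normLE_fft (hP0 := hP0) 1 (fun i _ => decompose_le a i) i
  rwa [pow_one (rho _ _), pow_one (ringX _)] at this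

theorem forward_spec (c : Ctx E p m k n) {s j a b : ℕ} {st : St} {Q : ℕ → St → Prop} {d : Stmt}
    (hb : Tables hP0 m k n st) (ha' : a < 2 ^ m) (hb' : b < 2 ^ m)
    (hinp : E.inp = bits m a ++ bits m b)
    (hd : ∀ u st', s ≤ u → E.Rep (E.σ u).mem st' → Tables hP0 m k n st' →
      st'.a 18 = st.a 18 → st'.out = st.out →
      p.PassesFFT E.prog E.σ 0 u (rho p.P p.N) (ringX p.P) (decompose p.P a) →
      p.PassesFFT E.prog E.σ 0 u (rho p.P p.N) (ringX p.P) (decompose p.P b) →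
      (∀ i < p.N, NormLE hP0 (arrVal p st' 8 i - transform p a i) (1 / (2 ^ p.P) ^ 25)) →
      (∀ i < p.N, NormLE hP0 (arrVal p st' 9 i - transform p b i) (1 / (2 ^ p.P) ^ 25)) →
      E.wpt d j Q u st') :
    E.wpt (inputCode 5 0 ;; inputCode 6 vm ;; set 16 1 ;; fftCode 5 ;; fftCode 6 ;;
      reorderCode 5 8 ;; reorderCode 6 9 ;; d) (31000 * (p.P * (2 * p.P * p.N)) + j) Q s st := by
  obtain ⟨hL, -, -, h2⟩ := c.cost_le
  have hN1 : 1 < p.N := by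
    have := c.n_lt; have := c.hkn; omega
  have hBg := c.good.B_ge
  generalize hW : p.P * (2 * p.P * p.N) = W at hL
  refine Env.wpt_then (j' := 30900 * W + j) (input_spec c (bv := 0) (a := a) hb.base.toVars
    (Or.inl ⟨rfl, rfl⟩) ha' (fun s l h => by rw [hinp, zero_add]; exact ofBits_drop_take h _)
    (by rw [hinp]; simp [length_bits])) (by omega) fun u1 s1 hu1 _ _ h1 => ?_
  have b1 := hb.frame h1.1 (by norm_num) (by simp)
  refine Env.wpt_then (j' := 30800 * W + j) (input_spec c (bv := m) (a := b) b1.base.toVars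
    (Or.inr ⟨rfl, rfl⟩) hb' (fun s l h => by
      have := ofBits_drop_take (a := b) h []
      rw [hinp, ← List.drop_drop, List.drop_left' (length_bits _ _)]
      simpa using this)
    (by rw [hinp]; simp [length_bits])) (by omega) fun u2 s2 hu2 _ _ h2 => ?_
  have b2 := b1.frame h2.1 (by norm_num) (by simp)
  refine Env.wpt_then (j' := 30700 * W + j) (Env.wpt_set c.good (x := 16) (e := 1)
    (Q := fun _ st' => st' = s2.set 16 1) trivial (show 1 < E.B by omega) fun t ht => rfl)
    (show 1 + _ ≤ _ by omega) fun u3 s3 hu3 _ _ h3 => ?_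
  have f3 : Frame 16 [] s2 s3 := by
    rw [h3, Frame.set_iff (by norm_num)]; exact Frame.refl _ _ _
  have b3 := b2.frame f3 (by norm_num) (by simp)
  have h316 : s3.v 16 = 1 := by rw [h3]; simp [St.set]
  refine Env.wpt_then (j' := 15700 * W + j) (transform_spec c (sv := 1) (r := 2) (e := 25) (s := u3) (F := decompose p.P a) (by norm_num)
    (by norm_num) (by norm_num) b3 h316 hN1 (by norm_num) (by norm_num) (by norm_num)
    (fun i _ => decompose_le a i) fun i hi => by
      rw [arrVal_frame f3 (by simp), arrVal_frame h2.1 (by simp), h1.2 i hi, sub_self]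
      intro q hq
      rw [map_zero, norm_zero]
      positivity) (by rw [hW]; omega) fun u4 s4 hu4 _ _ ⟨p4, f4, h4⟩ => ?_
  have b4 := b3.frame f4 (by norm_num) (by simp)
  refine Env.wpt_then (j' := 700 * W + j) (transform_spec c (sv := 1) (r := 2) (e := 25) (s := u4) (F := decompose p.P b) (by norm_num)
    (by norm_num) (by norm_num) b4 (by rw [f4.v 16 (by norm_num), h316]) hN1 (by norm_num)
    (by norm_num) (by norm_num)
    (fun i _ => decompose_le b i) fun i hi => by
      rw [arrVal_frame f4 (by simp), arrVal_frame f3 (by simp), h2.2 i hi, sub_self]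
      intro q hq
      rw [map_zero, norm_zero]
      positivity) (by rw [hW]; omega) fun u5 s5 hu5 _ _ ⟨p5, f5, h5⟩ => ?_
  have b5 := b4.frame f5 (by norm_num) (by simp)
  refine Env.wpt_then (j' := 600 * W + j) (reorder_spec c b5.base (by norm_num) (by norm_num)
    (by norm_num)) (by omega) fun u6 s6 hu6 _ _ ⟨f6, h6⟩ => ?_
  have b6 := b5.frame f6 (by norm_num) (by simp)
  refine Env.wpt_then (j' := j) (reorder_spec c b6.base (by norm_num) (by norm_num)
    (by norm_num)) (by omega) fun u7 s7 hu7 hr _ ⟨f7, h7⟩ => ?_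
  have b7 := b6.frame f7 (by norm_num) (by simp)
  rw [pow_one (rho _ _), pow_one (ringX _)] at p4 p5 h4 h5
  refine hd u7 s7 (by omega) hr b7 ?_ ?_ (p4.mono (Nat.zero_le _) (by omega))
    (p5.mono (Nat.zero_le _) (by omega)) (fun i hi => ?_) fun i hi => ?_
  · rw [f7.a 18 (by simp), f6.a 18 (by simp), f5.a 18 (by simp), f4.a 18 (by simp),
      f3.a 18 (by simp), h2.1.a 18 (by simp), h1.1.a 18 (by simp)]
  · rw [f7.out, f6.out, f5.out, f4.out, f3.out, h2.1.out, h1.1.out]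
  · rw [arrVal_frame f7 (by simp), h6 i hi, arrVal_frame f5 (by simp), transform, c.fft_eq]
    exact h4 _ (c.bitRev_lt i)
  · rw [h7 i hi, arrVal_frame f6 (by simp), transform, c.fft_eq]
    exact h5 _ (c.bitRev_lt i)

theorem Ctx.one_div_pow_le (c : Ctx E p m k n) {a e : ℕ} (h : a ≤ e) :
    (1 : ℝ) / (2 ^ p.P) ^ e ≤ 1 / (2 ^ p.P) ^ a :=
  one_div_le_one_div_of_le (by positivity)
    (pow_le_pow_right₀ (by have := c.four_le; linarith) h)

theorem Ctx.holds (c : Ctx E p m k n) {t : ℕ} {st : St} (hrep : E.Rep (E.σ t).mem st) {A r e : ℕ}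
    (hA : A < 24) {F : ℕ → PolyRing p.P} (hr : r ≤ 15) (he : 1 ≤ e)
    (hF : ∀ i < p.N, NormLE hP0 (F i) ((2 ^ p.P) ^ r))
    (h : ∀ i < p.N, NormLE hP0 (arrVal p st A i - F i) (1 / (2 ^ p.P) ^ e)) :
    p.HoldsArray (E.σ t) (104 + A * E.L) F := by
  refine c.holdsArray hrep hA hF h (by simpa using c.one_div_pow_le he) ?_ (by positivity)
  refine le_trans ?_ (c.precise (r := r) (e := 10) hr le_rfl (by omega)).fits
  gcongr
  exact le_mul_of_one_le_right (by positivity) (one_le_pow₀ (by norm_num))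

theorem Ctx.normLE_inv_mul (c : Ctx E p m k n) {z : PolyRing p.P} {r : ℝ} (hr : 0 ≤ r)
    (h : NormLE hP0 z r) : NormLE hP0 (AdjoinRoot.of _ (p.N : ℂ)⁻¹ * z) r := by
  have hN : (1 : ℝ) ≤ p.N := by exact_mod_cast c.N_pos
  refine ((normLE_of _).mul h).mono ?_
  rw [norm_inv, Complex.norm_natCast]
  exact mul_le_of_le_one_left hr (inv_le_one_of_one_le₀ hN)

theorem Ctx.divide_error (c : Ctx E p m k n) {u v : Fin 2 → ℕ → ℤ} {z : PolyRing p.P}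
    (h : NormLE hP0 (p.stdVal u - z) (1 / (2 ^ p.P) ^ 9)) (hv : ∀ e, ∀ j < p.P, v e j = u e j / p.N) :
    NormLE hP0 (p.stdVal v - AdjoinRoot.of _ (p.N : ℂ)⁻¹ * z) (1 / (2 ^ p.P) ^ 8) := by
  have h1 := (c.normLE_divide (hP0 := hP0) hv).add (c.normLE_inv_mul (by positivity) h)
  rw [mul_sub, sub_add_sub_cancel] at h1
  refine h1.mono ?_
  have h2 := c.round_le
  have h3 := c.one_div_pow_le (show 9 ≤ 99 by norm_num)
  have h4 := mul_one_div_pow_le (c := 3) c.four_le 8 1 (by norm_num)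
  linarith

theorem Ctx.convCoeff_le (c : Ctx E p m k n) {N a b i j : ℕ}
    (h : NormLE hP0 (ofCoeffs p.P fun j => (convCoeff p.P N a b i j : ℂ)) ((2 ^ p.P) ^ 13))
    (hj : j < p.P) : convCoeff p.P N a b i j ≤ (2 ^ p.P) ^ 13 := by
  have := norm_coeff_le c.hP h hj
  rw [Complex.norm_natCast] at this
  exact_mod_cast this

theorem Ctx.L_mul_lt (c : Ctx E p m k n) : 2 * (2 * p.P * p.N * (2 ^ p.P) ^ 13) < E.B := by
  refine c.lt_B (a := 19) ?_ (by norm_num)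
  have h1 := (Ctx.P_lt (p := p)).le
  have h2 := c.two_le
  calc 2 * (2 * p.P * p.N * (2 ^ p.P) ^ 13)
      ≤ 2 ^ p.P * (2 ^ p.P * 2 ^ p.P * (2 ^ p.P) ^ 3 * (2 ^ p.P) ^ 13) := by
        gcongr; exact c.N_le
    _ = (2 ^ p.P) ^ 19 := by ring

theorem backward_spec (c : Ctx E p m k n) {s a b : ℕ} {st : St}
    (hr : E.Rep (E.σ s).mem st) (hb : Tables hP0 m k n st) (ha' : a < 2 ^ m) (hb' : b < 2 ^ m)
    (h18 : ∀ t < 2 * p.P * p.N, st.a 18 t = 0) (hout : st.out = [])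
    (hpa : p.PassesFFT E.prog E.σ 0 s (rho p.P p.N) (ringX p.P) (decompose p.P a))
    (hpb : p.PassesFFT E.prog E.σ 0 s (rho p.P p.N) (ringX p.P) (decompose p.P b))
    (h8 : ∀ i < p.N, NormLE hP0 (arrVal p st 8 i - transform p a i) (1 / (2 ^ p.P) ^ 25))
    (h9 : ∀ i < p.N, NormLE hP0 (arrVal p st 9 i - transform p b i) (1 / (2 ^ p.P) ^ 25)) :
    E.wpt (productCode ;; set 16 (vN - 1) ;; fftCode 10 ;; divideCode 10 8 ;;
      digitCode ;; carryCode ;; outputCode) (30000 * (p.P * (2 * p.P * p.N))) (fun t st' =>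
        p.Performs E.prog E.σ t a b ∧ st'.out = bits (2 * m) (a * b)) s st := by
  obtain ⟨hL, -, hC, h2⟩ := c.cost_le
  have hNB : p.N < E.B := by have := c.N_le_L; have := c.L_lt; omega
  have hN0 := c.N_pos
  generalize hW : p.P * (2 * p.P * p.N) = W at hL hC ⊢
  have hε : (1 : ℝ) / (2 ^ p.P) ^ 25 ≤ 1 := by simpa using c.one_div_pow_le (Nat.zero_le 25)
  have hta := fun i => c.normLE_transform (hP0 := hP0) a i
  have htb := fun i => c.normLE_transform (hP0 := hP0) b i
  refine Env.wpt_then (j' := 23000 * W) (product_spec c hb.base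
    (fun i hi e j hj => c.abs_split_le (r := 5) (by norm_num) hε (h8 i hi) (hta i) e hj)
    (fun i hi e j hj => c.abs_split_le (r := 5) (by norm_num) hε (h9 i hi) (htb i) e hj)
    fun i hi e j hj => c.abs_prodCoeff_le (r := 5) (by norm_num) hε (h8 i hi) (hta i) (h9 i hi)
      (htb i) e hj) (by omega) fun u1 s1 hu1 r1 _ ⟨f1, h1⟩ => ?_
  have b1 := hb.frame f1 (by norm_num) (by simp)
  have hz : ∀ i < p.N, NormLE hP0 (transform p a i * transform p b i) ((2 ^ p.P) ^ 10) :=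
    fun i _ => ((hta i).mul (htb i)).mono (le_of_eq (by ring))
  have h10 : ∀ i < p.N, NormLE hP0 (arrVal p s1 10 i - transform p a i * transform p b i)
      (1 / (2 ^ p.P) ^ 18) := fun i hi =>
    c.product_error (h8 i hi) (hta i) (h9 i hi) (htb i) (h1 i hi).2
  refine Env.wpt_then (j' := 22000 * W) (Env.wpt_set c.good (x := 16) (e := vN - 1)
    (Q := fun _ st' => st' = s1.set 16 (p.N - 1)) (by exact ⟨trivial, trivial⟩)
    (show s1.v 3 - 1 < E.B by rw [b1.base.vars.2.2.2.1]; omega)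
    fun t ht => by
      show s1.set 16 (s1.v 3 - 1) = _
      rw [b1.base.vars.2.2.2.1])
    (show 2 + _ ≤ _ by omega) fun u2 s2 hu2 _ _ h2 => ?_
  have f2 : Frame 16 [] s1 s2 := by
    rw [h2, Frame.set_iff (by norm_num)]; exact Frame.refl _ _ _
  have b2 := b1.frame f2 (by norm_num) (by simp)
  refine Env.wpt_then (j' := 7000 * W) (transform_spec c (sv := p.N - 1) (r := 10) (e := 9)
    (F := fun i => transform p a i * transform p b i) (by norm_num)
    (by norm_num) (by norm_num) b2 (by rw [h2]; simp [St.set]) (by omega) (by norm_num) (by norm_num)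
    (by norm_num) hz fun i hi => by rw [arrVal_frame f2 (by simp)]; exact h10 i hi)
    (by rw [hW]; omega) fun u3 s3 hu3 _ _ ⟨p3, f3, h3⟩ => ?_
  have b3 := b2.frame f3 (by norm_num) (by simp)
  have hnorm := c.normLE_fft (hP0 := hP0) (p.N - 1) hz
  have hε9 : (1 : ℝ) / (2 ^ p.P) ^ 9 ≤ 1 := by simpa using c.one_div_pow_le (Nat.zero_le 9)
  refine Env.wpt_then (j' := 6000 * W) (divide_spec c b3.base (by norm_num) (by norm_num)
    fun i hi t ht => by
      have hn := c.normLE_fftState (hP0 := hP0) (ω := rho p.P p.N ^ (p.N - 1))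
        (ξ := ringX p.P ^ (p.N - 1)) ((normLE_rho _).pow_one _) (normLE_ringX.pow_one _) hz le_rfl i hi
      have := c.abs_split_le (r := 13) (by norm_num) hε9 (h3 i hi) (hn.mono (by
        rw [show 13 = 10 + 3 from rfl, pow_add _ 10 3]
        exact mul_le_mul_of_nonneg_left c.pow_n_le (by positivity)))
        ⟨t % 2, Nat.mod_lt _ (by norm_num)⟩ (show t / 2 < p.P by omega)
      rwa [Params.split, Nat.div_add_mod] at this)
    (by omega) fun u4 s4 hu4 r4 o4 ⟨f4, h4⟩ => ?_
  have b4 := b3.frame f4 (by norm_num) (by simp)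
  have out4 : s4.out = [] := by rw [f4.out, f3.out, f2.out, f1.out, hout]
  have a18 : s4.a 18 = st.a 18 := by
    rw [f4.a 18 (by simp), f3.a 18 (by simp), f2.a 18 (by simp), f1.a 18 (by simp)]
  have herr : ∀ i < p.N, NormLE hP0 (arrVal p s4 8 i - AdjoinRoot.of _ (p.N : ℂ)⁻¹ *
      fft p.N (2 * p.P) (rho p.P p.N ^ (p.N - 1)) (ringX p.P ^ (p.N - 1))
        (fun i => transform p a i * transform p b i) i) (1 / (2 ^ p.P) ^ 8) := fun i hi => by
    rw [c.fft_eq]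
    exact c.divide_error (h3 _ (c.bitRev_lt i)) fun e j hj => h4 i hi _ (by omega)
  have hnorm' : ∀ i < p.N, NormLE hP0 (AdjoinRoot.of _ (p.N : ℂ)⁻¹ *
      fft p.N (2 * p.P) (rho p.P p.N ^ (p.N - 1)) (ringX p.P ^ (p.N - 1))
        (fun i => transform p a i * transform p b i) i) ((2 ^ p.P) ^ 13) := fun i _ =>
    c.normLE_inv_mul (by positivity) (hnorm i)
  have hperf : ∀ T ≥ u4, p.Performs E.prog E.σ T a b := fun T hT =>
    ⟨s, u1, u3, u4, hu1, hu2.trans hu3, hu4, hT, hpa, hpb,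
      ⟨_, _, _, c.holds hr (by norm_num) (by norm_num) (by norm_num) (fun i _ => hta i) h8,
        c.holds hr (by norm_num) (by norm_num) (by norm_num) (fun i _ => htb i) h9,
        c.holds r1 (by norm_num) (by norm_num) (by norm_num) hz h10, fun i hi => (h1 i hi).1⟩,
      p3.mono hu2 le_rfl,
      ⟨_, c.holds r4 (by norm_num) (by norm_num) (by norm_num) hnorm' herr⟩, by rw [o4, out4]⟩
  have hi4 : (1 : ℝ) / (2 ^ p.P) ^ 8 ≤ 1 / 4 :=
    (c.one_div_pow_le (show 1 ≤ 8 by norm_num)).trans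
      (by rw [pow_one]; exact one_div_le_one_div_of_le (by norm_num) c.four_le)
  refine Env.wpt_then (j' := 5000 * W) (digit_spec c b4.base.toVars (by rwa [a18])
    (convCoeff p.P p.N a b) (Y := (2 ^ p.P) ^ 13)
    (fun i hi j hj => c.round_eq (u := Params.split (arrInt p s4 8 i)) hi4
      (by rw [← c.inverse_eq ha' hb' hi]; exact herr i hi) hj
      (by simp [Params.split, arrInt]))
    (fun i hi j hj => c.convCoeff_le (hP0 := hP0)
      (by rw [← c.inverse_eq ha' hb' hi]; exact hnorm' i hi) hj)
    (by have := c.L_mul_lt; omega)) (by omega) fun u5 s5 hu5 _ _ ⟨f5, hle, hsum⟩ => ?_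
  have hcap : 2 ^ m ≤ 2 ^ (p.N / 2 * (p.P / 2 * p.P)) := Nat.pow_le_pow_right (by norm_num) c.cap
  rw [sum_convCoeff ((Dvd.intro _ rfl).trans c.dvd_N) (ha'.trans_le hcap) (hb'.trans_le hcap)] at hsum
  have v5 := b4.base.toVars.frame f5 (by norm_num)
  refine Env.wpt_then (j' := 4000 * W) (carry_spec c v5 hle c.L_mul_lt hsum) (by omega)
    fun u6 s6 hu6 _ _ ⟨f6, h6⟩ => ?_
  refine Env.wpt_mono (output_spec c (v5.frame f6 (by norm_num)) (by rw [f6.out, f5.out, out4]) h6)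
    (by omega) fun u7 s7 hu7 _ _ h7 => ⟨hperf u7 (by omega), h7⟩

theorem main_spec (c : Ctx E p m k n) {s a b : ℕ} {st : St} (hb : Vars p m k n st)
    (ha' : a < 2 ^ m) (hb' : b < 2 ^ m) (hinp : E.inp = bits m a ++ bits m b)
    (h18 : ∀ t < 2 * p.P * p.N, st.a 18 t = 0) (hout : st.out = []) :
    E.wpt mainCode (81000 * (p.P * (2 * p.P * p.N))) (fun t st' =>
        p.Performs E.prog E.σ t a b ∧ st'.out = bits (2 * m) (a * b)) s st := by
  have hP0 : p.P ≠ 0 := by have := c.P_pos; omega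
  refine Env.wpt_mono (tables_spec (hP0 := hP0) c hb fun u1 s1 hu1 f1 b1 =>
    forward_spec c b1 ha' hb' hinp fun u2 s2 hu2 r2 b2 e18 eout pa pb h8 h9 =>
      backward_spec c r2 b2 ha' hb' (by rwa [e18, f1.a 18 (by simp)]) (by rw [eout, f1.out, hout])
        pa pb h8 h9) (by omega) fun _ _ _ _ _ h => h

end FR.Prog

namespace FR.Prog

open LogRAM LogRAM.Stmt

variable {E F : Env} {p : Params} {m k n : ℕ}

/-! ### The parameters -/

/-- `2 ^ k` is the least admissible degree, and then `2 ^ n` is the least admissible length. -/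
structure Choice (m k n : ℕ) : Prop where
  hk : 1 ≤ k
  lt : m < 2 ^ 2 ^ k
  least : ∀ i, 1 ≤ i → i < k → 2 ^ 2 ^ i ≤ m
  hkn : k + 1 ≤ n
  le : 4 * m ≤ 2 ^ n * 2 ^ k * 2 ^ k
  least' : ∀ i, k + 1 ≤ i → i < n → 2 ^ i * 2 ^ k * 2 ^ k < 4 * m

theorem exists_choice (m : ℕ) : ∃ k n, Choice m k n := by
  classical
  have h1 : ∃ k, 1 ≤ k ∧ m < 2 ^ 2 ^ k := ⟨m + 1, by omega, by
    calc m < 2 ^ m := Nat.lt_two_pow_self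
      _ ≤ 2 ^ 2 ^ (m + 1) := Nat.pow_le_pow_right (by norm_num)
        (Nat.lt_two_pow_self.le.trans (Nat.pow_le_pow_right (by norm_num) (by omega)))⟩
  set k := Nat.find h1
  have h2 : ∃ n, k + 1 ≤ n ∧ 4 * m ≤ 2 ^ n * 2 ^ k * 2 ^ k := ⟨4 * m + (k + 1), by omega, by
    calc 4 * m ≤ 2 ^ (4 * m) := Nat.lt_two_pow_self.le
      _ ≤ 2 ^ (4 * m + (k + 1)) := Nat.pow_le_pow_right (by norm_num) (by omega)
      _ ≤ _ := by rw [mul_assoc]; exact Nat.le_mul_of_pos_right _ (by positivity)⟩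
  refine ⟨k, Nat.find h2, (Nat.find_spec h1).1, (Nat.find_spec h1).2, fun i hi hik => ?_,
    (Nat.find_spec h2).1, (Nat.find_spec h2).2, fun i hi hin => ?_⟩
  · have := Nat.find_min h1 hik
    simpa [hi] using this
  · have := Nat.find_min h2 hin
    simpa [hi] using this

theorem Choice.k_le (h : Choice m k n) : k ≤ 2 * m + 1 := by
  by_contra hc
  have h1 := h.least (2 * m + 1) (by omega) (by omega)
  have h2 : 2 * m + 1 < 2 ^ (2 * m + 1) := Nat.lt_two_pow_self
  have h3 : 2 ^ (2 * m + 1) < 2 ^ 2 ^ (2 * m + 1) := Nat.lt_two_pow_self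
  omega

theorem Choice.n_le (h : Choice m k n) : n ≤ k + 1 + 2 * m := by
  by_contra hc
  have h1 := h.least' (k + 1 + 2 * m) (by omega) (by omega)
  have h2 : 2 * m < 2 ^ (2 * m) := Nat.lt_two_pow_self
  have h3 : 2 ^ (2 * m) * 2 ≤ 2 ^ (k + 1 + 2 * m) := by
    rw [← pow_succ]; exact Nat.pow_le_pow_right (by norm_num) (by omega)
  have h4 : 2 ^ (k + 1 + 2 * m) ≤ 2 ^ (k + 1 + 2 * m) * 2 ^ k * 2 ^ k := by
    rw [mul_assoc]; exact Nat.le_mul_of_pos_right _ (by positivity)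
  omega

theorem pow_spec (hF : F.Good) {s y b e : ℕ} {bE : Exp} {st : St} (hy : y ≠ 13) (hy' : y ≠ 20)
    (hb : ∀ st', st'.v 13 = st.v 13 → bE.Ok F st' ∧ bE.val st' = b) (hlen : (bE.code 1).length = 0)
    (he : e < 256) (hlt : ∀ i ≤ e, b ^ i < F.B) :
    F.wpt (powCode y bE e) 4000 (fun _ st' => Frame 0 [] st st' ∧
      (∀ z ≠ 20, st'.v z = if z = y then b ^ e else st.v z)) s st := by
  have hB := hF.B_ge
  refine Env.wpt_cons' hF (n := 3900) (R := fun st' => Frame 0 [] st st' ∧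
    ∀ z ≠ 20, st'.v z = if z = y then 1 else st.v z) ?_ ?_ ?_
  · simp [Stmt.len]
  · simp [Stmt.wp, Frame.refl]
    omega
  rintro t1 _ st1 ⟨fr1, h0⟩
  refine Env.wpt_loop' hF (n := e) (T := 3) (fun i st' => Frame 0 [] st st' ∧
    ∀ z ≠ 20, st'.v z = if z = y then b ^ i else st.v z) (by omega) ?_ ?_ ?_ ?_ (fun _ _ st' h _ => h)
  · refine ⟨by simpa using fr1, fun z hz => ?_⟩
    simp [hz, h0 z hz]
  · rintro l _ st' - -
    simp
  · rintro l hl t _ st' hv ⟨hfr, h⟩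
    obtain ⟨h1, h2⟩ := hb st' (by rw [h 13 (by norm_num), if_neg (by omega)])
    refine Env.wpt_body hF (by simp [Stmt.len, hlen]) ?_
    have h3 := h y hy'
    rw [if_pos rfl] at h3
    have h4 := hlt (l + 1) (by omega)
    rw [pow_succ] at h4
    simp [Stmt.wp, h1, h2, h3, hfr, h4, hv, pow_succ, hy'.symm]
    intro z hz
    simp only [hz, h z hz, if_false]
    split_ifs <;> rfl
  · have : ((Exp.const e).code 0).length = 0 := rfl
    rw [this]; omega

theorem degree_spec (hF : F.Good) (h : Choice m k n) {s : ℕ} {st : St} (hB : 2 ^ 2 ^ k < F.B)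
    (hm : 2 * m < F.B)
    (h0 : st.v 0 = 2 * m) (h1 : st.v 1 = m) (h2 : st.v 2 = 2) (h4 : st.v 4 = 1) (h13 : st.v 13 = 4) :
    F.wpt (loop 20 vn (ifz (vb - vm) (set 2 (2 * vP) ;; set 4 (vlP + 1) ;; set 13 (vb * vb)) skip))
      (40 * (2 * m + 1)) (fun _ st' => Frame 0 [] st st' ∧ st'.v 0 = 2 * m ∧ st'.v 1 = m ∧
        st'.v 2 = 2 ^ k ∧ st'.v 4 = k ∧ st'.v 13 = 2 ^ 2 ^ k) s st := by
  have hB' := hF.B_ge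
  have hk := h.k_le
  have hk1 := h.hk
  refine Env.wpt_loop' hF (n := 2 * m) (T := 20) (fun i st' => Frame 0 [] st st' ∧ st'.v 0 = 2 * m ∧
    st'.v 1 = m ∧ st'.v 2 = 2 ^ min k (i + 1) ∧ st'.v 4 = min k (i + 1) ∧
    st'.v 13 = 2 ^ 2 ^ min k (i + 1)) hm ?_ ?_ ?_ ?_ ?_
  · simp [h0, h1, h2, h4, h13, Frame.refl, hk1]
  · rintro i _ st' ⟨-, e0, -⟩ _
    simp [e0]
  · rintro i hi t _ st' hv ⟨hfr, e0, e1, e2, e4, e13⟩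
    refine Env.wpt_body hF (by simp [Stmt.len]) ?_
    simp only [Stmt.wp, Exp.ok_sub, Exp.ok_var, true_and, Exp.val_sub, Exp.val_var, e1, e13]
    refine ⟨fun hz => ?_, fun hz => ?_⟩
    · have hik : i + 1 < k := by
        by_contra hc
        have := h.lt
        rw [min_eq_left (by omega)] at hz
        omega
      rw [min_eq_right (by omega)] at e2 e4 e13
      have hp : 2 ^ 2 ^ (i + 2) ≤ 2 ^ 2 ^ k :=
        Nat.pow_le_pow_right (by norm_num) (Nat.pow_le_pow_right (by norm_num) (by omega))
      have hp' : 2 ^ (i + 2) < 2 ^ 2 ^ (i + 2) := Nat.lt_two_pow_self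
      have hp'' : i + 2 < 2 ^ (i + 2) := Nat.lt_two_pow_self
      have es : 2 ^ 2 ^ (i + 1) * 2 ^ 2 ^ (i + 1) = 2 ^ 2 ^ (i + 2) := by
        rw [← pow_add, ← two_mul, ← pow_succ']
      have es' : 2 * 2 ^ (i + 1) = 2 ^ (i + 2) := (pow_succ' _ _).symm
      simp [e0, e1, e2, e4, e13, es, es', hv, hfr, min_eq_right (show i + 1 + 1 ≤ k by omega)]
      omega
    · have hik : k ≤ i + 1 := by
        by_contra hc
        rw [min_eq_right (by omega)] at hz
        have := h.least (i + 1) (by omega) (by omega)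
        omega
      rw [min_eq_left hik] at e2 e4 e13
      simp [e0, e1, e2, e4, e13, hv, hfr, min_eq_left (show k ≤ i + 1 + 1 by omega)]
  · have : (vn.code 0).length = 0 := rfl
    rw [this]; omega
  · rintro t _ st' h' -
    rwa [min_eq_left hk] at h'

theorem length_spec (hF : F.Good) (h : Choice m k n) {s : ℕ} {st : St} (hB : 2 ^ n < F.B)
    (hm : 2 * m < F.B)
    (h0 : st.v 0 = 2 * m) (h1 : st.v 1 = m) (h2 : st.v 2 = 2 ^ k) (h3 : st.v 3 = 2 ^ (k + 1))
    (h4 : st.v 4 = k) (h5 : st.v 5 = k + 1) (h7 : st.v 7 = 2 * 2 ^ k) (h13 : st.v 13 = 2 ^ 2 ^ k) :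
    F.wpt (loop 20 vn (ifz (vN * vP * vP + 1 - 4 * vm) (set 3 (2 * vN) ;; set 5 (vlN + 1)) skip))
      (40 * (2 * m + 1)) (fun _ st' => Frame 0 [] st st' ∧ st'.v 0 = 2 * m ∧ st'.v 1 = m ∧
        st'.v 2 = 2 ^ k ∧ st'.v 4 = k ∧ st'.v 7 = 2 * 2 ^ k ∧ st'.v 13 = 2 ^ 2 ^ k ∧
        st'.v 3 = 2 ^ n ∧ st'.v 5 = n) s st := by
  have hB' := hF.B_ge
  have hn := h.n_le
  have hkn := h.hkn
  refine Env.wpt_loop' hF (n := 2 * m) (T := 20) (fun i st' => Frame 0 [] st st' ∧ st'.v 0 = 2 * m ∧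
    st'.v 1 = m ∧ st'.v 2 = 2 ^ k ∧ st'.v 4 = k ∧ st'.v 7 = 2 * 2 ^ k ∧ st'.v 13 = 2 ^ 2 ^ k ∧
    st'.v 3 = 2 ^ min n (k + 1 + i) ∧ st'.v 5 = min n (k + 1 + i)) hm ?_ ?_ ?_ ?_ ?_
  · simp [h0, h1, h2, h3, h4, h5, h7, h13, Frame.refl, hkn]
  · rintro i _ st' ⟨-, e0, -⟩ _
    simp [e0]
  · rintro i hi t _ st' hv ⟨hfr, e0, e1, e2, e4, e7, e13, e3, e5⟩
    refine Env.wpt_body hF (by simp [Stmt.len]) ?_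
    simp only [Stmt.wp, Exp.ok_sub, Exp.ok_mul, Exp.ok_add, Exp.ok_var, Exp.ok_ofNat, true_and,
      and_true, Exp.val_sub, Exp.val_mul, Exp.val_add, Exp.val_ofNat, Exp.val_var, e1, e2, e3]
    refine ⟨fun hz => ?_, fun hz => ?_⟩
    · have hik : k + 1 + i < n := by
        by_contra hc
        have := h.le
        rw [min_eq_left (by omega)] at hz
        omega
      rw [min_eq_right (by omega)] at e3 e5
      have hp : 2 ^ (k + 1 + (i + 1)) ≤ 2 ^ n := Nat.pow_le_pow_right (by norm_num) (by omega)
      have hp'' : k + 1 + (i + 1) < 2 ^ (k + 1 + (i + 1)) := Nat.lt_two_pow_self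
      have es' : 2 * 2 ^ (k + 1 + i) = 2 ^ (k + 1 + (i + 1)) := (pow_succ' _ _).symm
      simp [e0, e1, e2, e4, e5, e7, e13, es', hv, hfr, min_eq_right hik.le,
        min_eq_right (show k + 1 + (i + 1) ≤ n by omega)]
      omega
    · have hik : n ≤ k + 1 + i := by
        by_contra hc
        rw [min_eq_right (by omega)] at hz
        have := h.least' (k + 1 + i) (by omega) (by omega)
        omega
      rw [min_eq_left hik] at e3 e5
      simp [e0, e1, e2, e3, e4, e5, e7, e13, hv, hfr, min_eq_left (show n ≤ k + 1 + (i + 1) by omega)]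
  · have : (vn.code 0).length = 0 := rfl
    rw [this]; omega
  · rintro t _ st' h' -
    rwa [min_eq_left hn] at h'

theorem param_spec (c : Ctx E p m k n) (hF : F.Good) (hFB : F.B = E.B) (h : Choice m k n) {s : ℕ}
    {st : St} (h0 : st.v 0 = 2 * m) :
    F.wpt paramCode (20000 + 160 * m) (fun _ st' => Vars p m k n st' ∧ Frame 0 [] st st') s st := by
  have hB' := hF.B_ge
  have hP := c.P_pos
  have hLB := c.L_lt
  have hNL := c.N_le_L
  have hPL := c.P_le_L
  have hmB : 2 ^ p.P < E.B := by simpa using c.pow_lt (a := 1) (by norm_num)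
  have hm2 : 2 * m < F.B := by
    have h1 := c.pow_lt (a := 2) (by norm_num)
    have h2 := c.hm'
    have h3 := c.two_le
    have : 2 * m ≤ 2 ^ (2 * p.P) := by
      rw [two_mul p.P, pow_add]; exact Nat.mul_le_mul h3 h2.le
    omega
  have hM := c.M_lt
  have hpowB : ∀ i, i < 750 → (2 ^ p.P) ^ i < F.B := fun i hi => by
    rw [← pow_mul, mul_comm, hFB]; exact c.pow_lt hi
  have h250 : 2 ^ 250 < F.B := by
    have h1 := c.pow_lt (a := 250) (by norm_num)
    have h2 : 2 ^ 250 ≤ 2 ^ (250 * p.P) := Nat.pow_le_pow_right (by norm_num) (by omega)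
    omega
  rw [← hFB] at hLB hmB hM
  have hk1 : k + 1 < F.B := by have := c.k_lt; have := Ctx.P_lt (p := p); omega
  refine Env.wpt_cons hF (n := 19990 + 160 * m) (by simp [Stmt.len]; omega)
    ⟨by simp, by simp [h0]; omega, fun u1 _ => ?_⟩
  refine Env.wpt_cons hF (n := 19988 + 160 * m) (by simp [Stmt.len]; omega)
    ⟨by simp, by simp; omega, fun u2 _ => ?_⟩
  refine Env.wpt_cons hF (n := 19986 + 160 * m) (by simp [Stmt.len]; omega)
    ⟨by simp, by simp; omega, fun u3 _ => ?_⟩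
  refine Env.wpt_cons hF (n := 19984 + 160 * m) (by simp [Stmt.len]; omega)
    ⟨by simp, by simp; omega, fun u4 _ => ?_⟩
  refine Env.wpt_then (j' := 19900 + 80 * m) (degree_spec hF h (by rwa [← c.hP]) hm2 (by simp [h0])
    (by simp [h0]) (by simp) (by simp) (by simp)) (by omega)
    fun u5 s5 _ _ _ ⟨f5, a0, a1, a2, a4, a13⟩ => ?_
  have f5' : Frame 0 [] st s5 := by
    refine Frame.trans ?_ f5
    simp [Frame.refl]
  refine Env.wpt_cons hF (n := 19890 + 80 * m) (by simp [Stmt.len]; omega)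
    ⟨by simp, by simp [a2, ← c.hP]; omega, fun u6 _ => ?_⟩
  refine Env.wpt_cons hF (n := 19880 + 80 * m) (by simp [Stmt.len]; omega)
    ⟨by simp, by simp [a2, ← c.hP]; omega, fun u7 _ => ?_⟩
  refine Env.wpt_cons hF (n := 19870 + 80 * m) (by simp [Stmt.len]; omega)
    ⟨by simp, by simp [a4]; omega, fun u8 _ => ?_⟩
  refine Env.wpt_then (j' := 19000) (length_spec hF h (by rw [← c.hN]; omega) hm2 (by simp [a0])
    (by simp [a1]) (by simp [a2]) (by simp [a2, pow_succ']) (by simp [a4]) (by simp [a4])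
    (by simp [a2]) (by simp [a13])) (by omega)
    fun u9 s9 _ _ _ ⟨f9, b0, b1, b2, b4, b7, b13, b3, b5⟩ => ?_
  have f9' : Frame 0 [] st s9 := by
    refine Frame.trans ?_ f9
    simp [f5']
  clear f9 f5
  have hvb : ∀ {st : St}, st.v 13 = 2 ^ 2 ^ k → ∀ st' : St, st'.v 13 = st.v 13 →
      vb.Ok F st' ∧ vb.val st' = 2 ^ p.P := fun h st' h' => ⟨trivial, by
    rw [c.hP, ← h, ← h']; rfl⟩
  refine Env.wpt_then (j' := 15000) (pow_spec hF (y := 8) (by norm_num) (by norm_num) (hvb b13)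
    rfl (by norm_num) fun i hi => hpowB i (by omega)) (by omega) fun u10 s10 _ _ _ ⟨f10, h10⟩ => ?_
  refine Env.wpt_then (j' := 11000) (pow_spec hF (y := 9) (by norm_num) (by norm_num)
    (hvb (by simp [h10, b13])) rfl (by norm_num) fun i hi => hpowB i (by omega)) (by omega)
    fun u11 s11 _ _ _ ⟨f11, h11⟩ => ?_
  refine Env.wpt_then (j' := 7000) (pow_spec hF (y := 10) (by norm_num) (by norm_num)
    (hvb (by simp [h11, h10, b13])) rfl (by norm_num) fun i hi => hpowB i (by omega)) (by omega)
    fun u12 s12 _ _ _ ⟨f12, h12⟩ => ?_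
  refine Env.wpt_then (j' := 3000) (pow_spec hF (y := 14) (b := 2) (e := 250) (by norm_num)
    (by norm_num) (fun st' _ => ⟨trivial, rfl⟩) rfl (by norm_num)
    fun i hi => lt_of_le_of_lt (Nat.pow_le_pow_right (by norm_num) hi) h250) (by omega)
    fun u13 s13 _ _ _ ⟨f13, h13⟩ => ?_
  have f := ((f9'.trans f10).trans f11).trans (f12.trans f13)
  have hv : ∀ z < 20, s13.v z = if z = 14 then 2 ^ 250 else if z = 10 then 2 ^ p.K else
      if z = 9 then 2 ^ p.S else if z = 8 then 2 ^ p.H else s9.v z := fun z hz => by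
    rw [h13 z (by omega), h12 z (by omega), h11 z (by omega), h10 z (by omega), c.hK, c.hS, c.hH,
      ← pow_mul, ← pow_mul, ← pow_mul, mul_comm p.P, mul_comm p.P, mul_comm p.P]
  clear h13 h12 h11 h10
  refine Env.wpt_body hF (by simp [Stmt.len]) ?_
  have hP2 : 2 ^ k ≠ 0 := by positivity
  simp [Stmt.wp, hv, b2, b7, b3, f, Vars, b0, b1, b4, b5, b13, c.hP, c.hN]
  rw [← c.hP, ← c.hN]
  generalize 2 ^ p.K / p.P = q
  omega

end FR.Prog

namespace FR.Prog

open LogRAM LogRAM.Stmt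

variable {m k n : ℕ}

/-- The parameters with degree `2 ^ k` and length `2 ^ n`. -/
def params (k n : ℕ) : Params where
  P := 2 ^ k
  N := 2 ^ n
  S := 100 * 2 ^ k
  H := 120 * 2 ^ k
  K := 250 * 2 ^ k

namespace Choice

variable (h : Choice m k n)
include h

theorem two_le : 2 ≤ 2 ^ k :=
  (Nat.pow_le_pow_right (by norm_num) h.hk).trans' (by norm_num)

theorem P_le : 2 ^ k ≤ 2 * (Nat.log 2 m + 1) := by
  obtain ⟨i, rfl⟩ : ∃ i, k = i + 1 := ⟨k - 1, by have := h.hk; omega⟩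
  rcases Nat.eq_zero_or_pos i with rfl | hi
  · norm_num
  · have := Nat.le_log_of_pow_le (by norm_num) (h.least i hi (by omega))
    rw [pow_succ']
    omega

theorem le_P : Nat.log 2 m + 1 ≤ 2 ^ k := by
  rcases Nat.eq_zero_or_pos m with rfl | hm
  · simpa using Nat.one_le_two_pow
  · exact Nat.log_lt_of_lt_pow (by omega) h.lt

theorem n_le_P : n ≤ 2 ^ k := by
  have hP : 4 ≤ 2 ^ k * 2 ^ k := Nat.mul_le_mul h.two_le h.two_le
  have hkn := h.hkn
  rcases Nat.lt_or_ge (k + 1) n with hn | hn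
  · obtain ⟨i, rfl⟩ : ∃ i, n = i + 1 := ⟨n - 1, by omega⟩
    have h1 := h.least' i (by omega) (by omega)
    have h2 := h.lt
    rw [mul_assoc] at h1
    have h3 : 2 ^ i * 4 ≤ 2 ^ i * (2 ^ k * 2 ^ k) := Nat.mul_le_mul_left _ hP
    exact (Nat.pow_lt_pow_iff_right (a := 2) (by norm_num)).1 (by omega)
  · have : k < 2 ^ k := Nat.lt_two_pow_self
    omega

omit h in
theorem _root_.FR.Prog.cube_le (i : ℕ) : i ^ 3 ≤ 4 * 2 ^ i := by
  rcases Nat.lt_or_ge i 4 with hi | hi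
  · interval_cases i <;> norm_num
  · induction i, hi using Nat.le_induction with
    | base => norm_num
    | succ i hi ih =>
      rw [pow_succ 2 i]
      nlinarith [Nat.mul_le_mul hi hi, Nat.mul_le_mul (Nat.mul_le_mul hi hi) (le_refl i)]

theorem size_le (hm : 1 ≤ m) : 2 ^ n * (2 ^ k) ^ 2 ≤ 64 * m := by
  have hkn := h.hkn
  rcases Nat.lt_or_ge (k + 1) n with hn | hn
  · obtain ⟨i, rfl⟩ : ∃ i, n = i + 1 := ⟨n - 1, by omega⟩
    have h1 := h.least' i (by omega) (by omega)
    rw [show 2 ^ (i + 1) * (2 ^ k) ^ 2 = 2 * (2 ^ i * 2 ^ k * 2 ^ k) by ring]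
    omega
  · obtain rfl : n = k + 1 := by omega
    obtain ⟨i, rfl⟩ : ∃ i, k = i + 1 := ⟨k - 1, by have := h.hk; omega⟩
    rcases Nat.eq_zero_or_pos i with rfl | hi
    · norm_num; omega
    · have h1 := h.least i hi (by omega)
      have h2 := cube_le (2 ^ i)
      rw [show 2 ^ (i + 1 + 1) * (2 ^ (i + 1)) ^ 2 = 16 * (2 ^ i) ^ 3 by ring]
      omega

theorem capacity : m ≤ 2 ^ n / 2 * (2 ^ k / 2 * 2 ^ k) := by
  obtain ⟨i, rfl⟩ : ∃ i, k = i + 1 := ⟨k - 1, by have := h.hk; omega⟩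
  obtain ⟨j, rfl⟩ : ∃ j, n = j + 1 := ⟨n - 1, by have := h.hkn; omega⟩
  have h1 := h.le
  rw [pow_succ 2 i, pow_succ 2 j] at h1 ⊢
  rw [Nat.mul_div_cancel _ (by norm_num), Nat.mul_div_cancel _ (by norm_num)]
  rw [show 2 ^ j * 2 * (2 ^ i * 2) * (2 ^ i * 2) = 4 * (2 ^ j * (2 ^ i * (2 ^ i * 2))) by ring] at h1
  omega

theorem valid (hm : 1 ≤ m) : (params k n).Valid m 500 where
  P_pow := ⟨k - 1, by rw [Nat.sub_add_cancel h.hk]; rfl⟩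
  N_pow := ⟨n, rfl⟩
  dvd_N := by
    change 2 * 2 ^ k ∣ 2 ^ n
    rw [← pow_succ']
    exact pow_dvd_pow _ h.hkn
  capacity := h.capacity
  dvd_K := Dvd.intro_left _ rfl
  large_K := by
    change 4 * 2 ^ k * 2 ^ (2 * (120 * 2 ^ k)) < 2 ^ (250 * 2 ^ k)
    have h1 : 2 ^ k < 2 ^ 2 ^ k := Nat.lt_two_pow_self
    have h2 := h.two_le
    calc 4 * 2 ^ k * 2 ^ (2 * (120 * 2 ^ k))
        < 4 * 2 ^ 2 ^ k * 2 ^ (2 * (120 * 2 ^ k)) := by gcongr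
      _ = 2 ^ (2 + 2 ^ k + 2 * (120 * 2 ^ k)) := by rw [pow_add, pow_add]; norm_num
      _ ≤ 2 ^ (250 * 2 ^ k) := Nat.pow_le_pow_right (by norm_num) (by omega)
  N_le := (h.size_le hm).trans (by omega)
  order x hx := by
    have h1 := h.P_le
    have h2 := h.le_P
    simp only [params, List.mem_cons, List.not_mem_nil, or_false] at hx
    rcases hx with rfl | rfl | rfl | rfl <;> omega

theorem ctx {E : Env} (hw : E.w = 12000 * (Nat.log 2 E.inp.length + 1))
    (hlen : E.inp.length = 2 * m) (hL : E.L = 2 * 2 ^ k * 2 ^ n) (hacc : E.acc = E.L)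
    (hB : E.B = 2 ^ (750 * 2 ^ k)) : Ctx E (params k n) m k n := by
  have hP := h.two_le
  have hlog : Nat.log 2 m ≤ Nat.log 2 (2 * m) := Nat.log_mono_right (by omega)
  have hPl := h.P_le
  have hn := h.n_le_P
  have hPw : 6000 * 2 ^ k ≤ E.w := by rw [hw, hlen]; omega
  have h256 : 2 ^ 8 ≤ E.B := by rw [hB]; exact Nat.pow_le_pow_right (by norm_num) (by omega)
  refine ⟨⟨h256, ?_, ?_, hacc.le⟩, rfl, h.hk, rfl, h.hkn, hn.trans (Nat.le_mul_of_pos_left _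
    (by norm_num)), rfl, rfl, rfl, hL, hacc.trans hL, hB, h.lt, h.capacity,
    show 2 ^ k ≤ E.w by omega⟩
  · rw [hB, ← pow_mul]
    exact Nat.pow_le_pow_right (by norm_num) (by omega)
  · have h1 : 2 ^ k ≤ 2 ^ 2 ^ k := Nat.lt_two_pow_self.le
    have h2 : 2 ^ n ≤ 2 ^ 2 ^ k := Nat.pow_le_pow_right (by norm_num) hn
    have h3 : 0 < 2 ^ k * 2 ^ n := by positivity
    have h4 : 2 ^ k * 2 ^ n ≤ 2 ^ (2 ^ k + 2 ^ k) := by rw [pow_add]; exact Nat.mul_le_mul h1 h2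
    rw [hL, hB]
    calc 104 + 24 * (2 * 2 ^ k * 2 ^ n) = 104 + 48 * (2 ^ k * 2 ^ n) := by ring
      _ ≤ 2 ^ 8 * (2 ^ k * 2 ^ n) := by omega
      _ ≤ 2 ^ 8 * 2 ^ (2 ^ k + 2 ^ k) := Nat.mul_le_mul_left _ h4
      _ = 2 ^ (8 + (2 ^ k + 2 ^ k)) := (pow_add _ _ _).symm
      _ ≤ 2 ^ (750 * 2 ^ k) := Nat.pow_le_pow_right (by norm_num) (by omega)

end Choice

/-! ### The program -/

/-- The numbers of the first registers of the arrays. -/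
def baseCode : List Instr :=
  .assign (.reg 80) .add (.const 104) (.const 0) ::
    (List.range 23).map fun a => .assign (.reg (81 + a)) .add (.reg (80 + a)) (.reg 11)

def program : Program :=
  paramCode.code 0 ++ (baseCode ++ mainCode.code (paramCode.len + 24))

theorem length_program : program.length = paramCode.len + 24 + mainCode.len := by
  simp [program, baseCode, Stmt.length_code]; omega

theorem _root_.LogRAM.Env.Rep.update_base {F : Env} {mem : ℕ → ℕ} {st : St} (h : F.Rep mem st)
    (h0 : F.acc = 0) {r : ℕ} (hr : 80 ≤ r) (hr' : r < 104) (y : ℕ) :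
    F.Rep (Function.update mem r y) st where
  var z hz := by rw [Function.update_of_ne (by omega), h.var z hz]
  base hp := by omega
  arr a ha i hi := by rw [Function.update_of_ne (by omega), h.arr a ha i hi]
  var_lt := h.var_lt
  arr_lt := h.arr_lt

theorem base_spec {E : Env} (hE : E.Good) {s o : ℕ} {st : St}
    (h : ({ E with acc := 0 } : Env).At s o st) (hc : E.CodeAt o baseCode) (h11 : st.v 11 = E.L) :
    E.At (s + 24) (o + 24) st := by
  have hL := hE.L_le
  have key : ∀ a < 24, ({ E with acc := 0 } : Env).At (s + (a + 1)) (o + (a + 1)) st ∧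
      ∀ b ≤ a, (E.σ (s + (a + 1))).mem (80 + b) = 104 + b * E.L := by
    intro a
    induction a with
    | zero =>
      intro _
      obtain ⟨a1, a2⟩ := h.assign (y := 104) (st' := st) (hc 0 (by simp [baseCode])) rfl
        (Exp.Env.Good.lt_of_le hE (by omega)) rfl (h.rep.update_base rfl (by simp [Dest.addr])
          (by simp [Dest.addr]) _)
      refine ⟨a1, fun b hb => ?_⟩
      obtain rfl : b = 0 := by omega
      change (({ E with acc := 0 } : Env).σ (s + 1)).mem 80 = _
      rw [a2]
      simp [Dest.addr]
    | succ a ih =>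
      intro ha
      obtain ⟨a1, a2⟩ := ih (by omega)
      have hI : E.prog[o + (a + 1)]? =
          some (.assign (.reg (81 + a)) .add (.reg (80 + a)) (.reg 11)) :=
        (hc (a + 1) (by simp [baseCode]; omega)).trans
          (by simp [baseCode, List.getElem?_range (show a < 23 by omega)])
      have hv : (E.σ (s + (a + 1))).mem 11 = E.L := by
        rw [← h11]; exact a1.rep.var 11 (by norm_num)
      have hle : (a + 1) * E.L ≤ 24 * E.L := Nat.mul_le_mul_right _ (by omega)
      obtain ⟨b1, b2⟩ := a1.assign (y := 104 + (a + 1) * E.L) (st' := st) hI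
        (by
          change some ((E.σ (s + (a + 1))).mem (80 + a) + (E.σ (s + (a + 1))).mem 11) = _
          rw [a2 a le_rfl, hv, add_assoc, Nat.succ_mul])
        (Exp.Env.Good.lt_of_le hE (by omega)) rfl (a1.rep.update_base rfl
          (by simp [Dest.addr]; omega) (by simp [Dest.addr]; omega) _)
      refine ⟨b1, fun b hb => ?_⟩
      change (({ E with acc := 0 } : Env).σ (s + (a + 1) + 1)).mem (80 + b) = _
      rw [b2]
      by_cases hba : b = a + 1
      · subst hba
        rw [show 80 + (a + 1) = 81 + a by omega]
        simp [Dest.addr]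
      · rw [Function.update_of_ne (by simp [Dest.addr]; omega)]
        exact a2 b (by omega)
  obtain ⟨a1, a2⟩ := key 23 (by norm_num)
  exact ⟨a1.okay, a1.pc, a1.out, a1.rep.var, fun _ a ha => a2 a (by omega), a1.rep.arr,
    a1.rep.var_lt, a1.rep.arr_lt⟩

theorem wf_paramCode : paramCode.wf = true := by decide

theorem wf_mainCode : mainCode.wf = true := by decide

end FR.Prog

theorem theorem2 :
    ∃ (prog : LogRAM.Program) (κ c C : ℕ), ∀ m : ℕ, 1 ≤ m →
      ∃ p : FR.Params, p.Valid m c ∧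
        ∀ a b : ℕ, a < 2 ^ m → b < 2 ^ m →
          ∃ (σ : ℕ → LogRAM.Config) (T : ℕ),
            LogRAM.IsHaltingRun prog κ (LogRAM.bits m a ++ LogRAM.bits m b) σ T ∧
            T ≤ C * m ∧
            (σ T).out = LogRAM.bits (2 * m) (a * b) ∧
            p.Performs prog σ T a b := by
  open LogRAM FR.Prog in
  refine ⟨program, 12000, 500, 20000000, fun m hm => ?_⟩
  obtain ⟨k, n, h⟩ := exists_choice m
  refine ⟨params k n, h.valid hm, fun a b ha hb => ?_⟩
  have hlen : (bits m a ++ bits m b).length = 2 * m := by simp [length_bits]; omega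
  set E : Env := ⟨program, 12000 * (Nat.log 2 (bits m a ++ bits m b).length + 1),
    bits m a ++ bits m b, 2 * 2 ^ k * 2 ^ n, 2 * 2 ^ k * 2 ^ n, 2 ^ (750 * 2 ^ k)⟩ with hE
  have c : Ctx E (params k n) m k n := h.ctx rfl hlen rfl rfl rfl
  have hF : ({ E with acc := 0 } : Env).Good :=
    ⟨c.good.B_ge, c.good.B_le, c.good.L_le, Nat.zero_le _⟩
  have hcode : E.CodeAt 0 (paramCode.code 0 ++ (baseCode ++ mainCode.code (paramCode.len + 24))) := by
    intro i _
    rw [zero_add]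
    rfl
  rw [Env.codeAt_append, Env.codeAt_append, Stmt.length_code, zero_add] at hcode
  obtain ⟨c1, c2, c3⟩ := hcode
  let st : St := ⟨fun i => if i = 0 then 2 * m else 0, fun _ _ => 0, []⟩
  have hB := c.good.B_ge
  have hmB : 2 * m < E.B := by
    have h1 := c.pow_lt (a := 2) (by norm_num)
    have h2 := c.hm'
    have h3 := c.two_le
    have : 2 * m ≤ 2 ^ (2 * (params k n).P) := by
      rw [two_mul (params k n).P, pow_add]; exact Nat.mul_le_mul h3 h2.le
    omega
  have at0 : ({ E with acc := 0 } : Env).At 0 0 st := by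
    refine ⟨fun t ht => by omega, rfl, rfl, fun y _ => ?_, fun h0 => absurd h0 (lt_irrefl _),
      fun y _ i _ => ?_, fun y _ => ?_, fun y _ i _ => by change 0 < E.B; omega⟩
    · change (if y = 0 then (bits m a ++ bits m b).length else 0) = if y = 0 then 2 * m else 0
      rw [hlen]
    · exact if_neg (by omega)
    · change (if y = 0 then 2 * m else 0) < E.B
      split_ifs <;> omega
  obtain ⟨t1, st1, -, ht1, at1, hv1, f1⟩ := param_spec c hF rfl h (s := 0) (st := st) rfl
    wf_paramCode 0 c1 at0
  rw [zero_add] at at1 ht1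
  have at2 := base_spec c.good at1 c2 hv1.2.2.2.2.2.2.2.2.2.2.1
  obtain ⟨T, st2, hT, hT', at3, hperf, hout⟩ := main_spec c hv1 ha hb rfl
    (fun t _ => by rw [f1.a 18 (by simp)]) f1.out wf_mainCode _
    (by simpa [baseCode] using c3) at2
  refine ⟨E.σ, T, ⟨rfl, fun t ht => ?_, ?_⟩, ?_, by rw [at3.out, hout], hperf⟩
  · exact Option.bind_eq_some_iff.1 (at3.okay t ht)
  · rw [at3.pc, List.getElem?_eq_none_iff, length_program]
  · have h1 := h.size_le hm
    have h2 : (params k n).P * (2 * (params k n).P * (params k n).N) = 2 * (2 ^ n * (2 ^ k) ^ 2) := by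
      simp only [params]; ring
    rw [h2] at hT'
    generalize 2 ^ n * (2 ^ k) ^ 2 = V at *
    clear * - hT' h1 ht1 hm
    omega
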